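/- **Setting.** Let $\varepsilon>0$. Consider an $\varepsilon$-periodic metric graph $\mathbb G_{\rm per}$ whose edges in the $k$-th cell are identified with consecutive segments $\varepsilon(k+[p_e,p_e+l_e])$ of $\mathbb R$ ($k\in\mathbb Z$, $\sum_e l_e=1$), so that $L^2(\mathbb G_{\rm per})=L^2(\mathbb R)$. Put $a_e(\varepsilon)=a_e>0$ on stiff edges and $a_e(\varepsilon)=\varepsilon a_e$, $a_e>0$, on soft edges. $A_\varepsilon$ is the operator $-a_e(\varepsilon)^2\,d^2/dx^2$ on the edges, with domain the $W^{2,2}$ functions that are continuous at each vertex and for which the sum of inward co-derivatives $\pm a_e(\varepsilon)^2u_e'$ vanishes at each vertex. For $t\in[-\pi/\varepsilon,\pi/\varepsilon)$, $\tau=\varepsilon t$, the fibre operator $A_\varepsilon^{(t)}$ acts in $L^2(0,\varepsilon)$ (one cell, with the vertices of all cells identified modulo translation) as $-a_e(\varepsilon)^2(d/dx+it)^2$ on $W^{2,2}$ functions such that at each vertex $V$ the values $w_V(e)u_e(V)$ coincide and $\sum_{e\sim V}\pm w_V(e)a_e(\varepsilon)^2(d/dx+it)u_e(V)=0$, with unimodular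 weights $w_V(e)$. $P_{\rm stiff}$ is the orthogonal projection onto the functions supported by the stiff edges (both in $L^2(0,\varepsilon)$ and in $L^2(\mathbb R)$), and $L$ is the sum of the $l_e$ over the stiff edges of a cell. The Gelfand transform $\mathcal GF(y,t)=\sqrt{\varepsilon/2\pi}\sum_{k\in\mathbb Z}F(y+k\varepsilon)e^{-it(y+k\varepsilon)}$ is unitary from $L^2(\mathbb R)$ onto $L^2((0,\varepsilon)\times(-\pi/\varepsilon,\pi/\varepsilon))$. The graphs are the following; all lengths and coefficients are positive. Each cell has two vertices $V_1,V_2$. * Example (0): $l^{(1)}+l^{(2)}=1$; an infinite chain in which a stiff edge $e_1$ (from $V_2$ of the previous cell to $V_1$; $l^{(1)},a_1$) alternates with a soft edge $e_2$ (from $V_1$ to $V_2$; $l^{(2)}$, $a_2=1$); all weights are $1$; $L=l^{(1)}$. * Examples (1), (2): $l^{(1)}+l^{(2)}+l^{(3)}=1$; edges $e_1$ from $V_2$ of the previous cell to $V_1$, $e_2$ from $V_1$ to $V_2$, $e_3$ from $V_2$ to $V_1$; weights $w_{V_1}=(1,1,e^{i\tau(l^{(2)}+l^{(3)})})$, $w_{V_2}=(e^{i\tau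 l^{(3)}},1,1)$ on $(e_1,e_2,e_3)$. In Example (1), $e_1,e_3$ are stiff ($a_1$, $a_3$), $e_2$ is soft with $a_2=1$, and $L=l^{(1)}+l^{(3)}$. In Example (2), $e_1,e_2$ are soft ($a_1,a_2$), $e_3$ is stiff ($a_3$), and $L=l^{(3)}$. With $\sigma^2=(l^{(1)}/a_1^2+l^{(3)}/a_3^2)^{-1}$ and $\theta(\tau)=\zeta/|\zeta|$, $\zeta=\frac{a_1^2}{l^{(1)}}e^{-i\tau}+\frac{a_3^2}{l^{(3)}}$, the dispersion functions are * (0) $K(\tau,z)=\dfrac{2\sqrt z\,(\cos(l^{(2)}\sqrt z)-\cos\tau)}{l^{(1)}\sin(l^{(2)}\sqrt z)}$; * (1) $K(\tau,z)=\dfrac1{l^{(1)}+l^{(3)}}\Bigl\{2\sqrt z\Bigl(\cot(l^{(2)}\sqrt z)-\dfrac{\Re\theta(\tau)}{\sin(l^{(2)}\sqrt z)}\Bigr)+\Bigl(\dfrac{\sigma\tau}\varepsilon\Bigr)^2\Bigr\}$; * (2) $K(\tau,z)=\dfrac{2\sqrt z}{l^{(3)}}\Bigl\{a_1\dfrac{\cos(l^{(1)}\sqrt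 z/a_1)-\cos\tau}{\sin(l^{(1)}\sqrt z/a_1)}-a_2\tan\dfrac{l^{(2)}\sqrt z}{2a_2}\Bigr\}$. Let $\Psi_K^\varepsilon$ be the Fourier multiplier on $L^2(\mathbb R)$ with symbol $(K(\varepsilon t,z)-z)^{-1}$ for $t\in[-\pi/\varepsilon,\pi/\varepsilon)$ and $0$ for other $t$, i.e. $\Psi_K^\varepsilon F(x)=\frac1{\sqrt{2\pi}}\int_{-\pi/\varepsilon}^{\pi/\varepsilon}(K(\varepsilon t,z)-z)^{-1}\widehat F(t)e^{itx}\,dt$ with $\widehat F(t)=\frac1{\sqrt{2\pi}}\int_{\mathbb R} F(x)e^{-ixt}dx$. **Theorem.** In each of the three examples: (a) For all $\varepsilon>0$ and $z\in\mathbb C\setminus\mathbb R$ the resolvents $(A_\varepsilon-z)^{-1}$, $(A_\varepsilon^{(t)}-z)^{-1}$ and the direct integral $D_\varepsilon(z)=\oplus\!\int_{-\pi/\varepsilon}^{\pi/\varepsilon}P_{\rm stiff}(A_\varepsilon^{(t)}-z)^{-1}P_{\rm stiff}\,dt$ exist, and $\mathcal G\,P_{\rm stiff}(A_\varepsilon-z)^{-1}P_{\rm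 stiff}=D_\varepsilon(z)\,\mathcal G$. (b) Let $r=2$ in Examples (0), (2) and $r=1$ in Example (1). For every compact $Z\subset\mathbb C$ and $\delta>0$ there are $C$ and $\varepsilon_0>0$ such that for all $0<\varepsilon\le\varepsilon_0$ and all $z\in Z$ with $|\Im z|\ge\delta$ one has $\|D_\varepsilon(z)-T_\varepsilon(z)\|\le C\varepsilon^r$ for some operator $T_\varepsilon(z)$ which is unitarily equivalent to $\Psi_K^\varepsilon$, and also to $P_{\rm stiff}L^{-1}\Psi_K^\varepsilon P_{\rm stiff}$ on $L^2(\mathbb R)$, by unitary operators that do not depend on $z$. (c) In Example (1), for every nonreal $z$ and $F\in L^2(\mathbb R)$ the effective time-dispersive equation $$-\sigma^2U''-\Bigl\{(l^{(1)}+l^{(3)})z+2\sqrt z\tan\Bigl(\frac{l^{(2)}\sqrt z}2\Bigr)\Bigr\}U=F\quad\text{on }\mathbb R$$ has exactly one solution $U=\Psi^0F\in W^{2,2}(\mathbb R)$, the solution operator $\Psi^0=\Psi^0(z)$ is bounded on $L^2(\mathbb R)$, and, with $C,\varepsilon_0$ depending on $Z$ and $\delta$ as in (b), $\|L^{-1}\Psi_K^\varepsilon-\Psi^0\|_{L^2(\mathbb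 R)\to L^2(\mathbb R)}\le C\varepsilon^2$, where $L=l^{(1)}+l^{(3)}$. -/

import Mathlib

open MeasureTheory Set Complex
open scoped ENNReal FourierTransform

noncomputable section

/-! ### Function spaces -/

/-- `L²(ℝ)`; it is also the space `L²` of the periodic graph, whose edges are laid out one after
another along the line. -/
abbrev L2Line : Type := Lp ℂ 2 (volume : Measure ℝ)

/-- `L²(0, ε)`, the `L²` space of the (flattened) period cell. -/
abbrev L2Cell (ε : ℝ) : Type := Lp ℂ 2 (volume.restrict (Ioo (0 : ℝ) ε))

/-- The set of quasimomenta, as a measure space. -/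
abbrev quasiMeasure (ε : ℝ) : Measure ℝ := volume.restrict (Ioo (-(Real.pi / ε)) (Real.pi / ε))

/-- `L²((0, ε) × (-π/ε, π/ε))`, the direct integral over the quasimomentum of the spaces
`L²(0, ε)`. -/
abbrev L2Fibred (ε : ℝ) : Type :=
  Lp ℂ 2 ((volume.restrict (Ioo (0 : ℝ) ε)).prod (quasiMeasure ε))

/-- Multiplication by the indicator function of `S`, as a linear map on `L²(μ)`. -/
def indicatorLin (μ : Measure ℝ) (S : Set ℝ) (hS : MeasurableSet S) :
    Lp ℂ 2 μ →ₗ[ℂ] Lp ℂ 2 μ where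
  toFun f := MemLp.toLp (S.indicator f) ((Lp.memLp f).indicator hS)
  map_add' f g := by
    rw [← MemLp.toLp_add]
    refine MemLp.toLp_congr _ _ ?_
    filter_upwards [Lp.coeFn_add f g] with x hx
    by_cases h : x ∈ S
    · simpa [h] using hx
    · simp [h]
  map_smul' c f := by
    rw [RingHom.id_apply, ← MemLp.toLp_const_smul]
    refine MemLp.toLp_congr _ _ ?_
    filter_upwards [Lp.coeFn_smul c f] with x hx
    by_cases h : x ∈ S
    · simpa [h] using hx
    · simp [h]

theorem norm_indicatorLin_le (μ : Measure ℝ) (S : Set ℝ) (hS : MeasurableSet S) (f : Lp ℂ 2 μ) :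
    ‖indicatorLin μ S hS f‖ ≤ 1 * ‖f‖ := by
  have h : ‖indicatorLin μ S hS f‖ = (eLpNorm (S.indicator f) 2 μ).toReal :=
    Lp.norm_toLp (S.indicator (f : ℝ → ℂ)) ((Lp.memLp f).indicator hS)
  rw [one_mul, h, Lp.norm_def]
  exact ENNReal.toReal_mono (Lp.eLpNorm_ne_top f) (eLpNorm_indicator_le _)

/-- Multiplication by the indicator function of `S`: the orthogonal projection onto the functions
in `L²(μ)` which vanish outside `S`. -/
def indicatorProj (μ : Measure ℝ) (S : Set ℝ) (hS : MeasurableSet S) :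
    Lp ℂ 2 μ →L[ℂ] Lp ℂ 2 μ :=
  (indicatorLin μ S hS).mkContinuous 1 (norm_indicatorLin_le μ S hS)

/-! ### Second-order operators on metric graphs -/

/-- `φ ∈ W^{2,2}(0, ℓ)`, with continuously differentiable representative `φ` on `[0, ℓ]`, first
derivative `φ'` (absolutely continuous) and second derivative `φ'' ∈ L²(0, ℓ)`. -/
structure IsW22 (ℓ : ℝ) (φ φ' φ'' : ℝ → ℂ) : Prop where
  memLp : MemLp φ'' 2 (volume.restrict (Ioo (0 : ℝ) ℓ))
  deriv_eq : ∀ x ∈ Icc (0 : ℝ) ℓ, φ' x = φ' 0 + ∫ y in (0 : ℝ)..x, φ'' y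
  eq : ∀ x ∈ Icc (0 : ℝ) ℓ, φ x = φ 0 + ∫ y in (0 : ℝ)..x, φ' y

/-- A metric graph with edges `E` and vertices `V`. The edge `e` is identified with `[0, len e]` and
is laid out on the line as the segment `[pos e, pos e + len e]`; the endpoint `0 : Fin 2` is the left
one, `1 : Fin 2` the right one. `coef e` is the weight `a` in the differential expression
`-a² (d/dx + it)²` and `wt e b` is the weight `w_V(e)` at the vertex `V = vert e b`. -/
structure MetricGraph (E V : Type) where
  pos : E → ℝ
  len : E → ℝ
  coef : E → ℝ
  vert : E → Fin 2 → V
  wt : E → Fin 2 → ℂ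

namespace MetricGraph

variable {E V : Type}

/-- The local coordinate of an endpoint. -/
def endPt (Γ : MetricGraph E V) (e : E) (b : Fin 2) : ℝ := if b = 0 then 0 else Γ.len e

/-- `1` at left endpoints and `-1` at right ones. -/
def endSign (b : Fin 2) : ℂ := if b = 0 then 1 else -1

/-- The (graph of the) operator `-a² (d/dx + it)²` on the metric graph: `Γ.IsOp t u g` says that `u`
lies in the domain of the operator, that is, `u` is of class `W^{2,2}` on every edge, at each vertex
`V` the products `w_V(e) u_e(V)` have a common value, and the sum of the weighted inward co-derivatives
`± w_V(e) a² (d/dx + it) u_e (V)` over the edge endpoints at `V` is zero, and that the operator maps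
`u` to `g`. (As `g` is square-integrable on the whole graph, so are the derivatives of `u`.) -/
def IsOp (Γ : MetricGraph E V) (t : ℝ) {μ : Measure ℝ} (u g : Lp ℂ 2 μ) : Prop :=
  ∃ φ φ' φ'' : E → ℝ → ℂ,
    (∀ e, IsW22 (Γ.len e) (φ e) (φ' e) (φ'' e)) ∧
    (∀ e, ∀ᵐ x ∂(volume.restrict (Ioo (0 : ℝ) (Γ.len e))), u (Γ.pos e + x) = φ e x) ∧
    (∀ e, ∀ᵐ x ∂(volume.restrict (Ioo (0 : ℝ) (Γ.len e))),
      g (Γ.pos e + x) =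
        -(Γ.coef e : ℂ) ^ 2 * (φ'' e x + 2 * I * t * φ' e x - (t : ℂ) ^ 2 * φ e x)) ∧
    (∀ e b e' b', Γ.vert e b = Γ.vert e' b' →
      Γ.wt e b * φ e (Γ.endPt e b) = Γ.wt e' b' * φ e' (Γ.endPt e' b')) ∧
    (∀ v : V, ∑ᶠ p : {p : E × Fin 2 // Γ.vert p.1 p.2 = v},
      endSign p.1.2 * Γ.wt p.1.1 p.1.2 * (Γ.coef p.1.1 : ℂ) ^ 2 *
        (φ' p.1.1 (Γ.endPt p.1.1 p.1.2) + I * t * φ p.1.1 (Γ.endPt p.1.1 p.1.2)) = 0)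

end MetricGraph

/-- `R = (A - z)⁻¹`, where the operator `A` is given by its graph: `A - z` maps the domain of `A`
bijectively onto the whole space, with bounded inverse `R`. -/
def IsResolvent {H : Type} [NormedAddCommGroup H] [NormedSpace ℂ H] (A : H → H → Prop) (z : ℂ)
    (R : H →L[ℂ] H) : Prop :=
  ∀ f u : H, A u (f + z • u) ↔ u = R f

/-! ### High-contrast periodic graphs -/

/-- The data of an `ε`-periodic high-contrast graph with `n` edges and two vertices per period, after
scaling to period one. The edges of the cell number `k : ℤ` are copies of `Fin n`, laid out as
`[k + pos e, k + pos e + len e]`; the endpoint `b` of the edge `e` of the cell `k` is attached to the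
vertex `vert e b` of the cell `k + shift e b`. The coefficient is `a_e` on stiff edges and `ε a_e` on
soft ones. `wt e b τ` are the unimodular weights at the quasimomentum `τ = ε t`. -/
structure Composite (n : ℕ) where
  len : Fin n → ℝ
  pos : Fin n → ℝ
  coef : Fin n → ℝ
  stiff : Fin n → Bool
  vert : Fin n → Fin 2 → Fin 2
  shift : Fin n → Fin 2 → ℤ
  wt : Fin n → Fin 2 → ℝ → ℂ

namespace Composite

variable {n : ℕ}

/-- The coefficient `a_e(ε)`. -/
def coefEps (P : Composite n) (ε : ℝ) (e : Fin n) : ℝ :=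
  if P.stiff e then P.coef e else ε * P.coef e

/-- The periodic graph `𝔾_per` of period `ε`, with unweighted matching conditions. -/
def perGraph (P : Composite n) (ε : ℝ) : MetricGraph (ℤ × Fin n) (ℤ × Fin 2) where
  pos := fun p => ε * (p.1 + P.pos p.2)
  len := fun p => ε * P.len p.2
  coef := fun p => P.coefEps ε p.2
  vert := fun p b => (p.1 + P.shift p.2 b, P.vert p.2 b)
  wt := fun _ _ => 1

/-- The compact graph on which the fibre operators at the quasimomentum `t` act. -/
def cellGraph (P : Composite n) (ε t : ℝ) : MetricGraph (Fin n) (Fin 2) where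
  pos := fun e => ε * P.pos e
  len := fun e => ε * P.len e
  coef := fun e => P.coefEps ε e
  vert := P.vert
  wt := fun e b => P.wt e b (ε * t)

/-- The operator `A_ε` on the periodic graph: `-a_e(ε)² d²/dx²` with Kirchhoff conditions. -/
def perOp (P : Composite n) (ε : ℝ) : L2Line → L2Line → Prop :=
  (P.perGraph ε).IsOp 0

/-- The fibre operator `A_ε^{(t)}`: `-a_e(ε)² (d/dx + it)²` with weighted Kirchhoff conditions. -/
def fibreOp (P : Composite n) (ε t : ℝ) : L2Cell ε → L2Cell ε → Prop :=
  (P.cellGraph ε t).IsOp t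

/-- The stiff component of the period cell. -/
def stiffCell (P : Composite n) (ε : ℝ) : Set ℝ :=
  ⋃ e : {e : Fin n // P.stiff e = true}, Ioo (ε * P.pos e) (ε * P.pos e + ε * P.len e)

/-- The stiff component of the periodic graph. -/
def stiffPer (P : Composite n) (ε : ℝ) : Set ℝ :=
  ⋃ p : ℤ × {e : Fin n // P.stiff e = true},
    Ioo (ε * (p.1 + P.pos p.2)) (ε * (p.1 + P.pos p.2) + ε * P.len p.2)

/-- `P_stiff` on the space of the period cell. -/
def stiffProjCell (P : Composite n) (ε : ℝ) : L2Cell ε →L[ℂ] L2Cell ε :=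
  indicatorProj _ (P.stiffCell ε) (MeasurableSet.iUnion fun _ => measurableSet_Ioo)

/-- `P_stiff` on the space of the periodic graph. -/
def stiffProjPer (P : Composite n) (ε : ℝ) : L2Line →L[ℂ] L2Line :=
  indicatorProj _ (P.stiffPer ε) (MeasurableSet.iUnion fun _ => measurableSet_Ioo)

/-- The total length `L` of the stiff edges of the cell scaled to period one. -/
def stiffLength (P : Composite n) : ℝ := ∑ e, if P.stiff e then P.len e else 0

end Composite

/-! ### Direct integrals, the Gelfand transform, Fourier multipliers -/

/-- `D = ⊕∫ T t dt`: for every `f`, one has `(D f)(·, t) = T t (f(·, t))` for almost all `t`. -/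
def IsDirectIntegral {ε : ℝ} (D : L2Fibred ε →L[ℂ] L2Fibred ε)
    (T : ℝ → L2Cell ε →L[ℂ] L2Cell ε) : Prop :=
  ∀ f : L2Fibred ε, ∀ᵐ t ∂(quasiMeasure ε),
    ∃ h : MemLp (fun y => f (y, t)) 2 (volume.restrict (Ioo (0 : ℝ) ε)),
      (fun y => D f (y, t)) =ᵐ[volume.restrict (Ioo (0 : ℝ) ε)] T t h.toLp

/-- `G` is the Gelfand transform
`(G F)(y, t) = (ε / 2π)^{1/2} ∑ₖ F (y + ε k) exp (-it (y + ε k))`, a unitary operator which is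
determined by its values on functions of bounded support, for which the sum is finite. -/
def IsGelfand (ε : ℝ) (G : L2Line ≃ₗᵢ[ℂ] L2Fibred ε) : Prop :=
  ∀ F : L2Line, (∃ r : ℝ, ∀ᵐ x : ℝ, r < |x| → F x = 0) →
    G F =ᵐ[(volume.restrict (Ioo (0 : ℝ) ε)).prod (quasiMeasure ε)] fun p : ℝ × ℝ =>
      (Real.sqrt (ε / (2 * Real.pi)) : ℂ) *
        ∑' k : ℤ, F (p.1 + ε * k) * exp (-I * p.2 * (p.1 + ε * k))

/-- `M` is the Fourier multiplier on `L²(ℝ)` with symbol `m`,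
`(M F)(x) = (2π)^{-1/2} ∫ m(t) F̂(t) exp (itx) dt` with
`F̂(t) = (2π)^{-1/2} ∫ F(x) exp (-itx) dx`. (The Fourier transform `𝓕` on `L²(ℝ)` has the kernel
`exp (-2π i x s)`, so that `t = 2π s`.) -/
def IsFourierMultiplier (m : ℝ → ℂ) (M : L2Line →L[ℂ] L2Line) : Prop :=
  ∀ F : L2Line, (𝓕 (M F) : L2Line) =ᵐ[volume] fun s => m (2 * Real.pi * s) * (𝓕 F : L2Line) s

/-- The symbol `(K(εt, z) - z)⁻¹` for `t ∈ [-π/ε, π/ε)`, extended by zero, where `K = K(τ)` is the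
dispersion function at the spectral parameter `z`. -/
def dispersionSymbol (ε : ℝ) (K : ℝ → ℂ) (z : ℂ) : ℝ → ℂ :=
  (Ico (-(Real.pi / ε)) (Real.pi / ε)).indicator fun t => (K (ε * t) - z)⁻¹

/-- `U ∈ W^{2,2}(ℝ)` and `-s U'' - c U = F` almost everywhere on `ℝ`. -/
def SolvesLineEquation (s : ℝ) (c : ℂ) (U F : L2Line) : Prop :=
  ∃ φ φ' φ'' : ℝ → ℂ,
    U =ᵐ[volume] φ ∧ MemLp φ' 2 (volume : Measure ℝ) ∧ MemLp φ'' 2 (volume : Measure ℝ) ∧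
    (∀ x, φ x = φ 0 + ∫ y in (0 : ℝ)..x, φ' y) ∧
    (∀ x, φ' x = φ' 0 + ∫ y in (0 : ℝ)..x, φ'' y) ∧
    ∀ᵐ x : ℝ, -(s : ℂ) * φ'' x - c * φ x = F x

namespace Composite

variable {n : ℕ}

/-- `D` is the direct integral over `t ∈ [-π/ε, π/ε)` of `P_stiff (A_ε^{(t)} - z)⁻¹ P_stiff`. -/
def IsStiffDirectIntegral (P : Composite n) (ε : ℝ) (z : ℂ)
    (D : L2Fibred ε →L[ℂ] L2Fibred ε) : Prop :=
  ∃ R : ℝ → L2Cell ε →L[ℂ] L2Cell ε,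
    (∀ t ∈ Ico (-(Real.pi / ε)) (Real.pi / ε), IsResolvent (P.fibreOp ε t) z (R t)) ∧
    IsDirectIntegral D fun t => P.stiffProjCell ε ∘L R t ∘L P.stiffProjCell ε

/-- For nonreal `z`, the resolvents of the fibre operators and of `A_ε` and the direct integral of
`P_stiff (A_ε^{(t)} - z)⁻¹ P_stiff` exist, and the Gelfand transform takes
`P_stiff (A_ε - z)⁻¹ P_stiff` to this direct integral. -/
def StiffCompressionIsDirectIntegral (P : Composite n) : Prop :=
  ∀ ε : ℝ, 0 < ε → ∃ G : L2Line ≃ₗᵢ[ℂ] L2Fibred ε, IsGelfand ε G ∧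
    ∀ z : ℂ, z.im ≠ 0 →
      ∃ (D : L2Fibred ε →L[ℂ] L2Fibred ε) (R : L2Line →L[ℂ] L2Line),
        P.IsStiffDirectIntegral ε z D ∧ IsResolvent (P.perOp ε) z R ∧
        ∀ F : L2Line, G (P.stiffProjPer ε (R (P.stiffProjPer ε F))) = D (G F)

/-- Uniformly for `z` in a compact set at a positive distance from the real line, the direct integral
of `P_stiff (A_ε^{(t)} - z)⁻¹ P_stiff` is `O(ε^r)`-close in the operator norm to an operator `T` which
is unitarily equivalent both to the Fourier multiplier `Ψ` on `L²(ℝ)` with the symbol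
`(K(εt, z) - z)⁻¹`, `t ∈ [-π/ε, π/ε)`, and to the operator `P_stiff L⁻¹ Ψ P_stiff`, that is, to
`F ↦ L⁻¹ (2π)^{-1/2} ∫ (K(εt, z) - z)⁻¹ F̂(t) exp (itx) dt` considered on functions on the stiff component
and extended by zero to the soft component. The unitary operators do not depend on `z`. -/
def StiffDispersiveAsymptotics (P : Composite n) (K : ℝ → ℝ → ℂ → ℂ) (r : ℕ) : Prop :=
  ∀ (Z : Set ℂ) (δ : ℝ), IsCompact Z → 0 < δ → ∃ C ε₀ : ℝ, 0 < ε₀ ∧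
    ∀ ε : ℝ, 0 < ε → ε ≤ ε₀ → ∃ W W' : L2Fibred ε ≃ₗᵢ[ℂ] L2Line,
      ∀ z ∈ Z, δ ≤ |z.im| → ∀ D : L2Fibred ε →L[ℂ] L2Fibred ε, P.IsStiffDirectIntegral ε z D →
        ∃ (Ψ : L2Line →L[ℂ] L2Line) (T : L2Fibred ε →L[ℂ] L2Fibred ε),
          IsFourierMultiplier (dispersionSymbol ε (fun τ => K ε τ z) z) Ψ ∧
          (∀ f, T f = W.symm (Ψ (W f))) ∧
          (∀ f, T f = W'.symm (P.stiffProjPer ε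
            ((P.stiffLength : ℂ)⁻¹ • Ψ (P.stiffProjPer ε (W' f))))) ∧
          ‖D - T‖ ≤ C * ε ^ r

end Composite

/-! ### The three examples -/

/-- Both components disconnected: an infinite chain in which a stiff edge of length `l₁` with
coefficient `a₁` alternates with a soft edge of length `l₂` with coefficient `1`. -/
def example0 (l₁ l₂ a₁ : ℝ) : Composite 2 where
  len := ![l₁, l₂]
  pos := ![0, l₁]
  coef := ![a₁, 1]
  stiff := ![true, false]
  vert := ![![1, 0], ![0, 1]]
  shift := ![![-1, 0], ![0, 0]]
  wt := fun _ _ _ => 1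

/-- The graph of the other two examples. With `V₁ = 0`, `V₂ = 1`, the edges of a period are
`e₁` from `V₂` (of the previous cell) to `V₁`, `e₂` from `V₁` to `V₂`, and `e₃` from `V₂` to `V₁`. -/
def loopGraph (l₁ l₂ l₃ : ℝ) (a : Fin 3 → ℝ) (stiff : Fin 3 → Bool) : Composite 3 where
  len := ![l₁, l₂, l₃]
  pos := ![0, l₁, l₁ + l₂]
  coef := a
  stiff := stiff
  vert := ![![1, 0], ![0, 1], ![1, 0]]
  shift := ![![-1, 0], ![0, 0], ![0, 0]]
  wt := fun e b τ =>
    (![![exp (I * τ * l₃), 1], ![1, 1], ![1, exp (I * τ * (l₂ + l₃))]] : Fin 3 → Fin 2 → ℂ) e b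

/-- Connected stiff component: `e₁`, `e₃` are stiff with coefficients `a₁`, `a₃`, and `e₂` is soft with
coefficient `1`. -/
def example1 (l₁ l₂ l₃ a₁ a₃ : ℝ) : Composite 3 :=
  loopGraph l₁ l₂ l₃ ![a₁, 1, a₃] ![true, false, true]

/-- Connected soft component: `e₁`, `e₂` are soft with coefficients `a₁`, `a₂`, and `e₃` is stiff with
coefficient `a₃`. -/
def example2 (l₁ l₂ l₃ a₁ a₂ a₃ : ℝ) : Composite 3 :=
  loopGraph l₁ l₂ l₃ ![a₁, a₂, a₃] ![false, false, true]

/-- The square root `√z`. All expressions below are even in `√z`. -/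
def sqrtC (z : ℂ) : ℂ := z ^ (1 / 2 : ℂ)

/-- The dispersion function `K(τ, z)` of the chain. -/
def dispersion0 (l₁ l₂ τ : ℝ) (z : ℂ) : ℂ :=
  2 * sqrtC z * (cos (l₂ * sqrtC z) - Real.cos τ) / (l₁ * sin (l₂ * sqrtC z))

/-- `θ(τ)`, the number `(a₁²/l₁) e^{-iτ} + a₃²/l₃` divided by its modulus. -/
def thetaPhase (l₁ l₃ a₁ a₃ τ : ℝ) : ℂ :=
  ((a₁ ^ 2 / l₁ : ℝ) * exp (-I * τ) + (a₃ ^ 2 / l₃ : ℝ)) /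
    (‖(a₁ ^ 2 / l₁ : ℝ) * exp (-I * τ) + (a₃ ^ 2 / l₃ : ℝ)‖ : ℝ)

/-- `σ² = (l₁/a₁² + l₃/a₃²)⁻¹`. -/
def sigmaSq (l₁ l₃ a₁ a₃ : ℝ) : ℝ := (l₁ / a₁ ^ 2 + l₃ / a₃ ^ 2)⁻¹

/-- The dispersion function `K(τ, z)` for the connected stiff component; it depends on `ε`. -/
def dispersion1 (l₁ l₂ l₃ a₁ a₃ ε τ : ℝ) (z : ℂ) : ℂ :=
  ((l₁ + l₃ : ℝ) : ℂ)⁻¹ *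
    (2 * sqrtC z * (cos (l₂ * sqrtC z) / sin (l₂ * sqrtC z)
        - (thetaPhase l₁ l₃ a₁ a₃ τ).re / sin (l₂ * sqrtC z))
      + (sigmaSq l₁ l₃ a₁ a₃ * (τ / ε) ^ 2 : ℝ))

/-- The dispersion function `K(τ, z)` for the connected soft component. -/
def dispersion2 (l₁ l₂ l₃ a₁ a₂ τ : ℝ) (z : ℂ) : ℂ :=
  2 * sqrtC z / l₃ *
    (a₁ * (cos (l₁ * sqrtC z / a₁) - Real.cos τ) / sin (l₁ * sqrtC z / a₁)
      - a₂ * tan (l₂ * sqrtC z / (2 * a₂)))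

/-- The zero-order coefficient `(l₁ + l₃) z + 2 √z tan (l₂ √z / 2)` of the effective equation. -/
def effectiveCoef (l₁ l₂ l₃ : ℝ) (z : ℂ) : ℂ :=
  (l₁ + l₃ : ℝ) * z + 2 * sqrtC z * tan (l₂ * sqrtC z / 2)

end

noncomputable section

/-! ### Calculus of absolutely continuous functions -/

theorem integral_indicator_le_eq {x y : ℝ} (hy : y ∈ Ioc 0 x) (q : ℝ → ℂ) :
    ∫ s in Ioc 0 x, (Iic y).indicator q s = ∫ s in (0 : ℝ)..y, q s := by
  rw [integral_indicator measurableSet_Iic, Measure.restrict_restrict measurableSet_Iic,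
    intervalIntegral.integral_of_le hy.1.le]
  congr 2
  ext s
  simp only [mem_inter_iff, mem_Iic, mem_Ioc]
  constructor
  · rintro ⟨h1, h2, h3⟩
    exact ⟨h2, h1⟩
  · rintro ⟨h1, h2⟩
    exact ⟨h2, h1, h2.trans hy.2⟩

theorem integral_indicator_lt_eq {x y : ℝ} (hy : y ∈ Ioc 0 x) (q : ℝ → ℂ) :
    ∫ s in Ioc 0 x, (Iio y).indicator q s = ∫ s in (0 : ℝ)..y, q s := by
  rw [← integral_indicator_le_eq hy]
  refine integral_congr_ae (ae_restrict_of_ae ?_)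
  filter_upwards [(Iio_ae_eq_Iic (μ := (volume : Measure ℝ)) (a := y))] with s hs
  have h : (s ∈ Iio y) = (s ∈ Iic y) := hs
  by_cases h1 : s ∈ Iio y
  · rw [indicator_of_mem h1, indicator_of_mem (h ▸ h1)]
  · rw [indicator_of_notMem h1, indicator_of_notMem (h ▸ h1)]

/-- Integration by parts for two absolutely continuous functions. -/
theorem integral_mul_add_mul_eq_sub {x : ℝ} (hx : 0 ≤ x) {p q P Q : ℝ → ℂ}
    (hp : IntervalIntegrable p volume 0 x) (hq : IntervalIntegrable q volume 0 x)
    (hP : ∀ y ∈ Icc 0 x, P y = P 0 + ∫ s in (0 : ℝ)..y, p s)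
    (hQ : ∀ y ∈ Icc 0 x, Q y = Q 0 + ∫ s in (0 : ℝ)..y, q s) :
    IntervalIntegrable (fun y => p y * Q y) volume 0 x ∧
    IntervalIntegrable (fun y => P y * q y) volume 0 x ∧
    (∫ y in (0 : ℝ)..x, p y * Q y) + (∫ y in (0 : ℝ)..x, P y * q y) = P x * Q x - P 0 * Q 0 := by
  have cont : ∀ {r R : ℝ → ℂ}, IntervalIntegrable r volume 0 x →
      (∀ y ∈ Icc 0 x, R y = R 0 + ∫ s in (0 : ℝ)..y, r s) → ContinuousOn R (Icc 0 x) := by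
    intro r R hr hR
    have h1 : ContinuousOn (fun y => R 0 + ∫ s in (0 : ℝ)..y, r s) (Icc 0 x) := by
      have := intervalIntegral.continuousOn_primitive_interval (f := r) (μ := volume)
        (a := 0) (b := x) (by rw [uIcc_of_le hx]; exact (intervalIntegrable_iff_integrableOn_Icc_of_le hx).1 hr)
      rw [uIcc_of_le hx] at this
      exact continuousOn_const.add this
    exact h1.congr hR
  have cP := cont hp hP
  have cQ := cont hq hQ
  have i1 : IntervalIntegrable (fun y => p y * Q y) volume 0 x :=
    hp.mul_continuousOn (by rwa [uIcc_of_le hx])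
  have i2 : IntervalIntegrable (fun y => P y * q y) volume 0 x :=
    hq.continuousOn_mul (by rwa [uIcc_of_le hx])
  refine ⟨i1, i2, ?_⟩
  have hp' : Integrable p (volume.restrict (Ioc 0 x)) :=
    (intervalIntegrable_iff_integrableOn_Ioc_of_le hx).1 hp
  have hq' : Integrable q (volume.restrict (Ioc 0 x)) :=
    (intervalIntegrable_iff_integrableOn_Ioc_of_le hx).1 hq
  set μ := volume.restrict (Ioc 0 x) with hμ
  have hpq : Integrable (fun z : ℝ × ℝ => p z.1 * q z.2) (μ.prod μ) := hp'.mul_prod hq'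
  have mS : MeasurableSet {z : ℝ × ℝ | z.2 ≤ z.1} := measurableSet_le measurable_snd measurable_fst
  set F : ℝ × ℝ → ℂ := fun z => p z.1 * q z.2
  set S : Set (ℝ × ℝ) := {z : ℝ × ℝ | z.2 ≤ z.1}
  have e1 : ∫ y, p y * Q y ∂μ = Q 0 * ∫ y, p y ∂μ + ∫ z, S.indicator F z ∂(μ.prod μ) := by
    rw [integral_prod _ (hpq.indicator mS), ← integral_const_mul, ← integral_add]
    · refine setIntegral_congr_fun measurableSet_Ioc fun y hy => ?_
      have : ∀ s, S.indicator F (y, s) = p y * (Iic y).indicator q s := by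
        intro s
        by_cases h : s ≤ y
        · rw [indicator_of_mem (show (y, s) ∈ S from h), indicator_of_mem (show s ∈ Iic y from h)]
        · rw [indicator_of_notMem (show (y, s) ∉ S from h),
            indicator_of_notMem (show s ∉ Iic y from h), mul_zero]
      simp only [this]
      rw [integral_const_mul, integral_indicator_le_eq hy, hQ y ⟨hy.1.le, hy.2⟩]
      ring
    · exact hp'.const_mul _
    · exact (hpq.indicator mS).integral_prod_left
  have e2 : ∫ y, P y * q y ∂μ = P 0 * ∫ y, q y ∂μ + ∫ z, Sᶜ.indicator F z ∂(μ.prod μ) := by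
    rw [integral_prod_symm _ (hpq.indicator mS.compl), ← integral_const_mul, ← integral_add]
    · refine setIntegral_congr_fun measurableSet_Ioc fun y hy => ?_
      have : ∀ s, Sᶜ.indicator F (s, y) = (Iio y).indicator p s * q y := by
        intro s
        by_cases h : s < y
        · rw [indicator_of_mem (show (s, y) ∈ Sᶜ from not_le.2 h),
            indicator_of_mem (show s ∈ Iio y from h)]
        · rw [indicator_of_notMem (show (s, y) ∉ Sᶜ from fun h' => h (not_le.1 h')),
            indicator_of_notMem (show s ∉ Iio y from h), zero_mul]
      simp only [this]
      rw [integral_mul_const, integral_indicator_lt_eq hy, hP y ⟨hy.1.le, hy.2⟩]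
      ring
    · exact hq'.const_mul _
    · exact (hpq.indicator mS.compl).integral_prod_right
  have e3 : ∫ z, S.indicator F z ∂(μ.prod μ) + ∫ z, Sᶜ.indicator F z ∂(μ.prod μ)
      = (∫ y, p y ∂μ) * ∫ y, q y ∂μ := by
    rw [← integral_prod_mul, ← integral_add (hpq.indicator mS) (hpq.indicator mS.compl)]
    exact integral_congr_ae (Filter.Eventually.of_forall fun z => indicator_self_add_compl_apply S F z)
  have hPx := hP x ⟨hx, le_rfl⟩
  have hQx := hQ x ⟨hx, le_rfl⟩
  rw [intervalIntegral.integral_of_le hx] at hPx hQx ⊢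
  rw [intervalIntegral.integral_of_le hx, e1, e2, hPx, hQx]
  linear_combination e3

namespace IsW22

variable {ℓ : ℝ} {φ φ' φ'' ψ ψ' ψ'' : ℝ → ℂ}

theorem integrableOn (h : IsW22 ℓ φ φ' φ'') : IntegrableOn φ'' (Ioo 0 ℓ) :=
  h.memLp.integrable (by norm_num)

theorem intervalIntegrable (h : IsW22 ℓ φ φ' φ'') (hℓ : 0 ≤ ℓ) :
    IntervalIntegrable φ'' volume 0 ℓ :=
  (intervalIntegrable_iff_integrableOn_Ioo_of_le hℓ).2 h.integrableOn

theorem continuousOn' (h : IsW22 ℓ φ φ' φ'') : ContinuousOn φ' (Icc 0 ℓ) := by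
  rcases lt_or_ge ℓ 0 with hℓ | hℓ
  · rw [Icc_eq_empty (not_le.2 hℓ)]; exact continuousOn_empty _
  have := intervalIntegral.continuousOn_primitive_interval (f := φ'') (μ := volume)
        (a := 0) (b := ℓ) (by rw [uIcc_of_le hℓ]; exact (intervalIntegrable_iff_integrableOn_Icc_of_le hℓ).1 (h.intervalIntegrable hℓ))
  rw [uIcc_of_le hℓ] at this
  exact (continuousOn_const.add this).congr h.deriv_eq

theorem intervalIntegrable' (h : IsW22 ℓ φ φ' φ'') (hℓ : 0 ≤ ℓ) :
    IntervalIntegrable φ' volume 0 ℓ :=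
  ContinuousOn.intervalIntegrable (by rw [uIcc_of_le hℓ]; exact h.continuousOn')

theorem continuousOn (h : IsW22 ℓ φ φ' φ'') : ContinuousOn φ (Icc 0 ℓ) := by
  rcases lt_or_ge ℓ 0 with hℓ | hℓ
  · rw [Icc_eq_empty (not_le.2 hℓ)]; exact continuousOn_empty _
  have := intervalIntegral.continuousOn_primitive_interval (f := φ') (μ := volume)
        (a := 0) (b := ℓ) (by rw [uIcc_of_le hℓ]; exact (intervalIntegrable_iff_integrableOn_Icc_of_le hℓ).1 (h.intervalIntegrable' hℓ))
  rw [uIcc_of_le hℓ] at this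
  exact (continuousOn_const.add this).congr h.eq

theorem mono (h : IsW22 ℓ φ φ' φ'') {x : ℝ} (hx : x ≤ ℓ) : IsW22 x φ φ' φ'' where
  memLp := h.memLp.mono_measure (Measure.restrict_mono (Ioo_subset_Ioo_right hx) le_rfl)
  deriv_eq y hy := h.deriv_eq y ⟨hy.1, hy.2.trans hx⟩
  eq y hy := h.eq y ⟨hy.1, hy.2.trans hx⟩

theorem memLp_mul {g ψ : ℝ → ℂ} (hg : MemLp g 2 (volume.restrict (Ioo 0 ℓ)))
    (hψ : ContinuousOn ψ (Icc 0 ℓ)) :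
    MemLp (fun x => g x * ψ x) 2 (volume.restrict (Ioo 0 ℓ)) := by
  obtain ⟨C, hC⟩ := isCompact_Icc.exists_bound_of_continuousOn hψ
  have hm : AEStronglyMeasurable ψ (volume.restrict (Ioo 0 ℓ)) :=
    (hψ.mono Ioo_subset_Icc_self).aestronglyMeasurable measurableSet_Ioo
  refine MemLp.of_le_mul (c := C) hg (hg.1.mul hm) ?_
  filter_upwards [ae_restrict_mem measurableSet_Ioo] with x hx
  rw [norm_mul, mul_comm]
  exact mul_le_mul_of_nonneg_right (hC x (Ioo_subset_Icc_self hx)) (norm_nonneg _)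

theorem memLp_of_continuousOn {ψ : ℝ → ℂ} (hψ : ContinuousOn ψ (Icc 0 ℓ)) :
    MemLp ψ 2 (volume.restrict (Ioo 0 ℓ)) := by
  have h1 : MemLp (fun _ : ℝ => (1 : ℂ)) 2 (volume.restrict (Ioo 0 ℓ)) := memLp_const 1
  simpa using memLp_mul h1 hψ

theorem add (h : IsW22 ℓ φ φ' φ'') (k : IsW22 ℓ ψ ψ' ψ'') :
    IsW22 ℓ (fun x => φ x + ψ x) (fun x => φ' x + ψ' x) (fun x => φ'' x + ψ'' x) where
  memLp := h.memLp.add k.memLp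
  deriv_eq x hx := by
    rw [intervalIntegral.integral_add ((h.mono hx.2).intervalIntegrable hx.1)
      ((k.mono hx.2).intervalIntegrable hx.1), h.deriv_eq x hx, k.deriv_eq x hx]
    ring
  eq x hx := by
    rw [intervalIntegral.integral_add ((h.mono hx.2).intervalIntegrable' hx.1)
      ((k.mono hx.2).intervalIntegrable' hx.1), h.eq x hx, k.eq x hx]
    ring

theorem const_mul (h : IsW22 ℓ φ φ' φ'') (c : ℂ) :
    IsW22 ℓ (fun x => c * φ x) (fun x => c * φ' x) (fun x => c * φ'' x) where
  memLp := h.memLp.const_mul c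
  deriv_eq x hx := by
    rw [intervalIntegral.integral_const_mul, h.deriv_eq x hx]
    ring
  eq x hx := by
    rw [intervalIntegral.integral_const_mul, h.eq x hx]
    ring

theorem zero : IsW22 ℓ (fun _ => 0) (fun _ => 0) (fun _ => 0) where
  memLp := MemLp.zero'
  deriv_eq x hx := by simp
  eq x hx := by simp

theorem sum {ι : Type*} (s : Finset ι) {f f' f'' : ι → ℝ → ℂ}
    (h : ∀ i ∈ s, IsW22 ℓ (f i) (f' i) (f'' i)) :
    IsW22 ℓ (fun x => ∑ i ∈ s, f i x) (fun x => ∑ i ∈ s, f' i x) (fun x => ∑ i ∈ s, f'' i x) := by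
  classical
  induction s using Finset.induction_on with
  | empty => simpa using zero
  | insert a s ha ih =>
    simp only [Finset.sum_insert ha]
    exact (h a (Finset.mem_insert_self _ _)).add
      (ih fun i hi => h i (Finset.mem_insert_of_mem hi))

theorem star (h : IsW22 ℓ φ φ' φ'') :
    IsW22 ℓ (fun x => (starRingEnd ℂ) (φ x)) (fun x => (starRingEnd ℂ) (φ' x))
      (fun x => (starRingEnd ℂ) (φ'' x)) where
  memLp := h.memLp.star
  deriv_eq x hx := by
    have : ∫ y in (0 : ℝ)..x, (starRingEnd ℂ) (φ'' y) = (starRingEnd ℂ) (∫ y in (0 : ℝ)..x, φ'' y) := by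
      simp only [intervalIntegral.integral_of_le hx.1]
      exact integral_conj
    rw [this, ← map_add, ← h.deriv_eq x hx]
  eq x hx := by
    have : ∫ y in (0 : ℝ)..x, (starRingEnd ℂ) (φ' y) = (starRingEnd ℂ) (∫ y in (0 : ℝ)..x, φ' y) := by
      simp only [intervalIntegral.integral_of_le hx.1]
      exact integral_conj
    rw [this, ← map_add, ← h.eq x hx]

theorem mul (h : IsW22 ℓ φ φ' φ'') (k : IsW22 ℓ ψ ψ' ψ'') :
    IsW22 ℓ (fun x => φ x * ψ x) (fun x => φ' x * ψ x + φ x * ψ' x)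
      (fun x => φ'' x * ψ x + 2 * (φ' x * ψ' x) + φ x * ψ'' x) where
  memLp := by
    refine ((memLp_mul h.memLp k.continuousOn).add
      (memLp_of_continuousOn (continuousOn_const.mul (h.continuousOn'.mul k.continuousOn')))).add ?_
    simpa only [mul_comm] using memLp_mul k.memLp h.continuousOn
  deriv_eq x hx := by
    have hx' := h.mono hx.2
    have kx := k.mono hx.2
    obtain ⟨a1, a2, a3⟩ := integral_mul_add_mul_eq_sub hx.1 (hx'.intervalIntegrable hx.1)
      (kx.intervalIntegrable' hx.1) hx'.deriv_eq kx.eq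
    obtain ⟨b1, b2, b3⟩ := integral_mul_add_mul_eq_sub hx.1 (hx'.intervalIntegrable' hx.1)
      (kx.intervalIntegrable hx.1) hx'.eq kx.deriv_eq
    have : ∀ y, φ'' y * ψ y + 2 * (φ' y * ψ' y) + φ y * ψ'' y
      = (φ'' y * ψ y + φ' y * ψ' y) + (φ' y * ψ' y + φ y * ψ'' y) := fun y => by ring
    simp only [this]
    rw [intervalIntegral.integral_add (a1.add a2) (b1.add b2), intervalIntegral.integral_add a1 a2,
      intervalIntegral.integral_add b1 b2, a3, b3]
    ring
  eq x hx := by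
    have hx' := h.mono hx.2
    have kx := k.mono hx.2
    obtain ⟨a1, a2, a3⟩ := integral_mul_add_mul_eq_sub hx.1 (hx'.intervalIntegrable' hx.1)
      (kx.intervalIntegrable' hx.1) hx'.eq kx.eq
    rw [intervalIntegral.integral_add a1 a2, a3]
    ring

theorem of_hasDerivAt (h1 : ∀ x, HasDerivAt φ (φ' x) x) (h2 : ∀ x, HasDerivAt φ' (φ'' x) x)
    (h3 : Continuous φ'') : IsW22 ℓ φ φ' φ'' where
  memLp := memLp_of_continuousOn h3.continuousOn
  deriv_eq x _ := by
    rw [intervalIntegral.integral_eq_sub_of_hasDerivAt (fun y _ => h2 y)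
      (h3.intervalIntegrable _ _)]
    ring
  eq x _ := by
    have : Continuous φ' := continuous_iff_continuousAt.2 fun x => (h2 x).continuousAt
    rw [intervalIntegral.integral_eq_sub_of_hasDerivAt (fun y _ => h1 y)
      (this.intervalIntegrable _ _)]
    ring

/-- Green's identity. -/
theorem green (hℓ : 0 ≤ ℓ) (h : IsW22 ℓ φ φ' φ'') (k : IsW22 ℓ ψ ψ' ψ'') :
    (∫ x in (0 : ℝ)..ℓ, φ'' x * ψ x) - ∫ x in (0 : ℝ)..ℓ, φ x * ψ'' x =
      (φ' ℓ * ψ ℓ - φ ℓ * ψ' ℓ) - (φ' 0 * ψ 0 - φ 0 * ψ' 0) := by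
  have a := (integral_mul_add_mul_eq_sub hℓ (h.intervalIntegrable hℓ)
      (k.intervalIntegrable' hℓ) h.deriv_eq k.eq).2.2
  have b := (integral_mul_add_mul_eq_sub hℓ (h.intervalIntegrable' hℓ)
      (k.intervalIntegrable hℓ) h.eq k.deriv_eq).2.2
  linear_combination a - b

theorem integral_by_parts (hℓ : 0 ≤ ℓ) (h : IsW22 ℓ φ φ' φ'') (k : IsW22 ℓ ψ ψ' ψ'') :
    (∫ x in (0 : ℝ)..ℓ, φ'' x * ψ x) + ∫ x in (0 : ℝ)..ℓ, φ' x * ψ' x =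
      φ' ℓ * ψ ℓ - φ' 0 * ψ 0 :=
  (integral_mul_add_mul_eq_sub hℓ (h.intervalIntegrable hℓ)
      (k.intervalIntegrable' hℓ) h.deriv_eq k.eq).2.2

end IsW22

/-! ### Square integrals and traces -/

/-- The squared `L²` norm on `(0, ℓ)`. -/
def sqInt (ℓ : ℝ) (h : ℝ → ℂ) : ℝ := ∫ x in Ioo 0 ℓ, ‖h x‖ ^ 2

theorem sqInt_nonneg (ℓ : ℝ) (h : ℝ → ℂ) : 0 ≤ sqInt ℓ h :=
  integral_nonneg fun _ => by positivity

theorem integral_Ioo_eq {ℓ : ℝ} (hℓ : 0 ≤ ℓ) (f : ℝ → ℂ) :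
    ∫ x in (0 : ℝ)..ℓ, f x = ∫ x in Ioo 0 ℓ, f x := by
  rw [intervalIntegral.integral_of_le hℓ, integral_Ioc_eq_integral_Ioo]

theorem norm_toLp_sq {α : Type*} [MeasurableSpace α] {μ : Measure α} {h : α → ℂ} (hh : MemLp h 2 μ) :
    ‖hh.toLp‖ ^ 2 = ∫ x, ‖h x‖ ^ 2 ∂μ := by
  have h1 : ‖hh.toLp‖ ^ 2 = RCLike.re (inner ℂ hh.toLp hh.toLp) := (inner_self_eq_norm_sq (𝕜 := ℂ) _).symm
  rw [h1, L2.inner_def]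
  have h2 : ∫ a, inner ℂ (MemLp.toLp h hh a) (MemLp.toLp h hh a) ∂μ = ((∫ x, ‖h x‖ ^ 2 ∂μ : ℝ) : ℂ) := by
    rw [← integral_complex_ofReal]
    refine integral_congr_ae ?_
    filter_upwards [hh.coeFn_toLp] with x hx
    rw [hx, inner_self_eq_norm_sq_to_K]
    simp
  rw [h2]
  simp

theorem norm_Lp_sq {α : Type*} [MeasurableSpace α] {μ : Measure α} (u : Lp ℂ 2 μ) :
    ‖u‖ ^ 2 = ∫ x, ‖u x‖ ^ 2 ∂μ := by
  have := norm_toLp_sq (Lp.memLp u)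
  rwa [Lp.toLp_coeFn] at this

theorem inner_toLp {α : Type*} [MeasurableSpace α] {μ : Measure α} {h k : α → ℂ} (hh : MemLp h 2 μ)
    (hk : MemLp k 2 μ) :
    inner ℂ hh.toLp hk.toLp = ∫ x, (starRingEnd ℂ) (h x) * k x ∂μ := by
  rw [L2.inner_def]
  refine integral_congr_ae ?_
  filter_upwards [hh.coeFn_toLp, hk.coeFn_toLp] with x hx hx'
  rw [hx, hx', RCLike.inner_apply, mul_comm]

theorem inner_Lp {α : Type*} [MeasurableSpace α] {μ : Measure α} (u v : Lp ℂ 2 μ) :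
    inner ℂ u v = ∫ x, (starRingEnd ℂ) (u x) * v x ∂μ := by
  have := inner_toLp (Lp.memLp u) (Lp.memLp v)
  rwa [Lp.toLp_coeFn, Lp.toLp_coeFn] at this

/-- The Cauchy–Schwarz inequality. -/
theorem norm_integral_mul_sq_le {α : Type*} [MeasurableSpace α] {μ : Measure α} {h k : α → ℂ}
    (hh : MemLp h 2 μ) (hk : MemLp k 2 μ) :
    ‖∫ x, h x * k x ∂μ‖ ^ 2 ≤ (∫ x, ‖h x‖ ^ 2 ∂μ) * ∫ x, ‖k x‖ ^ 2 ∂μ := by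
  have h1 := inner_toLp hh.star hk
  have h2 := norm_inner_le_norm (𝕜 := ℂ) hh.star.toLp hk.toLp
  rw [h1] at h2
  have h3 := norm_toLp_sq hh.star
  have h4 := norm_toLp_sq hk
  simp only [Pi.star_apply, RCLike.star_def, RCLike.norm_conj, starRingEnd_self_apply] at h2 h3
  rw [← h3, ← h4, ← mul_pow]
  exact pow_le_pow_left₀ (norm_nonneg _) h2 2

theorem norm_integral_mul_sq_le_sqInt {ℓ : ℝ} (hℓ : 0 ≤ ℓ) {h k : ℝ → ℂ}
    (hh : MemLp h 2 (volume.restrict (Ioo 0 ℓ))) (hk : MemLp k 2 (volume.restrict (Ioo 0 ℓ))) :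
    ‖∫ x in (0 : ℝ)..ℓ, h x * k x‖ ^ 2 ≤ sqInt ℓ h * sqInt ℓ k := by
  rw [integral_Ioo_eq hℓ]
  exact norm_integral_mul_sq_le hh hk

theorem norm_integral_sq_le_sqInt {ℓ : ℝ} (hℓ : 0 ≤ ℓ) {h : ℝ → ℂ}
    (hh : MemLp h 2 (volume.restrict (Ioo 0 ℓ))) :
    ‖∫ x in (0 : ℝ)..ℓ, h x‖ ^ 2 ≤ ℓ * sqInt ℓ h := by
  have := norm_integral_mul_sq_le_sqInt hℓ hh (k := fun _ => 1) (memLp_const 1)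
  have h1 : sqInt ℓ (fun _ => 1) = ℓ := by simp [sqInt, hℓ]
  simpa [h1, mul_comm] using this

theorem integrable_norm_sq {α : Type*} [MeasurableSpace α] {μ : Measure α} {h : α → ℂ}
    (hh : MemLp h 2 μ) : Integrable (fun x => ‖h x‖ ^ 2) μ :=
  (memLp_two_iff_integrable_sq_norm hh.1).1 hh

theorem integral_norm_add_sq_le {α : Type*} [MeasurableSpace α] {μ : Measure α} {h k : α → ℂ}
    (hh : MemLp h 2 μ) (hk : MemLp k 2 μ) :
    ∫ x, ‖h x + k x‖ ^ 2 ∂μ ≤ 2 * (∫ x, ‖h x‖ ^ 2 ∂μ) + 2 * ∫ x, ‖k x‖ ^ 2 ∂μ := by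
  rw [← integral_const_mul, ← integral_const_mul, ← integral_add]
  · refine integral_mono (integrable_norm_sq (hh.add hk)) ?_ fun x => ?_
    · exact ((integrable_norm_sq hh).const_mul 2).add ((integrable_norm_sq hk).const_mul 2)
    · have := norm_add_le (h x) (k x)
      have h0 := norm_nonneg (h x + k x)
      simp only
      nlinarith [sq_nonneg (‖h x‖ - ‖k x‖)]
  · exact (integrable_norm_sq hh).const_mul 2
  · exact (integrable_norm_sq hk).const_mul 2

theorem sqInt_add_le {ℓ : ℝ} {h k : ℝ → ℂ}
    (hh : MemLp h 2 (volume.restrict (Ioo 0 ℓ))) (hk : MemLp k 2 (volume.restrict (Ioo 0 ℓ))) :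
    sqInt ℓ (fun x => h x + k x) ≤ 2 * sqInt ℓ h + 2 * sqInt ℓ k :=
  integral_norm_add_sq_le hh hk

theorem sqInt_const_mul (ℓ : ℝ) (c : ℂ) (h : ℝ → ℂ) :
    sqInt ℓ (fun x => c * h x) = ‖c‖ ^ 2 * sqInt ℓ h := by
  simp only [sqInt, norm_mul, mul_pow, integral_const_mul]

theorem sqInt_congr_norm {ℓ : ℝ} {h k : ℝ → ℂ}
    (hk : ∀ᵐ x ∂(volume.restrict (Ioo 0 ℓ)), ‖h x‖ = ‖k x‖) : sqInt ℓ h = sqInt ℓ k :=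
  integral_congr_ae (by filter_upwards [hk] with x hx; rw [hx])

theorem sqInt_mono {ℓ : ℝ} {h k : ℝ → ℂ} (hk : MemLp k 2 (volume.restrict (Ioo 0 ℓ)))
    (hle : ∀ x ∈ Ioo 0 ℓ, ‖h x‖ ≤ ‖k x‖) : sqInt ℓ h ≤ sqInt ℓ k := by
  refine integral_mono_of_nonneg (Filter.Eventually.of_forall fun _ => by positivity)
    (integrable_norm_sq hk) ?_
  filter_upwards [ae_restrict_mem measurableSet_Ioo] with x hx
  exact pow_le_pow_left₀ (norm_nonneg _) (hle x hx) 2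

theorem sqInt_le_of_bound {ℓ : ℝ} (hℓ : 0 ≤ ℓ) {h : ℝ → ℂ} {M : ℝ} (hM : ∀ x ∈ Ioo 0 ℓ, ‖h x‖ ≤ M) :
    sqInt ℓ h ≤ ℓ * M ^ 2 := by
  have : sqInt ℓ h ≤ sqInt ℓ fun _ => (M : ℂ) :=
    sqInt_mono (memLp_const _) fun x hx => (hM x hx).trans (by simpa using le_abs_self M)
  simpa [sqInt, hℓ] using this

namespace IsW22

variable {ℓ : ℝ} {φ φ' φ'' ψ ψ' ψ'' : ℝ → ℂ}

theorem cubic (a b c d : ℂ) : IsW22 ℓ (fun x => a + b * x + c * x ^ 2 + d * x ^ 3)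
    (fun x => b + 2 * c * x + 3 * d * x ^ 2) (fun x => 2 * c + 6 * d * x) := by
  have hid : ∀ x : ℝ, HasDerivAt (fun x : ℝ => (x : ℂ)) 1 x := fun x => ofRealCLM.hasDerivAt
  refine of_hasDerivAt (fun x => ?_) (fun x => ?_) (by fun_prop)
  · have := ((((hasDerivAt_const x a).add ((hid x).const_mul b)).add
      (((hid x).pow 2).const_mul c))).add (((hid x).pow 3).const_mul d)
    refine this.congr_deriv ?_
    push_cast
    ring
  · have := (((hasDerivAt_const x b).add ((hid x).const_mul (2 * c))).add
      (((hid x).pow 2).const_mul (3 * d)))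
    refine this.congr_deriv ?_
    push_cast
    ring

theorem norm_green_sq_le (hℓ : 0 ≤ ℓ) (h : IsW22 ℓ φ φ' φ'') (k : IsW22 ℓ ψ ψ' ψ'') :
    ‖(φ' ℓ * ψ ℓ - φ ℓ * ψ' ℓ) - (φ' 0 * ψ 0 - φ 0 * ψ' 0)‖ ^ 2 ≤
      2 * (sqInt ℓ ψ + sqInt ℓ ψ'') * (sqInt ℓ φ + sqInt ℓ φ'') := by
  rw [← green hℓ h k]
  have h1 := norm_integral_mul_sq_le_sqInt hℓ h.memLp (memLp_of_continuousOn k.continuousOn)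
  have h2 := norm_integral_mul_sq_le_sqInt hℓ (memLp_of_continuousOn h.continuousOn) k.memLp
  have h3 := norm_sub_le (∫ x in (0 : ℝ)..ℓ, φ'' x * ψ x) (∫ x in (0 : ℝ)..ℓ, φ x * ψ'' x)
  have := sqInt_nonneg ℓ φ
  have := sqInt_nonneg ℓ φ''
  have := sqInt_nonneg ℓ ψ
  have := sqInt_nonneg ℓ ψ''
  calc _ ≤ (‖∫ x in (0 : ℝ)..ℓ, φ'' x * ψ x‖ + ‖∫ x in (0 : ℝ)..ℓ, φ x * ψ'' x‖) ^ 2 :=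
        pow_le_pow_left₀ (norm_nonneg _) h3 2
    _ ≤ 2 * (sqInt ℓ φ'' * sqInt ℓ ψ) + 2 * (sqInt ℓ φ * sqInt ℓ ψ'') := by
        nlinarith [sq_nonneg (‖∫ x in (0 : ℝ)..ℓ, φ'' x * ψ x‖ - ‖∫ x in (0 : ℝ)..ℓ, φ x * ψ'' x‖)]
    _ ≤ _ := by nlinarith [mul_nonneg ‹0 ≤ sqInt ℓ φ› ‹0 ≤ sqInt ℓ ψ›,
        mul_nonneg ‹0 ≤ sqInt ℓ φ''› ‹0 ≤ sqInt ℓ ψ''›]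

/-- The trace inequality, with the interpolation inequality for the first derivative. -/
theorem exists_trace_bound (hℓ : 0 < ℓ) : ∃ C : ℝ, 0 ≤ C ∧ ∀ {φ φ' φ'' : ℝ → ℂ},
    IsW22 ℓ φ φ' φ'' →
    ‖φ 0‖ ^ 2 ≤ C * (sqInt ℓ φ + sqInt ℓ φ'') ∧ ‖φ ℓ‖ ^ 2 ≤ C * (sqInt ℓ φ + sqInt ℓ φ'') ∧
    ‖φ' 0‖ ^ 2 ≤ C * (sqInt ℓ φ + sqInt ℓ φ'') ∧ ‖φ' ℓ‖ ^ 2 ≤ C * (sqInt ℓ φ + sqInt ℓ φ'') ∧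
    sqInt ℓ φ' ≤ C * (sqInt ℓ φ + sqInt ℓ φ'') := by
  have hℓ' : (ℓ : ℂ) ≠ 0 := by exact_mod_cast hℓ.ne'
  have key : ∀ a b c d : ℂ, ∃ C : ℝ, 0 ≤ C ∧ ∀ {φ φ' φ'' : ℝ → ℂ}, IsW22 ℓ φ φ' φ'' →
      ‖(φ' ℓ * (a + b * ℓ + c * ℓ ^ 2 + d * ℓ ^ 3) - φ ℓ * (b + 2 * c * ℓ + 3 * d * ℓ ^ 2)) -
        (φ' 0 * a - φ 0 * b)‖ ^ 2 ≤ C * (sqInt ℓ φ + sqInt ℓ φ'') := by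
    intro a b c d
    refine ⟨2 * (sqInt ℓ (fun x : ℝ => a + b * x + c * x ^ 2 + d * x ^ 3) +
      sqInt ℓ (fun x : ℝ => 2 * c + 6 * d * x)), ?_, fun h => ?_⟩
    rotate_left
    · have := norm_green_sq_le hℓ.le h (cubic a b c d)
      simp only [ofReal_zero] at this
      convert this using 4
      ring
    · have := sqInt_nonneg ℓ (fun x : ℝ => a + b * x + c * x ^ 2 + d * x ^ 3)
      have := sqInt_nonneg ℓ (fun x : ℝ => 2 * c + 6 * d * x)
      positivity
  obtain ⟨C1, p1, h1⟩ := key 0 1 (-2 / ℓ) (1 / ℓ ^ 2)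
  obtain ⟨C2, p2, h2⟩ := key 1 0 (-3 / ℓ ^ 2) (2 / ℓ ^ 3)
  obtain ⟨C3, p3, h3⟩ := key 0 0 (-1 / ℓ) (1 / ℓ ^ 2)
  obtain ⟨C4, p4, h4⟩ := key 0 0 (3 / ℓ ^ 2) (-2 / ℓ ^ 3)
  refine ⟨1 + C1 + C2 + C3 + C4, by positivity, fun {φ φ' φ''} h => ?_⟩
  have q1 := h1 h
  have q2 := h2 h
  have q3 := h3 h
  have q4 := h4 h
  have e1 : (φ' ℓ * (0 + 1 * ℓ + -2 / ℓ * ℓ ^ 2 + 1 / ℓ ^ 2 * ℓ ^ 3) -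
      φ ℓ * (1 + 2 * (-2 / ℓ) * ℓ + 3 * (1 / ℓ ^ 2) * ℓ ^ 2)) - (φ' 0 * 0 - φ 0 * 1) = φ 0 := by
    field_simp; ring
  have e2 : (φ' ℓ * (1 + 0 * ℓ + -3 / ℓ ^ 2 * ℓ ^ 2 + 2 / ℓ ^ 3 * ℓ ^ 3) -
      φ ℓ * (0 + 2 * (-3 / ℓ ^ 2) * ℓ + 3 * (2 / ℓ ^ 3) * ℓ ^ 2)) - (φ' 0 * 1 - φ 0 * 0) = -φ' 0 := by
    field_simp; ring
  have e3 : (φ' ℓ * (0 + 0 * ℓ + -1 / ℓ * ℓ ^ 2 + 1 / ℓ ^ 2 * ℓ ^ 3) -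
      φ ℓ * (0 + 2 * (-1 / ℓ) * ℓ + 3 * (1 / ℓ ^ 2) * ℓ ^ 2)) - (φ' 0 * 0 - φ 0 * 0) = -φ ℓ := by
    field_simp; ring
  have e4 : (φ' ℓ * (0 + 0 * ℓ + 3 / ℓ ^ 2 * ℓ ^ 2 + -2 / ℓ ^ 3 * ℓ ^ 3) -
      φ ℓ * (0 + 2 * (3 / ℓ ^ 2) * ℓ + 3 * (-2 / ℓ ^ 3) * ℓ ^ 2)) - (φ' 0 * 0 - φ 0 * 0) = φ' ℓ := by
    field_simp; ring
  rw [e1] at q1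
  rw [e2, norm_neg] at q2
  rw [e3, norm_neg] at q3
  rw [e4] at q4
  have n1 := sqInt_nonneg ℓ φ
  have n2 := sqInt_nonneg ℓ φ''
  set Q := sqInt ℓ φ + sqInt ℓ φ'' with hQ
  have nQ : 0 ≤ Q := add_nonneg n1 n2
  have := mul_nonneg p1 nQ
  have := mul_nonneg p2 nQ
  have := mul_nonneg p3 nQ
  have := mul_nonneg p4 nQ
  refine ⟨by nlinarith, by nlinarith, by nlinarith, by nlinarith, ?_⟩
  have ip := integral_by_parts hℓ.le h h.star
  have e5 : ∫ x in (0 : ℝ)..ℓ, φ' x * (starRingEnd ℂ) (φ' x) = (sqInt ℓ φ' : ℂ) := by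
    rw [integral_Ioo_eq hℓ.le, sqInt, ← integral_complex_ofReal]
    refine integral_congr_ae (Filter.Eventually.of_forall fun x => ?_)
    simp only [mul_conj, normSq_eq_norm_sq]
  rw [e5] at ip
  have c1 := norm_integral_mul_sq_le_sqInt hℓ.le h.memLp (memLp_of_continuousOn h.star.continuousOn)
  have e6 : sqInt ℓ (fun x => (starRingEnd ℂ) (φ x)) = sqInt ℓ φ :=
    sqInt_congr_norm (Filter.Eventually.of_forall fun x => RCLike.norm_conj _)
  rw [e6] at c1
  set J := ∫ x in (0 : ℝ)..ℓ, φ'' x * (starRingEnd ℂ) (φ x) with hJ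
  have c2 : ‖J‖ ≤ Q := by
    refine abs_le_of_sq_le_sq' ?_ nQ |>.2
    nlinarith
  have e7 : (sqInt ℓ φ' : ℂ) = φ' ℓ * (starRingEnd ℂ) (φ ℓ) - φ' 0 * (starRingEnd ℂ) (φ 0) - J := by
    linear_combination ip
  have c3 : sqInt ℓ φ' ≤ ‖φ' ℓ‖ * ‖φ ℓ‖ + ‖φ' 0‖ * ‖φ 0‖ + ‖J‖ := by
    calc sqInt ℓ φ' = ‖(sqInt ℓ φ' : ℂ)‖ := by simp [abs_of_nonneg (sqInt_nonneg ℓ φ')]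
      _ ≤ _ := by
        rw [e7]
        refine (norm_sub_le _ _).trans (add_le_add_left ((norm_sub_le _ _).trans ?_) _)
        simp
  nlinarith [sq_nonneg (‖φ' ℓ‖ - ‖φ ℓ‖), sq_nonneg (‖φ' 0‖ - ‖φ 0‖)]

end IsW22

/-! ### The signs of `w tan w` and `w cot w` -/

theorem two_mul_sin_mul_conj_cos (w : ℂ) :
    2 * (sin w * (starRingEnd ℂ) (cos w)) =
      ((Real.sin (2 * w.re) : ℝ) : ℂ) + (Real.sinh (2 * w.im) : ℝ) * I := by
  have h1 : 2 * (sin w * (starRingEnd ℂ) (cos w)) =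
      sin (w + (starRingEnd ℂ) w) + sin (w - (starRingEnd ℂ) w) := by
    rw [← cos_conj, sin_add, sin_sub]
    ring
  rw [h1, add_conj, sub_conj]
  push_cast
  rw [sin_mul_I]

theorem two_mul_cos_mul_conj_sin (w : ℂ) :
    2 * (cos w * (starRingEnd ℂ) (sin w)) =
      ((Real.sin (2 * w.re) : ℝ) : ℂ) - (Real.sinh (2 * w.im) : ℝ) * I := by
  have := congrArg (starRingEnd ℂ) (two_mul_sin_mul_conj_cos w)
  simp only [map_mul, map_add, conj_ofReal, conj_I, starRingEnd_self_apply, map_ofNat] at this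
  linear_combination this

theorem sin_sinh_pos {x y : ℝ} (hxy : x * y ≠ 0) (s : ℝ) (hs : |s| ≤ 1) :
    0 < (2 * x * y) * (x * Real.sinh (2 * y) + s * (y * Real.sin (2 * x))) := by
  have hx : x ≠ 0 := left_ne_zero_of_mul hxy
  have hy : y ≠ 0 := right_ne_zero_of_mul hxy
  have h1 : 2 * y ^ 2 < y * Real.sinh (2 * y) := by
    rcases lt_or_gt_of_ne hy with h | h
    · have := Real.self_lt_sinh_iff.2 (show 0 < -(2 * y) by linarith)
      rw [Real.sinh_neg] at this
      nlinarith
    · have := Real.self_lt_sinh_iff.2 (show 0 < 2 * y by linarith)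
      nlinarith
  have h2 : |x * Real.sin (2 * x)| ≤ 2 * x ^ 2 := by
    rw [abs_mul]
    have := Real.abs_sin_le_abs (x := 2 * x)
    rw [abs_mul, abs_two] at this
    nlinarith [abs_nonneg x, sq_abs x]
  have h3 : |s * (x * Real.sin (2 * x))| ≤ 2 * x ^ 2 := by
    rw [abs_mul]
    nlinarith [abs_nonneg (x * Real.sin (2 * x))]
  have h4 := (abs_le.1 h3).1
  have hx2 : 0 < x ^ 2 := by positivity
  have hy2 : 0 < y ^ 2 := by positivity
  have : (2 * x * y) * (x * Real.sinh (2 * y) + s * (y * Real.sin (2 * x)))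
    = 2 * (x ^ 2 * (y * Real.sinh (2 * y)) + y ^ 2 * (s * (x * Real.sin (2 * x)))) := by ring
  rw [this]
  nlinarith [mul_lt_mul_of_pos_left h1 hx2, mul_le_mul_of_nonneg_left h4 hy2.le]

theorem sq_im (w : ℂ) : (w ^ 2).im = 2 * w.re * w.im := by
  rw [sq, mul_im]; ring

theorem im_mul_sin_mul_conj_cos_pos {w : ℂ} (hw : (w ^ 2).im ≠ 0) :
    0 < (w ^ 2).im * (w * (sin w * (starRingEnd ℂ) (cos w))).im := by
  have h := two_mul_sin_mul_conj_cos w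
  have e : (w * (sin w * (starRingEnd ℂ) (cos w))).im =
      (w.re * Real.sinh (2 * w.im) + 1 * (w.im * Real.sin (2 * w.re))) / 2 := by
    have : w * (sin w * (starRingEnd ℂ) (cos w)) =
      w * (((Real.sin (2 * w.re) : ℝ) : ℂ) + (Real.sinh (2 * w.im) : ℝ) * I) * ((1 / 2 : ℝ) : ℂ) := by
      rw [← h]; push_cast; ring
    rw [this, im_mul_ofReal, mul_im]
    simp only [add_re, ofReal_re, mul_re, I_re, ofReal_im, I_im, add_im, mul_im]
    ring
  rw [sq_im] at hw ⊢
  have := sin_sinh_pos (x := w.re) (y := w.im) (by intro h; apply hw; rw [mul_assoc, h, mul_zero]) 1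
    (by simp)
  rw [e]
  linarith

theorem im_mul_cos_mul_conj_sin_neg {w : ℂ} (hw : (w ^ 2).im ≠ 0) :
    0 < (w ^ 2).im * -(w * (cos w * (starRingEnd ℂ) (sin w))).im := by
  have h := two_mul_cos_mul_conj_sin w
  have e : -(w * (cos w * (starRingEnd ℂ) (sin w))).im =
      (w.re * Real.sinh (2 * w.im) + (-1) * (w.im * Real.sin (2 * w.re))) / 2 := by
    have : w * (cos w * (starRingEnd ℂ) (sin w)) =
      w * (((Real.sin (2 * w.re) : ℝ) : ℂ) - (Real.sinh (2 * w.im) : ℝ) * I) * ((1 / 2 : ℝ) : ℂ) := by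
      rw [← h]; push_cast; ring
    rw [this, im_mul_ofReal, mul_im]
    simp only [sub_re, ofReal_re, mul_re, I_re, ofReal_im, I_im, sub_im, mul_im]
    ring
  rw [sq_im] at hw ⊢
  have := sin_sinh_pos (x := w.re) (y := w.im) (by intro h; apply hw; rw [mul_assoc, h, mul_zero]) (-1)
    (by simp)
  rw [e]
  linarith

theorem sin_ne_zero_of_sq_im {w : ℂ} (hw : (w ^ 2).im ≠ 0) : sin w ≠ 0 := by
  intro h
  have := im_mul_sin_mul_conj_cos_pos hw
  simp [h] at this

theorem cos_ne_zero_of_sq_im {w : ℂ} (hw : (w ^ 2).im ≠ 0) : cos w ≠ 0 := by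
  intro h
  have := im_mul_sin_mul_conj_cos_pos hw
  simp [h] at this

theorem im_mul_tan_pos {w : ℂ} (hw : (w ^ 2).im ≠ 0) : 0 < (w ^ 2).im * (w * tan w).im := by
  have hc := cos_ne_zero_of_sq_im hw
  have h := im_mul_sin_mul_conj_cos_pos hw
  have hn : 0 < normSq (cos w) := normSq_pos.2 hc
  have : w * (sin w * (starRingEnd ℂ) (cos w)) = w * tan w * (normSq (cos w) : ℝ) := by
    rw [normSq_eq_conj_mul_self, tan_eq_sin_div_cos]
    field_simp
  rw [this, im_mul_ofReal, ← mul_assoc] at h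
  exact pos_of_mul_pos_left h hn.le

theorem im_mul_cot_neg {w : ℂ} (hw : (w ^ 2).im ≠ 0) :
    0 < (w ^ 2).im * (-(w * (cos w / sin w))).im := by
  have hc := sin_ne_zero_of_sq_im hw
  have h := im_mul_cos_mul_conj_sin_neg hw
  have hn : 0 < normSq (sin w) := normSq_pos.2 hc
  have : w * (cos w * (starRingEnd ℂ) (sin w)) = w * (cos w / sin w) * (normSq (sin w) : ℝ) := by
    rw [normSq_eq_conj_mul_self]
    field_simp
  rw [this, im_mul_ofReal, ← neg_mul, ← mul_assoc] at h
  rw [neg_im]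
  exact pos_of_mul_pos_left h hn.le

theorem sqrtC_sq (z : ℂ) : sqrtC z ^ 2 = z := by
  rw [sqrtC, ← cpow_nat_mul]
  simp

theorem half_angle_sq_im {z : ℂ} (hz : z.im ≠ 0) {p : ℝ} (hp : p ≠ 0) :
    (((p : ℂ) * sqrtC z) ^ 2).im ≠ 0 := by
  rw [mul_pow, sqrtC_sq, ← ofReal_pow, im_ofReal_mul]
  exact mul_ne_zero (pow_ne_zero _ hp) hz

/-- `cot (2 w) - 1 / sin (2 w) = - tan w` and `cot (2 w) + 1 / sin (2 w) = cot w`. -/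
theorem cot_two_mul {w : ℂ} (hs : sin w ≠ 0) (hc : cos w ≠ 0) :
    cos (2 * w) / sin (2 * w) - 1 / sin (2 * w) = -tan w ∧
    cos (2 * w) / sin (2 * w) + 1 / sin (2 * w) = cos w / sin w := by
  rw [tan_eq_sin_div_cos, sin_two_mul, cos_two_mul]
  have h := sin_sq_add_cos_sq w
  constructor
  · field_simp
    linear_combination 2 * h
  · field_simp
    ring

/-! ### The equation `a² φ'' = -(F + z φ)` on an edge -/

namespace IsW22

variable {ℓ : ℝ} {φ φ' φ'' : ℝ → ℂ}

theorem sin_cos (k α β : ℂ) : IsW22 ℓ (fun x => α * sin (k * x) + β * cos (k * x))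
    (fun x => k * (α * cos (k * x) - β * sin (k * x)))
    (fun x => -(k ^ 2) * (α * sin (k * x) + β * cos (k * x))) := by
  have hid : ∀ x : ℝ, HasDerivAt (fun x : ℝ => k * (x : ℂ)) k x := fun x => by
    simpa using (ofRealCLM.hasDerivAt (x := x)).const_mul k
  have hsin : ∀ x : ℝ, HasDerivAt (fun x : ℝ => sin (k * x)) (cos (k * x) * k) x := by
    intro x
    have := HasDerivAt.comp (h₂ := sin) x (Complex.hasDerivAt_sin (k * x)) (hid x)
    exact this
  have hcos : ∀ x : ℝ, HasDerivAt (fun x : ℝ => cos (k * x)) (-sin (k * x) * k) x := by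
    intro x
    have := HasDerivAt.comp (h₂ := cos) x (Complex.hasDerivAt_cos (k * x)) (hid x)
    exact this
  refine of_hasDerivAt (fun x => ?_) (fun x => ?_) (by fun_prop)
  · have := (((hsin x).const_mul α).add ((hcos x).const_mul β))
    refine this.congr_deriv ?_
    ring
  · have := ((((hcos x).const_mul α).sub ((hsin x).const_mul β)).const_mul k)
    refine this.congr_deriv ?_
    ring

/-- The end derivatives of a solution of the homogeneous equation in terms of its end values. -/
theorem end_deriv (hℓ : 0 ≤ ℓ) (h : IsW22 ℓ φ φ' φ'') {k : ℂ} (hs : sin (k * ℓ) ≠ 0)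
    (he : ∀ᵐ x ∂(volume.restrict (Ioo 0 ℓ)), φ'' x = -(k ^ 2) * φ x) :
    φ' 0 = k * (φ ℓ - φ 0 * cos (k * ℓ)) / sin (k * ℓ) ∧
    φ' ℓ = k * (φ ℓ * cos (k * ℓ) - φ 0) / sin (k * ℓ) := by
  have aux : ∀ α β : ℂ, (φ' ℓ * (α * sin (k * ℓ) + β * cos (k * ℓ)) -
      φ ℓ * (k * (α * cos (k * ℓ) - β * sin (k * ℓ)))) - (φ' 0 * β - φ 0 * (k * α)) = 0 := by
    intro α β
    have := green hℓ h (sin_cos k α β)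
    simp only [ofReal_zero, mul_zero, sin_zero, cos_zero, mul_one, zero_add, sub_zero] at this
    rw [← this, sub_eq_zero, integral_Ioo_eq hℓ, integral_Ioo_eq hℓ]
    refine integral_congr_ae ?_
    filter_upwards [he] with x hx
    rw [hx]
    ring
  have h1 := aux 1 0
  have h2 := aux (-cos (k * ℓ)) (sin (k * ℓ))
  have h3 := sin_sq_add_cos_sq (k * ℓ)
  constructor
  · rw [eq_div_iff hs]
    linear_combination -h2 + φ ℓ * k * h3
  · rw [eq_div_iff hs]
    linear_combination h1

theorem primitive_ac {ℓ x : ℝ} {f : ℝ → ℂ} (hx : x ∈ Icc 0 ℓ) (hf : IntervalIntegrable f volume 0 ℓ) :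
    IntervalIntegrable f volume 0 x := by
  refine hf.mono_set ?_
  rw [uIcc_of_le hx.1, uIcc_of_le (hx.1.trans hx.2)]
  exact Icc_subset_Icc_right hx.2

/-- The solution of `φ'' + k² φ = F` with vanishing initial data. -/
theorem exists_initial_value (hℓ : 0 < ℓ) {k : ℂ} (hk : k ≠ 0) : ∃ C : ℝ, 0 ≤ C ∧ ∀ F : ℝ → ℂ,
    MemLp F 2 (volume.restrict (Ioo 0 ℓ)) → ∃ g g' g'' : ℝ → ℂ, IsW22 ℓ g g' g'' ∧
      (∀ x, g'' x = F x - k ^ 2 * g x) ∧ g 0 = 0 ∧ g' 0 = 0 ∧ ‖g ℓ‖ ^ 2 ≤ C * sqInt ℓ F ∧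
      ‖g' ℓ‖ ^ 2 ≤ C * sqInt ℓ F ∧ sqInt ℓ g ≤ C * sqInt ℓ F := by
  have hcs : Continuous fun x : ℝ => sin (k * x) := by fun_prop
  have hcc : Continuous fun x : ℝ => cos (k * x) := by fun_prop
  obtain ⟨B1, hB1⟩ := (isCompact_Icc (a := (0 : ℝ)) (b := ℓ)).exists_bound_of_continuousOn hcs.continuousOn
  obtain ⟨B2, hB2⟩ := (isCompact_Icc (a := (0 : ℝ)) (b := ℓ)).exists_bound_of_continuousOn hcc.continuousOn
  set B := max B1 B2
  have hB0 : 0 ≤ B := (norm_nonneg _).trans ((hB1 0 ⟨le_rfl, hℓ.le⟩).trans (le_max_left _ _))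
  have kn : 0 < ‖k‖ := norm_pos_iff.2 hk
  set C0 : ℝ := (1 + ‖k‖⁻¹ ^ 2) * (2 * B ^ 2) ^ 2 * ℓ with hC0
  have C0n : 0 ≤ C0 := by positivity
  refine ⟨C0 * (1 + ℓ), by positivity, fun F hF => ?_⟩
  have hFi : IntervalIntegrable F volume 0 ℓ :=
    (intervalIntegrable_iff_integrableOn_Ioo_of_le hℓ.le).2 (hF.integrable (by norm_num))
  set c : ℝ → ℂ := fun x => ∫ y in (0 : ℝ)..x, cos (k * y) * F y with hc
  set s : ℝ → ℂ := fun x => ∫ y in (0 : ℝ)..x, sin (k * y) * F y with hs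
  have ic : IntervalIntegrable (fun y : ℝ => cos (k * y) * F y) volume 0 ℓ :=
    hFi.continuousOn_mul hcc.continuousOn
  have is : IntervalIntegrable (fun y : ℝ => sin (k * y) * F y) volume 0 ℓ :=
    hFi.continuousOn_mul hcs.continuousOn
  have c0 : c 0 = 0 := by simp [hc]
  have s0 : s 0 = 0 := by simp [hs]
  have cac : ∀ y, c y = c 0 + ∫ t in (0 : ℝ)..y, cos (k * t) * F t := fun y => by rw [c0, zero_add]
  have sac : ∀ y, s y = s 0 + ∫ t in (0 : ℝ)..y, sin (k * t) * F t := fun y => by rw [s0, zero_add]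
  have W1 := sin_cos (ℓ := ℓ) k 1 0
  have W2 := sin_cos (ℓ := ℓ) k 0 1
  simp only [one_mul, zero_mul, add_zero, sub_zero, zero_add, zero_sub] at W1 W2
  set g : ℝ → ℂ := fun x => k⁻¹ * (sin (k * x) * c x - cos (k * x) * s x) with hg
  set g' : ℝ → ℂ := fun x => cos (k * x) * c x + sin (k * x) * s x with hg'
  have W : IsW22 ℓ g g' (fun x => F x - k ^ 2 * g x) := by
    have p1 : ∀ x ∈ Icc 0 ℓ, _ := fun x hx => integral_mul_add_mul_eq_sub hx.1
      (primitive_ac hx (W1.intervalIntegrable' hℓ.le)) (primitive_ac hx ic)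
      (W1.mono hx.2).eq (fun y _ => cac y)
    have p2 : ∀ x ∈ Icc 0 ℓ, _ := fun x hx => integral_mul_add_mul_eq_sub hx.1
      (primitive_ac hx (W2.intervalIntegrable' hℓ.le)) (primitive_ac hx is)
      (W2.mono hx.2).eq (fun y _ => sac y)
    have p3 : ∀ x ∈ Icc 0 ℓ, _ := fun x hx => integral_mul_add_mul_eq_sub hx.1
      (primitive_ac hx (W2.intervalIntegrable' hℓ.le)) (primitive_ac hx ic)
      (W2.mono hx.2).eq (fun y _ => cac y)
    have p4 : ∀ x ∈ Icc 0 ℓ, _ := fun x hx => integral_mul_add_mul_eq_sub hx.1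
      (primitive_ac hx (W1.intervalIntegrable' hℓ.le)) (primitive_ac hx is)
      (W1.mono hx.2).eq (fun y _ => sac y)
    have eqg : ∀ x ∈ Icc 0 ℓ, g x = g 0 + ∫ y in (0 : ℝ)..x, g' y := by
      intro x hx
      obtain ⟨a1, a2, a3⟩ := p1 x hx
      obtain ⟨b1, b2, b3⟩ := p2 x hx
      have e : ∀ y, g' y = k⁻¹ * ((k * cos (k * y) * c y + sin (k * y) * (cos (k * y) * F y))
          - (k * -sin (k * y) * s y + cos (k * y) * (sin (k * y) * F y))) := by
        intro y
        simp only [hg']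
        field_simp
        ring
      simp only [e]
      rw [intervalIntegral.integral_const_mul, intervalIntegral.integral_sub (a1.add a2) (b1.add b2),
        intervalIntegral.integral_add a1 a2, intervalIntegral.integral_add b1 b2, a3, b3]
      simp only [hg, c0, s0, mul_zero]
      ring
    have cg' : ContinuousOn g' (Icc 0 ℓ) := by
      have aux : ∀ {f : ℝ → ℂ}, IntervalIntegrable f volume 0 ℓ →
          ContinuousOn (fun x => ∫ y in (0 : ℝ)..x, f y) (Icc 0 ℓ) := by
        intro f hf
        have := intervalIntegral.continuousOn_primitive_interval (f := f) (μ := volume)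
          (a := 0) (b := ℓ) (by rw [uIcc_of_le hℓ.le]; exact (intervalIntegrable_iff_integrableOn_Icc_of_le hℓ.le).1 hf)
        rwa [uIcc_of_le hℓ.le] at this
      exact (hcc.continuousOn.mul (aux ic)).add (hcs.continuousOn.mul (aux is))
    have cg : ContinuousOn g (Icc 0 ℓ) := by
      have hi : IntegrableOn g' (uIcc 0 ℓ) := by
        rw [uIcc_of_le hℓ.le]; exact cg'.integrableOn_compact isCompact_Icc
      have := intervalIntegral.continuousOn_primitive_interval (f := g') (μ := volume)
        (a := 0) (b := ℓ) hi
      rw [uIcc_of_le hℓ.le] at this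
      exact (continuousOn_const.add this).congr eqg
    refine ⟨hF.sub ((memLp_of_continuousOn cg).const_mul _), fun x hx => ?_, eqg⟩
    obtain ⟨a1, a2, a3⟩ := p3 x hx
    obtain ⟨b1, b2, b3⟩ := p4 x hx
    have e : ∀ y, F y - k ^ 2 * g y = ((k * -sin (k * y) * c y + cos (k * y) * (cos (k * y) * F y))
          + (k * cos (k * y) * s y + sin (k * y) * (sin (k * y) * F y))) := by
      intro y
      simp only [hg]
      have := sin_sq_add_cos_sq (k * y)
      field_simp
      linear_combination -F y * this
    simp only [e]
    rw [intervalIntegral.integral_add (a1.add a2) (b1.add b2),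
        intervalIntegral.integral_add a1 a2, intervalIntegral.integral_add b1 b2, a3, b3]
    simp only [hg', c0, s0, mul_zero]
    ring
  have bd : ∀ (q : ℝ → ℂ), Continuous q → (∀ x ∈ Icc 0 ℓ, ‖q x‖ ≤ B) → ∀ x ∈ Icc 0 ℓ,
      ‖∫ y in (0 : ℝ)..x, q y * F y‖ ≤ B * Real.sqrt (ℓ * sqInt ℓ F) := by
    intro q hq hqB x hx
    have hF1 : ∀ x : ℝ, sqInt x (fun y => F y) = ∫ y in Ioo 0 x, ‖F y‖ ^ 2 := fun x => rfl
    have hi : IntervalIntegrable (fun y => ‖F y‖) volume 0 ℓ := hFi.norm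
    have m1 : ‖∫ y in (0 : ℝ)..x, q y * F y‖ ≤ ∫ y in (0 : ℝ)..x, B * ‖F y‖ := by
      refine intervalIntegral.norm_integral_le_of_norm_le hx.1 ?_ ?_
      · filter_upwards with y hy
        rw [norm_mul]
        exact mul_le_mul_of_nonneg_right (hqB y ⟨hy.1.le, hy.2.trans hx.2⟩) (norm_nonneg _)
      · refine (hi.const_mul B).mono_set ?_
        rw [uIcc_of_le hx.1, uIcc_of_le hℓ.le]
        exact Icc_subset_Icc_right hx.2
    have m2 : ∫ y in (0 : ℝ)..x, B * ‖F y‖ ≤ ∫ y in (0 : ℝ)..ℓ, B * ‖F y‖ := by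
      refine intervalIntegral.integral_mono_interval le_rfl hx.1 hx.2 ?_ (hi.const_mul B)
      exact Filter.Eventually.of_forall fun y => mul_nonneg hB0 (norm_nonneg _)
    refine m1.trans (m2.trans ?_)
    rw [intervalIntegral.integral_const_mul]
    refine mul_le_mul_of_nonneg_left (Real.le_sqrt_of_sq_le ?_) hB0
    have hn : MemLp (fun y => ((‖F y‖ : ℝ) : ℂ)) 2 (volume.restrict (Ioo 0 ℓ)) := hF.norm.ofReal
    have := norm_integral_sq_le_sqInt hℓ.le hn
    rw [intervalIntegral.integral_ofReal, norm_real, Real.norm_eq_abs, sq_abs] at this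
    refine this.trans (le_of_eq ?_)
    rw [sqInt_congr_norm (k := F) (Filter.Eventually.of_forall fun x => by simp)]
  have hS : 0 ≤ ℓ * sqInt ℓ F := mul_nonneg hℓ.le (sqInt_nonneg _ _)
  have bc := bd _ hcc fun x hx => (hB2 x hx).trans (le_max_right _ _)
  have bs := bd _ hcs fun x hx => (hB1 x hx).trans (le_max_left _ _)
  have bg1 : ∀ x ∈ Icc 0 ℓ, ‖sin (k * x) * c x‖ + ‖cos (k * x) * s x‖
      ≤ 2 * B ^ 2 * Real.sqrt (ℓ * sqInt ℓ F) := by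
    intro x hx
    rw [norm_mul, norm_mul]
    have r := Real.sqrt_nonneg (ℓ * sqInt ℓ F)
    have u1 := mul_le_mul ((hB1 x hx).trans (le_max_left B1 B2)) (bc x hx) (norm_nonneg _) hB0
    have u2 := mul_le_mul ((hB2 x hx).trans (le_max_right B1 B2)) (bs x hx) (norm_nonneg _) hB0
    linarith [u1, u2]
  have bg2 : ∀ x ∈ Icc 0 ℓ, ‖cos (k * x) * c x‖ + ‖sin (k * x) * s x‖
      ≤ 2 * B ^ 2 * Real.sqrt (ℓ * sqInt ℓ F) := by
    intro x hx
    rw [norm_mul, norm_mul]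
    have r := Real.sqrt_nonneg (ℓ * sqInt ℓ F)
    have u1 := mul_le_mul ((hB2 x hx).trans (le_max_right B1 B2)) (bc x hx) (norm_nonneg _) hB0
    have u2 := mul_le_mul ((hB1 x hx).trans (le_max_left B1 B2)) (bs x hx) (norm_nonneg _) hB0
    linarith [u1, u2]
  have sq2 : (2 * B ^ 2 * Real.sqrt (ℓ * sqInt ℓ F)) ^ 2 = (2 * B ^ 2) ^ 2 * ℓ * sqInt ℓ F := by
    rw [mul_pow, Real.sq_sqrt hS]; ring
  have nS := sqInt_nonneg ℓ F
  have g1 : ∀ x ∈ Icc 0 ℓ, ‖g x‖ ^ 2 ≤ C0 * sqInt ℓ F := by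
    intro x hx
    have : ‖g x‖ ≤ ‖k‖⁻¹ * (2 * B ^ 2 * Real.sqrt (ℓ * sqInt ℓ F)) := by
      simp only [hg]
      rw [norm_mul, norm_inv]
      exact mul_le_mul_of_nonneg_left ((norm_sub_le _ _).trans (bg1 x hx)) (by positivity)
    refine (pow_le_pow_left₀ (norm_nonneg _) this 2).trans ?_
    rw [mul_pow, sq2, hC0]
    have : 0 ≤ (2 * B ^ 2) ^ 2 * ℓ * sqInt ℓ F := by positivity
    nlinarith
  have g2 : ∀ x ∈ Icc 0 ℓ, ‖g' x‖ ^ 2 ≤ C0 * sqInt ℓ F := by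
    intro x hx
    refine (pow_le_pow_left₀ (norm_nonneg _) ((norm_add_le _ _).trans (bg2 x hx)) 2).trans ?_
    rw [sq2, hC0]
    have : 0 ≤ (2 * B ^ 2) ^ 2 * ℓ * sqInt ℓ F := by positivity
    have : 0 ≤ ‖k‖⁻¹ ^ 2 := by positivity
    nlinarith
  have hle : C0 * sqInt ℓ F ≤ C0 * (1 + ℓ) * sqInt ℓ F := by
    have : 0 ≤ C0 * sqInt ℓ F := by positivity
    nlinarith
  refine ⟨g, g', _, W, fun x => rfl, by simp [hg, c0, s0], by simp [hg', c0, s0],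
    (g1 ℓ ⟨hℓ.le, le_rfl⟩).trans hle, (g2 ℓ ⟨hℓ.le, le_rfl⟩).trans hle, ?_⟩
  have : sqInt ℓ g ≤ ℓ * (Real.sqrt (C0 * sqInt ℓ F)) ^ 2 :=
    sqInt_le_of_bound hℓ.le fun x hx => Real.le_sqrt_of_sq_le (g1 x (Ioo_subset_Icc_self hx))
  rw [Real.sq_sqrt (by positivity)] at this
  have : 0 ≤ C0 * sqInt ℓ F := by positivity
  nlinarith

end IsW22

/-! ### Functions on a metric graph which tiles a part of the line -/

theorem measurePreserving_add_Ioo (p ℓ : ℝ) :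
    MeasurePreserving (fun x => p + x) (volume.restrict (Ioo 0 ℓ))
      (volume.restrict (Ioo p (p + ℓ))) := by
  have := (measurePreserving_add_left (volume : Measure ℝ) p).restrict_preimage
    (measurableSet_Ioo (a := p) (b := p + ℓ))
  simpa using this

theorem setIntegral_Ioo_translate {G : Type*} [NormedAddCommGroup G] [NormedSpace ℝ G] (p ℓ : ℝ)
    (F : ℝ → G) : ∫ y in Ioo p (p + ℓ), F y = ∫ x in Ioo 0 ℓ, F (p + x) :=
  ((measurePreserving_add_Ioo p ℓ).integral_comp
    (MeasurableEquiv.addLeft p).measurableEmbedding F).symm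

namespace MetricGraph

variable {E V : Type}

/-- The segment of the line which is occupied by the edge `e`. -/
def seg (Γ : MetricGraph E V) (e : E) : Set ℝ := Ioo (Γ.pos e) (Γ.pos e + Γ.len e)

/-- The edges, laid out on the line, are disjoint and exhaust the measure `μ`. -/
structure Tiles (Γ : MetricGraph E V) (μ : Measure ℝ) : Prop where
  len_pos : ∀ e, 0 < Γ.len e
  disj : Pairwise (Function.onFun Disjoint Γ.seg)
  restr : ∀ e, μ.restrict (Γ.seg e) = volume.restrict (Γ.seg e)
  cover : ∀ᵐ y ∂μ, y ∈ ⋃ e, Γ.seg e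

namespace Tiles

variable {Γ : MetricGraph E V} {μ : Measure ℝ}

theorem restrict_iUnion (h : Γ.Tiles μ) : μ.restrict (⋃ e, Γ.seg e) = μ :=
  Measure.restrict_eq_self_of_ae_mem h.cover

theorem measurableSet_seg (e : E) : MeasurableSet (Γ.seg e) := measurableSet_Ioo

theorem measurePreserving (h : Γ.Tiles μ) (e : E) :
    MeasurePreserving (fun x => Γ.pos e + x) (volume.restrict (Ioo 0 (Γ.len e)))
      (μ.restrict (Γ.seg e)) := by
  rw [h.restr]
  exact measurePreserving_add_Ioo _ _

theorem memLp_edge (h : Γ.Tiles μ) {u : ℝ → ℂ} (hu : MemLp u 2 μ) (e : E) :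
    MemLp (fun x => u (Γ.pos e + x)) 2 (volume.restrict (Ioo 0 (Γ.len e))) :=
  (hu.restrict (Γ.seg e)).comp_measurePreserving (h.measurePreserving e)

theorem ae_edge (h : Γ.Tiles μ) {p : ℝ → Prop} (hp : ∀ᵐ y ∂μ, p y) (e : E) :
    ∀ᵐ x ∂(volume.restrict (Ioo 0 (Γ.len e))), p (Γ.pos e + x) :=
  (h.measurePreserving e).quasiMeasurePreserving.ae (ae_restrict_of_ae hp)

theorem ae_of_edge [Countable E] (h : Γ.Tiles μ) {p : ℝ → Prop}
    (hp : ∀ e, ∀ᵐ x ∂(volume.restrict (Ioo 0 (Γ.len e))), p (Γ.pos e + x)) : ∀ᵐ y ∂μ, p y := by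
  rw [← h.restrict_iUnion, ae_restrict_iUnion_iff]
  intro e
  rw [h.restr]
  have := (measurePreserving_add_Ioo (Γ.pos e) (Γ.len e))
  have hm := this.map_eq
  rw [seg, ← hm]
  exact ((MeasurableEquiv.addLeft (Γ.pos e)).measurableEmbedding.ae_map_iff).2 (hp e)

theorem hasSum_integral {G : Type*} [NormedAddCommGroup G] [NormedSpace ℝ G] [Countable E] (h : Γ.Tiles μ)
    {F : ℝ → G} (hF : Integrable F μ) :
    HasSum (fun e => ∫ x in Ioo 0 (Γ.len e), F (Γ.pos e + x)) (∫ y, F y ∂μ) := by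
  have := hasSum_integral_iUnion (μ := μ) (f := F) (s := Γ.seg) measurableSet_seg h.disj
    hF.integrableOn
  rw [h.restrict_iUnion] at this
  convert this using 2 with e
  rw [h.restr, seg, setIntegral_Ioo_translate]

theorem hasSum_sqInt [Countable E] (h : Γ.Tiles μ) {u : ℝ → ℂ} (hu : MemLp u 2 μ) :
    HasSum (fun e => sqInt (Γ.len e) fun x => u (Γ.pos e + x)) (∫ y, ‖u y‖ ^ 2 ∂μ) :=
  h.hasSum_integral (integrable_norm_sq hu)

theorem hasSum_sqInt_Lp [Countable E] (h : Γ.Tiles μ) (u : Lp ℂ 2 μ) :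
    HasSum (fun e => sqInt (Γ.len e) fun x => u (Γ.pos e + x)) (‖u‖ ^ 2) := by
  rw [norm_Lp_sq]
  exact h.hasSum_sqInt (Lp.memLp u)

theorem hasSum_inner [Countable E] (h : Γ.Tiles μ) (u v : Lp ℂ 2 μ) :
    HasSum (fun e => ∫ x in Ioo 0 (Γ.len e), (starRingEnd ℂ) (u (Γ.pos e + x)) * v (Γ.pos e + x))
      (inner ℂ u v) := by
  rw [inner_Lp]
  exact h.hasSum_integral ((Lp.memLp u).star.integrable_mul (Lp.memLp v))

end Tiles

/-- The function on the line with the prescribed values on the edges. -/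
def glue (Γ : MetricGraph E V) (φ : E → ℝ → ℂ) (y : ℝ) : ℂ :=
  ∑' e, (Γ.seg e).indicator (fun y => φ e (y - Γ.pos e)) y

namespace Tiles

variable {Γ : MetricGraph E V} {μ : Measure ℝ}

theorem glue_eq (h : Γ.Tiles μ) (φ : E → ℝ → ℂ) (e : E) {y : ℝ} (hy : y ∈ Γ.seg e) :
    Γ.glue φ y = φ e (y - Γ.pos e) := by
  rw [glue, tsum_eq_single e, indicator_of_mem hy]
  intro e' he'
  refine indicator_of_notMem (fun hy' => ?_) _
  exact (Set.disjoint_left.1 (h.disj he')) hy' hy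

theorem glue_edge (h : Γ.Tiles μ) (φ : E → ℝ → ℂ) (e : E) {x : ℝ} (hx : x ∈ Ioo 0 (Γ.len e)) :
    Γ.glue φ (Γ.pos e + x) = φ e x := by
  rw [h.glue_eq φ e (y := Γ.pos e + x) ⟨by linarith [hx.1], by linarith [hx.2]⟩]
  congr 1
  ring

theorem memLp_glue [Countable E] (h : Γ.Tiles μ) {φ : E → ℝ → ℂ}
    (hφ : ∀ e, MemLp (φ e) 2 (volume.restrict (Ioo 0 (Γ.len e))))
    (hs : Summable fun e => sqInt (Γ.len e) (φ e)) : MemLp (Γ.glue φ) 2 μ := by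
  have mp : ∀ e, MeasurePreserving (fun y => y - Γ.pos e) (μ.restrict (Γ.seg e))
      (volume.restrict (Ioo 0 (Γ.len e))) := by
    intro e
    have := MeasurePreserving.symm (MeasurableEquiv.addLeft (Γ.pos e)) (h.measurePreserving e)
    have e2 : (fun y => y - Γ.pos e) = (MeasurableEquiv.addLeft (Γ.pos e)).symm := by
      ext y
      simp [sub_eq_neg_add]
    rw [e2]
    exact this
  have m1 : ∀ e, MemLp (Γ.glue φ) 2 (μ.restrict (Γ.seg e)) := by
    intro e
    refine MemLp.ae_eq ?_ ((hφ e).comp_measurePreserving (mp e))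
    filter_upwards [ae_restrict_mem (measurableSet_seg e)] with y hy
    exact (h.glue_eq φ e hy).symm
  have m2 : AEStronglyMeasurable (Γ.glue φ) μ := by
    rw [← h.restrict_iUnion]
    exact aestronglyMeasurable_iUnion_iff.2 fun e => (m1 e).1
  rw [memLp_two_iff_integrable_sq_norm m2, ← h.restrict_iUnion]
  refine integrableOn_iUnion_of_summable_integral_norm (fun e => integrable_norm_sq (m1 e)) ?_
  refine hs.congr fun e => ?_
  rw [sqInt, h.restr, seg, setIntegral_Ioo_translate]
  refine setIntegral_congr_fun measurableSet_Ioo fun x hx => ?_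
  rw [Real.norm_of_nonneg (by positivity)]
  rw [h.glue_edge φ e hx]

end Tiles

/-- Finiteness assumptions on the data of a metric graph. -/
structure Regular (Γ : MetricGraph E V) : Prop where
  coef_pos : ∀ e, 0 < Γ.coef e
  finite_types : (range fun e => (Γ.len e, Γ.coef e)).Finite
  finite_fiber : ∀ v, Finite {p : E × Fin 2 // Γ.vert p.1 p.2 = v}
  norm_wt : ∀ e b, ‖Γ.wt e b‖ = 1

/-- The outgoing co-derivative. -/
def coDeriv (Γ : MetricGraph E V) (φ' : E → ℝ → ℂ) (e : E) (b : Fin 2) : ℂ :=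
  endSign b * (Γ.coef e : ℂ) ^ 2 * φ' e (Γ.endPt e b)

/-- The conditions in the definition of the operator `-a² d²/dx²`, for given edge functions. -/
structure OpData (Γ : MetricGraph E V) (u g : ℝ → ℂ) (φ φ' φ'' : E → ℝ → ℂ) : Prop where
  w22 : ∀ e, IsW22 (Γ.len e) (φ e) (φ' e) (φ'' e)
  fst_eq : ∀ e, ∀ᵐ x ∂(volume.restrict (Ioo (0 : ℝ) (Γ.len e))), u (Γ.pos e + x) = φ e x
  snd_eq : ∀ e, ∀ᵐ x ∂(volume.restrict (Ioo (0 : ℝ) (Γ.len e))),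
      g (Γ.pos e + x) = -(Γ.coef e : ℂ) ^ 2 * φ'' e x
  cont : ∀ e b e' b', Γ.vert e b = Γ.vert e' b' →
      Γ.wt e b * φ e (Γ.endPt e b) = Γ.wt e' b' * φ e' (Γ.endPt e' b')
  kirchhoff : ∀ v : V, ∑ᶠ p : {p : E × Fin 2 // Γ.vert p.1 p.2 = v},
      Γ.wt p.1.1 p.1.2 * Γ.coDeriv φ' p.1.1 p.1.2 = 0

theorem isOp_zero_iff (Γ : MetricGraph E V) {μ : Measure ℝ} (u g : Lp ℂ 2 μ) :
    Γ.IsOp 0 u g ↔ ∃ φ φ' φ'', Γ.OpData u g φ φ' φ'' := by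
  have e1 : ∀ (φ φ' φ'' : E → ℝ → ℂ) e x, -(Γ.coef e : ℂ) ^ 2 *
      (φ'' e x + 2 * I * (0 : ℝ) * φ' e x - ((0 : ℝ) : ℂ) ^ 2 * φ e x) =
      -(Γ.coef e : ℂ) ^ 2 * φ'' e x := by
    intros; simp
  have e2 : ∀ (φ φ' : E → ℝ → ℂ) (v : V) (p : {p : E × Fin 2 // Γ.vert p.1 p.2 = v}),
      endSign p.1.2 * Γ.wt p.1.1 p.1.2 * (Γ.coef p.1.1 : ℂ) ^ 2 *
        (φ' p.1.1 (Γ.endPt p.1.1 p.1.2) + I * (0 : ℝ) * φ p.1.1 (Γ.endPt p.1.1 p.1.2)) =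
      Γ.wt p.1.1 p.1.2 * Γ.coDeriv φ' p.1.1 p.1.2 := by
    intros; simp [coDeriv]; ring
  constructor
  · rintro ⟨φ, φ', φ'', h1, h2, h3, h4, h5⟩
    refine ⟨φ, φ', φ'', h1, h2, fun e => ?_, h4, fun v => ?_⟩
    · filter_upwards [h3 e] with x hx
      rw [hx, e1]
    · rw [← h5 v]
      exact finsum_congr fun p => (e2 φ φ' v p).symm
  · rintro ⟨φ, φ', φ'', h1, h2, h3, h4, h5⟩
    refine ⟨φ, φ', φ'', h1, h2, fun e => ?_, h4, fun v => ?_⟩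
    · filter_upwards [h3 e] with x hx
      rw [hx, e1]
    · rw [← h5 v]
      exact finsum_congr fun p => (e2 φ φ' v p)

theorem OpData.add {Γ : MetricGraph E V} (hR : Γ.Regular) {u g v k w m : ℝ → ℂ} {φ φ' φ'' ψ ψ' ψ'' : E → ℝ → ℂ}
    (h : Γ.OpData u g φ φ' φ'') (h' : Γ.OpData v k ψ ψ' ψ'')
    (hw : ∀ e, ∀ᵐ x ∂(volume.restrict (Ioo (0 : ℝ) (Γ.len e))),
      w (Γ.pos e + x) = u (Γ.pos e + x) + v (Γ.pos e + x))
    (hm : ∀ e, ∀ᵐ x ∂(volume.restrict (Ioo (0 : ℝ) (Γ.len e))),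
      m (Γ.pos e + x) = g (Γ.pos e + x) + k (Γ.pos e + x)) :
    Γ.OpData w m (fun e x => φ e x + ψ e x) (fun e x => φ' e x + ψ' e x)
      (fun e x => φ'' e x + ψ'' e x) where
  w22 e := (h.w22 e).add (h'.w22 e)
  fst_eq e := by
    filter_upwards [h.fst_eq e, h'.fst_eq e, hw e] with x h1 h2 h3
    rw [h3, h1, h2]
  snd_eq e := by
    filter_upwards [h.snd_eq e, h'.snd_eq e, hm e] with x h1 h2 h3
    rw [h3, h1, h2]
    ring
  cont e b e' b' hv := by
    have := h.cont e b e' b' hv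
    have := h'.cont e b e' b' hv
    simp only [mul_add, *]
  kirchhoff v := by
    have := hR.finite_fiber v
    have e1 := h.kirchhoff v
    have e2 := h'.kirchhoff v
    have : ∀ p : {p : E × Fin 2 // Γ.vert p.1 p.2 = v},
      Γ.wt p.1.1 p.1.2 * Γ.coDeriv (fun e x => φ' e x + ψ' e x) p.1.1 p.1.2 =
      Γ.wt p.1.1 p.1.2 * Γ.coDeriv φ' p.1.1 p.1.2 + Γ.wt p.1.1 p.1.2 * Γ.coDeriv ψ' p.1.1 p.1.2 := by
      intro p
      simp only [coDeriv]
      ring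
    simp only [this]
    rw [finsum_add_distrib (Set.toFinite _) (Set.toFinite _), e1, e2, add_zero]

theorem OpData.const_mul {Γ : MetricGraph E V} (hR : Γ.Regular) {u g w m : ℝ → ℂ} {φ φ' φ'' : E → ℝ → ℂ}
    (h : Γ.OpData u g φ φ' φ'') (c : ℂ)
    (hw : ∀ e, ∀ᵐ x ∂(volume.restrict (Ioo (0 : ℝ) (Γ.len e))),
      w (Γ.pos e + x) = c * u (Γ.pos e + x))
    (hm : ∀ e, ∀ᵐ x ∂(volume.restrict (Ioo (0 : ℝ) (Γ.len e))),
      m (Γ.pos e + x) = c * g (Γ.pos e + x)) :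
    Γ.OpData w m (fun e x => c * φ e x) (fun e x => c * φ' e x) (fun e x => c * φ'' e x) where
  w22 e := (h.w22 e).const_mul c
  fst_eq e := by
    filter_upwards [h.fst_eq e, hw e] with x h1 h3
    rw [h3, h1]
  snd_eq e := by
    filter_upwards [h.snd_eq e, hm e] with x h1 h3
    rw [h3, h1]
    ring
  cont e b e' b' hv := by
    have := h.cont e b e' b' hv
    linear_combination c * this
  kirchhoff v := by
    have := hR.finite_fiber v
    have e1 := h.kirchhoff v
    have : ∀ p : {p : E × Fin 2 // Γ.vert p.1 p.2 = v},
      Γ.wt p.1.1 p.1.2 * Γ.coDeriv (fun e x => c * φ' e x) p.1.1 p.1.2 =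
      c * (Γ.wt p.1.1 p.1.2 * Γ.coDeriv φ' p.1.1 p.1.2) := by
      intro p
      simp only [coDeriv]
      ring
    simp only [this]
    rw [← mul_finsum, e1, mul_zero]

/-- A constant which may be chosen for each edge may be chosen uniformly. -/
theorem Regular.exists_uniform {Γ : MetricGraph E V} (hR : Γ.Regular) {p : ℝ → ℝ → ℝ → Prop}
    (hp : ∀ l a C C', C ≤ C' → p l a C → p l a C')
    (h : ∀ e, ∃ C, p (Γ.len e) (Γ.coef e) C) : ∃ C, 0 ≤ C ∧ ∀ e, p (Γ.len e) (Γ.coef e) C := by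
  choose c hc using h
  have h2 : ∀ q ∈ range fun e => (Γ.len e, Γ.coef e), ∃ C, p q.1 q.2 C := by
    rintro _ ⟨e, rfl⟩
    exact ⟨c e, hc e⟩
  choose! D hD using h2
  obtain ⟨M, hM⟩ := (hR.finite_types.image D).bddAbove
  refine ⟨max M 0, le_max_right _ _, fun e => ?_⟩
  have he : (Γ.len e, Γ.coef e) ∈ range fun e => (Γ.len e, Γ.coef e) := ⟨e, rfl⟩
  exact hp _ _ _ _ ((hM ⟨_, he, rfl⟩).trans (le_max_left _ _)) (hD _ he)

/-- Boundary values which satisfy the matching conditions are orthogonal to boundary values which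
satisfy the Kirchhoff conditions. -/
theorem Regular.tsum_boundary_eq_zero {Γ : MetricGraph E V} (hR : Γ.Regular) {h d : E × Fin 2 → ℂ}
    (hs : Summable fun p => (starRingEnd ℂ) (h p) * d p)
    (hc : ∀ e b e' b', Γ.vert e b = Γ.vert e' b' → Γ.wt e b * h (e, b) = Γ.wt e' b' * h (e', b'))
    (hk : ∀ v : V, ∑ᶠ p : {p : E × Fin 2 // Γ.vert p.1 p.2 = v}, Γ.wt p.1.1 p.1.2 * d p.1 = 0) :
    ∑' p, (starRingEnd ℂ) (h p) * d p = 0 := by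
  rw [← (Equiv.sigmaFiberEquiv fun p : E × Fin 2 => Γ.vert p.1 p.2).tsum_eq]
  have hs' := ((Equiv.sigmaFiberEquiv fun p : E × Fin 2 => Γ.vert p.1 p.2).summable_iff).2 hs
  refine (Summable.tsum_sigma hs').trans ?_
  refine (tsum_congr fun v => ?_).trans tsum_zero
  have hf := hR.finite_fiber v
  have := Fintype.ofFinite {p : E × Fin 2 // Γ.vert p.1 p.2 = v}
  refine (tsum_fintype _).trans ?_
  have hk' := hk v
  rw [finsum_eq_sum_of_fintype] at hk'
  by_cases hne : Nonempty {p : E × Fin 2 // Γ.vert p.1 p.2 = v}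
  · obtain ⟨p₀⟩ := hne
    set c := Γ.wt p₀.1.1 p₀.1.2 * h p₀.1 with hcdef
    have e1 : ∀ p : {p : E × Fin 2 // Γ.vert p.1 p.2 = v}, (starRingEnd ℂ) (h p.1) * d p.1 =
        (starRingEnd ℂ) c * (Γ.wt p.1.1 p.1.2 * d p.1) := by
      intro p
      have := hc p.1.1 p.1.2 p₀.1.1 p₀.1.2 (p.2.trans p₀.2.symm)
      have hn : Γ.wt p.1.1 p.1.2 * (starRingEnd ℂ) (Γ.wt p.1.1 p.1.2) = 1 := by
        rw [mul_conj, normSq_eq_norm_sq, hR.norm_wt]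
        simp
      rw [hcdef]
      change Γ.wt p.1.1 p.1.2 * h p.1 = Γ.wt p₀.1.1 p₀.1.2 * h p₀.1 at this
      rw [← this, map_mul]
      linear_combination -(starRingEnd ℂ) (h p.1) * d p.1 * hn
    calc _ = ∑ p : {p : E × Fin 2 // Γ.vert p.1 p.2 = v}, (starRingEnd ℂ) c * (Γ.wt p.1.1 p.1.2 * d p.1) :=
          Finset.sum_congr rfl fun p _ => e1 p
      _ = 0 := by rw [← Finset.mul_sum, hk', mul_zero]
  · rw [not_nonempty_iff] at hne
    simp

end MetricGraph

namespace MetricGraph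

variable {E V : Type}

/-! ### Symmetry -/

theorem Regular.exists_trace_const {Γ : MetricGraph E V} (hR : Γ.Regular) (hl : ∀ e, 0 < Γ.len e) :
    ∃ C : ℝ, 0 ≤ C ∧ ∀ e, ∀ φ φ' φ'' : ℝ → ℂ, IsW22 (Γ.len e) φ φ' φ'' →
      (∀ b, ‖φ (Γ.endPt e b)‖ ^ 2 ≤
        C * (sqInt (Γ.len e) φ + Γ.coef e ^ 4 * sqInt (Γ.len e) φ'')) ∧
      (∀ b, ‖endSign b * (Γ.coef e : ℂ) ^ 2 * φ' (Γ.endPt e b)‖ ^ 2 ≤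
        C * (sqInt (Γ.len e) φ + Γ.coef e ^ 4 * sqInt (Γ.len e) φ'')) ∧
      sqInt (Γ.len e) φ' ≤ C * (sqInt (Γ.len e) φ + Γ.coef e ^ 4 * sqInt (Γ.len e) φ'') := by
  let p : ℝ → ℝ → ℝ → Prop := fun l a C => ∀ φ φ' φ'' : ℝ → ℂ, IsW22 l φ φ' φ'' →
      ((‖φ 0‖ ^ 2 ≤ C * (sqInt l φ + a ^ 4 * sqInt l φ'') ∧
        ‖φ l‖ ^ 2 ≤ C * (sqInt l φ + a ^ 4 * sqInt l φ'')) ∧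
      (a ^ 4 * ‖φ' 0‖ ^ 2 ≤ C * (sqInt l φ + a ^ 4 * sqInt l φ'') ∧
        a ^ 4 * ‖φ' l‖ ^ 2 ≤ C * (sqInt l φ + a ^ 4 * sqInt l φ''))) ∧
      sqInt l φ' ≤ C * (sqInt l φ + a ^ 4 * sqInt l φ'')
  have hp : ∀ l a C C', C ≤ C' → p l a C → p l a C' := by
    intro l a C C' hCC' h φ φ' φ'' hw
    have hQ : 0 ≤ sqInt l φ + a ^ 4 * sqInt l φ'' := by
      have := sqInt_nonneg l φ
      have := sqInt_nonneg l φ''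
      positivity
    have := mul_le_mul_of_nonneg_right hCC' hQ
    obtain ⟨⟨⟨h1, h2⟩, h3, h4⟩, h5⟩ := h φ φ' φ'' hw
    exact ⟨⟨⟨h1.trans this, h2.trans this⟩, h3.trans this, h4.trans this⟩, h5.trans this⟩
  have he : ∀ e, ∃ C, p (Γ.len e) (Γ.coef e) C := by
    intro e
    obtain ⟨C, hC0, hC⟩ := IsW22.exists_trace_bound (hl e)
    have ha := hR.coef_pos e
    set a := Γ.coef e
    refine ⟨C * (1 + (a ^ 4)⁻¹) * (1 + a ^ 4), fun φ φ' φ'' h => ?_⟩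
    obtain ⟨h1, h2, h3, h4, h5⟩ := hC h
    have n1 := sqInt_nonneg (Γ.len e) φ
    have n2 := sqInt_nonneg (Γ.len e) φ''
    have a4 : 0 < a ^ 4 := by positivity
    have k1 : sqInt (Γ.len e) φ + sqInt (Γ.len e) φ'' ≤
        (1 + (a ^ 4)⁻¹) * (sqInt (Γ.len e) φ + a ^ 4 * sqInt (Γ.len e) φ'') := by
      have : (1 + (a ^ 4)⁻¹) * (sqInt (Γ.len e) φ + a ^ 4 * sqInt (Γ.len e) φ'') =
        sqInt (Γ.len e) φ + sqInt (Γ.len e) φ'' + (a ^ 4)⁻¹ * sqInt (Γ.len e) φ +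
          a ^ 4 * sqInt (Γ.len e) φ'' := by
        field_simp
        ring
      rw [this]
      have : 0 ≤ (a ^ 4)⁻¹ * sqInt (Γ.len e) φ := by positivity
      have : 0 ≤ a ^ 4 * sqInt (Γ.len e) φ'' := by positivity
      linarith
    set Q := sqInt (Γ.len e) φ + a ^ 4 * sqInt (Γ.len e) φ'' with hQ
    have nQ : 0 ≤ Q := by positivity
    have k2 : C * (sqInt (Γ.len e) φ + sqInt (Γ.len e) φ'') ≤ C * (1 + (a ^ 4)⁻¹) * Q := by
      rw [mul_assoc]; exact mul_le_mul_of_nonneg_left k1 hC0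
    have nB : 0 ≤ C * (1 + (a ^ 4)⁻¹) * Q := by positivity
    have k3 : C * (1 + (a ^ 4)⁻¹) * (1 + a ^ 4) * Q =
      C * (1 + (a ^ 4)⁻¹) * Q + a ^ 4 * (C * (1 + (a ^ 4)⁻¹) * Q) := by ring
    rw [k3]
    have nB' : 0 ≤ a ^ 4 * (C * (1 + (a ^ 4)⁻¹) * Q) := by positivity
    refine ⟨⟨⟨by linarith, by linarith⟩, ?_, ?_⟩, by linarith⟩
    · have := mul_le_mul_of_nonneg_left (h3.trans k2) a4.le
      linarith
    · have := mul_le_mul_of_nonneg_left (h4.trans k2) a4.le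
      linarith
  obtain ⟨C, hC0, hC⟩ := hR.exists_uniform hp he
  refine ⟨C, hC0, fun e φ φ' φ'' h => ?_⟩
  obtain ⟨⟨⟨h1, h2⟩, h3, h4⟩, h5⟩ := hC e φ φ' φ'' h
  have hs : ∀ b, ‖endSign b‖ = 1 := by
    intro b; fin_cases b <;> simp [endSign]
  have hn : ∀ b w, ‖endSign b * (Γ.coef e : ℂ) ^ 2 * w‖ ^ 2 = Γ.coef e ^ 4 * ‖w‖ ^ 2 := by
    intro b w
    rw [norm_mul, norm_mul, hs, norm_pow, norm_real, mul_pow]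
    simp only [one_mul, Real.norm_eq_abs, sq_abs]
    ring
  refine ⟨fun b => ?_, fun b => ?_, h5⟩
  · fin_cases b
    · simpa [endPt] using h1
    · simpa [endPt] using h2
  · rw [hn]
    fin_cases b
    · simpa [endPt] using h3
    · simpa [endPt] using h4

namespace OpData

variable {Γ : MetricGraph E V} {μ : Measure ℝ} {φ φ' φ'' : E → ℝ → ℂ}

theorem sqInt_fst {u g : ℝ → ℂ} (h : Γ.OpData u g φ φ' φ'') (e : E) :
    sqInt (Γ.len e) (fun x => u (Γ.pos e + x)) = sqInt (Γ.len e) (φ e) :=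
  sqInt_congr_norm (by filter_upwards [h.fst_eq e] with x hx; rw [hx])

theorem sqInt_snd {u g : ℝ → ℂ} (h : Γ.OpData u g φ φ' φ'') (e : E) :
    sqInt (Γ.len e) (fun x => g (Γ.pos e + x)) = Γ.coef e ^ 4 * sqInt (Γ.len e) (φ'' e) := by
  have h1 : sqInt (Γ.len e) (fun x => g (Γ.pos e + x)) =
      sqInt (Γ.len e) (fun x => -(Γ.coef e : ℂ) ^ 2 * φ'' e x) :=
    sqInt_congr_norm (by filter_upwards [h.snd_eq e] with x hx; rw [hx])
  rw [h1, sqInt_const_mul, norm_neg, norm_pow, norm_real]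
  simp only [Real.norm_eq_abs, sq_abs]
  ring

theorem summable_sqInt [Countable E] (hT : Γ.Tiles μ) {u g : Lp ℂ 2 μ}
    (h : Γ.OpData u g φ φ' φ'') :
    Summable fun e => sqInt (Γ.len e) (φ e) + Γ.coef e ^ 4 * sqInt (Γ.len e) (φ'' e) := by
  have h1 := (hT.hasSum_sqInt_Lp u).summable
  have h2 := (hT.hasSum_sqInt_Lp g).summable
  simp only [h.sqInt_fst, h.sqInt_snd] at h1 h2
  exact h1.add h2

theorem hasSum_energy [Countable E] (hT : Γ.Tiles μ) (hR : Γ.Regular) {u g : Lp ℂ 2 μ}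
    (h : Γ.OpData u g φ φ' φ'') :
    HasSum (fun e => ((Γ.coef e ^ 2 * sqInt (Γ.len e) (φ' e) : ℝ) : ℂ)) (inner ℂ u g) := by
  obtain ⟨C, hC0, hC⟩ := hR.exists_trace_const hT.len_pos
  have hQ := h.summable_sqInt hT
  set Q : E → ℝ := fun e => sqInt (Γ.len e) (φ e) + Γ.coef e ^ 4 * sqInt (Γ.len e) (φ'' e)
  have hQ0 : ∀ e, 0 ≤ Q e := fun e =>
    add_nonneg (sqInt_nonneg _ _) (mul_nonneg (by positivity) (sqInt_nonneg _ _))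
  set f : E × Fin 2 → ℂ := fun p =>
    (starRingEnd ℂ) (φ p.1 (Γ.endPt p.1 p.2)) * Γ.coDeriv φ' p.1 p.2 with hf
  have hfs : Summable f := by
    have hb : Summable fun p : E × Fin 2 => C * Q p.1 := by
      refine (summable_prod_of_nonneg fun p => mul_nonneg hC0 (hQ0 _)).2
        ⟨fun e => Summable.of_finite, ?_⟩
      simpa [tsum_fintype] using (hQ.mul_left C).mul_left 2
    refine Summable.of_norm_bounded hb fun p => ?_
    obtain ⟨h1, h2, -⟩ := hC p.1 _ _ _ (h.w22 p.1)
    have h1 := h1 p.2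
    have h2 := h2 p.2
    rw [hf, norm_mul, RCLike.norm_conj]
    simp only [coDeriv]
    change _ ≤ C * (sqInt (Γ.len p.1) (φ p.1) + Γ.coef p.1 ^ 4 * sqInt (Γ.len p.1) (φ'' p.1))
    nlinarith [sq_nonneg (‖φ p.1 (Γ.endPt p.1 p.2)‖ -
      ‖endSign p.2 * (Γ.coef p.1 : ℂ) ^ 2 * φ' p.1 (Γ.endPt p.1 p.2)‖)]
  have hf0 : ∑' p, f p = 0 := hR.tsum_boundary_eq_zero
    (h := fun p => φ p.1 (Γ.endPt p.1 p.2)) (d := fun p => Γ.coDeriv φ' p.1 p.2) hfs h.cont h.kirchhoff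
  have hfe : HasSum (fun e => f (e, 0) + f (e, 1)) 0 := by
    rw [← hf0]
    refine HasSum.prod_fiberwise hfs.hasSum fun e => ?_
    have := hasSum_fintype fun b : Fin 2 => f (e, b)
    rwa [Fin.sum_univ_two] at this
  have key := (hT.hasSum_inner u g).sub hfe
  rw [sub_zero] at key
  refine key.congr_fun ?_ |> fun h => h
  intro e
  have hl := (hT.len_pos e).le
  have ip := IsW22.integral_by_parts hl (h.w22 e) (h.w22 e).star
  have e5 : ∫ x in (0 : ℝ)..Γ.len e, φ' e x * (starRingEnd ℂ) (φ' e x) = (sqInt (Γ.len e) (φ' e) : ℂ) := by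
    rw [integral_Ioo_eq hl, sqInt, ← integral_complex_ofReal]
    refine integral_congr_ae (Filter.Eventually.of_forall fun x => ?_)
    simp only [mul_conj, normSq_eq_norm_sq]
  have e6 : ∫ x in Ioo 0 (Γ.len e), (starRingEnd ℂ) (u (Γ.pos e + x)) * g (Γ.pos e + x) =
      -(Γ.coef e : ℂ) ^ 2 * ∫ x in (0 : ℝ)..Γ.len e, φ'' e x * (starRingEnd ℂ) (φ e x) := by
    rw [integral_Ioo_eq hl, ← integral_const_mul]
    refine integral_congr_ae ?_
    filter_upwards [h.fst_eq e, h.snd_eq e] with x h1 h2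
    rw [h1, h2]
    ring
  rw [e6]
  simp only [hf, coDeriv, endPt, endSign]
  rw [e5] at ip
  push_cast
  simp only [one_mul]
  linear_combination (Γ.coef e : ℂ) ^ 2 * ip

end OpData

variable {Γ : MetricGraph E V} {μ : Measure ℝ}

theorem IsOp.inner_im [Countable E] (hT : Γ.Tiles μ) (hR : Γ.Regular) {u g : Lp ℂ 2 μ}
    (h : Γ.IsOp 0 u g) : (inner ℂ u g : ℂ).im = 0 := by
  obtain ⟨φ, φ', φ'', hd⟩ := (isOp_zero_iff Γ u g).1 h
  have := hasSum_im (hd.hasSum_energy hT hR)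
  simp only [ofReal_im] at this
  exact this.unique hasSum_zero

theorem IsOp.norm_le [Countable E] (hT : Γ.Tiles μ) (hR : Γ.Regular) {z : ℂ} {u f : Lp ℂ 2 μ}
    (h : Γ.IsOp 0 u (f + z • u)) : |z.im| * ‖u‖ ≤ ‖f‖ := by
  have h1 := h.inner_im hT hR
  rw [inner_add_right, inner_smul_right, inner_self_eq_norm_sq_to_K, add_im] at h1
  have h2 : (z * ((‖u‖ : ℝ) : ℂ) ^ 2).im = z.im * ‖u‖ ^ 2 := by
    rw [← ofReal_pow, im_mul_ofReal]
  have h2' : (z * ((‖u‖ : ℂ)) ^ 2).im = z.im * ‖u‖ ^ 2 := h2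
  have h3 : |(inner ℂ u f : ℂ).im| ≤ ‖u‖ * ‖f‖ := (abs_im_le_norm _).trans (norm_inner_le_norm _ _)
  have h4 : z.im * ‖u‖ ^ 2 = -(inner ℂ u f : ℂ).im := by
    have h1' : (inner ℂ u f : ℂ).im + (z * ((‖u‖ : ℂ)) ^ 2).im = 0 := h1
    rw [h2'] at h1'
    linarith
  have h5 : |z.im| * ‖u‖ ^ 2 ≤ ‖u‖ * ‖f‖ := by
    rw [← abs_of_nonneg (sq_nonneg ‖u‖), ← abs_mul, h4, abs_neg]
    exact h3
  rcases (norm_nonneg u).eq_or_lt with h0 | h0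
  · rw [← h0, mul_zero]; exact norm_nonneg _
  · nlinarith

theorem IsOp.add (hT : Γ.Tiles μ) (hR : Γ.Regular) {u g v k : Lp ℂ 2 μ}
    (h : Γ.IsOp 0 u g) (h' : Γ.IsOp 0 v k) : Γ.IsOp 0 (u + v) (g + k) := by
  obtain ⟨φ, φ', φ'', hd⟩ := (isOp_zero_iff Γ u g).1 h
  obtain ⟨ψ, ψ', ψ'', hd'⟩ := (isOp_zero_iff Γ v k).1 h'
  exact (isOp_zero_iff Γ _ _).2 ⟨_, _, _, hd.add hR hd' (hT.ae_edge (Lp.coeFn_add u v))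
    (hT.ae_edge (Lp.coeFn_add g k))⟩

theorem IsOp.smul (hT : Γ.Tiles μ) (hR : Γ.Regular) {u g : Lp ℂ 2 μ}
    (h : Γ.IsOp 0 u g) (c : ℂ) : Γ.IsOp 0 (c • u) (c • g) := by
  obtain ⟨φ, φ', φ'', hd⟩ := (isOp_zero_iff Γ u g).1 h
  exact (isOp_zero_iff Γ _ _).2 ⟨_, _, _, hd.const_mul hR c (hT.ae_edge (Lp.coeFn_smul c u))
    (hT.ae_edge (Lp.coeFn_smul c g))⟩

theorem IsOp.unique [Countable E] (hT : Γ.Tiles μ) (hR : Γ.Regular) {z : ℂ} (hz : z.im ≠ 0)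
    {u v f : Lp ℂ 2 μ} (h : Γ.IsOp 0 u (f + z • u)) (h' : Γ.IsOp 0 v (f + z • v)) : u = v := by
  have h1 : Γ.IsOp 0 (u + (-1 : ℂ) • v) (0 + z • (u + (-1 : ℂ) • v)) := by
    have := h.add hT hR (h'.smul hT hR (-1))
    convert this using 1
    module
  have h2 := h1.norm_le hT hR
  rw [norm_zero] at h2
  have h3 : ‖u + (-1 : ℂ) • v‖ ≤ 0 := by
    have := abs_pos.2 hz
    by_contra hc
    push Not at hc
    exact absurd h2 (not_le.2 (mul_pos this hc))
  have h4 := norm_le_zero_iff.1 h3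
  rw [neg_one_smul] at h4
  exact sub_eq_zero.1 (by rwa [sub_eq_add_neg])

theorem exists_resolvent_of_surjective [Countable E] (hT : Γ.Tiles μ) (hR : Γ.Regular) {z : ℂ}
    (hz : z.im ≠ 0) (hs : ∀ f : Lp ℂ 2 μ, ∃ u, Γ.IsOp 0 u (f + z • u)) :
    ∃ R : Lp ℂ 2 μ →L[ℂ] Lp ℂ 2 μ, IsResolvent (Γ.IsOp 0) z R := by
  choose r hr using hs
  have uniq : ∀ f u, Γ.IsOp 0 u (f + z • u) → u = r f := fun f u h => h.unique hT hR hz (hr f)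
  let L : Lp ℂ 2 μ →ₗ[ℂ] Lp ℂ 2 μ :=
    { toFun := r
      map_add' := fun f g => (uniq _ _ (by
        have := (hr f).add hT hR (hr g)
        convert this using 1
        module)).symm
      map_smul' := fun c f => (uniq _ _ (by
        have := (hr f).smul hT hR c
        rwa [smul_add, smul_comm c z] at this)).symm }
  refine ⟨L.mkContinuous |z.im|⁻¹ fun f => ?_, fun f u => ⟨fun h => uniq f u h, ?_⟩⟩
  · have := (hr f).norm_le hT hR
    rw [inv_mul_eq_div, le_div_iff₀ (abs_pos.2 hz), mul_comm]
    exact this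
  · rintro rfl
    exact hr f

end MetricGraph

/-! ### Existence of resolvents -/

/-- The Dirichlet-to-Neumann matrix of the equation `-a² φ'' = a² k² φ` on `(0, ℓ)`: it takes the
values of `φ` at the endpoints to the outgoing co-derivatives. -/
def dtn (a : ℝ) (k : ℂ) (ℓ : ℝ) : EuclideanSpace ℂ (Fin 2) →L[ℂ] EuclideanSpace ℂ (Fin 2) :=
  LinearMap.toContinuousLinearMap (Matrix.toEuclideanLin
    !![-((a : ℂ) ^ 2 * k * (cos (k * ℓ) / sin (k * ℓ))), (a : ℂ) ^ 2 * k * (1 / sin (k * ℓ));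
      (a : ℂ) ^ 2 * k * (1 / sin (k * ℓ)), -((a : ℂ) ^ 2 * k * (cos (k * ℓ) / sin (k * ℓ)))])

theorem dtn_zero (a : ℝ) (k : ℂ) (ℓ : ℝ) (h : EuclideanSpace ℂ (Fin 2)) :
    dtn a k ℓ h 0 = (a : ℂ) ^ 2 * k * (1 / sin (k * ℓ) * h 1 - cos (k * ℓ) / sin (k * ℓ) * h 0) := by
  simp [dtn, Matrix.toLpLin_apply, dotProduct, Fin.sum_univ_two]
  ring

theorem dtn_one (a : ℝ) (k : ℂ) (ℓ : ℝ) (h : EuclideanSpace ℂ (Fin 2)) :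
    dtn a k ℓ h 1 = (a : ℂ) ^ 2 * k * (1 / sin (k * ℓ) * h 0 - cos (k * ℓ) / sin (k * ℓ) * h 1) := by
  simp [dtn, Matrix.toLpLin_apply, dotProduct, Fin.sum_univ_two]
  ring

theorem exists_dtn_coercive {z : ℂ} (hz : z.im ≠ 0) {a ℓ : ℝ} (ha : 0 < a) (hℓ : 0 < ℓ) :
    ∃ C : ℝ, 0 < C ∧ ∀ h : EuclideanSpace ℂ (Fin 2),
      ‖h‖ ^ 2 ≤ C * (z.im * (inner ℂ h (dtn a (sqrtC z / a) ℓ h) : ℂ).im) := by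
  set w : ℂ := ((ℓ / (2 * a) : ℝ) : ℂ) * sqrtC z with hw
  have ha' : (a : ℂ) ≠ 0 := by exact_mod_cast ha.ne'
  have hℓ' : (ℓ : ℂ) ≠ 0 := by exact_mod_cast hℓ.ne'
  have hwim : (w ^ 2).im ≠ 0 := half_angle_sq_im hz (by positivity)
  have hwz : (w ^ 2).im = (ℓ / (2 * a)) ^ 2 * z.im := by
    rw [hw, mul_pow, sqrtC_sq, ← ofReal_pow, im_ofReal_mul]
  have t1 := im_mul_tan_pos hwim
  have t2 := im_mul_cot_neg hwim
  have hq : 0 < (ℓ / (2 * a)) ^ 2 := by positivity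
  rw [hwz, mul_assoc] at t1 t2
  have t1 : 0 < z.im * (w * tan w).im := pos_of_mul_pos_right t1 hq.le
  have t2 : 0 < z.im * (-(w * (cos w / sin w))).im := pos_of_mul_pos_right t2 hq.le
  obtain ⟨i1, i2⟩ := cot_two_mul (sin_ne_zero_of_sq_im hwim) (cos_ne_zero_of_sq_im hwim)
  have hkl : sqrtC z / a * ℓ = 2 * w := by
    rw [hw]; push_cast; field_simp
  have hak : (a : ℂ) ^ 2 * (sqrtC z / a) = ((2 * a ^ 2 / ℓ : ℝ) : ℂ) * w := by
    rw [hw]; push_cast; field_simp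
  set P := z.im * (w * tan w).im
  set N := z.im * (-(w * (cos w / sin w))).im
  have formula : ∀ h : EuclideanSpace ℂ (Fin 2),
      z.im * (inner ℂ h (dtn a (sqrtC z / a) ℓ h) : ℂ).im =
      a ^ 2 / ℓ * (P * ‖h 0 + h 1‖ ^ 2 + N * ‖h 0 - h 1‖ ^ 2) := by
    intro h
    rw [PiLp.inner_apply, Fin.sum_univ_two, RCLike.inner_apply, RCLike.inner_apply, dtn_zero,
      dtn_one, hkl, hak]
    have e1 : ((‖h 0 + h 1‖ ^ 2 : ℝ) : ℂ) = (h 0 + h 1) * ((starRingEnd ℂ) (h 0) + (starRingEnd ℂ) (h 1)) := by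
      rw [← map_add, mul_conj, normSq_eq_norm_sq]
    have e2 : ((‖h 0 - h 1‖ ^ 2 : ℝ) : ℂ) = (h 0 - h 1) * ((starRingEnd ℂ) (h 0) - (starRingEnd ℂ) (h 1)) := by
      rw [← map_sub, mul_conj, normSq_eq_norm_sq]
    have e3 : ((2 * a ^ 2 / ℓ : ℝ) : ℂ) * w * (1 / sin (2 * w) * h 1 - cos (2 * w) / sin (2 * w) * h 0) *
        (starRingEnd ℂ) (h 0) + ((2 * a ^ 2 / ℓ : ℝ) : ℂ) * w * (1 / sin (2 * w) * h 0 -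
          cos (2 * w) / sin (2 * w) * h 1) * (starRingEnd ℂ) (h 1) =
        (w * tan w) * ((a ^ 2 / ℓ * ‖h 0 + h 1‖ ^ 2 : ℝ) : ℂ) +
          (-(w * (cos w / sin w))) * ((a ^ 2 / ℓ * ‖h 0 - h 1‖ ^ 2 : ℝ) : ℂ) := by
      rw [ofReal_mul (a ^ 2 / ℓ), ofReal_mul (a ^ 2 / ℓ), e1, e2]
      have j1 : tan w = 1 / sin (2 * w) - cos (2 * w) / sin (2 * w) := by
        linear_combination i1
      rw [← i2, j1]
      push_cast
      ring
    rw [e3, add_im, im_mul_ofReal, im_mul_ofReal]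
    ring
  refine ⟨(P⁻¹ + N⁻¹) * (ℓ / a ^ 2), by positivity, fun h => ?_⟩
  rw [formula, EuclideanSpace.norm_sq_eq, Fin.sum_univ_two]
  have pl : ‖h 0‖ ^ 2 + ‖h 1‖ ^ 2 ≤ ‖h 0 + h 1‖ ^ 2 + ‖h 0 - h 1‖ ^ 2 := by
    have := parallelogram_law_with_norm ℝ (h 0) (h 1)
    nlinarith [norm_nonneg (h 0), norm_nonneg (h 1)]
  refine pl.trans ?_
  have : (P⁻¹ + N⁻¹) * (ℓ / a ^ 2) * (a ^ 2 / ℓ * (P * ‖h 0 + h 1‖ ^ 2 + N * ‖h 0 - h 1‖ ^ 2)) =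
      ‖h 0 + h 1‖ ^ 2 + ‖h 0 - h 1‖ ^ 2 + (N⁻¹ * P * ‖h 0 + h 1‖ ^ 2 + P⁻¹ * N * ‖h 0 - h 1‖ ^ 2) := by
    field_simp
    ring
  rw [this]
  have : 0 ≤ N⁻¹ * P * ‖h 0 + h 1‖ ^ 2 + P⁻¹ * N * ‖h 0 - h 1‖ ^ 2 := by positivity
  linarith

namespace MetricGraph

variable {E V : Type}

/-- Pairs of boundary values on all edges. -/
abbrev BdryVals (E : Type) : Type := lp (fun _ : E => EuclideanSpace ℂ (Fin 2)) 2

theorem memℓp_two {f : E → EuclideanSpace ℂ (Fin 2)} (h : Summable fun e => ‖f e‖ ^ 2) :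
    Memℓp f 2 := by
  refine (memℓp_gen_iff (by norm_num)).2 ?_
  simpa using h

theorem summable_sq (h : BdryVals E) : Summable fun e => ‖h e‖ ^ 2 := by
  have := (memℓp_gen_iff (p := 2) (by norm_num)).1 (lp.memℓp h)
  simpa using this

/-- The boundary values which satisfy the matching conditions. -/
def matching (Γ : MetricGraph E V) : Submodule ℂ (BdryVals E) where
  carrier := {h | ∀ e b e' b', Γ.vert e b = Γ.vert e' b' → Γ.wt e b * h e b = Γ.wt e' b' * h e' b'}
  add_mem' {h k} hh hk e b e' b' hv := by
    have h1 := hh e b e' b' hv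
    have h2 := hk e b e' b' hv
    simp only [lp.coeFn_add, Pi.add_apply, PiLp.add_apply]
    linear_combination h1 + h2
  zero_mem' e b e' b' hv := by simp
  smul_mem' c h hh e b e' b' hv := by
    have h1 := hh e b e' b' hv
    simp only [lp.coeFn_smul, Pi.smul_apply, PiLp.smul_apply, smul_eq_mul]
    linear_combination c * h1

theorem continuous_apply (e : E) (b : Fin 2) : Continuous fun h : BdryVals E => h e b := by
  have h1 : Continuous fun h : BdryVals E => h e := by
    refine LipschitzWith.continuous (K := 1) (LipschitzWith.of_dist_le_mul fun h k => ?_)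
    rw [NNReal.coe_one, one_mul, dist_eq_norm, dist_eq_norm]
    exact lp.norm_apply_le_norm (by norm_num) (h - k) e
  exact (PiLp.continuous_apply 2 _ b).comp h1

theorem isClosed_matching (Γ : MetricGraph E V) : IsClosed (Γ.matching : Set (BdryVals E)) := by
  have : (Γ.matching : Set (BdryVals E)) = ⋂ (e) (b) (e') (b') (_ : Γ.vert e b = Γ.vert e' b'),
      {h : BdryVals E | Γ.wt e b * h e b = Γ.wt e' b' * h e' b'} := by
    ext h
    simp [matching]
  rw [this]
  refine isClosed_iInter fun e => isClosed_iInter fun b => isClosed_iInter fun e' =>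
    isClosed_iInter fun b' => isClosed_iInter fun _ => ?_
  exact isClosed_eq (continuous_const.mul (continuous_apply e b))
    (continuous_const.mul (continuous_apply e' b'))

variable {Γ : MetricGraph E V}

theorem Regular.exists_dtn (hR : Γ.Regular) (hl : ∀ e, 0 < Γ.len e) {z : ℂ} (hz : z.im ≠ 0) :
    ∃ N : BdryVals E →L[ℂ] BdryVals E,
      (∀ h e, N h e = dtn (Γ.coef e) (sqrtC z / Γ.coef e) (Γ.len e) (h e)) ∧
      ∃ C : ℝ, 0 < C ∧ ∀ h, ‖h‖ ^ 2 ≤ C * ‖(inner ℂ (N h) h : ℂ)‖ := by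
  obtain ⟨B, hB0, hB⟩ := hR.exists_uniform
    (p := fun l a C => ‖dtn a (sqrtC z / a) l‖ ≤ C) (fun _ _ _ _ h h' => h'.trans h)
    (fun e => ⟨_, le_rfl⟩)
  set N : BdryVals E →L[ℂ] BdryVals E :=
    lp.mapCLM 2 (fun e => dtn (Γ.coef e) (sqrtC z / Γ.coef e) (Γ.len e)) hB0 hB
  have hN : ∀ h e, N h e = dtn (Γ.coef e) (sqrtC z / Γ.coef e) (Γ.len e) (h e) := fun h e => rfl
  let p : ℝ → ℝ → ℝ → Prop := fun l a C => ∀ h : EuclideanSpace ℂ (Fin 2),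
    0 ≤ z.im * (inner ℂ h (dtn a (sqrtC z / a) l h) : ℂ).im ∧
    ‖h‖ ^ 2 ≤ C * (z.im * (inner ℂ h (dtn a (sqrtC z / a) l h) : ℂ).im)
  have hp : ∀ l a C C', C ≤ C' → p l a C → p l a C' := fun l a C C' hC h v =>
    ⟨(h v).1, (h v).2.trans (mul_le_mul_of_nonneg_right hC (h v).1)⟩
  have he : ∀ e, ∃ C, p (Γ.len e) (Γ.coef e) C := by
    intro e
    obtain ⟨C, hC1, hC⟩ := exists_dtn_coercive hz (hR.coef_pos e) (hl e)
    exact ⟨C, fun h => ⟨nonneg_of_mul_nonneg_right ((sq_nonneg ‖h‖).trans (hC h)) hC1, hC h⟩⟩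
  obtain ⟨C, hC0, hC⟩ := hR.exists_uniform hp he
  refine ⟨N, hN, (C + 1) * |z.im|, by have := abs_pos.2 hz; positivity, fun h => ?_⟩
  have s1 := lp.hasSum_inner (𝕜 := ℂ) h (N h)
  have s2 := (hasSum_im s1).mul_left z.im
  have s3 := hasSum_re (lp.hasSum_inner (𝕜 := ℂ) h h)
  have s4 : HasSum (fun e => ‖h e‖ ^ 2) (‖h‖ ^ 2) := by
    have e1 : ‖h‖ ^ 2 = (inner ℂ h h : ℂ).re := (inner_self_eq_norm_sq (𝕜 := ℂ) h).symm
    rw [e1]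
    exact s3.congr_fun fun e => (inner_self_eq_norm_sq (𝕜 := ℂ) (h e)).symm
  have s5 := hasSum_le (fun e => (hC e (h e)).2) s4 (s2.mul_left C)
  have s6 : z.im * (inner ℂ h (N h) : ℂ).im ≤ |z.im| * ‖(inner ℂ (N h) h : ℂ)‖ := by
    rw [norm_inner_symm]
    refine (le_abs_self _).trans ?_
    rw [abs_mul]
    exact mul_le_mul_of_nonneg_left (abs_im_le_norm _) (abs_nonneg _)
  have s7 : 0 ≤ |z.im| * ‖(inner ℂ (N h) h : ℂ)‖ := by positivity
  calc ‖h‖ ^ 2 ≤ C * (z.im * (inner ℂ h (N h) : ℂ).im) := s5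
    _ ≤ C * (|z.im| * ‖(inner ℂ (N h) h : ℂ)‖) := mul_le_mul_of_nonneg_left s6 hC0
    _ ≤ _ := by linarith

theorem Regular.exists_boundary (hR : Γ.Regular) (hl : ∀ e, 0 < Γ.len e) {z : ℂ} (hz : z.im ≠ 0)
    (D : BdryVals E) : ∃ h ∈ Γ.matching, ∃ d : BdryVals E,
      (∀ e, d e = dtn (Γ.coef e) (sqrtC z / Γ.coef e) (Γ.len e) (h e) + D e) ∧
      ∀ k ∈ Γ.matching, inner ℂ k d = (0 : ℂ) := by
  obtain ⟨N, hN, C, hC0, hC⟩ := hR.exists_dtn hl hz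
  have : CompleteSpace Γ.matching := (Γ.isClosed_matching).completeSpace_coe
  set T : Γ.matching →L[ℂ] Γ.matching :=
    Γ.matching.orthogonalProjectionOnto ∘L N ∘L Γ.matching.subtypeL
  have hT : ∀ x k : Γ.matching, inner ℂ (T x) k = (inner ℂ (N x) (k : BdryVals E) : ℂ) := fun x k =>
    Submodule.inner_orthogonalProjectionOnto_eq_of_mem_right k (N x)
  have hu : IsUnit T := by
    refine ContinuousLinearMap.isUnit_of_forall_le_norm_inner_map T (c := C.toNNReal⁻¹)
      (inv_pos.2 (Real.toNNReal_pos.2 hC0)) fun x => ?_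
    rw [hT]
    have := hC x
    rw [NNReal.coe_inv, Real.coe_toNNReal _ hC0.le, ← div_eq_mul_inv, div_le_iff₀ hC0, mul_comm]
    exact this
  obtain ⟨x, hx⟩ := ((ContinuousLinearMap.isUnit_iff_bijective).1 hu).2
    (-Γ.matching.orthogonalProjectionOnto D)
  refine ⟨x, x.2, N x + D, fun e => ?_, fun k hk => ?_⟩
  · rw [lp.coeFn_add, Pi.add_apply, hN]
  · have h1 := hT x ⟨k, hk⟩
    have h2 : (inner ℂ (Γ.matching.orthogonalProjectionOnto D) (⟨k, hk⟩ : Γ.matching) : ℂ) =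
        inner ℂ D k := Submodule.inner_orthogonalProjectionOnto_eq_of_mem_right ⟨k, hk⟩ D
    rw [hx, inner_neg_left, h2] at h1
    rw [← inner_conj_symm, inner_add_left, ← h1]
    simp


theorem Regular.kirchhoff_of_orthogonal (hR : Γ.Regular) (d : BdryVals E)
    (hd : ∀ k ∈ Γ.matching, inner ℂ k d = (0 : ℂ)) (v : V) :
    ∑ᶠ p : {p : E × Fin 2 // Γ.vert p.1 p.2 = v}, Γ.wt p.1.1 p.1.2 * d p.1.1 p.1.2 = 0 := by
  classical
  have hf := hR.finite_fiber v
  set q : E → Fin 2 → ℂ := fun e b => if Γ.vert e b = v then (starRingEnd ℂ) (Γ.wt e b) else 0 with hq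
  have hsupp : {p : E × Fin 2 | Γ.vert p.1 p.2 = v}.Finite := hf
  have hz : ∀ e, e ∉ Prod.fst '' {p : E × Fin 2 | Γ.vert p.1 p.2 = v} → ∀ b, q e b = 0 := by
    intro e he b
    simp only [hq]
    rw [if_neg]
    exact fun h => he ⟨(e, b), h, rfl⟩
  have hsum : Summable fun e => ‖(WithLp.toLp 2 (q e) : EuclideanSpace ℂ (Fin 2))‖ ^ 2 := by
    refine summable_of_ne_finset_zero (s := (hsupp.image Prod.fst).toFinset) fun e he => ?_
    rw [Set.Finite.mem_toFinset] at he
    rw [EuclideanSpace.norm_sq_eq]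
    simp [hz e he]
  set k : BdryVals E := ⟨fun e => WithLp.toLp 2 (q e), memℓp_two hsum⟩ with hk
  have hkv : ∀ e b, k e b = q e b := fun e b => rfl
  have hkm : k ∈ Γ.matching := by
    intro e b e' b' hv
    have hn : ∀ e b, Γ.wt e b * (starRingEnd ℂ) (Γ.wt e b) = 1 := by
      intro e b
      rw [mul_conj, normSq_eq_norm_sq, hR.norm_wt]
      simp
    simp only [hkv, hq, hv]
    split_ifs
    · rw [hn, hn]
    · simp
  have h0 := hd k hkm
  have h1 := lp.hasSum_inner (𝕜 := ℂ) k d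
  rw [h0] at h1
  set f : E × Fin 2 → ℂ := fun p => d p.1 p.2 * (starRingEnd ℂ) (q p.1 p.2) with hf'
  have h2 : ∀ e, (inner ℂ (k e) (d e) : ℂ) = ∑' b, f (e, b) := by
    intro e
    rw [PiLp.inner_apply, tsum_fintype]
    rfl
  have hfs : Summable f := by
    refine summable_of_ne_finset_zero (s := hsupp.toFinset) fun p hp => ?_
    rw [Set.Finite.mem_toFinset] at hp
    have hp' : ¬ Γ.vert p.1 p.2 = v := hp
    simp only [hf', hq]
    rw [if_neg hp']
    simp
  have h3 : ∑' p, f p = 0 := by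
    rw [hfs.tsum_prod, ← h1.tsum_eq]
    exact tsum_congr fun e => (h2 e).symm
  have := Fintype.ofFinite {p : E × Fin 2 // Γ.vert p.1 p.2 = v}
  rw [finsum_eq_sum_of_fintype, ← tsum_fintype (L := SummationFilter.unconditional _)]
  have h4 : ∀ p : E × Fin 2, f p = Set.indicator {p : E × Fin 2 | Γ.vert p.1 p.2 = v}
      (fun p => Γ.wt p.1 p.2 * d p.1 p.2) p := by
    intro p
    simp only [hf', hq, Set.indicator, mem_ofPred_eq]
    split_ifs
    · rw [starRingEnd_self_apply, mul_comm]
    · simp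
  rw [← h3, tsum_congr h4]
  exact tsum_subtype {p : E × Fin 2 | Γ.vert p.1 p.2 = v} (fun p => Γ.wt p.1 p.2 * d p.1 p.2)

/-- A particular solution on every edge, with vanishing initial data. -/
theorem Regular.exists_particular (hR : Γ.Regular) (hl : ∀ e, 0 < Γ.len e) {z : ℂ} (hz : z.im ≠ 0) :
    ∃ C : ℝ, 0 ≤ C ∧ ∀ e, ∀ F : ℝ → ℂ, MemLp F 2 (volume.restrict (Ioo 0 (Γ.len e))) →
      ∃ g g' g'' : ℝ → ℂ, IsW22 (Γ.len e) g g' g'' ∧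
      (∀ x, -(Γ.coef e : ℂ) ^ 2 * g'' x = F x + z * g x) ∧ g 0 = 0 ∧ g' 0 = 0 ∧
      ‖g (Γ.len e)‖ ^ 2 ≤ C * sqInt (Γ.len e) F ∧ ‖g' (Γ.len e)‖ ^ 2 ≤ C * sqInt (Γ.len e) F ∧
      sqInt (Γ.len e) g ≤ C * sqInt (Γ.len e) F := by
  let p : ℝ → ℝ → ℝ → Prop := fun l a C => ∀ F : ℝ → ℂ, MemLp F 2 (volume.restrict (Ioo 0 l)) →
      ∃ g g' g'' : ℝ → ℂ, IsW22 l g g' g'' ∧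
      (∀ x, -(a : ℂ) ^ 2 * g'' x = F x + z * g x) ∧ g 0 = 0 ∧ g' 0 = 0 ∧
      ‖g l‖ ^ 2 ≤ C * sqInt l F ∧ ‖g' l‖ ^ 2 ≤ C * sqInt l F ∧ sqInt l g ≤ C * sqInt l F
  have hp : ∀ l a C C', C ≤ C' → p l a C → p l a C' := by
    intro l a C C' hC h F hF
    obtain ⟨g, g', g'', h1, h2, h3, h4, h5, h6, h7⟩ := h F hF
    have := mul_le_mul_of_nonneg_right hC (sqInt_nonneg l F)
    exact ⟨g, g', g'', h1, h2, h3, h4, h5.trans this, h6.trans this, h7.trans this⟩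
  have he : ∀ e, ∃ C, p (Γ.len e) (Γ.coef e) C := by
    intro e
    have ha : (Γ.coef e : ℂ) ≠ 0 := by exact_mod_cast (hR.coef_pos e).ne'
    have hz0 : sqrtC z ≠ 0 := by
      intro h
      have := sqrtC_sq z
      rw [h] at this
      apply hz
      rw [← this]
      simp
    obtain ⟨C, hC0, hC⟩ := IsW22.exists_initial_value (hl e) (k := sqrtC z / Γ.coef e)
      (div_ne_zero hz0 ha)
    refine ⟨C * ‖-((Γ.coef e : ℂ) ^ 2)⁻¹‖ ^ 2, fun F hF => ?_⟩
    obtain ⟨g, g', g'', h1, h2, h3, h4, h5, h6, h7⟩ :=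
      hC (fun x => -((Γ.coef e : ℂ) ^ 2)⁻¹ * F x) (hF.const_mul _)
    rw [sqInt_const_mul, ← mul_assoc] at h5 h6 h7
    refine ⟨g, g', g'', h1, fun x => ?_, h3, h4, h5, h6, h7⟩
    rw [h2, div_pow, sqrtC_sq]
    field_simp
    ring
  exact hR.exists_uniform hp he

theorem Regular.exists_bounds (hR : Γ.Regular) (s : ℝ → ℝ → ℝ) :
    ∃ B : ℝ, 0 ≤ B ∧ ∀ e, s (Γ.len e) (Γ.coef e) ≤ B :=
  hR.exists_uniform (p := fun l a C => s l a ≤ C) (fun _ _ _ _ h h' => h'.trans h)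
    fun _ => ⟨_, le_rfl⟩

theorem exists_solution [Countable E] {μ : Measure ℝ} (hT : Γ.Tiles μ) (hR : Γ.Regular) {z : ℂ}
    (hz : z.im ≠ 0) (f : Lp ℂ 2 μ) : ∃ u, Γ.IsOp 0 u (f + z • u) := by
  have hl := hT.len_pos
  obtain ⟨C, hC0, hC⟩ := hR.exists_particular hl hz
  set F : E → ℝ → ℂ := fun e x => f (Γ.pos e + x) with hF
  have hFm : ∀ e, MemLp (F e) 2 (volume.restrict (Ioo 0 (Γ.len e))) := fun e =>
    hT.memLp_edge (Lp.memLp f) e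
  have hFs : Summable fun e => sqInt (Γ.len e) (F e) := (hT.hasSum_sqInt_Lp f).summable
  choose g g' g'' hg hgeq hg0 hg0' hgl hgl' hgs using fun e => hC e (F e) (hFm e)
  set k : E → ℂ := fun e => sqrtC z / Γ.coef e with hk
  have hkl : ∀ e, (((k e) * Γ.len e) ^ 2).im ≠ 0 := by
    intro e
    have : k e * Γ.len e = ((Γ.len e / Γ.coef e : ℝ) : ℂ) * sqrtC z := by
      simp only [hk]; push_cast; ring
    rw [this]
    exact half_angle_sq_im hz (div_pos (hl e) (hR.coef_pos e)).ne'
  have hsn : ∀ e, sin (k e * Γ.len e) ≠ 0 := fun e => sin_ne_zero_of_sq_im (hkl e)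
  have hka : ∀ e, (Γ.coef e : ℂ) ^ 2 * k e ^ 2 = z := by
    intro e
    have ha : (Γ.coef e : ℂ) ≠ 0 := by exact_mod_cast (hR.coef_pos e).ne'
    simp only [hk, div_pow, sqrtC_sq]
    field_simp
  set D : E → Fin 2 → ℂ := fun e => ![-(Γ.coef e : ℂ) ^ 2 * k e * (1 / sin (k e * Γ.len e)) * g e (Γ.len e),
    -(Γ.coef e : ℂ) ^ 2 * (g' e (Γ.len e) - k e * (cos (k e * Γ.len e) / sin (k e * Γ.len e)) * g e (Γ.len e))]
    with hD
  obtain ⟨B, hB0, hB⟩ := hR.exists_bounds fun l a =>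
    ‖-(a : ℂ) ^ 2 * (sqrtC z / a) * (1 / sin (sqrtC z / a * l))‖ ^ 2 + 2 * ‖-(a : ℂ) ^ 2‖ ^ 2 +
      2 * ‖-(a : ℂ) ^ 2‖ ^ 2 * ‖(sqrtC z / a) * (cos (sqrtC z / a * l) / sin (sqrtC z / a * l))‖ ^ 2
  have hDs : Summable fun e => ‖(WithLp.toLp 2 (D e) : EuclideanSpace ℂ (Fin 2))‖ ^ 2 := by
    refine Summable.of_nonneg_of_le (fun e => by positivity) (fun e => ?_)
      ((hFs.mul_left C).mul_left B)
    rw [EuclideanSpace.norm_sq_eq, Fin.sum_univ_two]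
    simp only [hD, Matrix.cons_val_zero, Matrix.cons_val_one]
    have hBe := hB e
    change ‖-(Γ.coef e : ℂ) ^ 2 * (k e) * (1 / sin (k e * Γ.len e))‖ ^ 2 + 2 * ‖-(Γ.coef e : ℂ) ^ 2‖ ^ 2 +
      2 * ‖-(Γ.coef e : ℂ) ^ 2‖ ^ 2 * ‖(k e) * (cos (k e * Γ.len e) / sin (k e * Γ.len e))‖ ^ 2 ≤ B at hBe
    set X := C * sqInt (Γ.len e) (F e)
    have hX : 0 ≤ X := mul_nonneg hC0 (sqInt_nonneg _ _)
    have e1 : ‖g' e (Γ.len e) - k e * (cos (k e * Γ.len e) / sin (k e * Γ.len e)) * g e (Γ.len e)‖ ^ 2 ≤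
        2 * X + 2 * ‖(k e) * (cos (k e * Γ.len e) / sin (k e * Γ.len e))‖ ^ 2 * X := by
      have t1 := norm_sub_le (g' e (Γ.len e)) (k e * (cos (k e * Γ.len e) / sin (k e * Γ.len e)) * g e (Γ.len e))
      have t2 := pow_le_pow_left₀ (norm_nonneg _) t1 2
      have t3 : ‖k e * (cos (k e * Γ.len e) / sin (k e * Γ.len e)) * g e (Γ.len e)‖ ^ 2 ≤
          ‖(k e) * (cos (k e * Γ.len e) / sin (k e * Γ.len e))‖ ^ 2 * X := by
        rw [norm_mul, mul_pow]
        exact mul_le_mul_of_nonneg_left (hgl e) (by positivity)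
      nlinarith [sq_nonneg (‖g' e (Γ.len e)‖ - ‖k e * (cos (k e * Γ.len e) / sin (k e * Γ.len e)) * g e (Γ.len e)‖),
        hgl' e]
    rw [norm_mul, mul_pow, norm_mul (-(Γ.coef e : ℂ) ^ 2) (g' e (Γ.len e) - _), mul_pow]
    have e2 := mul_le_mul_of_nonneg_left (hgl e)
      (sq_nonneg ‖-(Γ.coef e : ℂ) ^ 2 * k e * (1 / sin (k e * Γ.len e))‖)
    have e3 := mul_le_mul_of_nonneg_left e1 (sq_nonneg ‖-(Γ.coef e : ℂ) ^ 2‖)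
    have e4 := mul_le_mul_of_nonneg_right hBe hX
    linarith
  obtain ⟨h, hh, d, hd, horth⟩ := hR.exists_boundary hl hz ⟨fun e => WithLp.toLp 2 (D e), memℓp_two hDs⟩
  have hkir := hR.kirchhoff_of_orthogonal d horth
  set α : E → ℂ := fun e => (h e 1 - g e (Γ.len e) - h e 0 * cos (k e * Γ.len e)) / sin (k e * Γ.len e) with hα
  have W := fun e => (hg e).add (IsW22.sin_cos (ℓ := Γ.len e) (k e) (α e) (h e 0))
  set φ : E → ℝ → ℂ := fun e x => g e x + (α e * sin (k e * x) + h e 0 * cos (k e * x)) with hφ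
  have hφ0 : ∀ e, φ e 0 = h e 0 := by
    intro e
    simp [hφ, hg0]
  have hφl : ∀ e, φ e (Γ.len e) = h e 1 := by
    intro e
    simp only [hφ, hα]
    rw [div_mul_cancel₀ _ (hsn e)]
    ring
  have hφb : ∀ e b, φ e (Γ.endPt e b) = h e b := by
    intro e b
    fin_cases b
    · simpa [endPt] using hφ0 e
    · simpa [endPt] using hφl e
  obtain ⟨S, hS0, hS⟩ := hR.exists_uniform
    (p := fun l a M => ∀ h0 h1 : ℂ, sqInt l (fun x => (h1 - h0 * cos (sqrtC z / a * l)) / sin (sqrtC z / a * l) * sin (sqrtC z / a * x) +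
      h0 * cos (sqrtC z / a * x)) ≤ M * (‖h0‖ ^ 2 + ‖h1‖ ^ 2))
    (fun l a M M' hM hh h0 h1 => (hh h0 h1).trans (mul_le_mul_of_nonneg_right hM (by positivity)))
    (fun e => by
      set l := Γ.len e
      set κ := sqrtC z / (Γ.coef e : ℂ)
      have c1 : Continuous fun x : ℝ => sin (κ * x) := by fun_prop
      have c2 : Continuous fun x : ℝ => cos (κ * x) := by fun_prop
      have n1 := sqInt_nonneg l (fun x => sin (κ * x))
      have n2 := sqInt_nonneg l (fun x => cos (κ * x))
      refine ⟨4 * (‖1 / sin (κ * l)‖ ^ 2 + ‖cos (κ * l) / sin (κ * l)‖ ^ 2) * sqInt l (fun x => sin (κ * x)) +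
        2 * sqInt l (fun x => cos (κ * x)), fun h0 h1 => ?_⟩
      refine (sqInt_add_le ((IsW22.memLp_of_continuousOn c1.continuousOn).const_mul _)
        ((IsW22.memLp_of_continuousOn c2.continuousOn).const_mul _)).trans ?_
      rw [sqInt_const_mul, sqInt_const_mul]
      have e1 : ‖(h1 - h0 * cos (κ * l)) / sin (κ * l)‖ ^ 2 ≤
          2 * (‖1 / sin (κ * l)‖ ^ 2 + ‖cos (κ * l) / sin (κ * l)‖ ^ 2) * (‖h0‖ ^ 2 + ‖h1‖ ^ 2) := by
        have t0 : (h1 - h0 * cos (κ * l)) / sin (κ * l) =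
          1 / sin (κ * l) * h1 - cos (κ * l) / sin (κ * l) * h0 := by ring
        rw [t0]
        have t1 := norm_sub_le (1 / sin (κ * l) * h1) (cos (κ * l) / sin (κ * l) * h0)
        rw [norm_mul, norm_mul (cos (κ * l) / sin (κ * l))] at t1
        have t2 := pow_le_pow_left₀ (norm_nonneg _) t1 2
        refine t2.trans ?_
        nlinarith [sq_nonneg (‖1 / sin (κ * l)‖ * ‖h1‖ - ‖cos (κ * l) / sin (κ * l)‖ * ‖h0‖),
          mul_nonneg (sq_nonneg ‖1 / sin (κ * l)‖) (sq_nonneg ‖h0‖),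
          mul_nonneg (sq_nonneg ‖cos (κ * l) / sin (κ * l)‖) (sq_nonneg ‖h1‖)]
      have e2 := mul_le_mul_of_nonneg_right e1 n1
      have e3 : 0 ≤ sqInt l (fun x => cos (κ * x)) * ‖h1‖ ^ 2 := by positivity
      nlinarith)
  obtain ⟨S', hS'0, hS'⟩ := hR.exists_uniform
    (p := fun l a M => ∀ h0 h1 h2 : ℂ, ‖h0‖ ^ 2 + ‖h1 - h2‖ ^ 2 ≤ M * (‖h0‖ ^ 2 + ‖h1‖ ^ 2 + ‖h2‖ ^ 2))
    (fun l a M M' hM hh h0 h1 h2 => (hh h0 h1 h2).trans (mul_le_mul_of_nonneg_right hM (by positivity)))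
    (fun e => ⟨2, fun h0 h1 h2 => by
      have := pow_le_pow_left₀ (norm_nonneg _) (norm_sub_le h1 h2) 2
      nlinarith [sq_nonneg (‖h1‖ - ‖h2‖), sq_nonneg ‖h0‖]⟩)
  have hφs : Summable fun e => sqInt (Γ.len e) (φ e) := by
    have hhs := summable_sq h
    refine Summable.of_nonneg_of_le (fun e => sqInt_nonneg _ _) (fun e => ?_)
      (((hFs.mul_left C).mul_left 2).add
        (((hhs.add (hFs.mul_left C)).mul_left S').mul_left (2 * S)))
    refine (sqInt_add_le (IsW22.memLp_of_continuousOn (hg e).continuousOn)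
      (IsW22.memLp_of_continuousOn (IsW22.sin_cos (k e) (α e) (h e 0)).continuousOn)).trans ?_
    have u1 := hS e (h e 0) (h e 1 - g e (Γ.len e))
    have u2 := hS' e (h e 0) (h e 1) (g e (Γ.len e))
    have u3 : ‖h e 0‖ ^ 2 + ‖h e 1‖ ^ 2 = ‖h e‖ ^ 2 := by
      rw [EuclideanSpace.norm_sq_eq, Fin.sum_univ_two]
    rw [u3] at u2
    have u4 : ‖h e 0‖ ^ 2 + ‖h e 1 - g e (Γ.len e)‖ ^ 2 ≤
        S' * (‖h e‖ ^ 2 + C * sqInt (Γ.len e) (F e)) :=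
      u2.trans (mul_le_mul_of_nonneg_left (by linarith [hgl e]) hS'0)
    have u5 := u1.trans (mul_le_mul_of_nonneg_left u4 hS0)
    have u6 := hgs e
    have u7 : sqInt (Γ.len e) (fun x => α e * sin (k e * x) + h e 0 * cos (k e * x)) ≤
      S * (S' * (‖h e‖ ^ 2 + C * sqInt (Γ.len e) (F e))) := u5
    linarith
  have hum := hT.memLp_glue (fun e => IsW22.memLp_of_continuousOn (W e).continuousOn) hφs
  have hue : ∀ e, ∀ᵐ x ∂(volume.restrict (Ioo (0 : ℝ) (Γ.len e))), (hum.toLp (Γ.glue φ) : ℝ → ℂ) (Γ.pos e + x) = φ e x := by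
    intro e
    filter_upwards [hT.ae_edge hum.coeFn_toLp e, ae_restrict_mem measurableSet_Ioo] with x h1 h2
    rw [h1, hT.glue_edge φ e h2]
  refine ⟨hum.toLp, (isOp_zero_iff Γ _ _).2 ⟨φ, _, _, W, hue, fun e => ?_, ?_, fun v => ?_⟩⟩
  · filter_upwards [hT.ae_edge (Lp.coeFn_add f (z • hum.toLp)) e,
      hT.ae_edge (Lp.coeFn_smul z hum.toLp) e, hue e] with x h1 h2 h3
    rw [h1, Pi.add_apply, h2, Pi.smul_apply, h3, smul_eq_mul, mul_add]
    have q := hgeq e x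
    simp only [hF] at q
    linear_combination -q - (α e * sin (k e * x) + h e 0 * cos (k e * x)) * hka e
  · intro e b e' b' hv
    rw [hφb, hφb]
    exact hh e b e' b' hv
  · rw [← hkir v]
    refine finsum_congr fun p => ?_
    obtain ⟨⟨e, b⟩, hp⟩ := p
    congr 1
    simp only [coDeriv]
    rw [hd]
    have hs := hsn e
    have sc := sin_sq_add_cos_sq (k e * Γ.len e)
    fin_cases b
    · simp only [endSign, endPt, Fin.zero_eta, ↓reduceIte, PiLp.add_apply, dtn_zero, hD, Matrix.cons_val_zero,
        hg0', hα, ofReal_zero, mul_zero, cos_zero, sin_zero]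
      change _ = (Γ.coef e : ℂ) ^ 2 * k e * (1 / sin (k e * Γ.len e) * h e 1 - cos (k e * Γ.len e) / sin (k e * Γ.len e) * h e 0) + _
      ring
    · simp only [endSign, endPt, Fin.mk_one, Fin.isValue, one_ne_zero, ↓reduceIte, PiLp.add_apply, dtn_one, hD,
        Matrix.cons_val_one, Matrix.cons_val_fin_one, hα]
      change _ = (Γ.coef e : ℂ) ^ 2 * k e * (1 / sin (k e * Γ.len e) * h e 0 - cos (k e * Γ.len e) / sin (k e * Γ.len e) * h e 1) + _
      generalize k e = κ at hs sc ⊢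
      field_simp
      linear_combination (Γ.coef e : ℂ) ^ 2 * κ * h e 0 * sc

theorem exists_isResolvent [Countable E] {μ : Measure ℝ} (hT : Γ.Tiles μ) (hR : Γ.Regular) {z : ℂ}
    (hz : z.im ≠ 0) : ∃ R : Lp ℂ 2 μ →L[ℂ] Lp ℂ 2 μ, IsResolvent (Γ.IsOp 0) z R :=
  exists_resolvent_of_surjective hT hR hz (exists_solution hT hR hz)

end MetricGraph

/-! ### Multiplication by a phase -/

theorem norm_exp_I_mul (r : ℝ) : ‖exp (I * r)‖ = 1 := by
  rw [mul_comm]; exact norm_exp_ofReal_mul_I r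

section Phase

variable {α : Type} [MeasurableSpace α] (μ : Measure α) {θ : α → ℝ}

theorem memLp_phase (hθ : Measurable θ) {f : α → ℂ} (hf : MemLp f 2 μ) :
    MemLp (fun y => exp (I * θ y) * f y) 2 μ := by
  refine hf.of_le (AEStronglyMeasurable.mul ?_ hf.1) (Filter.Eventually.of_forall fun y => ?_)
  · have : Measurable fun y => exp (I * θ y) := by fun_prop
    exact this.aestronglyMeasurable
  · rw [norm_mul, norm_exp_I_mul, one_mul]

/-- Multiplication by `exp (iθ)` as an isometry. -/
def phaseIso (hθ : Measurable θ) : Lp ℂ 2 μ →ₗᵢ[ℂ] Lp ℂ 2 μ where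
  toFun f := (memLp_phase μ hθ (Lp.memLp f)).toLp
  map_add' f g := by
    rw [← MemLp.toLp_add]
    refine MemLp.toLp_congr _ _ ?_
    filter_upwards [Lp.coeFn_add f g] with x hx
    rw [hx]
    simp [mul_add]
  map_smul' c f := by
    rw [RingHom.id_apply, ← MemLp.toLp_const_smul]
    refine MemLp.toLp_congr _ _ ?_
    filter_upwards [Lp.coeFn_smul c f] with x hx
    rw [hx]
    simp only [Pi.smul_apply, smul_eq_mul]
    ring
  norm_map' f := by
    change ‖(memLp_phase μ hθ (Lp.memLp f)).toLp‖ = ‖f‖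
    have h1 := norm_toLp_sq (memLp_phase μ hθ (Lp.memLp f))
    have h2 := norm_Lp_sq f
    simp only [norm_mul, norm_exp_I_mul, one_mul] at h1
    rw [← h2] at h1
    exact (sq_eq_sq₀ (norm_nonneg _) (norm_nonneg _)).1 h1

theorem phaseIso_apply (hθ : Measurable θ) (f : Lp ℂ 2 μ) :
    phaseIso μ hθ f =ᵐ[μ] fun y => exp (I * θ y) * f y :=
  (memLp_phase μ hθ (Lp.memLp f)).coeFn_toLp

/-- Multiplication by `exp (iθ)` as a unitary operator. -/
def phaseEquiv (hθ : Measurable θ) : Lp ℂ 2 μ ≃ₗᵢ[ℂ] Lp ℂ 2 μ :=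
  LinearIsometryEquiv.ofSurjective (phaseIso μ hθ) fun f => by
    refine ⟨phaseIso μ hθ.neg f, ?_⟩
    refine Lp.ext ?_
    filter_upwards [phaseIso_apply μ hθ (phaseIso μ hθ.neg f), phaseIso_apply μ hθ.neg f] with y h1 h2
    rw [h1, h2, ← mul_assoc, ← exp_add]
    simp

theorem phaseEquiv_apply (hθ : Measurable θ) (f : Lp ℂ 2 μ) :
    phaseEquiv μ hθ f =ᵐ[μ] fun y => exp (I * θ y) * f y :=
  phaseIso_apply μ hθ f

end Phase

/-! ### Composites -/

theorem IsW22.exp_mul {ℓ : ℝ} (c d : ℂ) : IsW22 ℓ (fun x => exp (c * x + d))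
    (fun x => c * exp (c * x + d)) (fun x => c ^ 2 * exp (c * x + d)) := by
  have h : ∀ x : ℝ, HasDerivAt (fun x : ℝ => exp (c * x + d)) (c * exp (c * x + d)) x := by
    intro x
    have h0 : HasDerivAt (fun x : ℝ => c * (x : ℂ) + d) c x := by
      simpa using ((ofRealCLM.hasDerivAt (x := x)).const_mul c).add_const d
    have := HasDerivAt.comp (h₂ := exp) x (Complex.hasDerivAt_exp (c * x + d)) h0
    exact this.congr_deriv (mul_comm _ _)
  refine IsW22.of_hasDerivAt h (fun x => ?_) (by fun_prop)
  exact ((h x).const_mul c).congr_deriv (by ring)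

namespace Composite

variable {n : ℕ}

/-- The edges of a composite tile the period, and its weights come from the Gelfand transform. -/
structure WellFormed (P : Composite n) : Prop where
  len_pos : ∀ e, 0 < P.len e
  coef_pos : ∀ e, 0 < P.coef e
  pos_nonneg : ∀ e, 0 ≤ P.pos e
  end_le : ∀ e, P.pos e + P.len e ≤ 1
  disj : ∀ e e', e ≠ e' → P.pos e + P.len e ≤ P.pos e' ∨ P.pos e' + P.len e' ≤ P.pos e
  cover : ∀ x ∈ Ico (0 : ℝ) 1, ∃ e, x ∈ Ico (P.pos e) (P.pos e + P.len e)
  wt_eq : ∃ g : Fin 2 → ℝ, ∀ e b τ, P.wt e b τ =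
    exp (I * ((τ * (P.pos e + (if b = 0 then 0 else P.len e) - P.shift e b - g (P.vert e b)) : ℝ) : ℂ))

/-- The period cell, with the quasiperiodic matching conditions for `exp (ity) u(y)`. -/
def twistGraph (P : Composite n) (ε t : ℝ) : MetricGraph (Fin n) (Fin 2) where
  pos := fun e => ε * P.pos e
  len := fun e => ε * P.len e
  coef := fun e => P.coefEps ε e
  vert := P.vert
  wt := fun e b => exp (I * ((-(ε * t * P.shift e b) : ℝ) : ℂ))

theorem WellFormed.coefEps_pos {P : Composite n} (h : P.WellFormed) {ε : ℝ} (hε : 0 < ε) (e : Fin n) :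
    0 < P.coefEps ε e := by
  have := h.coef_pos e
  unfold coefEps
  split_ifs <;> positivity

theorem WellFormed.regular_twistGraph {P : Composite n} (h : P.WellFormed) {ε : ℝ} (hε : 0 < ε) (t : ℝ) :
    (P.twistGraph ε t).Regular where
  coef_pos e := h.coefEps_pos hε e
  finite_types := Set.toFinite _
  finite_fiber _ := inferInstance
  norm_wt _ _ := norm_exp_I_mul _

theorem WellFormed.regular_perGraph {P : Composite n} (h : P.WellFormed) {ε : ℝ} (hε : 0 < ε) :
    (P.perGraph ε).Regular where
  coef_pos e := h.coefEps_pos hε e.2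
  finite_types := by
    refine (Set.finite_range fun e : Fin n => (ε * P.len e, P.coefEps ε e)).subset ?_
    rintro _ ⟨p, rfl⟩
    exact ⟨p.2, rfl⟩
  finite_fiber v := by
    refine Finite.of_injective (β := Fin n × Fin 2) (fun p => (p.1.1.2, p.1.2)) ?_
    rintro ⟨⟨⟨k, e⟩, b⟩, hp⟩ ⟨⟨⟨k', e'⟩, b'⟩, hp'⟩ hpp
    simp only [Prod.mk.injEq] at hpp
    obtain ⟨rfl, rfl⟩ := hpp
    have h1 : k + P.shift e b = k' + P.shift e b :=
      (congrArg Prod.fst hp).trans (congrArg Prod.fst hp').symm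
    have : k = k' := by omega
    subst this
    rfl
  norm_wt e b := by simp [perGraph]

theorem WellFormed.tiles_twistGraph {P : Composite n} (h : P.WellFormed) {ε : ℝ} (hε : 0 < ε) (t : ℝ) :
    (P.twistGraph ε t).Tiles (volume.restrict (Ioo 0 ε)) where
  len_pos e := mul_pos hε (h.len_pos e)
  disj e e' hee' := by
    refine Set.disjoint_left.2 fun y hy hy' => ?_
    simp only [MetricGraph.seg, twistGraph, mem_Ioo] at hy hy'
    rcases h.disj e e' hee' with h1 | h1
    · have := mul_le_mul_of_nonneg_left h1 hε.le
      linarith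
    · have := mul_le_mul_of_nonneg_left h1 hε.le
      linarith
  restr e := by
    rw [Measure.restrict_restrict (MetricGraph.Tiles.measurableSet_seg e), inter_eq_left.2]
    intro y hy
    simp only [MetricGraph.seg, twistGraph, mem_Ioo] at hy
    have h1 := mul_nonneg hε.le (h.pos_nonneg e)
    have h2 := mul_le_mul_of_nonneg_left (h.end_le e) hε.le
    exact ⟨by linarith, by linarith⟩
  cover := by
    have hc : (⋃ e, {ε * P.pos e}).Countable := Set.countable_iUnion fun e => Set.countable_singleton _
    have h0 := (hc.ae_notMem (volume.restrict (Ioo (0 : ℝ) ε)))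
    filter_upwards [h0, ae_restrict_mem measurableSet_Ioo] with y hy hy'
    obtain ⟨e, he⟩ := h.cover (y / ε) ⟨div_nonneg hy'.1.le hε.le, (div_lt_one hε).2 hy'.2⟩
    refine mem_iUnion.2 ⟨e, ?_⟩
    rw [mem_Ico, le_div_iff₀ hε, div_lt_iff₀ hε] at he
    refine ⟨lt_of_le_of_ne (by simp only [twistGraph]; linarith [he.1]) ?_, by simp only [twistGraph]; linarith [he.2]⟩
    rintro rfl
    exact hy (mem_iUnion.2 ⟨e, rfl⟩)

theorem WellFormed.tiles_perGraph {P : Composite n} (h : P.WellFormed) {ε : ℝ} (hε : 0 < ε) :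
    (P.perGraph ε).Tiles volume where
  len_pos e := mul_pos hε (h.len_pos e.2)
  disj := by
    rintro ⟨k, e⟩ ⟨k', e'⟩ hne
    refine Set.disjoint_left.2 fun y hy hy' => ?_
    simp only [MetricGraph.seg, perGraph, mem_Ioo] at hy hy'
    have b1 := h.pos_nonneg e
    have b2 := h.end_le e
    have b1' := h.pos_nonneg e'
    have b2' := h.end_le e'
    have c1 : ε * (k + P.pos e) < ε * (k' + P.pos e' + P.len e') := by linarith
    have c2 : ε * (k' + P.pos e') < ε * (k + P.pos e + P.len e) := by linarith
    have c1 := lt_of_mul_lt_mul_left c1 hε.le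
    have c2 := lt_of_mul_lt_mul_left c2 hε.le
    have d1 : (k : ℝ) < k' + 1 := by linarith
    have d2 : (k' : ℝ) < k + 1 := by linarith
    have d1 : k < k' + 1 := by exact_mod_cast d1
    have d2 : k' < k + 1 := by exact_mod_cast d2
    have : k = k' := by omega
    subst this
    have hee : e ≠ e' := fun h => hne (by rw [h])
    rcases h.disj e e' hee with h1 | h1 <;> linarith
  restr e := rfl
  cover := by
    have hc : (⋃ q : ℤ × Fin n, {ε * (q.1 + P.pos q.2)}).Countable :=
      Set.countable_iUnion fun e => Set.countable_singleton _
    have h0 := (hc.ae_notMem volume)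
    filter_upwards [h0] with y hy
    obtain ⟨e, he⟩ := h.cover (Int.fract (y / ε)) ⟨Int.fract_nonneg _, Int.fract_lt_one _⟩
    refine mem_iUnion.2 ⟨(⌊y / ε⌋, e), ?_⟩
    have hy' : y = ε * (⌊y / ε⌋ + Int.fract (y / ε)) := by
      rw [Int.floor_add_fract]; field_simp
    have e1 := mul_le_mul_of_nonneg_left he.1 hε.le
    have e2 := mul_lt_mul_of_pos_left he.2 hε
    have e3 : y = ε * ⌊y / ε⌋ + ε * Int.fract (y / ε) := by rw [← mul_add]; exact hy'
    simp only [MetricGraph.seg, perGraph]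
    refine ⟨lt_of_le_of_ne (by linarith) ?_, by linarith⟩
    intro heq
    exact hy (mem_iUnion.2 ⟨(⌊y / ε⌋, e), heq.symm⟩)

/-- The gauge transformation which removes the quasimomentum from the differential expression. -/
theorem WellFormed.fibreOp_iff {P : Composite n} (h : P.WellFormed) {ε : ℝ} (hε : 0 < ε) (t : ℝ)
    (u g : L2Cell ε) : P.fibreOp ε t u g ↔ ∃ φ φ' φ'', (P.twistGraph ε t).OpData
      (fun y => exp (I * (t * y : ℝ)) * u y) (fun y => exp (I * (t * y : ℝ)) * g y) φ φ' φ'' := by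
  obtain ⟨γ, hγ⟩ := h.wt_eq
  set p : Fin n → ℝ := fun e => ε * P.pos e with hp
  set c : Fin n → ℝ → ℂ := fun e x => exp (I * t * x + I * t * p e) with hc
  set c' : Fin n → ℝ → ℂ := fun e x => exp (-I * t * x + -I * t * p e) with hc'
  have hcc : ∀ e x, c e x * c' e x = 1 := by
    intro e x
    rw [hc, hc', ← exp_add, ← exp_zero]
    congr 1; ring
  have hcp : ∀ e (x : ℝ), exp (I * (t * (p e + x) : ℝ)) = c e x := by
    intro e x
    simp only [hc]
    congr 1; push_cast; ring
  have hend : ∀ e b, (P.cellGraph ε t).endPt e b = ε * (if b = 0 then 0 else P.len e) := by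
    intro e b
    simp only [MetricGraph.endPt, cellGraph]
    split_ifs <;> simp
  have hwt : ∀ e b, (P.cellGraph ε t).wt e b * c' e ((P.cellGraph ε t).endPt e b) =
      exp (I * ((-(ε * t * γ (P.vert e b)) : ℝ) : ℂ)) * (P.twistGraph ε t).wt e b := by
    intro e b
    rw [hend]
    simp only [cellGraph, twistGraph, hγ, hc', hp]
    rw [← exp_add, ← exp_add]
    congr 1
    push_cast
    ring
  have hunit : ∀ r : ℝ, exp (I * r) ≠ 0 := fun r => exp_ne_zero _
  constructor
  · rintro ⟨φ, φ', φ'', h1, h2, h3, h4, h5⟩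
    have W := fun e => (IsW22.exp_mul (I * t) (I * t * p e)).mul (h1 e)
    refine ⟨_, _, _, W, fun e => ?_, fun e => ?_, ?_, fun v => ?_⟩
    · filter_upwards [h2 e] with x hx
      rw [← hx]
      change exp (I * (t * (p e + x) : ℝ)) * u (p e + x) = c e x * u (p e + x)
      rw [hcp]
    · filter_upwards [h3 e] with x hx
      simp only [twistGraph]
      change exp (I * (t * (p e + x) : ℝ)) * _ = _
      simp only [cellGraph] at hx
      rw [hcp, hx]
      simp only [hc]
      have : I ^ 2 = -1 := I_sq
      linear_combination (P.coefEps ε e : ℂ) ^ 2 * exp (I * t * x + I * t * p e) * t ^ 2 * φ e x * this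
    · intro e b e' b' hv
      have h4' := h4 e b e' b' hv
      have w1 := hwt e b
      have w2 := hwt e' b'
      have hv' : P.vert e b = P.vert e' b' := hv
      rw [hv'] at w1
      refine mul_left_cancel₀ (hunit (-(ε * t * γ (P.vert e' b')))) ?_
      have k1 := hcc e ((P.cellGraph ε t).endPt e b)
      have k2 := hcc e' ((P.cellGraph ε t).endPt e' b')
      simp only [hc, hc'] at k1 k2 w1 w2
      have hend' : ∀ e b, (P.twistGraph ε t).endPt e b = (P.cellGraph ε t).endPt e b := fun _ _ => rfl
      simp only [hend']
      set q := (P.cellGraph ε t).endPt e b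
      set q' := (P.cellGraph ε t).endPt e' b'
      linear_combination h4' + (P.cellGraph ε t).wt e b * φ e q * k1 -
        (P.cellGraph ε t).wt e' b' * φ e' q' * k2 -
        exp (I * t * q + I * t * p e) * φ e q * w1 + exp (I * t * q' + I * t * p e') * φ e' q' * w2
    · have h5' := h5 v
      refine mul_left_cancel₀ (hunit (-(ε * t * γ v))) ?_
      rw [mul_zero, mul_finsum, ← h5']
      refine finsum_congr fun q => ?_
      obtain ⟨⟨e, b⟩, hq⟩ := q
      have w1 := hwt e b
      have hq' : P.vert e b = v := hq
      rw [hq'] at w1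
      rw [← mul_assoc]
      simp only
      rw [← w1]
      have k1 := hcc e ((P.cellGraph ε t).endPt e b)
      simp only [hc] at k1
      have hend' : ∀ e b, (P.twistGraph ε t).endPt e b = (P.cellGraph ε t).endPt e b := fun _ _ => rfl
      simp only [MetricGraph.coDeriv, hend']
      have hco : (P.twistGraph ε t).coef e = (P.cellGraph ε t).coef e := rfl
      rw [hco]
      linear_combination MetricGraph.endSign b * (P.cellGraph ε t).wt e b * ((P.cellGraph ε t).coef e : ℂ) ^ 2 *
        (φ' e ((P.cellGraph ε t).endPt e b) + I * t * φ e ((P.cellGraph ε t).endPt e b)) * k1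
  · rintro ⟨φ, φ', φ'', h1, h2, h3, h4, h5⟩
    have W := fun e => (IsW22.exp_mul (-I * t) (-I * t * p e)).mul (h1 e)
    refine ⟨_, _, _, W, fun e => ?_, fun e => ?_, ?_, fun v => ?_⟩
    · filter_upwards [h2 e] with x hx
      simp only [twistGraph] at hx
      rw [← hx]
      change u (p e + x) = _ * (exp (I * (t * (p e + x) : ℝ)) * _)
      rw [hcp]
      have k1 := hcc e x
      simp only [hc, hc'] at k1 ⊢
      change u (p e + x) = _ * (_ * u (p e + x))
      linear_combination -u (p e + x) * k1
    · filter_upwards [h3 e] with x hx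
      simp only [twistGraph] at hx
      change exp (I * (t * (p e + x) : ℝ)) * g (p e + x) = _ at hx
      change g (p e + x) = -(P.coefEps ε e : ℂ) ^ 2 * _
      rw [hcp] at hx
      have k1 := hcc e x
      simp only [hc, hc'] at k1 hx ⊢
      have : I ^ 2 = -1 := I_sq
      linear_combination -g (p e + x) * k1 + exp (-I * t * x + -I * t * p e) * hx -
        (P.coefEps ε e : ℂ) ^ 2 * exp (-I * t * x + -I * t * p e) * t ^ 2 * φ e x * this
    · intro e b e' b' hv
      have h4' := h4 e b e' b' hv
      have w1 := hwt e b
      have w2 := hwt e' b'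
      have hv' : P.vert e b = P.vert e' b' := hv
      rw [hv'] at w1
      have hend' : ∀ e b, (P.twistGraph ε t).endPt e b = (P.cellGraph ε t).endPt e b := fun _ _ => rfl
      simp only [hend'] at h4'
      simp only [hc'] at w1 w2
      linear_combination φ e ((P.cellGraph ε t).endPt e b) * w1 -
        φ e' ((P.cellGraph ε t).endPt e' b') * w2 +
        exp (I * ((-(ε * t * γ (P.vert e' b')) : ℝ) : ℂ)) * h4'
    · have h5' := h5 v
      have h6 := congrArg (fun s => exp (I * ((-(ε * t * γ v) : ℝ) : ℂ)) * s) h5'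
      simp only [mul_zero] at h6
      rw [mul_finsum] at h6
      rw [← h6]
      refine finsum_congr fun q => ?_
      obtain ⟨⟨e, b⟩, hq⟩ := q
      have w1 := hwt e b
      have hq' : P.vert e b = v := hq
      rw [hq'] at w1
      have hend' : ∀ e b, (P.twistGraph ε t).endPt e b = (P.cellGraph ε t).endPt e b := fun _ _ => rfl
      have hco : (P.twistGraph ε t).coef e = (P.cellGraph ε t).coef e := rfl
      simp only [MetricGraph.coDeriv, hend', hco]
      simp only [hc'] at w1
      linear_combination MetricGraph.endSign b * ((P.cellGraph ε t).coef e : ℂ) ^ 2 *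
        φ' e ((P.cellGraph ε t).endPt e b) * w1

theorem WellFormed.fibreOp_iff_isOp {P : Composite n} (h : P.WellFormed) {ε : ℝ} (hε : 0 < ε) {t : ℝ}
    (hm : Measurable fun y : ℝ => t * y) (u g : L2Cell ε) : P.fibreOp ε t u g ↔
      (P.twistGraph ε t).IsOp 0 (phaseEquiv _ hm u) (phaseEquiv _ hm g) := by
  rw [h.fibreOp_iff hε, MetricGraph.isOp_zero_iff]
  have hT := h.tiles_twistGraph hε t
  have e1 := fun e => hT.ae_edge (phaseEquiv_apply (volume.restrict (Ioo (0 : ℝ) ε)) hm u) e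
  have e2 := fun e => hT.ae_edge (phaseEquiv_apply (volume.restrict (Ioo (0 : ℝ) ε)) hm g) e
  constructor
  · rintro ⟨φ, φ', φ'', h1, h2, h3, h4, h5⟩
    refine ⟨φ, φ', φ'', h1, fun e => ?_, fun e => ?_, h4, h5⟩
    · filter_upwards [h2 e, e1 e] with x hx hx'
      exact hx'.trans hx
    · filter_upwards [h3 e, e2 e] with x hx hx'
      exact hx'.trans hx
  · rintro ⟨φ, φ', φ'', h1, h2, h3, h4, h5⟩
    refine ⟨φ, φ', φ'', h1, fun e => ?_, fun e => ?_, h4, h5⟩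
    · filter_upwards [h2 e, e1 e] with x hx hx'
      exact hx'.symm.trans hx
    · filter_upwards [h3 e, e2 e] with x hx hx'
      exact hx'.symm.trans hx

/-- The resolvents of the fibre operators. -/
theorem WellFormed.exists_isResolvent_fibreOp {P : Composite n} (h : P.WellFormed) {ε : ℝ} (hε : 0 < ε)
    (t : ℝ) {z : ℂ} (hz : z.im ≠ 0) :
    ∃ R : L2Cell ε →L[ℂ] L2Cell ε, IsResolvent (P.fibreOp ε t) z R := by
  obtain ⟨R, hR⟩ := MetricGraph.exists_isResolvent (h.tiles_twistGraph hε t) (h.regular_twistGraph hε t) hz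
  have hm : Measurable fun y : ℝ => t * y := by fun_prop
  set M := phaseEquiv (volume.restrict (Ioo (0 : ℝ) ε)) hm
  refine ⟨(M.symm : L2Cell ε →L[ℂ] L2Cell ε) ∘L R ∘L (M : L2Cell ε →L[ℂ] L2Cell ε), fun f u => ?_⟩
  rw [h.fibreOp_iff_isOp hε hm, map_add, map_smul]
  refine (hR (M f) (M u)).trans ?_
  constructor
  · intro hu
    simp [← hu]
  · rintro rfl
    simp

end Composite

/-! ### Cutoffs on a metric graph -/

/-- The cubic which interpolates between `α` at `0` and `β` at `ℓ` with vanishing slopes. -/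
def cutoff (ℓ : ℝ) (α β : ℂ) (x : ℝ) : ℂ :=
  α + 0 * x + 3 * (β - α) / ℓ ^ 2 * x ^ 2 + -(2 * (β - α) / ℓ ^ 3) * x ^ 3

def cutoff' (ℓ : ℝ) (α β : ℂ) (x : ℝ) : ℂ :=
  0 + 2 * (3 * (β - α) / ℓ ^ 2) * x + 3 * -(2 * (β - α) / ℓ ^ 3) * x ^ 2

def cutoff'' (ℓ : ℝ) (α β : ℂ) (x : ℝ) : ℂ :=
  2 * (3 * (β - α) / ℓ ^ 2) + 6 * -(2 * (β - α) / ℓ ^ 3) * x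

theorem isW22_cutoff (ℓ : ℝ) (α β : ℂ) : IsW22 ℓ (cutoff ℓ α β) (cutoff' ℓ α β) (cutoff'' ℓ α β) :=
  IsW22.cubic _ _ _ _

theorem cutoff_zero (ℓ : ℝ) (α β : ℂ) : cutoff ℓ α β 0 = α := by simp [cutoff]

theorem cutoff_self {ℓ : ℝ} (hℓ : 0 < ℓ) (α β : ℂ) : cutoff ℓ α β ℓ = β := by
  have : (ℓ : ℂ) ≠ 0 := by exact_mod_cast hℓ.ne'
  simp only [cutoff]; field_simp; ring

theorem cutoff'_zero (ℓ : ℝ) (α β : ℂ) : cutoff' ℓ α β 0 = 0 := by simp [cutoff']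

theorem cutoff'_self {ℓ : ℝ} (hℓ : 0 < ℓ) (α β : ℂ) : cutoff' ℓ α β ℓ = 0 := by
  have : (ℓ : ℂ) ≠ 0 := by exact_mod_cast hℓ.ne'
  simp only [cutoff']; field_simp; ring

theorem cutoff_same (ℓ : ℝ) (α : ℂ) (x : ℝ) :
    cutoff ℓ α α x = α ∧ cutoff' ℓ α α x = 0 ∧ cutoff'' ℓ α α x = 0 := by
  simp [cutoff, cutoff', cutoff'']

theorem norm_cutoff_le {ℓ : ℝ} (hℓ : 0 < ℓ) {α β : ℂ} (hα : ‖α‖ ≤ 1) (hβ : ‖β‖ ≤ 1) {x : ℝ}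
    (hx : x ∈ Ioo 0 ℓ) :
    ‖cutoff ℓ α β x‖ ≤ 11 ∧ ‖cutoff' ℓ α β x‖ ≤ 24 / ℓ ∧ ‖cutoff'' ℓ α β x‖ ≤ 36 / ℓ ^ 2 := by
  have hℓc : (ℓ : ℂ) ≠ 0 := by exact_mod_cast hℓ.ne'
  obtain ⟨s, hs⟩ : ∃ s, s = x / ℓ := ⟨_, rfl⟩
  have hs0 : 0 ≤ s := by rw [hs]; exact div_nonneg hx.1.le hℓ.le
  have hs1 : s ≤ 1 := by rw [hs, div_le_one hℓ]; exact hx.2.le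
  have hxs : x = s * ℓ := by rw [hs]; field_simp
  have hd : ‖β - α‖ ≤ 2 := (norm_sub_le _ _).trans (by linarith)
  have ns : ‖(s : ℂ)‖ ≤ 1 := by rw [norm_real, Real.norm_eq_abs, abs_of_nonneg hs0]; exact hs1
  have e1 : cutoff ℓ α β x = α + (β - α) * (3 * s ^ 2) + (β - α) * (-2 * s ^ 3) := by
    simp only [cutoff, hxs]; push_cast; field_simp; ring
  have e2 : cutoff' ℓ α β x = (β - α) * (6 * s) / ℓ + (β - α) * (-6 * s ^ 2) / ℓ := by
    simp only [cutoff', hxs]; push_cast; field_simp; ring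
  have e3 : cutoff'' ℓ α β x = (β - α) * 6 / ℓ ^ 2 + (β - α) * (-12 * s) / ℓ ^ 2 := by
    simp only [cutoff'', hxs]; push_cast; field_simp; ring
  have nl : ‖(ℓ : ℂ)‖ = ℓ := by rw [norm_real, Real.norm_eq_abs, abs_of_pos hℓ]
  have s2 : ‖(s : ℂ)‖ ^ 2 ≤ 1 := pow_le_one₀ (norm_nonneg _) ns
  have s3 : ‖(s : ℂ)‖ ^ 3 ≤ 1 := pow_le_one₀ (norm_nonneg _) ns
  have n0 := norm_nonneg (β - α)
  have n1 := norm_nonneg (s : ℂ)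
  refine ⟨?_, ?_, ?_⟩
  · rw [e1]
    refine (norm_add₃_le).trans ?_
    simp only [norm_mul, norm_pow, norm_neg, Complex.norm_ofNat]
    nlinarith [pow_nonneg n1 2, pow_nonneg n1 3]
  · rw [e2]
    refine (norm_add_le _ _).trans ?_
    simp only [norm_mul, norm_div, norm_pow, norm_neg, Complex.norm_ofNat, nl]
    rw [← add_div]
    refine div_le_div_of_nonneg_right ?_ hℓ.le
    nlinarith [pow_nonneg n1 2]
  · rw [e3]
    refine (norm_add_le _ _).trans ?_
    simp only [norm_mul, norm_div, norm_pow, norm_neg, Complex.norm_ofNat, nl]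
    rw [← add_div]
    refine div_le_div_of_nonneg_right ?_ (by positivity)
    nlinarith

namespace MetricGraph

variable {E V : Type} {Γ : MetricGraph E V} {μ : Measure ℝ} {φ φ' φ'' : E → ℝ → ℂ}

theorem Regular.exists_cutoff_const (hR : Γ.Regular) (hl : ∀ e, 0 < Γ.len e) :
    ∃ C : ℝ, 0 ≤ C ∧ ∀ e, ∀ φ φ' φ'' : ℝ → ℂ, IsW22 (Γ.len e) φ φ' φ'' → ∀ α β : ℂ, ‖α‖ ≤ 1 → ‖β‖ ≤ 1 →
      sqInt (Γ.len e) (fun x => cutoff (Γ.len e) α β x * φ x) ≤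
        C * (sqInt (Γ.len e) φ + Γ.coef e ^ 4 * sqInt (Γ.len e) φ'') ∧
      Γ.coef e ^ 4 * sqInt (Γ.len e) (fun x => cutoff'' (Γ.len e) α β x * φ x +
          2 * (cutoff' (Γ.len e) α β x * φ' x) + cutoff (Γ.len e) α β x * φ'' x) ≤
        C * (sqInt (Γ.len e) φ + Γ.coef e ^ 4 * sqInt (Γ.len e) φ'') := by
  obtain ⟨C, hC0, hC⟩ := hR.exists_trace_const hl
  obtain ⟨M, hM0, hM⟩ := hR.exists_uniform (p := fun l a M => 11 ≤ M ∧ 24 / l ≤ M ∧ 36 / l ^ 2 ≤ M ∧ a ^ 4 ≤ M)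
    (fun l a c c' hcc h => ⟨h.1.trans hcc, h.2.1.trans hcc, h.2.2.1.trans hcc, h.2.2.2.trans hcc⟩)
    (fun e => ⟨max (max 11 (24 / Γ.len e)) (max (36 / Γ.len e ^ 2) (Γ.coef e ^ 4)), by simp⟩)
  refine ⟨M ^ 2 + 4 * M ^ 3 + 16 * M ^ 3 * C + 2 * M ^ 2, by positivity, fun e φ φ' φ'' h α β hα hβ => ?_⟩
  obtain ⟨m1, m2, m3, m4⟩ := hM e
  have hb := fun x hx => norm_cutoff_le (hl e) hα hβ (x := x) hx
  have hw := isW22_cutoff (Γ.len e) α β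
  set ℓ := Γ.len e
  have key : ∀ {ρ ψ : ℝ → ℂ}, MemLp ψ 2 (volume.restrict (Ioo 0 ℓ)) → (∀ x ∈ Ioo 0 ℓ, ‖ρ x‖ ≤ M) →
      sqInt ℓ (fun x => ρ x * ψ x) ≤ M ^ 2 * sqInt ℓ ψ := by
    intro ρ ψ hψ hρ
    have := sqInt_mono (h := fun x => ρ x * ψ x) (k := fun x => (M : ℂ) * ψ x) (hψ.const_mul _) fun x hx => by
      rw [norm_mul, norm_mul, norm_real, Real.norm_eq_abs, abs_of_nonneg hM0]
      exact mul_le_mul_of_nonneg_right (hρ x hx) (norm_nonneg _)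
    rwa [sqInt_const_mul, norm_real, Real.norm_eq_abs, sq_abs] at this
  have mφ := IsW22.memLp_of_continuousOn h.continuousOn
  have mφ' := IsW22.memLp_of_continuousOn h.continuousOn'
  have k1 := key mφ fun x hx => (hb x hx).1.trans m1
  have k2 := key mφ fun x hx => (hb x hx).2.2.trans m3
  have k3 := key mφ' fun x hx => (hb x hx).2.1.trans m2
  have k4 := key h.memLp fun x hx => (hb x hx).1.trans m1
  have a1 : MemLp (fun x => cutoff'' ℓ α β x * φ x) 2 (volume.restrict (Ioo 0 ℓ)) :=
    IsW22.memLp_mul hw.memLp h.continuousOn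
  have a2 : MemLp (fun x => 2 * (cutoff' ℓ α β x * φ' x)) 2 (volume.restrict (Ioo 0 ℓ)) :=
    IsW22.memLp_of_continuousOn (continuousOn_const.mul (hw.continuousOn'.mul h.continuousOn'))
  have a3 : MemLp (fun x => cutoff ℓ α β x * φ'' x) 2 (volume.restrict (Ioo 0 ℓ)) := by
    simpa only [mul_comm] using IsW22.memLp_mul h.memLp hw.continuousOn
  have s1 : sqInt ℓ (fun x => cutoff'' ℓ α β x * φ x + 2 * (cutoff' ℓ α β x * φ' x) + cutoff ℓ α β x * φ'' x)
      ≤ 2 * sqInt ℓ (fun x => cutoff'' ℓ α β x * φ x + 2 * (cutoff' ℓ α β x * φ' x)) +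
        2 * sqInt ℓ (fun x => cutoff ℓ α β x * φ'' x) := sqInt_add_le (a1.add a2) a3
  have s2 := sqInt_add_le a1 a2
  rw [sqInt_const_mul] at s2
  have h3 := (hC e φ φ' φ'' h).2.2
  have q0 := sqInt_nonneg ℓ φ
  have q1 := sqInt_nonneg ℓ φ'
  have q2 := sqInt_nonneg ℓ φ''
  have ha : 0 ≤ Γ.coef e ^ 4 := by have := hR.coef_pos e; positivity
  set Q := sqInt ℓ φ + Γ.coef e ^ 4 * sqInt ℓ φ'' with hQ
  have hQ1 : sqInt ℓ φ ≤ Q := by have := mul_nonneg ha q2; linarith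
  have hQ2 : Γ.coef e ^ 4 * sqInt ℓ φ'' ≤ Q := by linarith
  have hQ0 : 0 ≤ Q := q0.trans hQ1
  have p1 : 0 ≤ 4 * M ^ 3 * Q := by positivity
  have p2 : 0 ≤ 16 * M ^ 3 * C * Q := by positivity
  have p3 : 0 ≤ 2 * M ^ 2 * Q := by positivity
  have p4 : 0 ≤ M ^ 2 * Q := by positivity
  constructor
  · have := mul_le_mul_of_nonneg_left hQ1 (by positivity : 0 ≤ M ^ 2)
    linarith
  · have t1 : sqInt ℓ (fun x => cutoff'' ℓ α β x * φ x + 2 * (cutoff' ℓ α β x * φ' x) + cutoff ℓ α β x * φ'' x)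
        ≤ (4 * M ^ 2 * sqInt ℓ φ + 16 * M ^ 2 * sqInt ℓ φ') + 2 * M ^ 2 * sqInt ℓ φ'' := by
      norm_num at s2
      refine s1.trans ?_
      nlinarith
    have t2 := mul_le_mul_of_nonneg_left t1 ha
    have t3 : Γ.coef e ^ 4 * (4 * M ^ 2 * sqInt ℓ φ + 16 * M ^ 2 * sqInt ℓ φ') ≤
        M * (4 * M ^ 2 * Q + 16 * M ^ 2 * (C * Q)) :=
      mul_le_mul m4 (by gcongr) (by positivity) hM0
    have t4 : 2 * M ^ 2 * (Γ.coef e ^ 4 * sqInt ℓ φ'') ≤ 2 * M ^ 2 * Q := by gcongr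
    nlinarith

/-- The elements of the domain which vanish on all but finitely many edges form a core. -/
theorem OpData.exists_finite_approx [Countable E] (hT : Γ.Tiles μ) (hR : Γ.Regular) {u g : Lp ℂ 2 μ}
    (h : Γ.OpData u g φ φ' φ'') {η : ℝ} (hη : 0 < η) :
    ∃ (v k : Lp ℂ 2 μ) (ψ ψ' ψ'' : E → ℝ → ℂ) (S : Set E), Γ.OpData v k ψ ψ' ψ'' ∧ S.Finite ∧
      (∀ e ∉ S, ψ e = 0 ∧ ψ' e = 0 ∧ ψ'' e = 0) ∧ ‖v - u‖ ≤ η ∧ ‖k - g‖ ≤ η := by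
  classical
  obtain ⟨C, hC0, hC⟩ := hR.exists_cutoff_const hT.len_pos
  have hQ := h.summable_sqInt hT
  set Q : E → ℝ := fun e => sqInt (Γ.len e) (φ e) + Γ.coef e ^ 4 * sqInt (Γ.len e) (φ'' e)
  have hQ0 : ∀ e, 0 ≤ Q e := fun e =>
    add_nonneg (sqInt_nonneg _ _) (mul_nonneg (by positivity) (sqInt_nonneg _ _))
  have hη2 : 0 < η ^ 2 / (C + 1) := by positivity
  obtain ⟨F, hF⟩ := (hQ.hasSum.eventually (lt_mem_nhds (sub_lt_self _ hη2))).exists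
  let W : Set V := {v | ∃ e ∈ F, ∃ b, Γ.vert e b = v}
  have hW : W.Finite := by
    refine ((F.finite_toSet.prod (Set.toFinite (univ : Set (Fin 2)))).image fun p => Γ.vert p.1 p.2).subset ?_
    rintro v ⟨e, he, b, rfl⟩
    exact ⟨(e, b), ⟨he, mem_univ _⟩, rfl⟩
  let c : V → ℂ := fun v => if v ∈ W then 0 else -1
  have hc1 : ∀ v, ‖c v‖ ≤ 1 := by
    intro v
    simp only [c]
    split_ifs <;> simp
  let ρ : E → ℝ → ℂ := fun e => cutoff (Γ.len e) (c (Γ.vert e 0)) (c (Γ.vert e 1))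
  let ρ' : E → ℝ → ℂ := fun e => cutoff' (Γ.len e) (c (Γ.vert e 0)) (c (Γ.vert e 1))
  let ρ'' : E → ℝ → ℂ := fun e => cutoff'' (Γ.len e) (c (Γ.vert e 0)) (c (Γ.vert e 1))
  have hρ : ∀ e, IsW22 (Γ.len e) (ρ e) (ρ' e) (ρ'' e) := fun e => isW22_cutoff _ _ _
  have hρv : ∀ e b, ρ e (Γ.endPt e b) = c (Γ.vert e b) ∧ ρ' e (Γ.endPt e b) = 0 := by
    intro e b
    fin_cases b
    · exact ⟨cutoff_zero _ _ _, cutoff'_zero _ _ _⟩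
    · exact ⟨cutoff_self (hT.len_pos e) _ _, cutoff'_self (hT.len_pos e) _ _⟩
  let χ : E → ℝ → ℂ := fun e x => ρ e x * φ e x
  let χ' : E → ℝ → ℂ := fun e x => ρ' e x * φ e x + ρ e x * φ' e x
  let χ'' : E → ℝ → ℂ := fun e x => ρ'' e x * φ e x + 2 * (ρ' e x * φ' e x) + ρ e x * φ'' e x
  have hχ : ∀ e, IsW22 (Γ.len e) (χ e) (χ' e) (χ'' e) := fun e => (hρ e).mul (h.w22 e)
  have hFz : ∀ e ∈ F, ∀ x, χ e x = 0 ∧ χ'' e x = 0 := by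
    intro e he x
    have c0 : ∀ b, c (Γ.vert e b) = 0 := fun b => if_pos ⟨e, he, b, rfl⟩
    have := cutoff_same (Γ.len e) 0 x
    simp only [χ, χ'', ρ, ρ', ρ'', c0, this]
    simp
  have hb1 : ∀ e, sqInt (Γ.len e) (χ e) ≤ (if e ∈ F then 0 else C * Q e) := by
    intro e
    split_ifs with he
    · simp [sqInt, (hFz e he _).1]
    · exact (hC e _ _ _ (h.w22 e) _ _ (hc1 _) (hc1 _)).1
  have hb2 : ∀ e, Γ.coef e ^ 4 * sqInt (Γ.len e) (χ'' e) ≤ (if e ∈ F then 0 else C * Q e) := by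
    intro e
    split_ifs with he
    · simp [sqInt, (hFz e he _).2]
    · exact (hC e _ _ _ (h.w22 e) _ _ (hc1 _) (hc1 _)).2
  have hsum : HasSum (fun e => if e ∈ F then 0 else C * Q e) (C * (∑' e, Q e) - C * ∑ e ∈ F, Q e) := by
    have h1 := (hQ.hasSum.mul_left C).sub
      (hasSum_sum_of_ne_finset_zero (f := fun e => if e ∈ F then C * Q e else 0) (s := F)
        (fun e he => by simp [he]))
    have h2 : ∑ e ∈ F, (if e ∈ F then C * Q e else 0) = C * ∑ e ∈ F, Q e := by
      rw [Finset.mul_sum]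
      exact Finset.sum_congr rfl fun e he => by simp [he]
    rw [h2] at h1
    refine h1.congr_fun ?_ |> fun h => h
    intro e
    split_ifs <;> simp
  have htail : C * (∑' e, Q e) - C * ∑ e ∈ F, Q e ≤ η ^ 2 := by
    have : C * (η ^ 2 / (C + 1)) ≤ η ^ 2 := by
      rw [mul_div_assoc', div_le_iff₀ (by positivity)]
      nlinarith [sq_nonneg η]
    nlinarith
  have hs1 : Summable fun e => sqInt (Γ.len e) (χ e) :=
    Summable.of_nonneg_of_le (fun e => sqInt_nonneg _ _) hb1 hsum.summable
  have hs2 : Summable fun e => sqInt (Γ.len e) (fun x => -(Γ.coef e : ℂ) ^ 2 * χ'' e x) := by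
    refine Summable.of_nonneg_of_le (fun e => sqInt_nonneg _ _) (fun e => ?_) hsum.summable
    refine le_trans (le_of_eq ?_) (hb2 e)
    rw [sqInt_const_mul, norm_neg, norm_pow, norm_real, Real.norm_eq_abs, sq_abs]
    ring
  have m1 := hT.memLp_glue (fun e => IsW22.memLp_of_continuousOn (hχ e).continuousOn) hs1
  have m2 := hT.memLp_glue (fun e => (hχ e).memLp.const_mul (-(Γ.coef e : ℂ) ^ 2)) hs2
  have hd : Γ.OpData m1.toLp m2.toLp χ χ' χ'' := by
    refine ⟨hχ, fun e => ?_, fun e => ?_, ?_, fun v => ?_⟩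
    · filter_upwards [hT.ae_edge m1.coeFn_toLp e, ae_restrict_mem measurableSet_Ioo] with x hx hx'
      rw [hx, hT.glue_edge _ e hx']
    · filter_upwards [hT.ae_edge m2.coeFn_toLp e, ae_restrict_mem measurableSet_Ioo] with x hx hx'
      rw [hx, hT.glue_edge _ e hx']
    · intro e b e' b' hv
      have := h.cont e b e' b' hv
      simp only [χ, (hρv e b).1, (hρv e' b').1, hv]
      linear_combination c (Γ.vert e' b') * this
    · have := congrArg (fun s => c v * s) (h.kirchhoff v)
      simp only [mul_zero] at this
      rw [mul_finsum] at this
      rw [← this]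
      refine finsum_congr fun p => ?_
      simp only [coDeriv, χ', (hρv _ _).1, (hρv _ _).2, p.2]
      ring
  have nv : ‖m1.toLp‖ ≤ η := by
    have h1 := hT.hasSum_sqInt_Lp m1.toLp
    simp only [hd.sqInt_fst] at h1
    exact (sq_le_sq₀ (norm_nonneg _) hη.le).1 ((hasSum_le hb1 h1 hsum).trans htail)
  have nk : ‖m2.toLp‖ ≤ η := by
    have h1 := hT.hasSum_sqInt_Lp m2.toLp
    simp only [hd.sqInt_snd] at h1
    exact (sq_le_sq₀ (norm_nonneg _) hη.le).1 ((hasSum_le hb2 h1 hsum).trans htail)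
  refine ⟨u + m1.toLp, g + m2.toLp, _, _, _, {e | ∃ b, Γ.vert e b ∈ W},
    h.add hR hd (hT.ae_edge (Lp.coeFn_add u _)) (hT.ae_edge (Lp.coeFn_add g _)), ?_, ?_, by rwa [add_sub_cancel_left],
    by rwa [add_sub_cancel_left]⟩
  · have : {e | ∃ b, Γ.vert e b ∈ W} ⊆
        ⋃ v ∈ W, range fun p : {p : E × Fin 2 // Γ.vert p.1 p.2 = v} => p.1.1 := by
      rintro e ⟨b, hb⟩
      exact mem_biUnion hb ⟨⟨(e, b), rfl⟩, rfl⟩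
    exact (hW.biUnion fun v _ => by have := hR.finite_fiber v; exact Set.finite_range _).subset this
  · intro e he
    have c0 : ∀ b, c (Γ.vert e b) = -1 := fun b => if_neg fun hb => he ⟨b, hb⟩
    have := cutoff_same (Γ.len e) (-1)
    refine ⟨?_, ?_, ?_⟩ <;> ext x <;> simp only [χ, χ', χ'', ρ, ρ', ρ'', c0, this] <;> simp

end MetricGraph

/-! ### Fibres of square-integrable functions on a product -/

section Fibre

variable {α β : Type} [MeasurableSpace α] [MeasurableSpace β] {μ : Measure α} {ν : Measure β}
  [SFinite μ] [SFinite ν]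

theorem ae_ae_of_ae_prod_swap {p : α × β → Prop} (h : ∀ᵐ q ∂(μ.prod ν), p q) :
    ∀ᵐ t ∂ν, ∀ᵐ y ∂μ, p (y, t) :=
  Measure.ae_ae_of_ae_prod (p := fun q : β × α => p q.swap)
    (Measure.measurePreserving_swap.quasiMeasurePreserving.ae h)

theorem memLp_fibre {f : α × β → ℂ} (hf : MemLp f 2 (μ.prod ν)) :
    ∀ᵐ t ∂ν, MemLp (fun y => f (y, t)) 2 μ := by
  filter_upwards [hf.1.prodMk_right, (integrable_norm_sq hf).prod_left_ae] with t h1 h2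
  exact (memLp_two_iff_integrable_sq_norm h1).2 h2

open Classical in
/-- The function `f(·, t)` as an element of `L²(μ)`. -/
def fibre (μ : Measure α) (f : α × β → ℂ) (t : β) : Lp ℂ 2 μ :=
  if h : MemLp (fun y => f (y, t)) 2 μ then h.toLp else 0

theorem fibre_of_memLp {f : α × β → ℂ} {t : β} (h : MemLp (fun y => f (y, t)) 2 μ) :
    fibre μ f t = h.toLp := dif_pos h

theorem coeFn_fibre {f : α × β → ℂ} (hf : MemLp f 2 (μ.prod ν)) :
    ∀ᵐ t ∂ν, fibre μ f t =ᵐ[μ] fun y => f (y, t) := by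
  filter_upwards [memLp_fibre hf] with t ht
  rw [fibre_of_memLp ht]
  exact ht.coeFn_toLp

theorem fibre_add (f g : Lp ℂ 2 (μ.prod ν)) :
    ∀ᵐ t ∂ν, fibre μ (f + g : Lp ℂ 2 (μ.prod ν)) t = fibre μ f t + fibre μ g t := by
  filter_upwards [ae_ae_of_ae_prod_swap (Lp.coeFn_add f g), coeFn_fibre (Lp.memLp f),
    coeFn_fibre (Lp.memLp g), coeFn_fibre (Lp.memLp (f + g))] with t h1 h2 h3 h4
  refine Lp.ext ?_
  filter_upwards [h1, h2, h3, h4, Lp.coeFn_add (fibre μ f t) (fibre μ g t)] with y k1 k2 k3 k4 k5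
  rw [k4, k5, k1]
  simp only [Pi.add_apply, k2, k3]

theorem fibre_smul (c : ℂ) (f : Lp ℂ 2 (μ.prod ν)) :
    ∀ᵐ t ∂ν, fibre μ (c • f : Lp ℂ 2 (μ.prod ν)) t = c • fibre μ f t := by
  filter_upwards [ae_ae_of_ae_prod_swap (Lp.coeFn_smul c f), coeFn_fibre (Lp.memLp f),
    coeFn_fibre (Lp.memLp (c • f))] with t h1 h2 h4
  refine Lp.ext ?_
  filter_upwards [h1, h2, h4, Lp.coeFn_smul c (fibre μ f t)] with y k1 k2 k4 k5
  rw [k4, k5, k1]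
  simp only [Pi.smul_apply, k2]

theorem fibre_sub (f g : Lp ℂ 2 (μ.prod ν)) :
    ∀ᵐ t ∂ν, fibre μ (f - g : Lp ℂ 2 (μ.prod ν)) t = fibre μ f t - fibre μ g t := by
  have e : f - g = f + (-1 : ℂ) • g := by module
  rw [e]
  filter_upwards [fibre_add f ((-1 : ℂ) • g), fibre_smul (-1) g] with t h1 h2
  rw [h1, h2]
  module

theorem norm_fibre_sq {f : α × β → ℂ} (hf : MemLp f 2 (μ.prod ν)) :
    ∀ᵐ t ∂ν, ‖fibre μ f t‖ ^ 2 = ∫ y, ‖f (y, t)‖ ^ 2 ∂μ := by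
  filter_upwards [memLp_fibre hf] with t ht
  rw [fibre_of_memLp ht, norm_toLp_sq]

theorem integrable_norm_fibre_sq {f : α × β → ℂ} (hf : MemLp f 2 (μ.prod ν)) :
    Integrable (fun t => ‖fibre μ f t‖ ^ 2) ν :=
  (integrable_norm_sq hf).integral_prod_right.congr
    (by filter_upwards [norm_fibre_sq hf] with t ht using ht.symm)

theorem norm_sq_eq_integral_fibre (f : Lp ℂ 2 (μ.prod ν)) :
    ‖f‖ ^ 2 = ∫ t, ‖fibre μ f t‖ ^ 2 ∂ν := by
  rw [norm_Lp_sq, integral_prod_symm _ (integrable_norm_sq (Lp.memLp f))]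
  exact integral_congr_ae (by filter_upwards [norm_fibre_sq (Lp.memLp f)] with t ht using ht.symm)

theorem norm_le_of_fibre {f g : Lp ℂ 2 (μ.prod ν)} {C : ℝ} (hC : 0 ≤ C)
    (h : ∀ᵐ t ∂ν, ‖fibre μ f t‖ ≤ C * ‖fibre μ g t‖) : ‖f‖ ≤ C * ‖g‖ := by
  refine (sq_le_sq₀ (norm_nonneg _) (by positivity)).1 ?_
  rw [mul_pow, norm_sq_eq_integral_fibre f, norm_sq_eq_integral_fibre g, ← integral_const_mul]
  refine integral_mono_ae (integrable_norm_fibre_sq (Lp.memLp f))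
    ((integrable_norm_fibre_sq (Lp.memLp g)).const_mul _) ?_
  filter_upwards [h] with t ht
  rw [← mul_pow]
  exact pow_le_pow_left₀ (norm_nonneg _) ht 2

theorem ext_fibre {f g : Lp ℂ 2 (μ.prod ν)} (h : ∀ᵐ t ∂ν, fibre μ f t = fibre μ g t) : f = g := by
  have : ‖f - g‖ ≤ 0 * ‖f‖ := by
    refine norm_le_of_fibre le_rfl ?_
    filter_upwards [h, fibre_sub f g] with t h1 h2
    rw [h2, h1]; simp
  rw [zero_mul] at this
  exact sub_eq_zero.1 (norm_le_zero_iff.1 this)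

theorem tendsto_fibre {f : Lp ℂ 2 (μ.prod ν)} {F : ℕ → Lp ℂ 2 (μ.prod ν)}
    (hF : ∀ n, ‖F n - f‖ ≤ (1 / 2) ^ n) :
    ∀ᵐ t ∂ν, Filter.Tendsto (fun n => fibre μ (F n) t) Filter.atTop (nhds (fibre μ f t)) := by
  have hm : ∀ n, AEMeasurable (fun t => ENNReal.ofReal (‖fibre μ (F n - f : Lp ℂ 2 (μ.prod ν)) t‖ ^ 2)) ν :=
    fun n => (integrable_norm_fibre_sq (Lp.memLp (F n - f))).1.aemeasurable.ennreal_ofReal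
  have h1 : ∀ n, ∫⁻ t, ENNReal.ofReal (‖fibre μ (F n - f : Lp ℂ 2 (μ.prod ν)) t‖ ^ 2) ∂ν ≤
      ENNReal.ofReal ((1 / 2) ^ n) := by
    intro n
    rw [← ofReal_integral_eq_lintegral_ofReal (integrable_norm_fibre_sq (Lp.memLp (F n - f)))
      (Filter.Eventually.of_forall fun _ => by positivity), ← norm_sq_eq_integral_fibre]
    refine ENNReal.ofReal_le_ofReal ?_
    have h2 : ((1 / 2 : ℝ) ^ n) ≤ 1 := pow_le_one₀ (by norm_num) (by norm_num)
    have := hF n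
    nlinarith [norm_nonneg (F n - f)]
  have h2 : ∫⁻ t, ∑' n, ENNReal.ofReal (‖fibre μ (F n - f : Lp ℂ 2 (μ.prod ν)) t‖ ^ 2) ∂ν ≠ ⊤ := by
    rw [lintegral_tsum hm]
    refine ne_top_of_le_ne_top ?_ (ENNReal.tsum_le_tsum h1)
    rw [← ENNReal.ofReal_tsum_of_nonneg (fun n => by positivity) summable_geometric_two]
    exact ENNReal.ofReal_ne_top
  have h3 := ae_lt_top' (AEMeasurable.ennreal_tsum hm) h2
  have h4 : ∀ᵐ t ∂ν, ∀ n, fibre μ (F n - f : Lp ℂ 2 (μ.prod ν)) t = fibre μ (F n) t - fibre μ f t :=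
    ae_all_iff.2 fun n => fibre_sub _ _
  filter_upwards [h3, h4] with t ht ht4
  have h5 := ENNReal.tendsto_atTop_zero_of_tsum_ne_top ht.ne
  have h6 := (ENNReal.tendsto_toReal ENNReal.zero_ne_top).comp h5
  rw [tendsto_iff_norm_sub_tendsto_zero]
  have h7 := (Real.continuous_sqrt.tendsto 0).comp h6
  rw [Real.sqrt_zero] at h7
  refine h7.congr fun n => ?_
  simp only [Function.comp]
  rw [ENNReal.toReal_ofReal (by positivity), Real.sqrt_sq (norm_nonneg _), ht4]

end Fibre

section Decomposable

variable {ε : ℝ}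

theorem isDirectIntegral_iff {D : L2Fibred ε →L[ℂ] L2Fibred ε} {T : ℝ → L2Cell ε →L[ℂ] L2Cell ε} :
    IsDirectIntegral D T ↔ ∀ f : L2Fibred ε, ∀ᵐ t ∂(quasiMeasure ε),
      fibre (volume.restrict (Ioo 0 ε)) (D f) t = T t (fibre (volume.restrict (Ioo 0 ε)) f t) := by
  refine forall_congr' fun f => ?_
  constructor
  · intro h
    filter_upwards [h, coeFn_fibre (Lp.memLp (D f))] with t ⟨h1, h2⟩ h3
    rw [fibre_of_memLp h1]
    exact Lp.ext (h3.trans h2)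
  · intro h
    filter_upwards [h, memLp_fibre (Lp.memLp f), coeFn_fibre (Lp.memLp (D f))] with t h1 h2 h3
    refine ⟨h2, ?_⟩
    rw [← fibre_of_memLp h2, ← h1]
    exact h3.symm

theorem IsDirectIntegral.comp {D D' : L2Fibred ε →L[ℂ] L2Fibred ε} {T T' : ℝ → L2Cell ε →L[ℂ] L2Cell ε}
    (h : IsDirectIntegral D T) (h' : IsDirectIntegral D' T') :
    IsDirectIntegral (D ∘L D') fun t => T t ∘L T' t := by
  rw [isDirectIntegral_iff] at *
  intro f
  filter_upwards [h (D' f), h' f] with t h1 h2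
  simp only [ContinuousLinearMap.comp_apply, h1, h2]

theorem isDirectIntegral_of_dense {D : L2Fibred ε →L[ℂ] L2Fibred ε} {T : ℝ → L2Cell ε →L[ℂ] L2Cell ε}
    {S : Set (L2Fibred ε)} (hS : Dense S) (h : ∀ f ∈ S, ∀ᵐ t ∂(quasiMeasure ε),
      fibre (volume.restrict (Ioo 0 ε)) (D f) t = T t (fibre (volume.restrict (Ioo 0 ε)) f t)) :
    IsDirectIntegral D T := by
  rw [isDirectIntegral_iff]
  intro f
  have hap : ∀ n : ℕ, ∃ g ∈ S, ‖g - f‖ ≤ (1 / 2) ^ n ∧ ‖D g - D f‖ ≤ (1 / 2) ^ n := by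
    intro n
    have hp : (0 : ℝ) < (1 / 2) ^ n / (‖D‖ + 1) := by positivity
    obtain ⟨g, hg, hgS⟩ := Metric.dense_iff.1 hS f _ hp
    rw [Metric.mem_ball, dist_eq_norm] at hg
    rw [lt_div_iff₀ (by positivity)] at hg
    refine ⟨g, hgS, ?_, ?_⟩
    · nlinarith [norm_nonneg (g - f), norm_nonneg D]
    · rw [← map_sub]
      refine (D.le_opNorm _).trans ?_
      nlinarith [norm_nonneg (g - f), norm_nonneg D]
  choose F hFS hF1 hF2 using hap
  have h3 : ∀ᵐ t ∂(quasiMeasure ε), ∀ n, fibre (volume.restrict (Ioo 0 ε)) (D (F n)) t =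
      T t (fibre (volume.restrict (Ioo 0 ε)) (F n) t) := ae_all_iff.2 fun n => h _ (hFS n)
  filter_upwards [tendsto_fibre hF1, tendsto_fibre (F := fun n => D (F n)) hF2, h3] with t h1 h2 h4
  refine tendsto_nhds_unique h2 ?_
  simp only [h4]
  exact ((T t).continuous.tendsto _).comp h1

theorem IsDirectIntegral.norm_sub_le {D D' : L2Fibred ε →L[ℂ] L2Fibred ε}
    {T T' : ℝ → L2Cell ε →L[ℂ] L2Cell ε} (h : IsDirectIntegral D T) (h' : IsDirectIntegral D' T')
    {C : ℝ} (hC : 0 ≤ C) (hTT : ∀ᵐ t ∂(quasiMeasure ε), ∀ f, ‖T t f - T' t f‖ ≤ C * ‖f‖) :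
    ‖D - D'‖ ≤ C := by
  rw [isDirectIntegral_iff] at h h'
  refine ContinuousLinearMap.opNorm_le_bound _ hC fun f => ?_
  refine norm_le_of_fibre hC ?_
  rw [ContinuousLinearMap.sub_apply]
  filter_upwards [h f, h' f, hTT, fibre_sub (D f) (D' f)] with t h1 h2 h3 h4
  rw [h4, h1, h2]
  exact h3 _

end Decomposable

/-! ### The Gelfand transform -/

/-- The line as the union of the cells `(εk, εk + ε)`. -/
def cellLine (ε : ℝ) : MetricGraph ℤ Unit where
  pos := fun k => ε * k
  len := fun _ => ε
  coef := fun _ => 1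
  vert := fun _ _ => ()
  wt := fun _ _ => 1

theorem tiles_cellLine {ε : ℝ} (hε : 0 < ε) : (cellLine ε).Tiles volume where
  len_pos _ := hε
  disj k k' hkk := by
    refine Set.disjoint_left.2 fun y hy hy' => hkk ?_
    simp only [MetricGraph.seg, cellLine, mem_Ioo] at hy hy'
    have c1 : ε * k < ε * (k' + 1) := by linarith
    have c2 : ε * k' < ε * (k + 1) := by linarith
    have d1 : k < k' + 1 := by exact_mod_cast lt_of_mul_lt_mul_left c1 hε.le
    have d2 : k' < k + 1 := by exact_mod_cast lt_of_mul_lt_mul_left c2 hε.le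
    omega
  restr _ := rfl
  cover := by
    have hc : (⋃ k : ℤ, {ε * (k : ℝ)}).Countable :=
      Set.countable_iUnion fun e => Set.countable_singleton _
    filter_upwards [hc.ae_notMem volume] with y hy
    refine mem_iUnion.2 ⟨⌊y / ε⌋, ?_⟩
    have e1 : ε * ⌊y / ε⌋ ≤ y := by
      have := mul_le_mul_of_nonneg_left (Int.floor_le (y / ε)) hε.le
      rwa [mul_div_cancel₀ _ hε.ne'] at this
    have e2 : y < ε * (⌊y / ε⌋ + 1) := by
      have := mul_lt_mul_of_pos_left (Int.lt_floor_add_one (y / ε)) hε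
      rwa [mul_div_cancel₀ _ hε.ne'] at this
    simp only [MetricGraph.seg, cellLine]
    refine ⟨lt_of_le_of_ne e1 fun heq => hy (mem_iUnion.2 ⟨⌊y / ε⌋, heq.symm⟩), by linarith⟩

section Cells

variable {ε : ℝ}

theorem memLp_cellEmb (hε : 0 < ε) (k : ℤ) (b : L2Cell ε) :
    MemLp ((cellLine ε).glue fun j => if j = k then (b : ℝ → ℂ) else 0) 2 volume := by
  refine (tiles_cellLine hε).memLp_glue (fun j => ?_) ?_
  · by_cases h : j = k
    · simp only [h, if_true]; exact Lp.memLp b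
    · simp only [h, if_false]; exact MemLp.zero
  · refine summable_of_ne_finset_zero (s := {k}) fun j hj => ?_
    rw [Finset.mem_singleton] at hj
    simp [hj, sqInt]

theorem cellEmb_aux (hε : 0 < ε) (k : ℤ) (b : L2Cell ε) (j : ℤ) : ∀ᵐ x ∂(volume.restrict (Ioo 0 ε)),
    ((memLp_cellEmb hε k b).toLp _ : ℝ → ℂ) (ε * j + x) = if j = k then b x else 0 := by
  filter_upwards [(tiles_cellLine hε).ae_edge (memLp_cellEmb hε k b).coeFn_toLp j,
    ae_restrict_mem measurableSet_Ioo] with x hx hx'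
  refine hx.trans (((tiles_cellLine hε).glue_edge _ j hx').trans ?_)
  split_ifs <;> rfl

/-- The embedding of the functions on the cell number `k`. -/
def cellEmb (hε : 0 < ε) (k : ℤ) : L2Cell ε →ₗᵢ[ℂ] L2Line where
  toFun b := (memLp_cellEmb hε k b).toLp
  map_add' b c := by
    refine Lp.ext ((tiles_cellLine hε).ae_of_edge fun j => ?_)
    filter_upwards [cellEmb_aux hε k b j, cellEmb_aux hε k c j, cellEmb_aux hε k (b + c) j, Lp.coeFn_add b c,
      (tiles_cellLine hε).ae_edge (Lp.coeFn_add ((memLp_cellEmb hε k b).toLp) ((memLp_cellEmb hε k c).toLp)) j]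
      with x h1 h2 h3 h4 h5
    refine h3.trans (Eq.trans ?_ h5.symm)
    refine Eq.trans ?_ (congrArg₂ (· + ·) h1 h2).symm
    split_ifs
    · exact h4
    · simp
  map_smul' c b := by
    refine Lp.ext ((tiles_cellLine hε).ae_of_edge fun j => ?_)
    filter_upwards [cellEmb_aux hε k b j, cellEmb_aux hε k (c • b) j, Lp.coeFn_smul c b,
      (tiles_cellLine hε).ae_edge (Lp.coeFn_smul c ((memLp_cellEmb hε k b).toLp)) j]
      with x h1 h3 h4 h5
    refine h3.trans (Eq.trans ?_ h5.symm)
    refine Eq.trans ?_ (congrArg (c • ·) h1).symm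
    split_ifs
    · exact h4
    · simp
  norm_map' b := by
    have h := (tiles_cellLine hε).hasSum_sqInt_Lp ((memLp_cellEmb hε k b).toLp)
    have h1 : ∀ j : ℤ, sqInt ε (fun x => ((memLp_cellEmb hε k b).toLp _ : ℝ → ℂ) (ε * j + x)) =
        if j = k then ‖b‖ ^ 2 else 0 := by
      intro j
      rw [sqInt_congr_norm (k := fun x => if j = k then b x else 0)
        (by filter_upwards [cellEmb_aux hε k b j] with x hx; rw [hx])]
      split_ifs
      · rw [norm_Lp_sq]; rfl
      · simp [sqInt]
    have h2 : HasSum (fun j : ℤ => sqInt ε (fun x => ((memLp_cellEmb hε k b).toLp _ : ℝ → ℂ) (ε * j + x)))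
        (‖b‖ ^ 2) := by
      simp only [h1]
      exact hasSum_ite_eq k _
    exact (sq_eq_sq₀ (norm_nonneg _) (norm_nonneg _)).1 (h.unique h2)

theorem cellEmb_edge (hε : 0 < ε) (k : ℤ) (b : L2Cell ε) (j : ℤ) : ∀ᵐ x ∂(volume.restrict (Ioo 0 ε)),
    cellEmb hε k b (ε * j + x) = if j = k then b x else 0 := cellEmb_aux hε k b j

/-- The restriction to the cell number `k`. -/
def cellPart (hε : 0 < ε) (k : ℤ) (F : L2Line) : L2Cell ε :=
  ((tiles_cellLine hε).memLp_edge (Lp.memLp F) k).toLp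

theorem cellPart_apply (hε : 0 < ε) (k : ℤ) (F : L2Line) :
    cellPart hε k F =ᵐ[volume.restrict (Ioo 0 ε)] fun x => F (ε * k + x) :=
  ((tiles_cellLine hε).memLp_edge (Lp.memLp F) k).coeFn_toLp

theorem inner_cellEmb (hε : 0 < ε) (k : ℤ) (b : L2Cell ε) (F : L2Line) :
    inner ℂ (cellEmb hε k b) F = inner ℂ b (cellPart hε k F) := by
  have h := (tiles_cellLine hε).hasSum_inner (cellEmb hε k b) F
  have h1 : ∀ j : ℤ, ∫ x in Ioo 0 ε, (starRingEnd ℂ) (cellEmb hε k b (ε * j + x)) * F (ε * j + x) =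
      if j = k then inner ℂ b (cellPart hε k F) else 0 := by
    intro j
    split_ifs with hj
    · rw [inner_Lp]
      refine integral_congr_ae ?_
      filter_upwards [cellEmb_edge hε k b j, cellPart_apply hε k F] with x h1 h2
      rw [h1, h2, if_pos hj, hj]
    · rw [integral_eq_zero_of_ae]
      filter_upwards [cellEmb_edge hε k b j] with x h1
      rw [h1, if_neg hj]
      simp
  have h2 : HasSum (fun j : ℤ => ∫ x in Ioo 0 ε, (starRingEnd ℂ) (cellEmb hε k b (ε * j + x)) * F (ε * j + x))
      (inner ℂ b (cellPart hε k F)) := by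
    simp only [h1]
    exact hasSum_ite_eq k _
  exact h.unique h2

theorem cellPart_cellEmb (hε : 0 < ε) (k j : ℤ) (b : L2Cell ε) :
    cellPart hε j (cellEmb hε k b) = if j = k then b else 0 := by
  refine Lp.ext ?_
  filter_upwards [cellPart_apply hε j (cellEmb hε k b), cellEmb_edge hε k b j,
    Lp.coeFn_zero ℂ 2 (volume.restrict (Ioo (0 : ℝ) ε))] with x h1 h2 h3
  rw [h1, h2]
  split_ifs
  · rfl
  · rw [h3]; rfl

theorem ext_cellPart (hε : 0 < ε) {F F' : L2Line} (h : ∀ k, cellPart hε k F = cellPart hε k F') : F = F' := by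
  refine Lp.ext ((tiles_cellLine hε).ae_of_edge fun k => ?_)
  filter_upwards [cellPart_apply hε k F, cellPart_apply hε k F'] with x h1 h2
  exact h1.symm.trans ((congrArg (fun b : L2Cell ε => (b : ℝ → ℂ) x) (h k)).trans h2)

theorem isHilbertSum_cellEmb (hε : 0 < ε) : IsHilbertSum ℂ (fun _ : ℤ => L2Cell ε) (cellEmb hε) := by
  refine IsHilbertSum.mk (fun j k hjk b c => ?_) (le_of_eq ?_)
  · rw [inner_cellEmb, cellPart_cellEmb, if_neg hjk, inner_zero_right]
  · symm
    rw [Submodule.topologicalClosure_eq_top_iff, Submodule.eq_bot_iff]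
    intro F hF
    rw [Submodule.mem_orthogonal] at hF
    refine ext_cellPart hε fun k => ?_
    have h1 := hF (cellEmb hε k (cellPart hε k F)) (Submodule.mem_iSup_of_mem k ⟨_, rfl⟩)
    rw [inner_cellEmb, inner_self_eq_zero] at h1
    rw [h1]
    refine Lp.ext ?_
    filter_upwards [cellPart_apply hε k (0 : L2Line), (tiles_cellLine hε).ae_edge
      (Lp.coeFn_zero ℂ 2 (volume : Measure ℝ)) k,
      Lp.coeFn_zero ℂ 2 (volume.restrict (Ioo (0 : ℝ) ε))] with x h2 h3 h4
    rw [h2, h4]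
    exact h3.symm

/-! The fibred space -/

/-- The normalizing constant of the Gelfand transform. -/
def gelfandConst (ε : ℝ) : ℝ := Real.sqrt (ε / (2 * Real.pi))

theorem gelfandConst_sq (hε : 0 < ε) : gelfandConst ε ^ 2 = ε / (2 * Real.pi) :=
  Real.sq_sqrt (by positivity)

end Cells

section FibredCells

variable {ε : ℝ}

theorem memLp_fibredEmb (ε : ℝ) (k : ℤ) (b : L2Cell ε) :
    MemLp (fun p : ℝ × ℝ => (gelfandConst ε : ℂ) * (exp (I * ((-(p.2 * (p.1 + ε * k)) : ℝ) : ℂ)) * b p.1)) 2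
      ((volume.restrict (Ioo (0 : ℝ) ε)).prod (quasiMeasure ε)) :=
  (memLp_phase _ (θ := fun p : ℝ × ℝ => -(p.2 * (p.1 + ε * k))) (by fun_prop)
    ((Lp.memLp b).comp_fst (quasiMeasure ε))).const_mul _

theorem quasiMeasure_real_univ (hε : 0 < ε) : (quasiMeasure ε).real univ = 2 * Real.pi / ε := by
  have : 0 ≤ Real.pi / ε := by positivity
  rw [measureReal_restrict_apply MeasurableSet.univ, univ_inter, Real.volume_real_Ioo_of_le (by linarith)]
  ring

theorem norm_fibredEmb_sq (hε : 0 < ε) (k : ℤ) (b : L2Cell ε) :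
    ‖(memLp_fibredEmb ε k b).toLp‖ ^ 2 = ‖b‖ ^ 2 := by
  rw [norm_toLp_sq, norm_Lp_sq b]
  simp only [norm_mul, norm_exp_I_mul, one_mul, mul_pow, norm_real, Real.norm_eq_abs, sq_abs,
    gelfandConst_sq hε]
  rw [integral_const_mul]
  have h := integral_prod_mul (μ := volume.restrict (Ioo (0 : ℝ) ε)) (ν := quasiMeasure ε)
    (fun y => ‖b y‖ ^ 2) (fun _ => (1 : ℝ))
  simp only [mul_one] at h
  rw [h, integral_const, quasiMeasure_real_univ hε]
  have := Real.pi_pos.ne'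
  simp only [smul_eq_mul, mul_one]
  field_simp

/-- The functions `exp (-it (y + εk)) b(y)` on the fibred space. -/
def fibredEmb (hε : 0 < ε) (k : ℤ) : L2Cell ε →ₗᵢ[ℂ] L2Fibred ε where
  toFun b := (memLp_fibredEmb ε k b).toLp
  map_add' b c := by
    rw [← MemLp.toLp_add]
    refine MemLp.toLp_congr _ _ ?_
    filter_upwards [Measure.quasiMeasurePreserving_fst.ae (Lp.coeFn_add b c)] with p hp
    rw [hp]
    simp only [Pi.add_apply]
    ring
  map_smul' a b := by
    rw [RingHom.id_apply, ← MemLp.toLp_const_smul]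
    refine MemLp.toLp_congr _ _ ?_
    filter_upwards [Measure.quasiMeasurePreserving_fst.ae (Lp.coeFn_smul a b)] with p hp
    rw [hp]
    simp only [Pi.smul_apply, smul_eq_mul]
    ring
  norm_map' b := (sq_eq_sq₀ (norm_nonneg _) (norm_nonneg _)).1 (norm_fibredEmb_sq hε k b)

theorem fibredEmb_apply (hε : 0 < ε) (k : ℤ) (b : L2Cell ε) :
    fibredEmb hε k b =ᵐ[(volume.restrict (Ioo (0 : ℝ) ε)).prod (quasiMeasure ε)] fun p =>
      (gelfandConst ε : ℂ) * (exp (I * ((-(p.2 * (p.1 + ε * k)) : ℝ) : ℂ)) * b p.1) :=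
  (memLp_fibredEmb ε k b).coeFn_toLp

theorem integral_exp_quasi (hε : 0 < ε) {m : ℤ} (hm : m ≠ 0) :
    ∫ t, exp (I * ε * m * t) ∂(quasiMeasure ε) = 0 := by
  have h0 : 0 ≤ Real.pi / ε := by positivity
  have hc : I * ε * m ≠ 0 := mul_ne_zero (mul_ne_zero I_ne_zero (by exact_mod_cast hε.ne')) (by exact_mod_cast hm)
  rw [← integral_Ioc_eq_integral_Ioo, ← intervalIntegral.integral_of_le (by linarith), integral_exp_mul_complex hc]
  have hε' : (ε : ℂ) ≠ 0 := by exact_mod_cast hε.ne'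
  have e : I * ε * m * ((Real.pi / ε : ℝ) : ℂ) = I * ε * m * ((-(Real.pi / ε) : ℝ) : ℂ) + m * (2 * Real.pi * I) := by
    push_cast
    field_simp
    ring
  rw [e, exp_periodic.int_mul m _]
  simp

theorem orthogonal_fibredEmb (hε : 0 < ε) :
    OrthogonalFamily ℂ (fun _ : ℤ => L2Cell ε) (fibredEmb hε) := by
  intro j k hjk b c
  have h1 : inner ℂ (fibredEmb hε j b) (fibredEmb hε k c) = _ :=
    inner_toLp (memLp_fibredEmb ε j b) (memLp_fibredEmb ε k c)
  have h : ∀ p : ℝ × ℝ, (starRingEnd ℂ) ((gelfandConst ε : ℂ) * (exp (I * ((-(p.2 * (p.1 + ε * j)) : ℝ) : ℂ)) * b p.1)) *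
      ((gelfandConst ε : ℂ) * (exp (I * ((-(p.2 * (p.1 + ε * k)) : ℝ) : ℂ)) * c p.1)) =
      ((gelfandConst ε : ℂ) ^ 2 * (starRingEnd ℂ (b p.1) * c p.1)) * exp (I * ε * ((j - k : ℤ) : ℂ) * p.2) := by
    intro p
    simp only [map_mul, conj_ofReal, ← exp_conj, conj_I]
    have e : exp (I * ε * ((j - k : ℤ) : ℂ) * p.2) = exp (-I * ((-(p.2 * (p.1 + ε * j)) : ℝ) : ℂ)) *
        exp (I * ((-(p.2 * (p.1 + ε * k)) : ℝ) : ℂ)) := by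
      rw [← exp_add]
      congr 1
      push_cast
      ring
    rw [e]
    ring
  rw [h1]
  simp only [h]
  rw [integral_prod_mul (μ := volume.restrict (Ioo (0 : ℝ) ε)) (ν := quasiMeasure ε)
    (fun y => (gelfandConst ε : ℂ) ^ 2 * (starRingEnd ℂ (b y) * c y))
    (fun t => exp (I * ε * ((j - k : ℤ) : ℂ) * t)), integral_exp_quasi hε (sub_ne_zero.2 hjk), mul_zero]

theorem ae_eq_zero_of_fourier (hε : 0 < ε) {f : ℝ → ℂ} (hf : MemLp f 2 (quasiMeasure ε))
    (h : ∀ k : ℤ, ∫ t, exp (I * ε * k * t) * f t ∂(quasiMeasure ε) = 0) : f =ᵐ[quasiMeasure ε] 0 := by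
  have h0 : 0 < Real.pi / ε := by positivity
  have hlt : -(Real.pi / ε) < Real.pi / ε := by linarith
  have hf' : MemLp f 2 (volume.restrict (Ioc (-(Real.pi / ε)) (Real.pi / ε))) := by
    rwa [← restrict_Ioo_eq_restrict_Ioc]
  have h1 := hasSum_sq_fourierCoeffOn hlt hf'
  have h2 : ∀ n : ℤ, fourierCoeffOn hlt f n = 0 := by
    intro n
    rw [fourierCoeffOn_eq_integral, intervalIntegral.integral_of_le hlt.le, integral_Ioc_eq_integral_Ioo]
    have h3 := h (-n)
    have h4 : ∫ x in Ioo (-(Real.pi / ε)) (Real.pi / ε),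
        (fourier (-n)) (x : AddCircle (Real.pi / ε - -(Real.pi / ε))) • f x = 0 := by
      rw [← h3]
      refine integral_congr_ae (Filter.Eventually.of_forall fun x => ?_)
      simp only [fourier_coe_apply, smul_eq_mul]
      congr 2
      have := Real.pi_pos.ne'
      have hp : (Real.pi : ℂ) ≠ 0 := by exact_mod_cast this
      have hε' : (ε : ℂ) ≠ 0 := by exact_mod_cast hε.ne'
      push_cast
      field_simp
      ring
    rw [h4, smul_zero]
  simp only [h2, norm_zero, ne_eq, OfNat.ofNat_ne_zero, not_false_eq_true, zero_pow] at h1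
  have h3 := h1.unique hasSum_zero
  rw [smul_eq_mul, mul_eq_zero, or_iff_right (inv_ne_zero (by linarith)),
    intervalIntegral.integral_of_le hlt.le, integral_Ioc_eq_integral_Ioo,
    integral_eq_zero_iff_of_nonneg (fun _ => by positivity) (integrable_norm_sq hf)] at h3
  filter_upwards [h3] with t ht
  simpa using ht

theorem eq_zero_of_inner_fibredEmb (hε : 0 < ε) (f : L2Fibred ε)
    (h : ∀ k b, inner ℂ (fibredEmb hε k b) f = 0) : f = 0 := by
  have hf := Lp.memLp f
  set μ := volume.restrict (Ioo (0 : ℝ) ε) with hμ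
  set ν := quasiMeasure ε with hν
  have hfi : Integrable f (μ.prod ν) := hf.integrable (by norm_num)
  have hphase : ∀ k : ℤ, Integrable (fun p : ℝ × ℝ => exp (I * ((p.2 * (p.1 + ε * k) : ℝ) : ℂ)) * f p) (μ.prod ν) :=
    fun k => (memLp_phase _ (θ := fun p : ℝ × ℝ => (p.2 * (p.1 + ε * k))) (by fun_prop) hf).integrable (by norm_num)
  have hgc : (gelfandConst ε : ℂ) ≠ 0 := by
    have := gelfandConst_sq hε
    have h2 : 0 < gelfandConst ε ^ 2 := by rw [this]; positivity
    rw [ne_eq, ofReal_eq_zero]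
    rintro h3
    simp [h3] at h2
  have key : ∀ k : ℤ, ∀ᵐ y ∂μ, ∫ t, exp (I * ((t * (y + ε * k) : ℝ) : ℂ)) * f (y, t) ∂ν = 0 := by
    intro k
    refine Integrable.ae_eq_zero_of_forall_setIntegral_eq_zero (hphase k).integral_prod_left fun s hs _ => ?_
    have hb : MemLp (s.indicator fun _ => (1 : ℂ)) 2 μ := (memLp_const 1).indicator hs
    have h1 := h k hb.toLp
    have h2 : inner ℂ (fibredEmb hε k hb.toLp) f = _ :=
      inner_Lp (fibredEmb hε k hb.toLp) f
    rw [h2] at h1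
    have h3 : ∫ p, (gelfandConst ε : ℂ) * ((s.indicator (fun _ => (1 : ℂ)) p.1) *
        (exp (I * ((p.2 * (p.1 + ε * k) : ℝ) : ℂ)) * f p)) ∂(μ.prod ν) = 0 := by
      rw [← h1]
      refine integral_congr_ae ?_
      filter_upwards [fibredEmb_apply hε k hb.toLp,
        Measure.quasiMeasurePreserving_fst.ae hb.coeFn_toLp] with p h4 h5
      rw [h4, h5]
      simp only [map_mul, conj_ofReal, ← exp_conj, conj_I]
      have e : -I * ((-(p.2 * (p.1 + ε * k)) : ℝ) : ℂ) = I * ((p.2 * (p.1 + ε * k) : ℝ) : ℂ) := by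
        push_cast; ring
      rw [e]
      by_cases hp : p.1 ∈ s
      · simp [hp, mul_assoc]
      · simp [hp]
    rw [integral_const_mul, mul_eq_zero, or_iff_right hgc] at h3
    have h6 : Integrable (fun p : ℝ × ℝ => (s.indicator (fun _ => (1 : ℂ)) p.1) *
        (exp (I * ((p.2 * (p.1 + ε * k) : ℝ) : ℂ)) * f p)) (μ.prod ν) := by
      have := (hphase k).indicator (hs.preimage measurable_fst)
      refine this.congr (Filter.Eventually.of_forall fun p => ?_)
      by_cases hp : p.1 ∈ s
      · simp [hp]
      · simp [hp]
    rw [integral_prod _ h6] at h3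
    rw [← integral_indicator hs, ← h3]
    refine integral_congr_ae (Filter.Eventually.of_forall fun y => ?_)
    by_cases hp : y ∈ s
    · simp [hp]
    · simp [hp]
  have h7 : ∀ᵐ y ∂μ, MemLp (fun t => f (y, t)) 2 ν := by
    filter_upwards [hf.1.prodMk_left, (integrable_norm_sq hf).prod_right_ae] with y k1 k2
    exact (memLp_two_iff_integrable_sq_norm k1).2 k2
  have h8 : ∀ᵐ y ∂μ, ∫ t, ‖f (y, t)‖ ^ 2 ∂ν = 0 := by
    filter_upwards [ae_all_iff.2 key, h7] with y k1 k2
    have k3 := ae_eq_zero_of_fourier hε (f := fun t => exp (I * ((t * y : ℝ) : ℂ)) * f (y, t))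
      (memLp_phase _ (θ := fun t : ℝ => t * y) (by fun_prop) k2) fun k => by
        rw [← k1 k]
        refine integral_congr_ae (Filter.Eventually.of_forall fun t => ?_)
        simp only
        rw [← mul_assoc, ← exp_add]
        congr 2
        push_cast
        ring
    rw [integral_eq_zero_of_ae]
    filter_upwards [k3] with t k4
    simp only [Pi.zero_apply, mul_eq_zero, exp_ne_zero, false_or] at k4
    simp [k4]
  have h9 : ‖f‖ ^ 2 = 0 := by
    rw [norm_Lp_sq, integral_prod _ (integrable_norm_sq hf)]
    exact integral_eq_zero_of_ae h8
  exact norm_eq_zero.1 (pow_eq_zero_iff two_ne_zero |>.1 h9)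

theorem isHilbertSum_fibredEmb (hε : 0 < ε) : IsHilbertSum ℂ (fun _ : ℤ => L2Cell ε) (fibredEmb hε) := by
  refine IsHilbertSum.mk (orthogonal_fibredEmb hε) (le_of_eq ?_)
  symm
  rw [Submodule.topologicalClosure_eq_top_iff, Submodule.eq_bot_iff]
  intro F hF
  rw [Submodule.mem_orthogonal] at hF
  exact eq_zero_of_inner_fibredEmb hε F fun k b => hF _ (Submodule.mem_iSup_of_mem k ⟨_, rfl⟩)

/-- The Gelfand transform. -/
def gelfand (hε : 0 < ε) : L2Line ≃ₗᵢ[ℂ] L2Fibred ε :=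
  (isHilbertSum_cellEmb hε).linearIsometryEquiv.trans (isHilbertSum_fibredEmb hε).linearIsometryEquiv.symm

theorem gelfand_cellEmb (hε : 0 < ε) (k : ℤ) (b : L2Cell ε) :
    gelfand hε (cellEmb hε k b) = fibredEmb hε k b := by
  classical
  have h1 := (isHilbertSum_cellEmb hε).linearIsometryEquiv_symm_apply_single (i := k) b
  have h2 := (isHilbertSum_fibredEmb hε).linearIsometryEquiv_symm_apply_single (i := k) b
  rw [gelfand, LinearIsometryEquiv.trans_apply, ← h1, LinearIsometryEquiv.apply_symm_apply, h2]

theorem eq_sum_cellEmb (hε : 0 < ε) {F : L2Line} {s : Finset ℤ} (hs : ∀ k ∉ s, cellPart hε k F = 0) :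
    F = ∑ k ∈ s, cellEmb hε k (cellPart hε k F) := by
  refine Lp.ext ((tiles_cellLine hε).ae_of_edge fun j => ?_)
  have h1 : ∀ᵐ x ∂(volume.restrict (Ioo 0 ε)), ∀ k, cellEmb hε k (cellPart hε k F) (ε * j + x) =
      if j = k then cellPart hε k F x else 0 := ae_all_iff.2 fun k => cellEmb_edge hε k _ j
  have h2 : ∀ᵐ x ∂(volume.restrict (Ioo 0 ε)), (∑ k ∈ s, cellEmb hε k (cellPart hε k F) : L2Line) (ε * j + x) =
      ∑ k ∈ s, cellEmb hε k (cellPart hε k F) (ε * j + x) := by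
    have := (tiles_cellLine hε).ae_edge (Lp.coeFn_finsetSum (p := 2) (μ := (volume : Measure ℝ)) s
      fun k => cellEmb hε k (cellPart hε k F)) j
    filter_upwards [this] with x hx
    refine hx.trans ?_
    rw [Finset.sum_apply]
    rfl
  filter_upwards [h1, h2, cellPart_apply hε j F, Lp.coeFn_zero ℂ 2 (volume.restrict (Ioo (0 : ℝ) ε))]
    with x k1 k2 k3 k4
  refine k3.symm.trans (Eq.trans ?_ k2.symm)
  simp only [k1, Finset.sum_ite_eq]
  split_ifs with hj
  · rfl
  · rw [hs j hj, k4]; rfl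

/-- The Gelfand transform of a function supported by finitely many cells. -/
theorem gelfand_apply (hε : 0 < ε) {F : L2Line} {s : Finset ℤ} (hs : ∀ k ∉ s, cellPart hε k F = 0) :
    gelfand hε F =ᵐ[(volume.restrict (Ioo (0 : ℝ) ε)).prod (quasiMeasure ε)] fun p =>
      (gelfandConst ε : ℂ) * ∑ k ∈ s, F (ε * k + p.1) * exp (I * ((-(p.2 * (p.1 + ε * k)) : ℝ) : ℂ)) := by
  have e : gelfand hε F = ∑ k ∈ s, fibredEmb hε k (cellPart hε k F) := by
    conv_lhs => rw [eq_sum_cellEmb hε hs]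
    rw [map_sum]
    exact Finset.sum_congr rfl fun k _ => gelfand_cellEmb hε k _
  rw [e]
  have h1 := ae_all_iff.2 fun k : ℤ => fibredEmb_apply hε k (cellPart hε k F)
  have h2 := ae_all_iff.2 fun k : ℤ =>
    (Measure.quasiMeasurePreserving_fst (ν := quasiMeasure ε)).ae (cellPart_apply hε k F)
  filter_upwards [h1, h2, Lp.coeFn_finsetSum (p := 2) (μ := (volume.restrict (Ioo (0 : ℝ) ε)).prod (quasiMeasure ε)) s
      fun k => fibredEmb hε k (cellPart hε k F)] with p k1 k2 k3
  rw [k3, Finset.sum_apply, Finset.mul_sum]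
  refine Finset.sum_congr rfl fun k _ => ?_
  rw [k1, k2]
  ring

theorem cellPart_eq_zero (hε : 0 < ε) {F : L2Line} {k : ℤ}
    (h : ∀ᵐ x ∂(volume.restrict (Ioo 0 ε)), F (ε * k + x) = 0) : cellPart hε k F = 0 := by
  refine Lp.ext ?_
  filter_upwards [cellPart_apply hε k F, h, Lp.coeFn_zero ℂ 2 (volume.restrict (Ioo (0 : ℝ) ε))] with x h1 h2 h3
  rw [h1, h2, h3]; rfl

theorem exists_finset_cells (hε : 0 < ε) {F : L2Line} {r : ℝ} (hr : ∀ᵐ x : ℝ, r < |x| → F x = 0) :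
    ∃ s : Finset ℤ, ∀ k ∉ s, ∀ᵐ x ∂(volume.restrict (Ioo 0 ε)), F (ε * k + x) = 0 := by
  obtain ⟨N, hN⟩ := exists_nat_gt ((|r| + ε) / ε)
  have hN' : |r| + ε < ε * N := by rwa [div_lt_iff₀ hε, mul_comm] at hN
  refine ⟨Finset.Icc (-(N : ℤ)) N, fun k hk => ?_⟩
  filter_upwards [(tiles_cellLine hε).ae_edge hr k, ae_restrict_mem measurableSet_Ioo] with x hx hx'
  refine hx ?_
  change r < |ε * k + x|
  rw [Finset.mem_Icc, not_and_or, not_le, not_le] at hk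
  have hr' := le_abs_self r
  rcases hk with hk | hk
  · have : (k : ℝ) < -N := by exact_mod_cast hk
    have := mul_lt_mul_of_pos_left this hε
    have := neg_abs_le (ε * k + x)
    linarith [hx'.2]
  · have : (N : ℝ) < k := by exact_mod_cast hk
    have := mul_lt_mul_of_pos_left this hε
    have := le_abs_self (ε * k + x)
    linarith [hx'.1]

theorem isGelfand_gelfand (hε : 0 < ε) : IsGelfand ε (gelfand hε) := by
  rintro F ⟨r, hr⟩
  obtain ⟨s, hout⟩ := exists_finset_cells hε hr
  have h0 : ∀ᵐ p ∂((volume.restrict (Ioo (0 : ℝ) ε)).prod (quasiMeasure ε)), ∀ k : ℤ,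
      k ∉ s → F (ε * k + p.1) = 0 := by
    refine ae_all_iff.2 fun k => ?_
    by_cases hk : k ∈ s
    · exact Filter.Eventually.of_forall fun p h => absurd hk h
    · filter_upwards [Measure.quasiMeasurePreserving_fst.ae (hout k hk)] with p hp _ using hp
  filter_upwards [gelfand_apply hε (s := s) fun k hk => cellPart_eq_zero hε (hout k hk), h0] with p h1 h2
  rw [h1, tsum_eq_sum (s := s)]
  · refine congrArg₂ (· * ·) rfl (Finset.sum_congr rfl fun k _ => ?_)
    rw [add_comm]
    congr 2
    push_cast
    ring
  · intro k hk
    have := h2 k hk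
    rw [add_comm] at this
    rw [this, zero_mul]

end FibredCells

theorem coeFn_indicatorProj (μ : Measure ℝ) (S : Set ℝ) (hS : MeasurableSet S) (f : Lp ℂ 2 μ) :
    indicatorProj μ S hS f =ᵐ[μ] S.indicator f :=
  ((Lp.memLp f).indicator hS).coeFn_toLp

section

variable {ε : ℝ}

theorem dense_finite_cells (hε : 0 < ε) :
    Dense {F : L2Line | ∃ s : Finset ℤ, ∀ k ∉ s, cellPart hε k F = 0} := by
  intro F
  have h := (isHilbertSum_cellEmb hε).hasSum_linearIsometryEquiv_symm
    ((isHilbertSum_cellEmb hε).linearIsometryEquiv F)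
  rw [LinearIsometryEquiv.symm_apply_apply] at h
  refine mem_closure_of_tendsto h (Filter.Eventually.of_forall fun s => ⟨s, fun k hk => ?_⟩)
  refine Lp.ext ?_
  have h1 : ∀ᵐ x ∂(volume.restrict (Ioo 0 ε)), ∀ j : ℤ, cellEmb hε j
      ((isHilbertSum_cellEmb hε).linearIsometryEquiv F j) (ε * k + x) = if k = j then
      ((isHilbertSum_cellEmb hε).linearIsometryEquiv F j) x else 0 :=
    ae_all_iff.2 fun j => cellEmb_edge hε j _ k
  have h2 := (tiles_cellLine hε).ae_edge (Lp.coeFn_finsetSum (p := 2) (μ := (volume : Measure ℝ)) s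
      fun j => cellEmb hε j ((isHilbertSum_cellEmb hε).linearIsometryEquiv F j)) k
  filter_upwards [h1, h2, cellPart_apply hε k (∑ j ∈ s, cellEmb hε j
      ((isHilbertSum_cellEmb hε).linearIsometryEquiv F j)),
      Lp.coeFn_zero ℂ 2 (volume.restrict (Ioo (0 : ℝ) ε))] with x k1 k2 k3 k4
  rw [k3, k4]
  refine k2.trans ?_
  rw [Finset.sum_apply]
  refine Finset.sum_eq_zero fun j hj => ?_
  refine (k1 j).trans (if_neg ?_)
  rintro rfl
  exact hk hj

end

namespace Composite

variable {n : ℕ} {P : Composite n} {ε : ℝ}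

theorem WellFormed.mem_stiffPer (h : P.WellFormed) (hε : 0 < ε) (k : ℤ) {y : ℝ} (hy : y ∈ Ioo 0 ε) :
    ε * k + y ∈ P.stiffPer ε ↔ y ∈ P.stiffCell ε := by
  simp only [stiffPer, stiffCell, mem_iUnion, mem_Ioo]
  constructor
  · rintro ⟨⟨k', e⟩, h1, h2⟩
    simp only at h1 h2
    have b1 := h.pos_nonneg e
    have b2 := h.end_le e
    have c1 : ε * k' < ε * (k + 1) := by nlinarith [hy.2]
    have c2 : ε * k < ε * (k' + 1) := by nlinarith [hy.1]
    have d1 : k' < k + 1 := by exact_mod_cast lt_of_mul_lt_mul_left c1 hε.le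
    have d2 : k < k' + 1 := by exact_mod_cast lt_of_mul_lt_mul_left c2 hε.le
    obtain rfl : k = k' := by omega
    exact ⟨e, by linarith, by linarith⟩
  · rintro ⟨e, h1, h2⟩
    exact ⟨(k, e), by simp only; linarith, by simp only; linarith⟩

theorem WellFormed.isDirectIntegral_stiffProj (h : P.WellFormed) (hε : 0 < ε) :
    IsDirectIntegral ((gelfand hε : L2Line →L[ℂ] L2Fibred ε) ∘L P.stiffProjPer ε ∘L
      ((gelfand hε).symm : L2Fibred ε →L[ℂ] L2Line)) fun _ => P.stiffProjCell ε := by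
  refine isDirectIntegral_of_dense
    ((gelfand hε).surjective.denseRange.dense_image (gelfand hε).continuous (dense_finite_cells hε)) ?_
  rintro _ ⟨F, ⟨s, hs⟩, rfl⟩
  have hPe : ∀ k : ℤ, ∀ᵐ x ∂(volume.restrict (Ioo 0 ε)),
      P.stiffProjPer ε F (ε * k + x) = (P.stiffCell ε).indicator (fun x => F (ε * k + x)) x := by
    intro k
    filter_upwards [(tiles_cellLine hε).ae_edge (coeFn_indicatorProj _ (P.stiffPer ε)
      (MeasurableSet.iUnion fun _ => measurableSet_Ioo) F) k, ae_restrict_mem measurableSet_Ioo] with x hx hx'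
    refine hx.trans ?_
    change (P.stiffPer ε).indicator F (ε * k + x) = _
    by_cases hm : x ∈ P.stiffCell ε
    · rw [indicator_of_mem hm, indicator_of_mem ((h.mem_stiffPer hε k hx').2 hm)]
    · rw [indicator_of_notMem hm, indicator_of_notMem fun hm' => hm ((h.mem_stiffPer hε k hx').1 hm')]
  have hs' : ∀ k ∉ s, cellPart hε k (P.stiffProjPer ε F) = 0 := by
    intro k hk
    have hz := hs k hk
    refine Lp.ext ?_
    have h4 := Lp.coeFn_zero ℂ 2 (volume.restrict (Ioo (0 : ℝ) ε))
    have h5 := cellPart_apply hε k F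
    rw [hz] at h5
    filter_upwards [hPe k, cellPart_apply hε k (P.stiffProjPer ε F), h4, h5] with x k1 k2 k4 k5
    rw [k2, k1, k4]
    by_cases hm : x ∈ P.stiffCell ε
    · rw [indicator_of_mem hm, ← k5, k4]
    · rw [indicator_of_notMem hm]; rfl
  simp only [ContinuousLinearMap.comp_apply]
  have e1 : (((gelfand hε).symm : L2Fibred ε →L[ℂ] L2Line)) (gelfand hε F) = F :=
    (gelfand hε).symm_apply_apply F
  rw [e1]
  have hall : ∀ᵐ y ∂(volume.restrict (Ioo 0 ε)), ∀ k : ℤ, P.stiffProjPer ε F (ε * k + y) =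
    (P.stiffCell ε).indicator (fun x => F (ε * k + x)) y := ae_all_iff.2 hPe
  filter_upwards [ae_ae_of_ae_prod_swap (gelfand_apply hε hs), ae_ae_of_ae_prod_swap (gelfand_apply hε hs'),
    coeFn_fibre (Lp.memLp (gelfand hε F)), coeFn_fibre (Lp.memLp (gelfand hε (P.stiffProjPer ε F)))]
    with t h1 h2 h3 h4
  refine Lp.ext ?_
  filter_upwards [h1, h2, h3, h4, hall, coeFn_indicatorProj _ (P.stiffCell ε)
      (MeasurableSet.iUnion fun _ => measurableSet_Ioo) (fibre (volume.restrict (Ioo 0 ε)) (gelfand hε F) t)]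
    with y k1 k2 k3 k4 k5 k6
  refine k4.trans (k2.trans ?_)
  refine Eq.trans ?_ k6.symm
  simp only [k5]
  by_cases hm : y ∈ P.stiffCell ε
  · simp only [indicator_of_mem hm]
    exact (k3.trans k1).symm
  · simp only [indicator_of_notMem hm]
    simp

/-- The Gelfand transform of an element of the domain which is supported by finitely many edges. -/
theorem WellFormed.fibreOp_gelfand (h : P.WellFormed) (hε : 0 < ε) {v g : L2Line}
    {ψ ψ' ψ'' : ℤ × Fin n → ℝ → ℂ} {S : Set (ℤ × Fin n)} (hd : (P.perGraph ε).OpData v g ψ ψ' ψ'')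
    (hS : S.Finite) (hz : ∀ e ∉ S, ψ e = 0 ∧ ψ' e = 0 ∧ ψ'' e = 0) :
    ∀ᵐ t ∂(quasiMeasure ε), P.fibreOp ε t (fibre (volume.restrict (Ioo 0 ε)) (gelfand hε v) t)
      (fibre (volume.restrict (Ioo 0 ε)) (gelfand hε g) t) := by
  have hs0 : (Prod.fst '' S).Finite := hS.image _
  set s : Finset ℤ := hs0.toFinset with hsdef
  have hzs : ∀ k ∉ s, ∀ e, ψ (k, e) = 0 ∧ ψ' (k, e) = 0 ∧ ψ'' (k, e) = 0 := by
    intro k hk e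
    refine hz _ fun he => hk ?_
    rw [hsdef, Set.Finite.mem_toFinset]
    exact ⟨_, he, rfl⟩
  have hT := h.tiles_twistGraph hε 0
  have hpos : ∀ (k : ℤ) e x, (P.perGraph ε).pos (k, e) + x = ε * k + (ε * P.pos e + x) := by
    intro k e x
    simp only [perGraph]; ring
  have e1 : ∀ (k : ℤ) e, ∀ᵐ x ∂(volume.restrict (Ioo 0 (ε * P.len e))),
      v (ε * k + (ε * P.pos e + x)) = ψ (k, e) x := by
    intro k e
    filter_upwards [hd.fst_eq (k, e)] with x hx
    rw [← hx, hpos]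
  have e2 : ∀ (k : ℤ) e, ∀ᵐ x ∂(volume.restrict (Ioo 0 (ε * P.len e))),
      g (ε * k + (ε * P.pos e + x)) = -(P.coefEps ε e : ℂ) ^ 2 * ψ'' (k, e) x := by
    intro k e
    filter_upwards [hd.snd_eq (k, e)] with x hx
    rw [← hpos, hx]; rfl
  have c1 : ∀ k ∉ s, cellPart hε k v = 0 := by
    intro k hk
    refine cellPart_eq_zero hε (hT.ae_of_edge fun e => ?_)
    filter_upwards [e1 k e] with x hx
    exact hx.trans (by rw [(hzs k hk e).1]; rfl)
  have c2 : ∀ k ∉ s, cellPart hε k g = 0 := by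
    intro k hk
    refine cellPart_eq_zero hε (hT.ae_of_edge fun e => ?_)
    filter_upwards [e2 k e] with x hx
    exact hx.trans (by rw [(hzs k hk e).2.2]; simp)
  filter_upwards [ae_ae_of_ae_prod_swap (gelfand_apply hε c1), ae_ae_of_ae_prod_swap (gelfand_apply hε c2),
    coeFn_fibre (Lp.memLp (gelfand hε v)), coeFn_fibre (Lp.memLp (gelfand hε g))] with t g1 g2 f1 f2
  rw [h.fibreOp_iff hε]
  set ω : ℤ → ℂ := fun k => gelfandConst ε * exp (I * ((-(t * (ε * k)) : ℝ) : ℂ)) with hω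
  have hωs : ∀ k m : ℤ, exp (I * ((-(ε * t * m) : ℝ) : ℂ)) * ω k = ω (k + m) := by
    intro k m
    simp only [hω]
    rw [mul_left_comm, ← exp_add]
    congr 2
    push_cast
    ring
  have hgel : ∀ {w : L2Line} {e : Fin n} {a : ℤ → ℂ} {x : ℝ},
      fibre (volume.restrict (Ioo 0 ε)) (gelfand hε w) t (ε * P.pos e + x) = gelfand hε w (ε * P.pos e + x, t) →
      gelfand hε w (ε * P.pos e + x, t) = (gelfandConst ε : ℂ) * ∑ k ∈ s, w (ε * k + (ε * P.pos e + x)) *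
        exp (I * ((-(t * ((ε * P.pos e + x) + ε * k)) : ℝ) : ℂ)) →
      (∀ k : ℤ, w (ε * k + (ε * P.pos e + x)) = a k) →
      exp (I * (t * (ε * P.pos e + x) : ℝ)) *
        fibre (volume.restrict (Ioo 0 ε)) (gelfand hε w) t (ε * P.pos e + x) = ∑ k ∈ s, ω k * a k := by
    intro w e a x k1 k2 k3
    rw [k1, k2]
    simp only [k3, Finset.mul_sum]
    refine Finset.sum_congr rfl fun k _ => ?_
    have : exp (I * (t * (ε * P.pos e + x) : ℝ)) * exp (I * ((-(t * ((ε * P.pos e + x) + ε * k)) : ℝ) : ℂ)) =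
        exp (I * ((-(t * (ε * k)) : ℝ) : ℂ)) := by
      rw [← exp_add]
      congr 1
      push_cast
      ring
    simp only [hω]
    rw [← this]
    ring
  have hsum : ∀ (a : ℤ → ℂ) (_ : ∀ k ∉ s, a k = 0) (m : ℤ),
      exp (I * ((-(ε * t * m) : ℝ) : ℂ)) * ∑ k ∈ s, ω k * a k = ∑' j, ω j * a (j - m) := by
    intro a ha m
    rw [← (Equiv.addRight m).tsum_eq, tsum_eq_sum (s := s), Finset.mul_sum]
    · refine Finset.sum_congr rfl fun k _ => ?_
      rw [← mul_assoc, hωs]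
      simp
    · intro k hk
      simp [ha k hk]
  refine ⟨fun e x => ∑ k ∈ s, ω k * ψ (k, e) x, fun e x => ∑ k ∈ s, ω k * ψ' (k, e) x,
    fun e x => ∑ k ∈ s, ω k * ψ'' (k, e) x, fun e => ?_, fun e => ?_, fun e => ?_, ?_, fun v => ?_⟩
  · exact IsW22.sum s fun k _ => (hd.w22 (k, e)).const_mul (ω k)
  · filter_upwards [hT.ae_edge f1 e, hT.ae_edge g1 e, ae_all_iff.2 fun k => e1 k e] with x k1 k2 k3
    exact hgel k1 k2 k3
  · filter_upwards [hT.ae_edge f2 e, hT.ae_edge g2 e, ae_all_iff.2 fun k => e2 k e] with x k1 k2 k3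
    refine (hgel k1 k2 k3).trans ?_
    rw [Finset.mul_sum]
    exact Finset.sum_congr rfl fun k _ => mul_left_comm _ _ _
  · intro e b e' b' hv
    have l1 := hsum (fun k => ψ (k, e) ((P.twistGraph ε t).endPt e b)) (fun k hk => by simp [(hzs k hk e).1])
      (P.shift e b)
    have l2 := hsum (fun k => ψ (k, e') ((P.twistGraph ε t).endPt e' b')) (fun k hk => by simp [(hzs k hk e').1])
      (P.shift e' b')
    refine l1.trans (Eq.trans ?_ l2.symm)
    refine tsum_congr fun j => congrArg _ ?_
    have := hd.cont (j - P.shift e b, e) b (j - P.shift e' b', e') b' (by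
      have hv' : P.vert e b = P.vert e' b' := hv
      simp only [perGraph, sub_add_cancel, hv'])
    simpa [perGraph, MetricGraph.endPt, twistGraph] using this
  · have l1 : ∀ p : {p : Fin n × Fin 2 // (P.twistGraph ε t).vert p.1 p.2 = v},
        (P.twistGraph ε t).wt p.1.1 p.1.2 * (P.twistGraph ε t).coDeriv (fun e x => ∑ k ∈ s, ω k * ψ' (k, e) x)
          p.1.1 p.1.2 = ∑' j, ω j * (P.perGraph ε).coDeriv ψ' (j - P.shift p.1.1 p.1.2, p.1.1) p.1.2 := by
      rintro ⟨⟨e, b⟩, hp⟩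
      rw [← hsum (fun k => (P.perGraph ε).coDeriv ψ' (k, e) b) (fun k hk => by
        simp [MetricGraph.coDeriv, (hzs k hk e).2.1]) (P.shift e b)]
      refine congrArg₂ (· * ·) rfl ?_
      simp only [MetricGraph.coDeriv, Finset.mul_sum]
      refine Finset.sum_congr rfl fun k _ => ?_
      exact mul_left_comm _ _ _
    rw [finsum_congr l1, finsum_eq_sum_of_fintype, ← Summable.tsum_finsetSum]
    · refine (tsum_congr fun j => ?_).trans tsum_zero
      rw [← Finset.mul_sum]
      refine mul_eq_zero_of_right _ ?_
      have k1 := hd.kirchhoff (j, v)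
      rw [← finsum_eq_sum_of_fintype, ← k1]
      refine finsum_eq_of_bijective (fun p => ⟨((j - P.shift p.1.1 p.1.2, p.1.1), p.1.2), ?_⟩) ⟨?_, ?_⟩ fun p => ?_
      · have := p.2
        simp only [perGraph, sub_add_cancel]
        exact Prod.ext rfl this
      · rintro ⟨⟨e, b⟩, hp⟩ ⟨⟨e', b'⟩, hp'⟩ hpp
        simp only [Subtype.mk.injEq, Prod.mk.injEq] at hpp
        obtain ⟨⟨_, rfl⟩, rfl⟩ := hpp
        rfl
      · rintro ⟨⟨⟨k, e⟩, b⟩, hp⟩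
        have h1 : k + P.shift e b = j := congrArg Prod.fst hp
        have h2 : P.vert e b = v := congrArg Prod.snd hp
        refine ⟨⟨(e, b), h2⟩, ?_⟩
        simp only [Subtype.mk.injEq, Prod.mk.injEq, and_true]
        omega
      · simp [perGraph]
    · rintro ⟨⟨e, b⟩, hp⟩ _
      refine summable_of_finite_support ((s.finite_toSet.image fun k => k + P.shift e b).subset fun j hj => ?_)
      refine ⟨j - P.shift e b, ?_, by simp⟩
      by_contra hk
      refine hj ?_
      simp [MetricGraph.coDeriv, (hzs _ hk e).2.1]

/-- The Gelfand transform decomposes the resolvent of the periodic graph. -/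
theorem WellFormed.isDirectIntegral_resolvent (h : P.WellFormed) (hε : 0 < ε) {z : ℂ}
    {R : L2Line →L[ℂ] L2Line} (hR : IsResolvent (P.perOp ε) z R) {T : ℝ → L2Cell ε →L[ℂ] L2Cell ε}
    (hT : ∀ t ∈ Ico (-(Real.pi / ε)) (Real.pi / ε), IsResolvent (P.fibreOp ε t) z (T t)) :
    IsDirectIntegral ((gelfand hε : L2Line →L[ℂ] L2Fibred ε) ∘L R ∘L
      ((gelfand hε).symm : L2Fibred ε →L[ℂ] L2Line)) T := by
  have hTi := h.tiles_perGraph hε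
  have hRe := h.regular_perGraph hε
  let S : Set L2Line := {f | ∃ (v g : L2Line) (ψ ψ' ψ'' : ℤ × Fin n → ℝ → ℂ) (S : Set (ℤ × Fin n)),
    (P.perGraph ε).OpData v g ψ ψ' ψ'' ∧ S.Finite ∧ (∀ e ∉ S, ψ e = 0 ∧ ψ' e = 0 ∧ ψ'' e = 0) ∧ f = g - z • v}
  have hS : Dense S := by
    refine Metric.dense_iff.2 fun f r hr => ?_
    have hop : P.perOp ε (R f) (f + z • R f) := (hR f (R f)).2 rfl
    obtain ⟨φ, φ', φ'', hd⟩ := (MetricGraph.isOp_zero_iff _ _ _).1 hop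
    have hη : 0 < r / (2 * (1 + ‖z‖)) := by positivity
    obtain ⟨v, g, ψ, ψ', ψ'', s, h1, h2, h3, h4, h5⟩ := hd.exists_finite_approx hTi hRe hη
    refine ⟨g - z • v, ?_, v, g, ψ, ψ', ψ'', s, h1, h2, h3, rfl⟩
    rw [Metric.mem_ball, dist_eq_norm]
    have e : g - z • v - f = (g - (f + z • R f)) - z • (v - R f) := by module
    rw [e]
    refine (norm_sub_le _ _).trans_lt ?_
    rw [norm_smul]
    have h6 := mul_le_mul_of_nonneg_left h4 (norm_nonneg z)
    have h7 : r / (2 * (1 + ‖z‖)) + ‖z‖ * (r / (2 * (1 + ‖z‖))) = r / 2 := by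
      field_simp
    linarith
  refine isDirectIntegral_of_dense
    ((gelfand hε).surjective.denseRange.dense_image (gelfand hε).continuous hS) ?_
  rintro _ ⟨f, ⟨v, g, ψ, ψ', ψ'', s, h1, h2, h3, rfl⟩, rfl⟩
  simp only [ContinuousLinearMap.comp_apply]
  have e1 : (((gelfand hε).symm : L2Fibred ε →L[ℂ] L2Line)) (gelfand hε (g - z • v)) = g - z • v :=
    (gelfand hε).symm_apply_apply _
  have e2 : R (g - z • v) = v := by
    symm
    rw [← hR]
    have : g - z • v + z • v = g := by module
    rw [this]
    exact (MetricGraph.isOp_zero_iff _ _ _).2 ⟨_, _, _, h1⟩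
  rw [e1, e2, map_sub, map_smul]
  filter_upwards [h.fibreOp_gelfand hε h1 h2 h3, fibre_sub (gelfand hε g) (z • gelfand hε v),
    fibre_smul z (gelfand hε v), ae_restrict_mem measurableSet_Ioo] with t k1 k2 k3 k4
  rw [k2, k3]
  refine (hT t ⟨k4.1.le, k4.2⟩ _ _).1 ?_
  exact (congrArg (P.fibreOp ε t _) (sub_add_cancel _ _)).mpr k1

theorem WellFormed.stiffCompressionIsDirectIntegral (h : P.WellFormed) :
    P.StiffCompressionIsDirectIntegral := by
  intro ε hε
  refine ⟨gelfand hε, isGelfand_gelfand hε, fun z hz => ?_⟩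
  obtain ⟨R, hR⟩ := MetricGraph.exists_isResolvent (h.tiles_perGraph hε) (h.regular_perGraph hε) hz
  choose T hT using fun t => h.exists_isResolvent_fibreOp hε t hz
  have d1 := h.isDirectIntegral_stiffProj hε
  have d2 := h.isDirectIntegral_resolvent hε hR fun t _ => hT t
  refine ⟨_, R, ⟨T, fun t _ => hT t, d1.comp (d2.comp d1)⟩, hR, fun F => ?_⟩
  simp

end Composite

/-! ### Fourier multipliers -/

section Mul

variable {m : ℝ → ℂ} {B : ℝ}

theorem memLp_bounded_mul (hm : Measurable m) (hB : ∀ x, ‖m x‖ ≤ B) (f : L2Line) :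
    MemLp (fun x => m x * f x) 2 volume :=
  (Lp.memLp f).of_le_mul (hm.aestronglyMeasurable.mul (Lp.memLp f).1)
    (Filter.Eventually.of_forall fun x => by
      rw [norm_mul]
      exact mul_le_mul_of_nonneg_right (hB x) (norm_nonneg _))

theorem norm_bounded_mul_le (hm : Measurable m) (hB : ∀ x, ‖m x‖ ≤ B) (f : L2Line) :
    ‖(memLp_bounded_mul hm hB f).toLp‖ ≤ B * ‖f‖ := by
  have hB0 : 0 ≤ B := (norm_nonneg _).trans (hB 0)
  refine (sq_le_sq₀ (norm_nonneg _) (by positivity)).1 ?_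
  rw [norm_toLp_sq, mul_pow, norm_Lp_sq f, ← integral_const_mul]
  refine integral_mono (integrable_norm_sq (memLp_bounded_mul hm hB f))
    ((integrable_norm_sq (Lp.memLp f)).const_mul _) fun x => ?_
  simp only [norm_mul, mul_pow]
  exact mul_le_mul_of_nonneg_right (pow_le_pow_left₀ (norm_nonneg _) (hB x) 2) (by positivity)

/-- Multiplication by a bounded measurable function. -/
def mulLp (hm : Measurable m) (hB : ∀ x, ‖m x‖ ≤ B) : L2Line →L[ℂ] L2Line :=
  LinearMap.mkContinuous
    { toFun := fun f => (memLp_bounded_mul hm hB f).toLp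
      map_add' := fun f g => by
        rw [← MemLp.toLp_add]
        refine MemLp.toLp_congr _ _ ?_
        filter_upwards [Lp.coeFn_add f g] with x hx
        rw [hx]
        simp [mul_add]
      map_smul' := fun c f => by
        rw [RingHom.id_apply, ← MemLp.toLp_const_smul]
        refine MemLp.toLp_congr _ _ ?_
        filter_upwards [Lp.coeFn_smul c f] with x hx
        rw [hx]
        simp only [Pi.smul_apply, smul_eq_mul]
        ring }
    B (norm_bounded_mul_le hm hB)

theorem mulLp_apply (hm : Measurable m) (hB : ∀ x, ‖m x‖ ≤ B) (f : L2Line) :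
    mulLp hm hB f =ᵐ[volume] fun x => m x * f x := (memLp_bounded_mul hm hB f).coeFn_toLp

theorem exists_isFourierMultiplier (hm : Measurable m) (hB : ∀ x, ‖m x‖ ≤ B) :
    ∃ M : L2Line →L[ℂ] L2Line, IsFourierMultiplier m M := by
  have hm' : Measurable fun s => m (2 * Real.pi * s) := hm.comp (by fun_prop)
  have hB' : ∀ s, ‖m (2 * Real.pi * s)‖ ≤ B := fun s => hB _
  refine ⟨((Lp.fourierTransformₗᵢ ℝ ℂ).symm : L2Line →L[ℂ] L2Line) ∘L mulLp hm' hB' ∘L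
    (Lp.fourierTransformₗᵢ ℝ ℂ : L2Line →L[ℂ] L2Line), fun F => ?_⟩
  have h : (𝓕 (((Lp.fourierTransformₗᵢ ℝ ℂ).symm : L2Line →L[ℂ] L2Line) (mulLp hm' hB'
      ((Lp.fourierTransformₗᵢ ℝ ℂ : L2Line →L[ℂ] L2Line) F))) : L2Line) = mulLp hm' hB' (𝓕 F) :=
    (Lp.fourierTransformₗᵢ ℝ ℂ).apply_symm_apply _
  simp only [ContinuousLinearMap.comp_apply]
  rw [h]
  exact mulLp_apply hm' hB' _

theorem norm_le_of_fourier {F H : L2Line} (hB0 : 0 ≤ B)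
    (h : ∀ᵐ s : ℝ, ‖(𝓕 H : L2Line) s‖ ≤ B * ‖(𝓕 F : L2Line) s‖) : ‖H‖ ≤ B * ‖F‖ := by
  rw [← Lp.norm_fourier_eq H, ← Lp.norm_fourier_eq F]
  refine (sq_le_sq₀ (norm_nonneg _) (by positivity)).1 ?_
  rw [norm_Lp_sq, mul_pow, norm_Lp_sq, ← integral_const_mul]
  refine integral_mono_ae (integrable_norm_sq (Lp.memLp _))
    ((integrable_norm_sq (Lp.memLp _)).const_mul _) ?_
  filter_upwards [h] with x hx
  rw [← mul_pow]
  exact pow_le_pow_left₀ (norm_nonneg _) hx 2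

end Mul

/-! ### The Gelfand transform of a Fourier multiplier -/

section

variable {ε : ℝ}

/-- The normalized constant function. -/
def cellConst (ε : ℝ) : L2Cell ε :=
  (memLp_const (((Real.sqrt ε)⁻¹ : ℝ) : ℂ) : MemLp (fun _ : ℝ => (((Real.sqrt ε)⁻¹ : ℝ) : ℂ)) 2
    (volume.restrict (Ioo (0 : ℝ) ε))).toLp

theorem cellConst_apply (ε : ℝ) :
    cellConst ε =ᵐ[volume.restrict (Ioo 0 ε)] fun _ => (((Real.sqrt ε)⁻¹ : ℝ) : ℂ) := MemLp.coeFn_toLp _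

theorem norm_cellConst (hε : 0 < ε) : ‖cellConst ε‖ = 1 := by
  have h : ‖cellConst ε‖ ^ 2 = _ := norm_toLp_sq (memLp_const (((Real.sqrt ε)⁻¹ : ℝ) : ℂ))
  rw [integral_const, norm_real, Real.norm_eq_abs, sq_abs, measureReal_restrict_apply MeasurableSet.univ,
    univ_inter, Real.volume_real_Ioo_of_le hε.le, inv_pow, Real.sq_sqrt hε.le, sub_zero, smul_eq_mul,
    mul_inv_cancel₀ hε.ne'] at h
  exact (pow_eq_one_iff_of_nonneg (norm_nonneg _) two_ne_zero).1 h

theorem quasiMeasurePreserving_mul_left {a : ℝ} (ha : a ≠ 0) :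
    Measure.QuasiMeasurePreserving (fun x : ℝ => a * x) volume volume :=
  ⟨by fun_prop, by rw [Real.map_volume_mul_left ha]; exact Measure.smul_absolutelyContinuous⟩

theorem inner_cellConst_fibre_aux (hε : 0 < ε) {F : L2Line} {f : ℝ → ℂ} (hF : F =ᵐ[volume] f)
    (hc : HasCompactSupport f) (hf : ContDiff ℝ (↑(⊤ : ℕ∞)) f) : ∀ᵐ t ∂(quasiMeasure ε),
    inner ℂ (cellConst ε) (fibre (volume.restrict (Ioo 0 ε)) (gelfand hε F) t) =
      (((Real.sqrt (2 * Real.pi))⁻¹ : ℝ) : ℂ) * (𝓕 F : L2Line) ((2 * Real.pi)⁻¹ * t) := by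
  set φ := hc.toSchwartzMap hf with hφ
  have hFφ : F = φ.toLp 2 := Lp.ext (hF.trans (φ.coeFn_toLp 2).symm)
  have h1 : (𝓕 F : L2Line) =ᵐ[volume] 𝓕 f := by
    rw [hFφ, SchwartzMap.toLp_fourier_eq]
    exact ((𝓕 φ).coeFn_toLp 2)
  have h2 : ∀ᵐ t ∂(quasiMeasure ε), (𝓕 F : L2Line) ((2 * Real.pi)⁻¹ * t) = 𝓕 f ((2 * Real.pi)⁻¹ * t) :=
    ae_restrict_of_ae ((quasiMeasurePreserving_mul_left (by positivity)).ae h1)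
  obtain ⟨r, hr⟩ := hc.isCompact.isBounded.exists_norm_le
  have hsupp : ∀ᵐ x : ℝ, r < |x| → F x = 0 := by
    filter_upwards [hF] with x hx hrx
    rw [hx]
    by_contra hne
    exact absurd (hr x (subset_tsupport f hne)) (not_le.2 hrx)
  obtain ⟨s, hs⟩ := exists_finset_cells hε hsupp
  have hint : Integrable f := hf.continuous.integrable_of_hasCompactSupport hc
  filter_upwards [h2, ae_ae_of_ae_prod_swap (gelfand_apply hε (s := s) fun k hk => cellPart_eq_zero hε (hs k hk)),
    coeFn_fibre (Lp.memLp (gelfand hε F))] with t k1 k2 k3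
  rw [k1, inner_Lp]
  have hintt : Integrable fun x : ℝ => exp (-(I * (t * x))) * F x := by
    refine (hint.congr hF.symm).bdd_mul (c := 1) (by fun_prop) (Filter.Eventually.of_forall fun x => ?_)
    have := norm_exp_I_mul (-(t * x))
    refine le_of_eq (Eq.trans ?_ this)
    congr 2
    push_cast
    ring
  have e1 : ∀ᵐ y ∂(volume.restrict (Ioo 0 ε)), (starRingEnd ℂ) (cellConst ε y) *
      fibre (volume.restrict (Ioo 0 ε)) (gelfand hε F) t y =
      (((Real.sqrt (2 * Real.pi))⁻¹ : ℝ) : ℂ) * ∑ k ∈ s, exp (-(I * (t * (ε * k + y : ℝ)))) * F (ε * k + y) := by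
    filter_upwards [cellConst_apply ε, k2, k3] with y j1 j2 j3
    rw [j1, j3, j2, conj_ofReal, ← mul_assoc]
    congr 1
    · rw [← ofReal_mul, gelfandConst, Real.sqrt_div hε.le]
      have := (Real.sqrt_pos.2 hε).ne'
      congr 1
      field_simp
    · refine Finset.sum_congr rfl fun k _ => ?_
      rw [mul_comm]
      congr 2
      push_cast
      ring
  rw [integral_congr_ae e1, integral_const_mul]
  congr 1
  rw [Real.fourier_real_eq_integral_exp_smul, integral_finsetSum]
  · have h5 := (tiles_cellLine hε).hasSum_integral hintt
    have h6 : ∀ k ∉ s, ∫ x in Ioo 0 ε, exp (-(I * (t * (ε * k + x : ℝ)))) * F (ε * k + x) = 0 := by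
      intro k hk
      refine integral_eq_zero_of_ae ?_
      filter_upwards [hs k hk] with x hx
      rw [hx, mul_zero]; rfl
    have h7 := (hasSum_sum_of_ne_finset_zero h6).unique h5
    rw [h7]
    refine integral_congr_ae ?_
    filter_upwards [hF] with x hx
    rw [hx, smul_eq_mul]
    congr 2
    have := Real.pi_pos.ne'
    have hp : (Real.pi : ℂ) ≠ 0 := by exact_mod_cast this
    push_cast
    field_simp
  · intro k _
    have hr := hintt.restrict (s := (cellLine ε).seg k)
    exact (((tiles_cellLine hε).measurePreserving k).integrable_comp hr.aestronglyMeasurable).2 hr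

/-- The mean value of the fibre of the Gelfand transform is the Fourier transform. -/
theorem inner_cellConst_fibre (hε : 0 < ε) (F : L2Line) : ∀ᵐ t ∂(quasiMeasure ε),
    inner ℂ (cellConst ε) (fibre (volume.restrict (Ioo 0 ε)) (gelfand hε F) t) =
      (((Real.sqrt (2 * Real.pi))⁻¹ : ℝ) : ℂ) * (𝓕 F : L2Line) ((2 * Real.pi)⁻¹ * t) := by
  have hd := Lp.dense_hasCompactSupport_contDiff (E := ℝ) (F := ℂ) (μ := volume) (p := 2) (by norm_num)
  have hap : ∀ n : ℕ, ∃ G : L2Line, (∃ g : ℝ → ℂ, G =ᵐ[volume] g ∧ HasCompactSupport g ∧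
      ContDiff ℝ (↑(⊤ : ℕ∞)) g) ∧ ‖G - F‖ ≤ (1 / 2) ^ n := by
    intro n
    obtain ⟨G, hG, hGS⟩ := Metric.dense_iff.1 hd F ((1 / 2) ^ n) (by positivity)
    rw [Metric.mem_ball, dist_eq_norm] at hG
    exact ⟨G, hGS, hG.le⟩
  choose G hG hGF using hap
  have h1 := tendsto_fibre (f := gelfand hε F) (F := fun n => gelfand hε (G n)) fun n => by
    rw [← map_sub, LinearIsometryEquiv.norm_map]; exact hGF n
  have h2 : ∀ᵐ t ∂(quasiMeasure ε), ∀ n, inner ℂ (cellConst ε)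
      (fibre (volume.restrict (Ioo 0 ε)) (gelfand hε (G n)) t) =
      (((Real.sqrt (2 * Real.pi))⁻¹ : ℝ) : ℂ) * (𝓕 (G n) : L2Line) ((2 * Real.pi)⁻¹ * t) :=
    ae_all_iff.2 fun n => by
      obtain ⟨g, h1, h2, h3⟩ := hG n
      exact inner_cellConst_fibre_aux hε h1 h2 h3
  have h3 : Filter.Tendsto G Filter.atTop (nhds F) := by
    rw [tendsto_iff_norm_sub_tendsto_zero]
    exact squeeze_zero (fun _ => norm_nonneg _) hGF
      (tendsto_pow_atTop_nhds_zero_of_lt_one (by norm_num) (by norm_num))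
  have h4 : Filter.Tendsto (fun n => (𝓕 (G n) : L2Line)) Filter.atTop (nhds (𝓕 F)) :=
    ((Lp.fourierTransformₗᵢ ℝ ℂ).continuous.tendsto F).comp h3
  obtain ⟨ns, hns, hconv⟩ := (tendstoInMeasure_of_tendsto_Lp h4).exists_seq_tendsto_ae
  have h5 := ae_restrict_of_ae (s := Ioo (-(Real.pi / ε)) (Real.pi / ε))
    ((quasiMeasurePreserving_mul_left (a := (2 * Real.pi)⁻¹) (by positivity)).ae hconv)
  filter_upwards [h1, h2, h5] with t k1 k2 k3
  have j1 : Filter.Tendsto (fun i => inner ℂ (cellConst ε)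
      (fibre (volume.restrict (Ioo 0 ε)) (gelfand hε (G (ns i))) t)) Filter.atTop (nhds
      (inner ℂ (cellConst ε) (fibre (volume.restrict (Ioo 0 ε)) (gelfand hε F) t))) :=
    ((innerSL ℂ (cellConst ε)).continuous.tendsto _).comp (k1.comp hns.tendsto_atTop)
  simp only [k2] at j1
  exact tendsto_nhds_unique j1 (k3.const_mul _)

theorem eq_inner_smul_of_norm_sq {H : Type} [NormedAddCommGroup H] [InnerProductSpace ℂ H] {c x : H}
    (hc : ‖c‖ = 1) : ‖x - (inner ℂ c x : ℂ) • c‖ ^ 2 = ‖x‖ ^ 2 - ‖(inner ℂ c x : ℂ)‖ ^ 2 := by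
  rw [@norm_sub_sq ℂ, inner_smul_right, norm_smul, hc, mul_one]
  have : inner ℂ x c = (starRingEnd ℂ) (inner ℂ c x) := (inner_conj_symm x c).symm
  rw [this]
  have h2 : RCLike.re ((inner ℂ c x : ℂ) * (starRingEnd ℂ) (inner ℂ c x)) = ‖(inner ℂ c x : ℂ)‖ ^ 2 := by
    rw [RCLike.mul_conj]
    norm_cast
  rw [h2]
  ring

/-- Functions whose Fourier transform vanishes outside `(-π/ε, π/ε)` have constant fibres. -/
theorem fibre_gelfand_of_band (hε : 0 < ε) {F : L2Line}
    (hF : ∀ᵐ s : ℝ, 2 * Real.pi * s ∉ Ioo (-(Real.pi / ε)) (Real.pi / ε) → (𝓕 F : L2Line) s = 0) :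
    ∀ᵐ t ∂(quasiMeasure ε), fibre (volume.restrict (Ioo 0 ε)) (gelfand hε F) t =
      (inner ℂ (cellConst ε) (fibre (volume.restrict (Ioo 0 ε)) (gelfand hε F) t) : ℂ) • cellConst ε := by
  set μ := volume.restrict (Ioo (0 : ℝ) ε)
  have hp := Real.pi_pos
  have i1 := integrable_norm_fibre_sq (ν := quasiMeasure ε) (Lp.memLp (gelfand hε F))
  have h1 : ∫ t, ‖fibre μ (gelfand hε F) t‖ ^ 2 ∂(quasiMeasure ε) = ‖F‖ ^ 2 := by
    rw [← norm_sq_eq_integral_fibre, LinearIsometryEquiv.norm_map]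
  set J := Ioo (-(Real.pi / ε)) (Real.pi / ε)
  let g : ℝ → ℝ := J.indicator fun t => ‖(((Real.sqrt (2 * Real.pi))⁻¹ : ℝ) : ℂ) *
    (𝓕 F : L2Line) ((2 * Real.pi)⁻¹ * t)‖ ^ 2
  have hg : (fun s => g (2 * Real.pi * s)) =ᵐ[volume] fun s => (2 * Real.pi)⁻¹ * ‖(𝓕 F : L2Line) s‖ ^ 2 := by
    filter_upwards [hF] with s hs
    by_cases h : 2 * Real.pi * s ∈ J
    · simp only [g, indicator_of_mem h]
      rw [norm_mul, mul_pow, norm_real, Real.norm_eq_abs, sq_abs, inv_pow, Real.sq_sqrt (by positivity)]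
      congr 4
      field_simp
    · simp only [g, indicator_of_notMem h, hs h]
      simp
  have h2 : ∫ t, ‖(inner ℂ (cellConst ε) (fibre μ (gelfand hε F) t) : ℂ)‖ ^ 2 ∂(quasiMeasure ε) = ‖F‖ ^ 2 := by
    have e1 : ∫ t, ‖(inner ℂ (cellConst ε) (fibre μ (gelfand hε F) t) : ℂ)‖ ^ 2 ∂(quasiMeasure ε) = ∫ t, g t := by
      rw [integral_indicator measurableSet_Ioo]
      refine integral_congr_ae ?_
      filter_upwards [inner_cellConst_fibre hε F] with t ht
      rw [ht]
    have e2 := Measure.integral_comp_mul_left g (2 * Real.pi)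
    rw [integral_congr_ae hg, integral_const_mul, ← norm_Lp_sq, Lp.norm_fourier_eq, smul_eq_mul,
      abs_of_pos (by positivity)] at e2
    rw [e1]
    exact (mul_left_cancel₀ (by positivity) e2).symm
  have i2 : Integrable (fun t => ‖(inner ℂ (cellConst ε) (fibre μ (gelfand hε F) t) : ℂ)‖ ^ 2) (quasiMeasure ε) := by
    have hgi : Integrable g := by
      rw [← integrable_comp_mul_left_iff g (R := 2 * Real.pi) (by positivity)]
      exact ((integrable_norm_sq (Lp.memLp (𝓕 F : L2Line))).const_mul _).congr hg.symm
    refine ((integrable_indicator_iff measurableSet_Ioo).1 hgi).congr ?_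
    filter_upwards [inner_cellConst_fibre hε F] with t ht
    rw [ht]
  have h3 : ∫ t, ‖fibre μ (gelfand hε F) t - (inner ℂ (cellConst ε) (fibre μ (gelfand hε F) t) : ℂ) • cellConst ε‖ ^ 2
      ∂(quasiMeasure ε) = 0 := by
    simp only [eq_inner_smul_of_norm_sq (norm_cellConst hε)]
    rw [integral_sub i1 i2, h1, h2, sub_self]
  rw [integral_eq_zero_iff_of_nonneg (fun _ => by positivity)] at h3
  · filter_upwards [h3] with t ht
    have : ‖fibre μ (gelfand hε F) t - (inner ℂ (cellConst ε) (fibre μ (gelfand hε F) t) : ℂ) • cellConst ε‖ ^ 2 = 0 := ht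
    exact sub_eq_zero.1 (norm_eq_zero.1 (pow_eq_zero_iff two_ne_zero |>.1 this))
  · simp only [eq_inner_smul_of_norm_sq (norm_cellConst hε)]
    exact i1.sub i2

/-- The operator `f ↦ a ⟨c, f⟩ c`. -/
def rankOneOp {H : Type} [NormedAddCommGroup H] [InnerProductSpace ℂ H] (a : ℂ) (c : H) : H →L[ℂ] H :=
  a • (innerSL ℂ c).smulRight c

theorem rankOneOp_apply {H : Type} [NormedAddCommGroup H] [InnerProductSpace ℂ H] (a : ℂ) (c x : H) :
    rankOneOp a c x = (a * inner ℂ c x) • c := by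
  simp [rankOneOp, smul_smul]

theorem isDirectIntegral_multiplier (hε : 0 < ε) {m : ℝ → ℂ} {M : L2Line →L[ℂ] L2Line}
    (hM : IsFourierMultiplier m M) (hm : ∀ t ∉ Ico (-(Real.pi / ε)) (Real.pi / ε), m t = 0) :
    IsDirectIntegral ((gelfand hε : L2Line →L[ℂ] L2Fibred ε) ∘L M ∘L
      ((gelfand hε).symm : L2Fibred ε →L[ℂ] L2Line)) fun t => rankOneOp (m t) (cellConst ε) := by
  rw [isDirectIntegral_iff]
  intro f
  obtain ⟨F, rfl⟩ := (gelfand hε).surjective f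
  have e1 : ((gelfand hε : L2Line →L[ℂ] L2Fibred ε) ∘L M ∘L
      ((gelfand hε).symm : L2Fibred ε →L[ℂ] L2Line)) (gelfand hε F) = gelfand hε (M F) := by simp
  rw [e1]
  have hp := Real.pi_pos
  have hband : ∀ᵐ s : ℝ, 2 * Real.pi * s ∉ Ioo (-(Real.pi / ε)) (Real.pi / ε) → (𝓕 (M F) : L2Line) s = 0 := by
    filter_upwards [hM F, (Set.countable_singleton (-(Real.pi / ε) / (2 * Real.pi))).ae_notMem volume] with s h1 h2 h3
    rw [h1, hm, zero_mul]
    intro h4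
    refine h3 ⟨lt_of_le_of_ne h4.1 fun h5 => h2 ?_, h4.2⟩
    rw [mem_singleton_iff, eq_div_iff (by positivity), h5]
    ring
  have hMF := ae_restrict_of_ae (s := Ioo (-(Real.pi / ε)) (Real.pi / ε))
    ((quasiMeasurePreserving_mul_left (a := (2 * Real.pi)⁻¹) (by positivity)).ae (hM F))
  filter_upwards [fibre_gelfand_of_band hε hband, inner_cellConst_fibre hε F, inner_cellConst_fibre hε (M F), hMF]
    with t k1 k2 k3 k4
  rw [k1, rankOneOp_apply, k3, k2, k4]
  congr 1
  have : 2 * Real.pi * ((2 * Real.pi)⁻¹ * t) = t := by field_simp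
  rw [this]
  ring

end

/-! ### Decomposable unitary operators -/

section

variable {ε : ℝ}

theorem IsDirectIntegral.symm {U : L2Fibred ε ≃ₗᵢ[ℂ] L2Fibred ε} {u : ℝ → L2Cell ε ≃ₗᵢ[ℂ] L2Cell ε}
    (h : IsDirectIntegral (U : L2Fibred ε →L[ℂ] L2Fibred ε) fun t => (u t : L2Cell ε →L[ℂ] L2Cell ε)) :
    IsDirectIntegral (U.symm : L2Fibred ε →L[ℂ] L2Fibred ε) fun t => ((u t).symm : L2Cell ε →L[ℂ] L2Cell ε) := by
  rw [isDirectIntegral_iff] at *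
  intro f
  filter_upwards [h (U.symm f)] with t ht
  have e : (U : L2Fibred ε →L[ℂ] L2Fibred ε) (U.symm f) = f := U.apply_symm_apply f
  rw [e] at ht
  rw [ht]
  exact ((u t).symm_apply_apply _).symm

theorem IsDirectIntegral.unique {D D' : L2Fibred ε →L[ℂ] L2Fibred ε} {T T' : ℝ → L2Cell ε →L[ℂ] L2Cell ε}
    (h : IsDirectIntegral D T) (h' : IsDirectIntegral D' T') (hT : ∀ t f, T t f = T' t f) (f : L2Fibred ε) :
    D f = D' f := by
  rw [isDirectIntegral_iff] at h h'
  refine ext_fibre ?_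
  filter_upwards [h f, h' f] with t h1 h2
  rw [h1, h2, hT]

theorem IsDirectIntegral.const_smul {D : L2Fibred ε →L[ℂ] L2Fibred ε} {T : ℝ → L2Cell ε →L[ℂ] L2Cell ε}
    (h : IsDirectIntegral D T) (c : ℂ) : IsDirectIntegral (c • D) fun t => c • T t := by
  rw [isDirectIntegral_iff] at *
  intro f
  filter_upwards [h f, fibre_smul c (D f)] with t h1 h2
  rw [ContinuousLinearMap.smul_apply, h2, h1]
  rfl

/-- Multiplication by `exp (ity)` on the fibred space. -/
def twist (ε : ℝ) : L2Fibred ε ≃ₗᵢ[ℂ] L2Fibred ε :=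
  phaseEquiv _ (θ := fun p : ℝ × ℝ => p.2 * p.1) (by fun_prop)

/-- Multiplication by `exp (ity)` on the cell. -/
def cellTwist (ε t : ℝ) : L2Cell ε ≃ₗᵢ[ℂ] L2Cell ε :=
  phaseEquiv _ (θ := fun y : ℝ => t * y) (by fun_prop)

theorem cellTwist_apply (ε t : ℝ) (f : L2Cell ε) :
    cellTwist ε t f =ᵐ[volume.restrict (Ioo 0 ε)] fun y => exp (I * (t * y : ℝ)) * f y :=
  phaseEquiv_apply _ _ _

theorem isDirectIntegral_twist (ε : ℝ) : IsDirectIntegral (twist ε : L2Fibred ε →L[ℂ] L2Fibred ε)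
    fun t => (cellTwist ε t : L2Cell ε →L[ℂ] L2Cell ε) := by
  rw [isDirectIntegral_iff]
  intro f
  have h0 : twist ε f =ᵐ[(volume.restrict (Ioo (0 : ℝ) ε)).prod (quasiMeasure ε)] _ :=
    phaseEquiv_apply _ (θ := fun p : ℝ × ℝ => p.2 * p.1) (by fun_prop) f
  filter_upwards [ae_ae_of_ae_prod_swap h0, coeFn_fibre (Lp.memLp f), coeFn_fibre (Lp.memLp (twist ε f))]
    with t h1 h2 h3
  refine Lp.ext ?_
  filter_upwards [h1, h2, h3, cellTwist_apply ε t (fibre (volume.restrict (Ioo 0 ε)) f t)] with y k1 k2 k3 k4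
  refine k3.trans (k1.trans (Eq.trans ?_ k4.symm))
  rw [k2]

theorem isHilbertSum_cellEmb_comp (hε : 0 < ε) (h : L2Cell ε ≃ₗᵢ[ℂ] L2Cell ε) :
    IsHilbertSum ℂ (fun _ : ℤ => L2Cell ε) fun k => (cellEmb hε k).comp h.toLinearIsometry := by
  refine IsHilbertSum.mk (fun j k hjk b c => (isHilbertSum_cellEmb hε).OrthogonalFamily hjk (h b) (h c)) (le_of_eq ?_)
  symm
  rw [Submodule.topologicalClosure_eq_top_iff, Submodule.eq_bot_iff]
  intro F hF
  rw [Submodule.mem_orthogonal] at hF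
  have h1 : ∀ k b, inner ℂ (cellEmb hε k b) F = 0 := by
    intro k b
    have := hF _ (Submodule.mem_iSup_of_mem k ⟨h.symm b, rfl⟩)
    simpa using this
  refine ext_cellPart hε fun k => ext_inner_left ℂ fun b => ?_
  rw [← inner_cellEmb, ← inner_cellEmb, h1, inner_zero_right]

/-- The operator which acts as `h` on each cell of the line. -/
def cellwise (hε : 0 < ε) (h : L2Cell ε ≃ₗᵢ[ℂ] L2Cell ε) : L2Line ≃ₗᵢ[ℂ] L2Line :=
  (isHilbertSum_cellEmb hε).linearIsometryEquiv.trans (isHilbertSum_cellEmb_comp hε h).linearIsometryEquiv.symm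

theorem cellwise_cellEmb (hε : 0 < ε) (h : L2Cell ε ≃ₗᵢ[ℂ] L2Cell ε) (k : ℤ) (b : L2Cell ε) :
    cellwise hε h (cellEmb hε k b) = cellEmb hε k (h b) := by
  classical
  have h1 := (isHilbertSum_cellEmb hε).linearIsometryEquiv_symm_apply_single (i := k) b
  have h2 := (isHilbertSum_cellEmb_comp hε h).linearIsometryEquiv_symm_apply_single (i := k) b
  rw [cellwise, LinearIsometryEquiv.trans_apply, ← h1, LinearIsometryEquiv.apply_symm_apply, h2]
  rfl

theorem cellPart_cellwise (hε : 0 < ε) (h : L2Cell ε ≃ₗᵢ[ℂ] L2Cell ε) (k : ℤ) (F : L2Line) :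
    cellPart hε k (cellwise hε h F) = h (cellPart hε k F) := by
  refine ext_inner_left ℂ fun b => ?_
  have e : cellEmb hε k b = cellwise hε h (cellEmb hε k (h.symm b)) := by
    rw [cellwise_cellEmb, LinearIsometryEquiv.apply_symm_apply]
  rw [← inner_cellEmb, e, LinearIsometryEquiv.inner_map_map, inner_cellEmb,
    ← LinearIsometryEquiv.inner_map_map h, LinearIsometryEquiv.apply_symm_apply]

theorem cellTwist_fibre_gelfand (hε : 0 < ε) {F : L2Line} {s : Finset ℤ} (hs : ∀ k ∉ s, cellPart hε k F = 0) :
    ∀ᵐ t ∂(quasiMeasure ε), cellTwist ε t (fibre (volume.restrict (Ioo 0 ε)) (gelfand hε F) t) =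
      ∑ k ∈ s, ((gelfandConst ε : ℂ) * exp (-(I * (t * (ε * k))))) • cellPart hε k F := by
  filter_upwards [ae_ae_of_ae_prod_swap (gelfand_apply hε hs), coeFn_fibre (Lp.memLp (gelfand hε F))] with t h1 h2
  refine Lp.ext ?_
  have h3 : ∀ᵐ y ∂(volume.restrict (Ioo 0 ε)), ∀ k : ℤ, (((gelfandConst ε : ℂ) * exp (-(I * (t * (ε * k))))) •
      cellPart hε k F : L2Cell ε) y = ((gelfandConst ε : ℂ) * exp (-(I * (t * (ε * k))))) * F (ε * k + y) := by
    refine ae_all_iff.2 fun k => ?_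
    filter_upwards [Lp.coeFn_smul ((gelfandConst ε : ℂ) * exp (-(I * (t * (ε * k))))) (cellPart hε k F),
      cellPart_apply hε k F] with y k1 k2
    rw [k1, Pi.smul_apply, k2, smul_eq_mul]
  filter_upwards [h1, h2, h3, cellTwist_apply ε t (fibre (volume.restrict (Ioo 0 ε)) (gelfand hε F) t),
    Lp.coeFn_finsetSum (p := 2) (μ := volume.restrict (Ioo 0 ε)) s fun k : ℤ =>
      ((gelfandConst ε : ℂ) * exp (-(I * (t * (ε * k))))) • cellPart hε k F] with y k1 k2 k3 k4 k5
  rw [k4, k5, Finset.sum_apply, k2, k1, Finset.mul_sum, Finset.mul_sum]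
  refine Finset.sum_congr rfl fun k _ => ?_
  rw [k3]
  have : exp (-(I * (t * (ε * k)))) = exp (I * (t * y : ℝ)) * exp (I * ((-(t * (y + ε * k)) : ℝ) : ℂ)) := by
    rw [← exp_add]
    congr 1
    push_cast
    ring
  rw [this]
  ring

/-- The operator on the fibred space which acts as `h` in every fibre. -/
def fibrewise (hε : 0 < ε) (h : L2Cell ε ≃ₗᵢ[ℂ] L2Cell ε) : L2Fibred ε ≃ₗᵢ[ℂ] L2Fibred ε :=
  ((gelfand hε).trans (twist ε)).symm.trans ((cellwise hε h).trans ((gelfand hε).trans (twist ε)))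

theorem isDirectIntegral_fibrewise (hε : 0 < ε) (h : L2Cell ε ≃ₗᵢ[ℂ] L2Cell ε) :
    IsDirectIntegral (fibrewise hε h : L2Fibred ε →L[ℂ] L2Fibred ε) fun _ => (h : L2Cell ε →L[ℂ] L2Cell ε) := by
  let G := (gelfand hε).trans (twist ε)
  refine isDirectIntegral_of_dense (G.surjective.denseRange.dense_image G.continuous (dense_finite_cells hε)) ?_
  rintro _ ⟨F, ⟨s, hs⟩, rfl⟩
  have e : (fibrewise hε h : L2Fibred ε →L[ℂ] L2Fibred ε) (G F) = G (cellwise hε h F) := by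
    change G (cellwise hε h (G.symm (G F))) = _
    rw [LinearIsometryEquiv.symm_apply_apply]
  rw [e]
  have hs' : ∀ k ∉ s, cellPart hε k (cellwise hε h F) = 0 := fun k hk => by
    rw [cellPart_cellwise, hs k hk, map_zero]
  have ht := isDirectIntegral_iff.1 (isDirectIntegral_twist ε)
  filter_upwards [cellTwist_fibre_gelfand hε hs, cellTwist_fibre_gelfand hε hs', ht (gelfand hε F),
    ht (gelfand hε (cellwise hε h F))] with t h1 h2 h3 h4
  refine (h4.trans h2).trans ?_
  have h5 := congrArg h (h3.trans h1)
  refine Eq.trans ?_ h5.symm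
  rw [map_sum]
  refine Finset.sum_congr rfl fun k _ => ?_
  rw [map_smul, cellPart_cellwise]

theorem exists_unitary_swap {H : Type} [NormedAddCommGroup H] [InnerProductSpace ℂ H] {v w : H}
    (hv : ‖v‖ = ‖w‖) (hvw : (inner ℂ v w : ℂ).im = 0) : ∃ h : H ≃ₗᵢ[ℂ] H, h v = w := by
  let K : Submodule ℂ H := ℂ ∙ (v - w)
  refine ⟨Kᗮ.reflection, ?_⟩
  have hsym : inner ℂ w v = inner ℂ v w := by
    rw [← inner_conj_symm, Complex.conj_eq_iff_im]; exact hvw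
  have h1 : v + w ∈ Kᗮ := by
    rw [Submodule.mem_orthogonal_singleton_iff_inner_right, inner_add_right, inner_sub_left, inner_sub_left,
      hsym, inner_self_eq_norm_sq_to_K, inner_self_eq_norm_sq_to_K, hv]
    ring
  have h2 := Submodule.reflection_mem_subspace_eq_self (K := Kᗮ) h1
  have h3 := Submodule.reflection_mem_subspace_orthogonal_precomplement_eq_neg (K := K)
    (Submodule.mem_span_singleton_self (v - w))
  rw [map_add] at h2
  rw [map_sub] at h3
  have h4 : (2 : ℂ) • Kᗮ.reflection v = (2 : ℂ) • w := by
    rw [two_smul, two_smul]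
    have := congrArg₂ (· + ·) h2 h3
    calc Kᗮ.reflection v + Kᗮ.reflection v = Kᗮ.reflection v + Kᗮ.reflection w +
        (Kᗮ.reflection v - Kᗮ.reflection w) := by abel
      _ = _ := by rw [this]; abel
  exact smul_right_injective H (two_ne_zero (α := ℂ)) h4

theorem inner_indicatorProj (μ : Measure ℝ) (S : Set ℝ) (hS : MeasurableSet S) (f g : Lp ℂ 2 μ) :
    inner ℂ f (indicatorProj μ S hS g) = inner ℂ (indicatorProj μ S hS f) g := by
  rw [inner_Lp, inner_Lp]
  refine integral_congr_ae ?_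
  filter_upwards [coeFn_indicatorProj μ S hS f, coeFn_indicatorProj μ S hS g] with x h1 h2
  rw [h1, h2]
  by_cases hx : x ∈ S <;> simp [hx]

end

namespace Composite

variable {n : ℕ} {P : Composite n} {ε : ℝ}

theorem measurableSet_stiffCell : MeasurableSet (P.stiffCell ε) :=
  MeasurableSet.iUnion fun _ => measurableSet_Ioo

theorem memLp_stiffConst (P : Composite n) (ε : ℝ) :
    MemLp ((P.stiffCell ε).indicator fun _ => (((Real.sqrt (ε * P.stiffLength))⁻¹ : ℝ) : ℂ)) 2
      (volume.restrict (Ioo (0 : ℝ) ε)) :=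
  (memLp_const _).indicator measurableSet_stiffCell

/-- The normalized function which is constant on the stiff component. -/
def stiffConst (P : Composite n) (ε : ℝ) : L2Cell ε := (P.memLp_stiffConst ε).toLp

theorem stiffConst_apply (P : Composite n) (ε : ℝ) : P.stiffConst ε =ᵐ[volume.restrict (Ioo 0 ε)]
    (P.stiffCell ε).indicator fun _ => (((Real.sqrt (ε * P.stiffLength))⁻¹ : ℝ) : ℂ) := MemLp.coeFn_toLp _

theorem WellFormed.mem_stiffCell (h : P.WellFormed) (hε : 0 < ε) (e : Fin n) {x : ℝ}
    (hx : x ∈ Ioo 0 (ε * P.len e)) : ε * P.pos e + x ∈ P.stiffCell ε ↔ P.stiff e = true := by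
  simp only [stiffCell, mem_iUnion]
  constructor
  · rintro ⟨⟨e', he'⟩, h1, h2⟩
    simp only at h1 h2
    by_cases hee : e = e'
    · rw [hee]; exact he'
    · exfalso
      rcases h.disj e e' hee with h3 | h3
      · have := mul_le_mul_of_nonneg_left h3 hε.le
        linarith [hx.2]
      · have := mul_le_mul_of_nonneg_left h3 hε.le
        linarith [hx.1]
  · intro he
    exact ⟨⟨e, he⟩, by simp only; linarith [hx.1], by simp only; linarith [hx.2]⟩

theorem WellFormed.norm_stiffConst (h : P.WellFormed) (hε : 0 < ε) (hL : 0 < P.stiffLength) :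
    ‖P.stiffConst ε‖ = 1 := by
  have hT := h.tiles_twistGraph hε 0
  have h1 := hT.hasSum_sqInt_Lp (P.stiffConst ε)
  have h2 : ∀ e, sqInt ((P.twistGraph ε 0).len e) (fun x => P.stiffConst ε ((P.twistGraph ε 0).pos e + x)) =
      (if P.stiff e then P.len e else 0) * P.stiffLength⁻¹ := by
    intro e
    have h3 : sqInt (ε * P.len e) (fun x => P.stiffConst ε (ε * P.pos e + x)) = sqInt (ε * P.len e) fun x =>
        if P.stiff e then (((Real.sqrt (ε * P.stiffLength))⁻¹ : ℝ) : ℂ) else 0 := by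
      refine sqInt_congr_norm ?_
      filter_upwards [hT.ae_edge (P.stiffConst_apply ε) e, ae_restrict_mem measurableSet_Ioo] with x hx hx'
      rw [show P.stiffConst ε (ε * P.pos e + x) = _ from hx]
      change ‖(P.stiffCell ε).indicator _ (ε * P.pos e + x)‖ = _
      by_cases he : P.stiff e = true
      · rw [indicator_of_mem ((h.mem_stiffCell hε e hx').2 he), if_pos he]
      · rw [indicator_of_notMem fun hm => he ((h.mem_stiffCell hε e hx').1 hm), if_neg he]
    refine h3.trans ?_
    have hl := (mul_pos hε (h.len_pos e)).le
    by_cases he : P.stiff e = true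
    · simp only [he, if_true, sqInt, norm_real, Real.norm_eq_abs, sq_abs, inv_pow,
        Real.sq_sqrt (mul_pos hε hL).le]
      rw [integral_const, measureReal_restrict_apply MeasurableSet.univ, univ_inter, Real.volume_real_Ioo_of_le hl]
      simp only [smul_eq_mul, sub_zero]
      field_simp
    · simp [he, sqInt]
  simp only [h2] at h1
  have h3 := h1.unique (hasSum_fintype _)
  rw [← Finset.sum_mul] at h3
  change _ = P.stiffLength * _ at h3
  rw [mul_inv_cancel₀ hL.ne'] at h3
  exact (pow_eq_one_iff_of_nonneg (norm_nonneg _) two_ne_zero).1 h3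

theorem stiffProj_cellConst (hε : 0 < ε) (hL : 0 < P.stiffLength) :
    P.stiffProjCell ε (cellConst ε) = ((Real.sqrt P.stiffLength : ℝ) : ℂ) • P.stiffConst ε := by
  refine Lp.ext ?_
  filter_upwards [coeFn_indicatorProj _ (P.stiffCell ε) measurableSet_stiffCell (cellConst ε), cellConst_apply ε,
    P.stiffConst_apply ε, Lp.coeFn_smul ((Real.sqrt P.stiffLength : ℝ) : ℂ) (P.stiffConst ε)] with y h1 h2 h3 h4
  refine h1.trans ?_
  rw [h4, Pi.smul_apply, h3]
  by_cases hy : y ∈ P.stiffCell ε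
  · rw [indicator_of_mem hy, indicator_of_mem hy, h2, smul_eq_mul, ← ofReal_mul, Real.sqrt_mul hε.le]
    have := (Real.sqrt_pos.2 hL).ne'
    congr 1
    field_simp
  · rw [indicator_of_notMem hy, indicator_of_notMem hy, smul_zero]

/-- The function `exp (-ity)` on the stiff component, normalized. -/
def stiffMode (P : Composite n) (ε t : ℝ) : L2Cell ε := (cellTwist ε t).symm (P.stiffConst ε)

/-- The reduction of the asymptotics to an estimate for the fibre operators. -/
theorem WellFormed.stiffDispersiveAsymptotics (h : P.WellFormed) (hL : 0 < P.stiffLength)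
    {K : ℝ → ℝ → ℂ → ℂ} {r : ℕ}
    (hm : ∀ ε z, Measurable fun τ => K ε τ z)
    (hb : ∀ z : ℂ, z.im ≠ 0 → ∃ B : ℝ, ∀ ε τ, ‖(K ε τ z - z)⁻¹‖ ≤ B)
    (hest : ∀ (Z : Set ℂ) (δ : ℝ), IsCompact Z → 0 < δ → ∃ C ε₀ : ℝ, 0 ≤ C ∧ 0 < ε₀ ∧ ∀ ε : ℝ, 0 < ε → ε ≤ ε₀ →
      ∀ z ∈ Z, δ ≤ |z.im| → ∀ t ∈ Ioo (-(Real.pi / ε)) (Real.pi / ε), ∀ R : L2Cell ε →L[ℂ] L2Cell ε,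
      IsResolvent (P.fibreOp ε t) z R → ∀ f, ‖P.stiffProjCell ε (R (P.stiffProjCell ε f)) -
        rankOneOp (K ε (ε * t) z - z)⁻¹ (P.stiffMode ε t) f‖ ≤ C * ε ^ r * ‖f‖) :
    P.StiffDispersiveAsymptotics K r := by
  intro Z δ hZ hδ
  obtain ⟨C, ε₀, hC, hε₀, H⟩ := hest Z δ hZ hδ
  refine ⟨C, ε₀, hε₀, fun ε hε hεε => ?_⟩
  have hreal : (inner ℂ (P.stiffConst ε) (cellConst ε) : ℂ).im = 0 := by
    rw [inner_Lp]
    have : ∀ᵐ y ∂(volume.restrict (Ioo 0 ε)), (starRingEnd ℂ) (P.stiffConst ε y) * cellConst ε y =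
        (((P.stiffCell ε).indicator (fun _ => (Real.sqrt (ε * P.stiffLength))⁻¹ * (Real.sqrt ε)⁻¹) y : ℝ) : ℂ) := by
      filter_upwards [P.stiffConst_apply ε, cellConst_apply ε] with y h1 h2
      rw [h1, h2]
      by_cases hy : y ∈ P.stiffCell ε
      · rw [indicator_of_mem hy, indicator_of_mem hy, conj_ofReal, ofReal_mul]
      · simp [hy]
    rw [integral_congr_ae this, integral_complex_ofReal, ofReal_im]
  obtain ⟨w, hw⟩ := exists_unitary_swap (v := P.stiffConst ε) (w := cellConst ε)
    (by rw [h.norm_stiffConst hε hL, norm_cellConst hε]) hreal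
  have dM := isDirectIntegral_twist ε
  have dU := isDirectIntegral_fibrewise hε w
  have dP := h.isDirectIntegral_stiffProj hε
  have dΨ := fun (m : ℝ → ℂ) (Ψ : L2Line →L[ℂ] L2Line) (hΨ : IsFourierMultiplier m Ψ) h => isDirectIntegral_multiplier hε hΨ h
  generalize fibrewise hε w = U at *
  generalize twist ε = M at *
  generalize gelfand hε = G at *
  refine ⟨M.trans (U.trans G.symm), M.trans G.symm, fun z hz hzδ D hD => ?_⟩
  have hz0 : z.im ≠ 0 := by
    intro h0
    rw [h0, abs_zero] at hzδ
    linarith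
  obtain ⟨B, hB⟩ := hb z hz0
  set m := dispersionSymbol ε (fun τ => K ε τ z) z with hmdef
  have hmm : Measurable m := by
    refine Measurable.indicator ?_ measurableSet_Ico
    exact (((hm ε z).comp (measurable_const_mul ε)).sub_const z).inv
  have hmB : ∀ t, ‖m t‖ ≤ B := by
    intro t
    simp only [m, dispersionSymbol]
    by_cases ht : t ∈ Ico (-(Real.pi / ε)) (Real.pi / ε)
    · rw [indicator_of_mem ht]; exact hB _ _
    · rw [indicator_of_notMem ht, norm_zero]; exact (norm_nonneg _).trans (hB 0 0)
  obtain ⟨Ψ, hΨ⟩ := exists_isFourierMultiplier hmm hmB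
  have dΨ := dΨ m Ψ hΨ fun t ht => indicator_of_notMem ht _
  have dT := dM.symm.comp (dU.symm.comp (dΨ.comp (dU.comp dM)))
  have dT' := dM.symm.comp (dP.comp (dΨ.comp (dP.comp dM)))
  set T := (M.symm : L2Fibred ε →L[ℂ] L2Fibred ε) ∘L (U.symm : L2Fibred ε →L[ℂ] L2Fibred ε) ∘L
    ((G : L2Line →L[ℂ] L2Fibred ε) ∘L Ψ ∘L (G.symm : L2Fibred ε →L[ℂ] L2Line)) ∘L
    (U : L2Fibred ε →L[ℂ] L2Fibred ε) ∘L (M : L2Fibred ε →L[ℂ] L2Fibred ε) with hTdef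
  have hfib : ∀ t x, (((cellTwist ε t).symm : L2Cell ε →L[ℂ] L2Cell ε) ∘L (w.symm : L2Cell ε →L[ℂ] L2Cell ε) ∘L
      rankOneOp (m t) (cellConst ε) ∘L (w : L2Cell ε →L[ℂ] L2Cell ε) ∘L (cellTwist ε t : L2Cell ε →L[ℂ] L2Cell ε)) x =
      rankOneOp (m t) (P.stiffMode ε t) x := by
    intro t x
    simp only [ContinuousLinearMap.comp_apply, rankOneOp_apply, map_smul]
    have e1 : (w.symm : L2Cell ε →L[ℂ] L2Cell ε) (cellConst ε) = P.stiffConst ε := by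
      rw [← hw]; exact w.symm_apply_apply _
    have e2 : inner ℂ (cellConst ε) ((w : L2Cell ε →L[ℂ] L2Cell ε) ((cellTwist ε t : L2Cell ε →L[ℂ] L2Cell ε) x)) =
        inner ℂ (P.stiffMode ε t) x := by
      rw [← hw]
      refine (w.inner_map_map _ _).trans ?_
      rw [stiffMode, ← (cellTwist ε t).inner_map_map ((cellTwist ε t).symm (P.stiffConst ε)),
        LinearIsometryEquiv.apply_symm_apply]
      rfl
    rw [e1, e2]
    rfl
  refine ⟨Ψ, T, hΨ, fun f => ?_, fun f => ?_, ?_⟩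
  · exact congrArg M.symm (congrArg U.symm (congrArg G (congrArg Ψ (congrArg G.symm rfl))))
  · have dS := dT'.const_smul (P.stiffLength : ℂ)⁻¹
    have h1 := IsDirectIntegral.unique dT dS (fun t x => ?_) f
    · refine h1.trans ?_
      have e4 : ∀ x, (G.symm : L2Fibred ε →L[ℂ] L2Line) ((G : L2Line →L[ℂ] L2Fibred ε) x) = x := G.symm_apply_apply
      simp only [ContinuousLinearMap.smul_apply, ContinuousLinearMap.comp_apply, map_smul, e4]
      rfl
    · refine (hfib t x).trans ?_
      simp only [ContinuousLinearMap.smul_apply, ContinuousLinearMap.comp_apply, rankOneOp_apply, map_smul]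
      have e2 : inner ℂ (cellConst ε) (P.stiffProjCell ε ((cellTwist ε t : L2Cell ε →L[ℂ] L2Cell ε) x)) =
          ((Real.sqrt P.stiffLength : ℝ) : ℂ) * inner ℂ (P.stiffMode ε t) x := by
        refine (inner_indicatorProj _ _ measurableSet_stiffCell _ _).trans ?_
        change inner ℂ (P.stiffProjCell ε (cellConst ε)) _ = _
        rw [stiffProj_cellConst hε hL, inner_smul_left, conj_ofReal, stiffMode,
          ← (cellTwist ε t).inner_map_map ((cellTwist ε t).symm (P.stiffConst ε)),
          LinearIsometryEquiv.apply_symm_apply]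
        rfl
      rw [e2, stiffProj_cellConst hε hL, map_smul, smul_smul, smul_smul]
      change _ = _ • P.stiffMode ε t
      congr 1
      have e3 : ((Real.sqrt P.stiffLength : ℝ) : ℂ) * ((Real.sqrt P.stiffLength : ℝ) : ℂ) = (P.stiffLength : ℂ) := by
        rw [← ofReal_mul, Real.mul_self_sqrt hL.le]
      have e4 : (P.stiffLength : ℂ) ≠ 0 := by exact_mod_cast hL.ne'
      field_simp
      linear_combination -(m t * inner ℂ (P.stiffMode ε t) x) * e3
  · obtain ⟨R, hR, hDR⟩ := hD
    refine IsDirectIntegral.norm_sub_le hDR dT (by positivity) ?_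
    filter_upwards [ae_restrict_mem measurableSet_Ioo] with t ht f
    have ht' : t ∈ Ico (-(Real.pi / ε)) (Real.pi / ε) := ⟨ht.1.le, ht.2⟩
    have := H ε hε hεε z hz hzδ t ht (R t) (hR t ht') f
    rw [hfib t f, hmdef, dispersionSymbol, indicator_of_mem ht']
    exact this

end Composite

/-! ### Estimates on the fibres, reduced to the edges -/

namespace Composite

variable {n : ℕ} {P : Composite n} {ε : ℝ}

/-- On the edges of the period cell, a solution of the resolvent equation with the load `F` of norm at most
`N`, supported by the stiff edges. -/
structure FibreData (P : Composite n) (ε τ : ℝ) (z : ℂ) (N : ℝ) (F φ φ' φ'' : Fin n → ℝ → ℂ) : Prop where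
  w22 : ∀ e, IsW22 (ε * P.len e) (φ e) (φ' e) (φ'' e)
  memLp : ∀ e, MemLp (F e) 2 (volume.restrict (Ioo 0 (ε * P.len e)))
  soft : ∀ e, P.stiff e = false → ∀ᵐ x ∂(volume.restrict (Ioo 0 (ε * P.len e))), F e x = 0
  eq : ∀ e, ∀ᵐ x ∂(volume.restrict (Ioo 0 (ε * P.len e))), F e x + z * φ e x = -(P.coefEps ε e : ℂ) ^ 2 * φ'' e x
  cont : ∀ e b e' b', P.vert e b = P.vert e' b' →
    exp (I * ((-(τ * P.shift e b) : ℝ) : ℂ)) * φ e (if b = 0 then 0 else ε * P.len e) =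
      exp (I * ((-(τ * P.shift e' b') : ℝ) : ℂ)) * φ e' (if b' = 0 then 0 else ε * P.len e')
  kirchhoff : ∀ v, ∑ e, ∑ b, (if P.vert e b = v then exp (I * ((-(τ * P.shift e b) : ℝ) : ℂ)) *
    (MetricGraph.endSign b * (P.coefEps ε e : ℂ) ^ 2 * φ' e (if b = 0 then 0 else ε * P.len e)) else 0) = 0
  load : ∀ e, sqInt (ε * P.len e) (F e) ≤ N ^ 2
  size : ∀ e, z.im ^ 2 * sqInt (ε * P.len e) (φ e) ≤ N ^ 2
  energy : ∀ e, z.im ^ 2 * (P.coefEps ε e ^ 2 * sqInt (ε * P.len e) (φ' e)) ≤ (|z.im| + ‖z‖) * N ^ 2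

theorem WellFormed.exists_fibreData (h : P.WellFormed) (hε : 0 < ε) {t : ℝ} {z : ℂ} {u g : L2Cell ε}
    (hu : P.fibreOp ε t u (P.stiffProjCell ε g + z • u)) : ∃ φ φ' φ'' : Fin n → ℝ → ℂ,
      P.FibreData ε (ε * t) z ‖cellTwist ε t (P.stiffProjCell ε g)‖
        (fun e x => cellTwist ε t (P.stiffProjCell ε g) (ε * P.pos e + x)) φ φ' φ'' ∧
      ∀ e, ∀ᵐ x ∂(volume.restrict (Ioo 0 (ε * P.len e))), cellTwist ε t u (ε * P.pos e + x) = φ e x := by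
  have hT := h.tiles_twistGraph hε t
  have hR := h.regular_twistGraph hε t
  have hop : (P.twistGraph ε t).IsOp 0 (cellTwist ε t u) (cellTwist ε t (P.stiffProjCell ε g + z • u)) :=
    (h.fibreOp_iff_isOp hε _ _ _).1 hu
  rw [map_add, map_smul] at hop
  set v := cellTwist ε t u
  set F := cellTwist ε t (P.stiffProjCell ε g) with hF
  have hn := hop.norm_le hT hR
  obtain ⟨φ, φ', φ'', hd⟩ := (MetricGraph.isOp_zero_iff _ _ _).1 hop
  have hv := hT.hasSum_sqInt_Lp v
  have hFs := hT.hasSum_sqInt_Lp F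
  have hE := hd.hasSum_energy hT hR
  refine ⟨φ, φ', φ'', ⟨hd.w22, fun e => hT.memLp_edge (Lp.memLp F) e, fun e he => ?_, fun e => ?_, hd.cont, fun w => ?_,
    fun e => ?_, fun e => ?_, fun e => ?_⟩, hd.fst_eq⟩
  · filter_upwards [hT.ae_edge (cellTwist_apply ε t (P.stiffProjCell ε g)) e,
      hT.ae_edge (coeFn_indicatorProj _ (P.stiffCell ε) measurableSet_stiffCell g) e,
      ae_restrict_mem measurableSet_Ioo] with x h1 h2 hx
    have h3 : P.stiffProjCell ε g (ε * P.pos e + x) = 0 := by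
      refine h2.trans (indicator_of_notMem (fun hm => ?_) _)
      rw [(h.mem_stiffCell hε e hx).1 hm] at he
      exact absurd he (by decide)
    refine h1.trans ?_
    change _ * P.stiffProjCell ε g (ε * P.pos e + x) = 0
    rw [h3, mul_zero]
  · filter_upwards [hd.fst_eq e, hd.snd_eq e, hT.ae_edge (Lp.coeFn_add F (z • v)) e,
      hT.ae_edge (Lp.coeFn_smul z v) e] with x h1 h2 h3 h4
    refine Eq.trans ?_ h2
    rw [h3, Pi.add_apply, h4, Pi.smul_apply, h1]
    rfl
  · have hk := hd.kirchhoff w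
    rw [finsum_eq_sum_of_fintype] at hk
    refine Eq.trans ?_ hk
    rw [← Fintype.sum_prod_type', ← Finset.sum_filter]
    exact (Finset.sum_subtype (Finset.univ.filter fun p : Fin n × Fin 2 => P.vert p.1 p.2 = w)
      (fun p => by simp; rfl) fun p => exp (I * ((-(ε * t * P.shift p.1 p.2) : ℝ) : ℂ)) *
      (MetricGraph.endSign p.2 * (P.coefEps ε p.1 : ℂ) ^ 2 * φ' p.1 (if p.2 = 0 then 0 else ε * P.len p.1)))
  · exact le_hasSum hFs e fun _ _ => sqInt_nonneg _ _
  · have h1 : sqInt (ε * P.len e) (φ e) ≤ ‖v‖ ^ 2 := by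
      have h2 : sqInt (ε * P.len e) (φ e) = _ := (hd.sqInt_fst e).symm
      rw [h2]
      exact le_hasSum hv e fun _ _ => sqInt_nonneg _ _
    calc z.im ^ 2 * sqInt (ε * P.len e) (φ e) ≤ z.im ^ 2 * ‖v‖ ^ 2 := by gcongr
      _ = (|z.im| * ‖v‖) ^ 2 := by rw [mul_pow, sq_abs]
      _ ≤ ‖F‖ ^ 2 := by gcongr
  · have h1 : P.coefEps ε e ^ 2 * sqInt (ε * P.len e) (φ' e) ≤ ‖v‖ * (‖F‖ + ‖z‖ * ‖v‖) := by
      have h2 := Complex.hasSum_re hE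
      simp only [ofReal_re] at h2
      refine (le_hasSum h2 e fun e' _ => mul_nonneg (by positivity) (sqInt_nonneg _ _)).trans ?_
      refine (Complex.re_le_norm _).trans ((norm_inner_le_norm _ _).trans ?_)
      gcongr
      exact (norm_add_le _ _).trans (by rw [norm_smul])
    have h0 := norm_nonneg v
    have h0' := norm_nonneg z
    have h0F := norm_nonneg F
    calc z.im ^ 2 * (P.coefEps ε e ^ 2 * sqInt (ε * P.len e) (φ' e)) ≤ z.im ^ 2 * (‖v‖ * (‖F‖ + ‖z‖ * ‖v‖)) := by gcongr
      _ = |z.im| * (|z.im| * ‖v‖) * ‖F‖ + ‖z‖ * (|z.im| * ‖v‖) ^ 2 := by rw [← sq_abs]; ring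
      _ ≤ |z.im| * ‖F‖ * ‖F‖ + ‖z‖ * ‖F‖ ^ 2 := by gcongr
      _ = _ := by ring

theorem inner_stiffMode (P : Composite n) (ε t : ℝ) (f : L2Cell ε) :
    inner ℂ (P.stiffMode ε t) f = inner ℂ (P.stiffConst ε) (cellTwist ε t f) := by
  rw [stiffMode, ← (cellTwist ε t).inner_map_map, LinearIsometryEquiv.apply_symm_apply]

/-- Estimates on the edges give an estimate of the operator norm. -/
theorem WellFormed.norm_sub_rankOneOp_le (h : P.WellFormed) (hε : 0 < ε) (hL : 0 < P.stiffLength) {t : ℝ} {z m : ℂ}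
    {B : ℝ} (hB : 0 ≤ B)
    (H : ∀ N F φ φ' φ'', 0 ≤ N → P.FibreData ε (ε * t) z N F φ φ' φ'' → ∀ e, P.stiff e = true →
      ∀ x ∈ Ioo 0 (ε * P.len e), ‖φ e x - m * (((ε * P.stiffLength : ℝ) : ℂ)⁻¹ *
        ∑ e', if P.stiff e' then ∫ x in (0 : ℝ)..ε * P.len e', F e' x else 0)‖ ≤ B * N)
    {R : L2Cell ε →L[ℂ] L2Cell ε} (hR : IsResolvent (P.fibreOp ε t) z R) (f : L2Cell ε) :
    ‖P.stiffProjCell ε (R (P.stiffProjCell ε f)) - rankOneOp m (P.stiffMode ε t) f‖ ≤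
      Real.sqrt (ε * P.stiffLength) * B * ‖f‖ := by
  have hT := h.tiles_twistGraph hε t
  have hS : 0 < ε * P.stiffLength := mul_pos hε hL
  set s : ℝ := Real.sqrt (ε * P.stiffLength) with hs
  have hs0 : 0 < s := Real.sqrt_pos.2 hS
  have hss : s * s = ε * P.stiffLength := Real.mul_self_sqrt hS.le
  obtain ⟨φ, φ', φ'', hd, hφ⟩ := h.exists_fibreData hε ((hR (P.stiffProjCell ε f) _).2 rfl)
  set u := R (P.stiffProjCell ε f)
  set F := cellTwist ε t (P.stiffProjCell ε f) with hF
  set J : ℂ := ∑ e', if P.stiff e' then ∫ x in (0 : ℝ)..ε * P.len e', F (ε * P.pos e' + x) else 0 with hJ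
  have hN : ‖F‖ ≤ ‖f‖ := by
    rw [hF, LinearIsometryEquiv.norm_map]
    have := norm_indicatorLin_le (volume.restrict (Ioo 0 ε)) (P.stiffCell ε) measurableSet_stiffCell f
    rwa [one_mul] at this
  have hc : inner ℂ (P.stiffMode ε t) f = ((s⁻¹ : ℝ) : ℂ) * J := by
    rw [inner_stiffMode]
    have h1 := (hT.hasSum_inner (P.stiffConst ε) (cellTwist ε t f)).unique (hasSum_fintype _)
    rw [h1, hJ, Finset.mul_sum]
    refine Finset.sum_congr rfl fun e _ => ?_
    have hl : 0 ≤ ε * P.len e := (mul_pos hε (h.len_pos e)).le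
    by_cases he : P.stiff e = true
    · rw [if_pos he, integral_Ioo_eq hl, ← integral_const_mul]
      refine integral_congr_ae ?_
      filter_upwards [hT.ae_edge (P.stiffConst_apply ε) e, hT.ae_edge (cellTwist_apply ε t f) e,
        hT.ae_edge (cellTwist_apply ε t (P.stiffProjCell ε f)) e,
        hT.ae_edge (coeFn_indicatorProj _ (P.stiffCell ε) measurableSet_stiffCell f) e,
        ae_restrict_mem measurableSet_Ioo] with x k1 k2 k3 k4 hx
      have hm : (P.twistGraph ε t).pos e + x ∈ P.stiffCell ε := (h.mem_stiffCell hε e hx).2 he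
      rw [indicator_of_mem hm] at k1
      have k4' : P.stiffProjCell ε f ((P.twistGraph ε t).pos e + x) = f ((P.twistGraph ε t).pos e + x) :=
        k4.trans (indicator_of_mem hm _)
      change _ = _ * F ((P.twistGraph ε t).pos e + x)
      rw [k1, k2, hF, k3, k4', conj_ofReal]
    · rw [if_neg he, mul_zero]
      refine integral_eq_zero_of_ae ?_
      filter_upwards [hT.ae_edge (P.stiffConst_apply ε) e, ae_restrict_mem measurableSet_Ioo] with x k1 hx
      have hm : (P.twistGraph ε t).pos e + x ∉ P.stiffCell ε := fun hm => he ((h.mem_stiffCell hε e hx).1 hm)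
      rw [indicator_of_notMem hm] at k1
      rw [k1, map_zero, zero_mul]
      rfl
  have e1 : P.stiffProjCell ε u - rankOneOp m (P.stiffMode ε t) f = (cellTwist ε t).symm
      (cellTwist ε t (P.stiffProjCell ε u) - (m * (((s⁻¹ : ℝ) : ℂ) * J)) • P.stiffConst ε) := by
    rw [map_sub, LinearIsometryEquiv.symm_apply_apply, map_smul, rankOneOp_apply, hc]
    rfl
  rw [e1, LinearIsometryEquiv.norm_map]
  set D := cellTwist ε t (P.stiffProjCell ε u) - (m * (((s⁻¹ : ℝ) : ℂ) * J)) • P.stiffConst ε with hD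
  have h2 : ∀ e, sqInt (ε * P.len e) (fun x => D (ε * P.pos e + x)) ≤
      (if P.stiff e then P.len e else 0) * (ε * (B * ‖F‖) ^ 2) := by
    intro e
    have hl : 0 ≤ ε * P.len e := (mul_pos hε (h.len_pos e)).le
    have key : ∀ᵐ x ∂(volume.restrict (Ioo 0 (ε * P.len e))), D (ε * P.pos e + x) =
        if P.stiff e then φ e x - m * (((ε * P.stiffLength : ℝ) : ℂ)⁻¹ * J) else 0 := by
      filter_upwards [hT.ae_edge (Lp.coeFn_sub (cellTwist ε t (P.stiffProjCell ε u))
          ((m * (((s⁻¹ : ℝ) : ℂ) * J)) • P.stiffConst ε)) e,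
        hT.ae_edge (Lp.coeFn_smul (m * (((s⁻¹ : ℝ) : ℂ) * J)) (P.stiffConst ε)) e,
        hT.ae_edge (P.stiffConst_apply ε) e, hT.ae_edge (cellTwist_apply ε t u) e,
        hT.ae_edge (cellTwist_apply ε t (P.stiffProjCell ε u)) e,
        hT.ae_edge (coeFn_indicatorProj _ (P.stiffCell ε) measurableSet_stiffCell u) e, hφ e,
        ae_restrict_mem measurableSet_Ioo] with x k1 k2 k3 k4 k5 k6 k7 hx
      have k6' : P.stiffProjCell ε u ((P.twistGraph ε t).pos e + x) =
        (P.stiffCell ε).indicator u ((P.twistGraph ε t).pos e + x) := k6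
      change D ((P.twistGraph ε t).pos e + x) = _
      rw [k1, Pi.sub_apply, k2, Pi.smul_apply, k3, k5, k6']
      by_cases he : P.stiff e = true
      · have hm : (P.twistGraph ε t).pos e + x ∈ P.stiffCell ε := (h.mem_stiffCell hε e hx).2 he
        rw [indicator_of_mem hm, indicator_of_mem hm, if_pos he, ← k4]
        have k7' : cellTwist ε t u ((P.twistGraph ε t).pos e + x) = φ e x := k7
        rw [k7', ← hs, ← hss, smul_eq_mul]
        push_cast
        ring
      · have hm : (P.twistGraph ε t).pos e + x ∉ P.stiffCell ε := fun hm => he ((h.mem_stiffCell hε e hx).1 hm)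
        rw [indicator_of_notMem hm, indicator_of_notMem hm, if_neg he]
        simp
    have e2 : sqInt (ε * P.len e) (fun x => D (ε * P.pos e + x)) = _ :=
      sqInt_congr_norm (key.mono fun x hx => congrArg norm hx)
    rw [e2]
    by_cases he : P.stiff e = true
    · simp only [if_pos he]
      refine (sqInt_le_of_bound hl (H _ _ _ _ _ (norm_nonneg F) hd e he)).trans (le_of_eq ?_)
      ring
    · simp [he, sqInt]
  have h3 : ‖D‖ ^ 2 ≤ (s * B * ‖f‖) ^ 2 := by
    have h4 := (hT.hasSum_sqInt_Lp D).unique (hasSum_fintype _)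
    rw [h4]
    refine (Finset.sum_le_sum fun e _ => h2 e).trans ?_
    rw [← Finset.sum_mul]
    change P.stiffLength * _ ≤ _
    calc P.stiffLength * (ε * (B * ‖F‖) ^ 2) = (s * s) * (B * ‖F‖) ^ 2 := by rw [hss]; ring
      _ ≤ (s * s) * (B * ‖f‖) ^ 2 := by gcongr
      _ = _ := by ring
  exact (sq_le_sq₀ (norm_nonneg _) (by positivity)).1 h3

end Composite

/-! ### Functions on a short edge -/

namespace IsW22

variable {ℓ : ℝ} {φ φ' φ'' : ℝ → ℂ}

theorem eq_add_integral (hℓ : 0 ≤ ℓ) (h : IsW22 ℓ φ φ' φ'') {x y : ℝ} (hx : x ∈ Icc 0 ℓ) (hy : y ∈ Icc 0 ℓ) :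
    φ y - φ x = ∫ u in x..y, φ' u := by
  have hi := h.continuousOn'.intervalIntegrable_of_Icc (μ := volume) hℓ
  rw [h.eq x hx, h.eq y hy, add_sub_add_left_eq_sub]
  exact intervalIntegral.integral_interval_sub_left (primitive_ac hy hi) (primitive_ac hx hi)

theorem norm_sub_le_of_deriv (hℓ : 0 ≤ ℓ) (h : IsW22 ℓ φ φ' φ'') {M : ℝ} (hM : ∀ x ∈ Icc 0 ℓ, ‖φ' x‖ ≤ M) {x y : ℝ}
    (hx : x ∈ Icc 0 ℓ) (hy : y ∈ Icc 0 ℓ) : ‖φ y - φ x‖ ≤ ℓ * M := by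
  have hM0 := (norm_nonneg _).trans (hM x hx)
  rw [h.eq_add_integral hℓ hx hy]
  have hxy : |y - x| ≤ ℓ := abs_sub_le_iff.2 ⟨by linarith [hx.1, hy.2], by linarith [hy.1, hx.2]⟩
  refine (intervalIntegral.norm_integral_le_of_norm_le_const fun u hu => hM u ?_).trans
    ((mul_le_mul_of_nonneg_left hxy hM0).trans (le_of_eq (mul_comm _ _)))
  exact (ordConnected_Icc.uIcc_subset hx hy) (uIoc_subset_uIcc hu)

theorem norm_sub_sq_le (hℓ : 0 ≤ ℓ) (h : IsW22 ℓ φ φ' φ'') {x y : ℝ} (hx : x ∈ Icc 0 ℓ) (hy : y ∈ Icc 0 ℓ) :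
    ‖φ y - φ x‖ ^ 2 ≤ ℓ * sqInt ℓ φ' := by
  rw [h.eq_add_integral hℓ hx hy]
  have hm := memLp_of_continuousOn h.continuousOn'
  have hsub : uIoc x y ⊆ Icc 0 ℓ := uIoc_subset_uIcc.trans (ordConnected_Icc.uIcc_subset hx hy)
  have hint : IntegrableOn (fun u => ‖φ' u‖) (Ioo 0 ℓ) := (hm.integrable (by norm_num)).norm
  have h1 : ‖∫ u in x..y, φ' u‖ ≤ ∫ u in Ioo 0 ℓ, ‖φ' u‖ := by
    refine (intervalIntegral.norm_integral_le_integral_norm_uIoc).trans ?_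
    rw [← integral_Icc_eq_integral_Ioo]
    refine setIntegral_mono_set ?_ (Filter.Eventually.of_forall fun _ => norm_nonneg _) hsub.eventuallyLE
    rwa [integrableOn_Icc_iff_integrableOn_Ioo]
  have h2 := norm_integral_sq_le_sqInt hℓ (h := fun u => ((‖φ' u‖ : ℝ) : ℂ)) hm.norm.ofReal
  rw [integral_Ioo_eq hℓ, integral_complex_ofReal, norm_real, Real.norm_eq_abs, sq_abs] at h2
  have h3 : sqInt ℓ (fun u => ((‖φ' u‖ : ℝ) : ℂ)) = sqInt ℓ φ' :=
    sqInt_congr_norm (Filter.Eventually.of_forall fun u => by simp)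
  rw [h3] at h2
  exact (pow_le_pow_left₀ (norm_nonneg _) h1 2).trans h2

theorem norm_sub_le (hℓ : 0 ≤ ℓ) (h : IsW22 ℓ φ φ' φ'') {Y : ℝ} (hY0 : 0 ≤ Y) (hY : sqInt ℓ φ' ≤ Y ^ 2) {x y : ℝ}
    (hx : x ∈ Icc 0 ℓ) (hy : y ∈ Icc 0 ℓ) : ‖φ y - φ x‖ ≤ Real.sqrt ℓ * Y := by
  refine (sq_le_sq₀ (norm_nonneg _) (by positivity)).1 ((h.norm_sub_sq_le hℓ hx hy).trans ?_)
  rw [mul_pow, Real.sq_sqrt hℓ]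
  gcongr

theorem norm_le (hℓ : 0 < ℓ) (h : IsW22 ℓ φ φ' φ'') {X Y : ℝ} (hX0 : 0 ≤ X) (hX : sqInt ℓ φ ≤ X ^ 2) (hY0 : 0 ≤ Y)
    (hY : sqInt ℓ φ' ≤ Y ^ 2) {x : ℝ} (hx : x ∈ Icc 0 ℓ) : ‖φ x‖ ≤ X / Real.sqrt ℓ + Real.sqrt ℓ * Y := by
  have hs := Real.sqrt_pos.2 hℓ
  by_contra! hlt
  set c := ‖φ x‖ - Real.sqrt ℓ * Y with hc
  have hcX : X / Real.sqrt ℓ < c := by rw [hc]; linarith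
  have hc0 : 0 < c := lt_of_le_of_lt (by positivity) hcX
  have h1 : sqInt ℓ (fun _ => (c : ℂ)) ≤ sqInt ℓ φ := by
    refine sqInt_mono (memLp_of_continuousOn h.continuousOn) fun y hy => ?_
    rw [norm_real, Real.norm_eq_abs, abs_of_pos hc0]
    have h2 := h.norm_sub_le hℓ.le hY0 hY hx (Ioo_subset_Icc_self hy)
    have h3 := norm_sub_norm_le (φ x) (φ y)
    rw [norm_sub_rev] at h2
    rw [hc]
    linarith
  have h4 : sqInt ℓ (fun _ => (c : ℂ)) = ℓ * c ^ 2 := by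
    simp [sqInt, hℓ.le]
  have h5 : X < c * Real.sqrt ℓ := (div_lt_iff₀ hs).1 hcX
  have h6 : X ^ 2 < (c * Real.sqrt ℓ) ^ 2 := by gcongr
  rw [mul_pow, Real.sq_sqrt hℓ.le] at h6
  linarith

end IsW22

/-- Bounds on a short edge which follow from bounds on the norm and on the energy. -/
theorem exists_short_edge_bound {l a δ M : ℝ} (hl : 0 < l) (ha : 0 < a) (hδ : 0 < δ) (hM : 0 ≤ M) :
    ∃ C : ℝ, 0 ≤ C ∧ ∀ (s N : ℝ) (z : ℂ) (φ φ' φ'' : ℝ → ℂ), 0 < s → s ≤ 1 → 0 ≤ N → δ ≤ |z.im| → ‖z‖ ≤ M →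
      IsW22 (s ^ 2 * l) φ φ' φ'' → z.im ^ 2 * sqInt (s ^ 2 * l) φ ≤ N ^ 2 →
      z.im ^ 2 * (a ^ 2 * sqInt (s ^ 2 * l) φ') ≤ (|z.im| + ‖z‖) * N ^ 2 →
      sqInt (s ^ 2 * l) φ ≤ (N / δ) ^ 2 ∧ (∀ u ∈ Icc 0 (s ^ 2 * l), ‖φ u‖ ≤ C * N / s) ∧
      ∀ u ∈ Icc 0 (s ^ 2 * l), ∀ v ∈ Icc 0 (s ^ 2 * l), ‖φ v - φ u‖ ≤ C * s * N := by
  set y := Real.sqrt (2 * M) / (δ * a) with hy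
  have hy0 : 0 ≤ y := by positivity
  refine ⟨1 / (δ * Real.sqrt l) + Real.sqrt l * y, by positivity, ?_⟩
  intro s N z φ φ' φ'' hs hs1 hN hz hzM hw hsize henergy
  set ℓ := s ^ 2 * l with hℓ
  have hℓ0 : 0 < ℓ := by positivity
  have hsl : Real.sqrt ℓ = s * Real.sqrt l := by rw [hℓ, Real.sqrt_mul (by positivity), Real.sqrt_sq hs.le]
  have hrl : 0 < Real.sqrt l := Real.sqrt_pos.2 hl
  have him : δ ^ 2 ≤ z.im ^ 2 := by rw [← sq_abs z.im]; gcongr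
  have q1 : sqInt ℓ φ ≤ (N / δ) ^ 2 := by
    rw [div_pow, le_div_iff₀ (by positivity), mul_comm]
    exact (mul_le_mul_of_nonneg_right him (sqInt_nonneg _ _)).trans hsize
  have q2 : sqInt ℓ φ' ≤ (y * N) ^ 2 := by
    have e1 : (y * N) ^ 2 = 2 * M * N ^ 2 / (δ ^ 2 * a ^ 2) := by
      rw [hy, mul_pow, div_pow, Real.sq_sqrt (by positivity)]
      ring
    rw [e1, le_div_iff₀ (by positivity)]
    have e2 : |z.im| ≤ M := (Complex.abs_im_le_norm z).trans hzM
    calc sqInt ℓ φ' * (δ ^ 2 * a ^ 2) = δ ^ 2 * (a ^ 2 * sqInt ℓ φ') := by ring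
      _ ≤ z.im ^ 2 * (a ^ 2 * sqInt ℓ φ') :=
        mul_le_mul_of_nonneg_right him (mul_nonneg (by positivity) (sqInt_nonneg _ _))
      _ ≤ (|z.im| + ‖z‖) * N ^ 2 := henergy
      _ ≤ (M + M) * N ^ 2 := by gcongr
      _ = _ := by ring
  refine ⟨q1, fun u hu => ?_, fun u hu v hv => ?_⟩
  · refine (hw.norm_le hℓ0 (by positivity) q1 (by positivity) q2 hu).trans ?_
    rw [hsl]
    have e1 : N / δ / (s * Real.sqrt l) = 1 / (δ * Real.sqrt l) * N / s := by field_simp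
    have e2 : s * Real.sqrt l * (y * N) ≤ Real.sqrt l * y * N / s := by
      rw [le_div_iff₀ hs]
      have : s * s ≤ 1 := by nlinarith
      calc s * Real.sqrt l * (y * N) * s = (s * s) * (Real.sqrt l * y * N) := by ring
        _ ≤ 1 * (Real.sqrt l * y * N) := by gcongr
        _ = _ := one_mul _
    rw [e1, add_mul, add_div]
    linarith
  · refine (hw.norm_sub_le hℓ0.le (by positivity) q2 hu hv).trans ?_
    rw [hsl]
    have : 0 ≤ 1 / (δ * Real.sqrt l) * s * N := by positivity
    linarith

/-- The asymptotics on a short stiff edge the fluxes at whose ends are prescribed. -/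
theorem exists_single_edge_bound {l a δ B M : ℝ} (hl : 0 < l) (ha : 0 < a) (hδ : 0 < δ) (hB : 0 ≤ B) (hM : 0 ≤ M) :
    ∃ C : ℝ, 0 ≤ C ∧ ∀ (s N : ℝ) (z K α β γ κ : ℂ) (F φ φ' φ'' : ℝ → ℂ), 0 < s → s ≤ 1 → 0 ≤ N → δ ≤ |z.im| → ‖z‖ ≤ M →
      ‖α‖ ≤ B → ‖β‖ ≤ B → ‖γ‖ ≤ B → ‖κ‖ ≤ B → l * K = α + β - γ - κ → δ ≤ ‖K - z‖ →
      IsW22 (s ^ 2 * l) φ φ' φ'' → MemLp F 2 (volume.restrict (Ioo 0 (s ^ 2 * l))) →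
      (∀ᵐ x ∂(volume.restrict (Ioo 0 (s ^ 2 * l))), F x + z * φ x = -(a : ℂ) ^ 2 * φ'' x) →
      sqInt (s ^ 2 * l) F ≤ N ^ 2 → z.im ^ 2 * sqInt (s ^ 2 * l) φ ≤ N ^ 2 →
      z.im ^ 2 * (a ^ 2 * sqInt (s ^ 2 * l) φ') ≤ (|z.im| + ‖z‖) * N ^ 2 →
      (a : ℂ) ^ 2 * φ' 0 = ((s ^ 2 : ℝ) : ℂ) * (α * φ 0 + β * φ (s ^ 2 * l)) →
      (a : ℂ) ^ 2 * φ' (s ^ 2 * l) = ((s ^ 2 : ℝ) : ℂ) * (γ * φ 0 + κ * φ (s ^ 2 * l)) →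
      ∀ x ∈ Ioo 0 (s ^ 2 * l), ‖φ x - (K - z)⁻¹ * (((s ^ 2 * l : ℝ) : ℂ)⁻¹ * ∫ x in (0 : ℝ)..s ^ 2 * l, F x)‖ ≤
        C * s ^ 3 * N := by
  obtain ⟨C1, hC10, hbd⟩ := exists_short_edge_bound hl ha hδ hM
  set W := Real.sqrt (2 + 2 * (M / δ) ^ 2) with hW
  set C2 := (2 * B * C1 + Real.sqrt l * W) / a ^ 2 with hC2
  have hW0 : 0 ≤ W := by positivity
  have hC20 : 0 ≤ C2 := by positivity
  refine ⟨l * C2 + (2 * B + M * l) * C2 / δ, by positivity, ?_⟩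
  intro s N z K α β γ κ F φ φ' φ'' hs hs1 hN hz hzM hα hβ hγ hκ hK hKz hw hF he hload hsize henergy hf0 hf1 x hx
  set ℓ := s ^ 2 * l with hℓ
  have hℓ0 : 0 < ℓ := by positivity
  have hsl : Real.sqrt ℓ = s * Real.sqrt l := by rw [hℓ, Real.sqrt_mul (by positivity), Real.sqrt_sq hs.le]
  have hrl : 0 < Real.sqrt l := Real.sqrt_pos.2 hl
  have h0m : (0 : ℝ) ∈ Icc 0 ℓ := ⟨le_rfl, hℓ0.le⟩
  have h1m : ℓ ∈ Icc 0 ℓ := ⟨hℓ0.le, le_rfl⟩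
  have him : δ ^ 2 ≤ z.im ^ 2 := by rw [← sq_abs z.im]; gcongr
  obtain ⟨q1, hsup, -⟩ := hbd s N z φ φ' φ'' hs hs1 hN hz hzM hw hsize henergy
  have q3 : sqInt ℓ φ'' ≤ (W * N / a ^ 2) ^ 2 := by
    have e1 : sqInt ℓ (fun x => F x + z * φ x) = sqInt ℓ fun x => -(a : ℂ) ^ 2 * φ'' x :=
      sqInt_congr_norm (he.mono fun x hx => congrArg norm hx)
    have e2 := sqInt_add_le hF ((IsW22.memLp_of_continuousOn hw.continuousOn).const_mul z)
    rw [e1, sqInt_const_mul, sqInt_const_mul, norm_neg, norm_pow, norm_real, Real.norm_eq_abs, abs_of_pos ha] at e2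
    have e3 : (W * N / a ^ 2) ^ 2 = (2 + 2 * (M / δ) ^ 2) * N ^ 2 / (a ^ 2) ^ 2 := by
      rw [div_pow, mul_pow, hW, Real.sq_sqrt (by positivity)]
    rw [e3, le_div_iff₀ (by positivity), mul_comm]
    have e4 : ‖z‖ ^ 2 * sqInt ℓ φ ≤ M ^ 2 * (N / δ) ^ 2 := by
      have := sqInt_nonneg ℓ φ
      gcongr
    calc _ ≤ _ := e2
      _ ≤ 2 * N ^ 2 + 2 * (M ^ 2 * (N / δ) ^ 2) := by gcongr
      _ = _ := by ring
  have hd0 : ‖φ' 0‖ ≤ 2 * B * C1 / a ^ 2 * s * N := by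
    have e1 : ‖(a : ℂ) ^ 2 * φ' 0‖ ≤ s ^ 2 * (B * (C1 * N / s) + B * (C1 * N / s)) := by
      rw [hf0, norm_mul, norm_real, Real.norm_eq_abs, abs_of_pos (by positivity : 0 < s ^ 2)]
      gcongr
      refine (norm_add_le _ _).trans ?_
      rw [norm_mul, norm_mul]
      gcongr
      · exact hsup 0 h0m
      · exact hsup ℓ h1m
    rw [norm_mul, norm_pow, norm_real, Real.norm_eq_abs, abs_of_pos ha] at e1
    have e2 : s ^ 2 * (B * (C1 * N / s) + B * (C1 * N / s)) = a ^ 2 * (2 * B * C1 / a ^ 2 * s * N) := by field_simp; ring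
    rw [e2] at e1
    exact le_of_mul_le_mul_left e1 (by positivity)
  have hd : ∀ u ∈ Icc 0 ℓ, ‖φ' u‖ ≤ C2 * s * N := by
    intro u hu
    have e1 : ‖∫ v in (0 : ℝ)..u, φ'' v‖ ^ 2 ≤ (s * Real.sqrt l * (W * N / a ^ 2)) ^ 2 := by
      have k1 := norm_integral_sq_le_sqInt hu.1 (h := φ'') (hw.memLp.mono_measure (Measure.restrict_mono
        (Ioo_subset_Ioo_right hu.2) le_rfl))
      refine k1.trans ?_
      have k2 : sqInt u φ'' ≤ sqInt ℓ φ'' :=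
        setIntegral_mono_set (integrable_norm_sq hw.memLp) (Filter.Eventually.of_forall fun _ => by positivity)
          (Ioo_subset_Ioo_right hu.2).eventuallyLE
      calc u * sqInt u φ'' ≤ ℓ * (W * N / a ^ 2) ^ 2 :=
            mul_le_mul hu.2 (k2.trans q3) (sqInt_nonneg _ _) hℓ0.le
        _ = _ := by rw [mul_pow (s * Real.sqrt l), mul_pow s, Real.sq_sqrt hl.le]
    have e2 := (sq_le_sq₀ (norm_nonneg _) (by positivity)).1 e1
    rw [hw.deriv_eq u hu]
    refine (norm_add_le _ _).trans ((add_le_add hd0 e2).trans (le_of_eq ?_))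
    rw [hC2]
    ring
  have hosc : ∀ u ∈ Icc 0 ℓ, ‖φ u - φ 0‖ ≤ ℓ * (C2 * s * N) := fun u hu => hw.norm_sub_le_of_deriv hℓ0.le hd h0m hu
  have hFi : IntervalIntegrable F volume 0 ℓ := by
    rw [intervalIntegrable_iff_integrableOn_Ioo_of_le hℓ0.le]
    exact hF.integrable (by norm_num)
  have hφi := hw.continuousOn.intervalIntegrable_of_Icc (μ := volume) hℓ0.le
  have hbal : (a : ℂ) ^ 2 * φ' ℓ - (a : ℂ) ^ 2 * φ' 0 = -(∫ u in (0 : ℝ)..ℓ, F u) - z * (ℓ * φ 0 + ∫ u in (0 : ℝ)..ℓ, (φ u - φ 0)) := by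
    have k1 : ∫ u in (0 : ℝ)..ℓ, (φ u - φ 0) = (∫ u in (0 : ℝ)..ℓ, φ u) - ℓ * φ 0 := by
      rw [intervalIntegral.integral_sub hφi (by simp), intervalIntegral.integral_const, sub_zero, real_smul]
    have k2 : ∫ u in (0 : ℝ)..ℓ, (F u + z * φ u) = ∫ u in (0 : ℝ)..ℓ, -(a : ℂ) ^ 2 * φ'' u := by
      rw [integral_Ioo_eq hℓ0.le, integral_Ioo_eq hℓ0.le]
      exact integral_congr_ae he
    rw [intervalIntegral.integral_add hFi (hφi.const_mul z), intervalIntegral.integral_const_mul,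
      intervalIntegral.integral_const_mul] at k2
    rw [k1, hw.deriv_eq ℓ h1m]
    linear_combination k2
  have hint : ‖∫ u in (0 : ℝ)..ℓ, (φ u - φ 0)‖ ≤ ℓ * (ℓ * (C2 * s * N)) := by
    refine (intervalIntegral.norm_integral_le_of_norm_le_const (C := ℓ * (C2 * s * N)) fun u hu => ?_).trans
      (le_of_eq (by rw [sub_zero, abs_of_pos hℓ0, mul_comm]))
    rw [uIoc_of_le hℓ0.le] at hu
    exact hosc u ⟨hu.1.le, hu.2⟩
  have hKz0 : K - z ≠ 0 := norm_pos_iff.1 (hδ.trans_le hKz)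
  have hℓc : (ℓ : ℂ) ≠ 0 := by exact_mod_cast hℓ0.ne'
  set E := ((s ^ 2 : ℝ) : ℂ) * (κ - β) * (φ ℓ - φ 0) + z * ∫ u in (0 : ℝ)..ℓ, (φ u - φ 0) with hE
  have hmain : ((ℓ : ℝ) : ℂ) * (K - z) * φ 0 = (∫ u in (0 : ℝ)..ℓ, F u) + E := by
    rw [hf0, hf1] at hbal
    have e1 : ((ℓ : ℝ) : ℂ) * K = ((s ^ 2 : ℝ) : ℂ) * (α + β - γ - κ) := by
      rw [← hK, hℓ]
      push_cast
      ring
    rw [hE]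
    linear_combination φ 0 * e1 - hbal
  have hEb : ‖E‖ ≤ ℓ * ((2 * B + M * l) * C2 * s ^ 3 * N) := by
    have k1 : ‖κ - β‖ ≤ 2 * B := (norm_sub_le _ _).trans (by linarith)
    have k2 : ‖((s ^ 2 : ℝ) : ℂ) * (κ - β) * (φ ℓ - φ 0)‖ ≤ s ^ 2 * (2 * B) * (ℓ * (C2 * s * N)) := by
      rw [norm_mul, norm_mul, norm_real, Real.norm_eq_abs, abs_of_pos (by positivity : 0 < s ^ 2)]
      gcongr
      exact hosc ℓ h1m
    have k3 : ‖z * ∫ u in (0 : ℝ)..ℓ, (φ u - φ 0)‖ ≤ M * (ℓ * (ℓ * (C2 * s * N))) := by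
      rw [norm_mul]
      gcongr
    refine (norm_add_le _ _).trans ((add_le_add k2 k3).trans (le_of_eq ?_))
    rw [hℓ]
    ring
  have h0 : φ 0 - (K - z)⁻¹ * (((ℓ : ℝ) : ℂ)⁻¹ * ∫ x in (0 : ℝ)..ℓ, F x) = (K - z)⁻¹ * (((ℓ : ℝ) : ℂ)⁻¹ * E) := by
    field_simp
    linear_combination hmain
  have h1 : ‖(K - z)⁻¹ * (((ℓ : ℝ) : ℂ)⁻¹ * E)‖ ≤ δ⁻¹ * ((2 * B + M * l) * C2 * s ^ 3 * N) := by
    rw [norm_mul, norm_mul, norm_inv, norm_inv, norm_real, Real.norm_eq_abs, abs_of_pos hℓ0]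
    have : ℓ⁻¹ * ‖E‖ ≤ (2 * B + M * l) * C2 * s ^ 3 * N := by
      rw [inv_mul_le_iff₀ hℓ0]; exact hEb
    gcongr
  have e3 : φ x - (K - z)⁻¹ * (((ℓ : ℝ) : ℂ)⁻¹ * ∫ x in (0 : ℝ)..ℓ, F x) =
      (φ x - φ 0) + (φ 0 - (K - z)⁻¹ * (((ℓ : ℝ) : ℂ)⁻¹ * ∫ x in (0 : ℝ)..ℓ, F x)) := by ring
  rw [e3, h0]
  refine (norm_add_le _ _).trans ((add_le_add (hosc x (Ioo_subset_Icc_self hx)) h1).trans (le_of_eq ?_))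
  rw [hℓ]
  ring

/-- The fluxes at the ends of a soft edge. -/
theorem Composite.FibreData.soft_flux {n : ℕ} {P : Composite n} {ε τ N : ℝ} {z : ℂ} {F φ φ' φ'' : Fin n → ℝ → ℂ}
    (h : P.FibreData ε τ z N F φ φ' φ'') (hε : 0 < ε) (hz : z.im ≠ 0) {e : Fin n} (hl : 0 < P.len e)
    (ha : 0 < P.coef e) (he : P.stiff e = false) {w : ℂ} (hw : w = ((P.len e / P.coef e : ℝ) : ℂ) * sqrtC z) :
    (P.coefEps ε e : ℂ) ^ 2 * φ' e 0 = (ε : ℂ) * (P.coef e * sqrtC z * (φ e (ε * P.len e) - φ e 0 * cos w) / sin w) ∧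
    (P.coefEps ε e : ℂ) ^ 2 * φ' e (ε * P.len e) =
      (ε : ℂ) * (P.coef e * sqrtC z * (φ e (ε * P.len e) * cos w - φ e 0) / sin w) := by
  have hc : (P.coefEps ε e : ℂ) = ε * P.coef e := by simp [Composite.coefEps, he]
  have hε' : (ε : ℂ) ≠ 0 := by exact_mod_cast hε.ne'
  have ha' : (P.coef e : ℂ) ≠ 0 := by exact_mod_cast ha.ne'
  have hk : sqrtC z / (ε * P.coef e) * ((ε * P.len e : ℝ) : ℂ) = w := by
    rw [hw]
    push_cast
    field_simp
  have hs : sin w ≠ 0 := by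
    rw [hw]
    exact sin_ne_zero_of_sq_im (half_angle_sq_im hz (div_pos hl ha).ne')
  have hd := (h.w22 e).end_deriv (mul_pos hε hl).le (k := sqrtC z / (ε * P.coef e)) (by rwa [hk]) (by
    filter_upwards [h.soft e he, h.eq e] with x h1 h2
    rw [h1, hc, zero_add] at h2
    rw [div_pow, sqrtC_sq]
    field_simp
    linear_combination h2)
  rw [hk] at hd
  rw [hd.1, hd.2, hc]
  constructor <;> field_simp

/-! ### The dispersion functions -/

theorem im_sqrtC_mul_tan_pos {z : ℂ} (hz : z.im ≠ 0) {p : ℝ} (hp : 0 < p) :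
    0 < z.im * (sqrtC z * tan (p * sqrtC z)).im := by
  have h := im_mul_tan_pos (half_angle_sq_im hz hp.ne')
  rw [mul_pow, sqrtC_sq, ← ofReal_pow, im_ofReal_mul, mul_assoc (p : ℂ), im_ofReal_mul] at h
  refine pos_of_mul_pos_right (a := p ^ 3) ?_ (by positivity)
  calc 0 < _ := h
    _ = _ := by ring

theorem im_sqrtC_mul_cot_neg {z : ℂ} (hz : z.im ≠ 0) {p : ℝ} (hp : 0 < p) :
    z.im * (sqrtC z * (cos (p * sqrtC z) / sin (p * sqrtC z))).im < 0 := by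
  have h := im_mul_cot_neg (half_angle_sq_im hz hp.ne')
  rw [mul_pow, sqrtC_sq, ← ofReal_pow, im_ofReal_mul, mul_assoc (p : ℂ), neg_im, im_ofReal_mul] at h
  refine neg_of_neg_pos (pos_of_mul_pos_right (a := p ^ 3) ?_ (by positivity))
  calc 0 < _ := h
    _ = _ := by ring

theorem im_sqrtC_mul_cos_sub_div_sin {z : ℂ} (hz : z.im ≠ 0) {p c : ℝ} (hp : 0 < p) (hc : |c| ≤ 1) :
    z.im * (sqrtC z * ((cos (p * sqrtC z) - c) / sin (p * sqrtC z))).im ≤ 0 := by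
  have hp2 : 0 < p / 2 := by positivity
  have hv := half_angle_sq_im hz hp2.ne'
  have hs := sin_ne_zero_of_sq_im hv
  have hco := cos_ne_zero_of_sq_im hv
  have h1 := im_sqrtC_mul_tan_pos hz hp2
  have h2 := im_sqrtC_mul_cot_neg hz hp2
  obtain ⟨k1, k2⟩ := cot_two_mul hs hco
  have e0 : 2 * (((p / 2 : ℝ) : ℂ) * sqrtC z) = p * sqrtC z := by push_cast; ring
  rw [e0] at k1 k2
  set v := ((p / 2 : ℝ) : ℂ) * sqrtC z
  have e1 : sqrtC z * ((cos (p * sqrtC z) - c) / sin (p * sqrtC z)) =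
      (((1 - c) / 2 : ℝ) : ℂ) * (sqrtC z * (cos v / sin v)) - (((1 + c) / 2 : ℝ) : ℂ) * (sqrtC z * tan v) := by
    push_cast
    linear_combination sqrtC z * ((1 + c) / 2 * k1 + (1 - c) / 2 * k2)
  rw [e1, sub_im, im_ofReal_mul, im_ofReal_mul]
  obtain ⟨c1, c2⟩ := abs_le.1 hc
  have m1 := mul_nonneg (by linarith : 0 ≤ (1 - c) / 2) (neg_nonneg.2 h2.le)
  have m2 := mul_nonneg (by linarith : 0 ≤ (1 + c) / 2) h1.le
  linarith

theorem abs_im_le_norm_sub {K z : ℂ} (h : z.im * K.im ≤ 0) : |z.im| ≤ ‖K - z‖ := by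
  refine le_trans ?_ (abs_im_le_norm _)
  rw [sub_im, ← sq_le_sq]
  nlinarith [sq_nonneg K.im]

theorem norm_inv_sub_le {K z : ℂ} (hz : z.im ≠ 0) (h : z.im * K.im ≤ 0) : ‖(K - z)⁻¹‖ ≤ |z.im|⁻¹ := by
  rw [norm_inv]
  exact inv_anti₀ (abs_pos.2 hz) (abs_im_le_norm_sub h)

theorem continuousAt_sqrtC {z : ℂ} (hz : z.im ≠ 0) : ContinuousAt sqrtC z :=
  continuousAt_cpow_const (Or.inr hz)

theorem exists_coef_bound {Z : Set ℂ} {δ : ℝ} (hZ : IsCompact Z) (hδ : 0 < δ) {p : ℝ} (hp : 0 < p) :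
    ∃ B : ℝ, 0 ≤ B ∧ ∀ z ∈ Z, δ ≤ |z.im| → ‖z‖ ≤ B ∧ ‖sqrtC z / sin (p * sqrtC z)‖ ≤ B ∧
      ‖sqrtC z * cos (p * sqrtC z) / sin (p * sqrtC z)‖ ≤ B := by
  have hS : IsCompact (Z ∩ {z : ℂ | δ ≤ |z.im|}) :=
    hZ.inter_right (isClosed_le continuous_const (continuous_abs.comp continuous_im))
  have him : ∀ z ∈ Z ∩ {z : ℂ | δ ≤ |z.im|}, z.im ≠ 0 := by
    rintro z ⟨-, hz⟩ h0
    rw [mem_ofPred_eq, h0, abs_zero] at hz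
    linarith
  have hsq : ContinuousOn sqrtC (Z ∩ {z : ℂ | δ ≤ |z.im|}) := fun z hz => (continuousAt_sqrtC (him z hz)).continuousWithinAt
  have hne : ∀ z ∈ Z ∩ {z : ℂ | δ ≤ |z.im|}, sin (p * sqrtC z) ≠ 0 := fun z hz =>
    sin_ne_zero_of_sq_im (half_angle_sq_im (him z hz) hp.ne')
  have hpq : ContinuousOn (fun z => (p : ℂ) * sqrtC z) (Z ∩ {z : ℂ | δ ≤ |z.im|}) := continuousOn_const.mul hsq
  have hsin := continuous_sin.comp_continuousOn hpq
  have hcos := continuous_cos.comp_continuousOn hpq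
  obtain ⟨B1, h1⟩ := hS.exists_bound_of_continuousOn (f := fun z : ℂ => z) continuousOn_id
  obtain ⟨B2, h2⟩ := hS.exists_bound_of_continuousOn (hsq.div hsin hne)
  obtain ⟨B3, h3⟩ := hS.exists_bound_of_continuousOn ((hsq.mul hcos).div hsin hne)
  refine ⟨max 0 (max B1 (max B2 B3)), le_max_left _ _, fun z hz hzδ => ⟨?_, ?_, ?_⟩⟩
  · exact (h1 z ⟨hz, hzδ⟩).trans (by simp)
  · exact (h2 z ⟨hz, hzδ⟩).trans (by simp)
  · exact (h3 z ⟨hz, hzδ⟩).trans (by simp)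

theorem exp_add_exp_neg (τ : ℝ) : exp (I * τ) + exp (-(I * τ)) = 2 * (Real.cos τ : ℂ) := by
  rw [ofReal_cos, Complex.two_cos, mul_comm I, neg_mul]

theorem exp_mul_exp_neg (τ : ℝ) : exp (I * τ) * exp (-(I * τ)) = 1 := by
  rw [← exp_add, add_neg_cancel, exp_zero]

theorem norm_exp_neg_I_mul (τ : ℝ) : ‖exp (-(I * τ))‖ = 1 := by
  have := norm_exp_I_mul (-τ)
  simpa using this

section

variable {l₁ l₂ l₃ a₁ a₂ a₃ : ℝ}

theorem dispersion0_eq (hl₁ : 0 < l₁) (τ : ℝ) (z : ℂ) : dispersion0 l₁ l₂ τ z =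
    ((2 / l₁ : ℝ) : ℂ) * (sqrtC z * ((cos (l₂ * sqrtC z) - (Real.cos τ : ℝ)) / sin (l₂ * sqrtC z))) := by
  rw [dispersion0, ofReal_div]
  have : (l₁ : ℂ) ≠ 0 := by exact_mod_cast hl₁.ne'
  simp only [div_eq_mul_inv, mul_inv]
  push_cast
  ring

theorem im_mul_dispersion0 (hl₁ : 0 < l₁) (hl₂ : 0 < l₂) (τ : ℝ) {z : ℂ} (hz : z.im ≠ 0) :
    z.im * (dispersion0 l₁ l₂ τ z).im ≤ 0 := by
  rw [dispersion0_eq hl₁, im_ofReal_mul, mul_left_comm]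
  exact mul_nonpos_of_nonneg_of_nonpos (by positivity)
    (im_sqrtC_mul_cos_sub_div_sin hz hl₂ (Real.abs_cos_le_one τ))

theorem dispersion2_eq (τ : ℝ) (z : ℂ) : dispersion2 l₁ l₂ l₃ a₁ a₂ τ z =
    ((2 / l₃ * a₁ : ℝ) : ℂ) * (sqrtC z * ((cos ((l₁ / a₁ : ℝ) * sqrtC z) - (Real.cos τ : ℝ)) / sin ((l₁ / a₁ : ℝ) * sqrtC z)))
      - ((2 / l₃ * a₂ : ℝ) : ℂ) * (sqrtC z * tan ((l₂ / (2 * a₂) : ℝ) * sqrtC z)) := by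
  have e1 : (l₁ : ℂ) * sqrtC z / a₁ = (l₁ / a₁ : ℝ) * sqrtC z := by push_cast; ring
  have e2 : (l₂ : ℂ) * sqrtC z / (2 * a₂) = (l₂ / (2 * a₂) : ℝ) * sqrtC z := by push_cast; ring
  rw [dispersion2, e1, e2]
  push_cast
  ring

theorem im_mul_dispersion2 (hl₁ : 0 < l₁) (hl₂ : 0 < l₂) (hl₃ : 0 < l₃) (ha₁ : 0 < a₁) (ha₂ : 0 < a₂) (τ : ℝ) {z : ℂ}
    (hz : z.im ≠ 0) : z.im * (dispersion2 l₁ l₂ l₃ a₁ a₂ τ z).im ≤ 0 := by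
  rw [dispersion2_eq, sub_im, im_ofReal_mul, im_ofReal_mul]
  have h1 := im_sqrtC_mul_cos_sub_div_sin hz (div_pos hl₁ ha₁) (Real.abs_cos_le_one τ)
  have h2 := im_sqrtC_mul_tan_pos hz (div_pos hl₂ (mul_pos two_pos ha₂))
  have h3 := mul_nonneg (by positivity : 0 ≤ 2 / l₃ * a₁) (neg_nonneg.2 h1)
  have h4 := mul_nonneg (by positivity : 0 ≤ 2 / l₃ * a₂) h2.le
  linarith

/-! ### The chain and the loop graph are admissible -/

theorem wellFormed_example0 (hl₁ : 0 < l₁) (hl₂ : 0 < l₂) (ha₁ : 0 < a₁) (h : l₁ + l₂ = 1) :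
    (example0 l₁ l₂ a₁).WellFormed where
  len_pos e := by fin_cases e <;> simpa [example0]
  coef_pos e := by fin_cases e <;> simp [example0, ha₁]
  pos_nonneg e := by fin_cases e <;> simp [example0, hl₁.le]
  end_le e := by fin_cases e <;> simp [example0] <;> linarith
  disj e e' hne := by
    fin_cases e <;> fin_cases e' <;> simp [example0] at hne ⊢
  cover x hx := by
    rcases lt_or_ge x l₁ with h1 | h1
    · exact ⟨0, by simpa [example0] using ⟨hx.1, h1⟩⟩
    · exact ⟨1, by simpa [example0, h] using ⟨h1, hx.2⟩⟩
  wt_eq := by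
    refine ⟨![l₁, 1], fun e b τ => ?_⟩
    fin_cases e <;> fin_cases b <;> simp [example0, h]

theorem wellFormed_loopGraph {a : Fin 3 → ℝ} {stiff : Fin 3 → Bool} (hl₁ : 0 < l₁) (hl₂ : 0 < l₂) (hl₃ : 0 < l₃)
    (ha : ∀ e, 0 < a e) (h : l₁ + l₂ + l₃ = 1) : (loopGraph l₁ l₂ l₃ a stiff).WellFormed where
  len_pos e := by fin_cases e <;> simpa [loopGraph]
  coef_pos := ha
  pos_nonneg e := by fin_cases e <;> simp [loopGraph] <;> linarith
  end_le e := by fin_cases e <;> simp [loopGraph] <;> linarith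
  disj e e' hne := by
    fin_cases e <;> fin_cases e' <;> simp [loopGraph] at hne ⊢ <;> first | (left; linarith) | (right; linarith)
  cover x hx := by
    rcases lt_or_ge x l₁ with h1 | h1
    · exact ⟨0, by simpa [loopGraph] using ⟨hx.1, h1⟩⟩
    · rcases lt_or_ge x (l₁ + l₂) with h2 | h2
      · exact ⟨1, by simpa [loopGraph] using ⟨h1, h2⟩⟩
      · exact ⟨2, by simpa [loopGraph, h] using ⟨h2, hx.2⟩⟩
  wt_eq := by
    have h3 : l₃ = 1 - l₁ - l₂ := by linarith
    refine ⟨![l₁, l₁ + l₂], fun e b τ => ?_⟩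
    fin_cases e <;> fin_cases b <;> simp [loopGraph, h3] <;> ring_nf

/-! ### Asymptotics in the case of a single stiff edge -/

theorem stiffDispersiveAsymptotics_example0 (hl₁ : 0 < l₁) (hl₂ : 0 < l₂) (ha₁ : 0 < a₁) (h : l₁ + l₂ = 1) :
    (example0 l₁ l₂ a₁).StiffDispersiveAsymptotics (fun _ τ z => dispersion0 l₁ l₂ τ z) 2 := by
  have hW := wellFormed_example0 hl₁ hl₂ ha₁ h
  have hLe : (example0 l₁ l₂ a₁).stiffLength = l₁ := by simp [Composite.stiffLength, example0]
  have hL : 0 < (example0 l₁ l₂ a₁).stiffLength := by rw [hLe]; exact hl₁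
  refine hW.stiffDispersiveAsymptotics hL (fun _ z => ?_)
    (fun z hz => ⟨|z.im|⁻¹, fun _ τ => norm_inv_sub_le hz (im_mul_dispersion0 hl₁ hl₂ τ hz)⟩) fun Z δ hZ hδ => ?_
  · unfold dispersion0
    fun_prop
  obtain ⟨B, hB0, hB⟩ := exists_coef_bound hZ hδ hl₂
  obtain ⟨C, hC0, hC⟩ := exists_single_edge_bound hl₁ ha₁ hδ hB0 hB0
  refine ⟨Real.sqrt l₁ * C, 1, by positivity, one_pos, fun ε hε hε1 z hz hzδ t _ R hR f => ?_⟩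
  obtain ⟨hzB, hb1, hb2⟩ := hB z hz hzδ
  have hz0 : z.im ≠ 0 := fun h0 => by rw [h0, abs_zero] at hzδ; linarith
  have hs0 : 0 < Real.sqrt ε := Real.sqrt_pos.2 hε
  have hs2 : Real.sqrt ε ^ 2 = ε := Real.sq_sqrt hε.le
  have hs1 : Real.sqrt ε ≤ 1 := Real.sqrt_le_one.2 hε1
  refine (hW.norm_sub_rankOneOp_le hε hL (B := C * Real.sqrt ε ^ 3) (by positivity) ?_ hR f).trans (le_of_eq ?_)
  · intro N F φ φ' φ'' hN d e he x hx
    have he0 : e = 0 := by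
      fin_cases e
      · rfl
      · simp [example0] at he
    subst he0
    set τ := ε * t
    have c0 : exp (I * τ) * φ 0 0 = φ 1 (ε * l₂) := by simpa [example0] using d.cont 0 0 1 1 rfl
    have c1 : φ 0 (ε * l₁) = φ 1 0 := by simpa [example0] using d.cont 0 1 1 0 rfl
    set w := (l₂ : ℂ) * sqrtC z with hw
    have hsin : sin w ≠ 0 := sin_ne_zero_of_sq_im (half_angle_sq_im hz0 hl₂.ne')
    have hf := d.soft_flux (e := 1) (w := w) hε hz0 hl₂ one_pos rfl (by simp [example0, hw])
    have f0 : (ε : ℂ) ^ 2 * φ' 1 0 = ε * (sqrtC z * (φ 1 (ε * l₂) - φ 1 0 * cos w) / sin w) := by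
      simpa [Composite.coefEps, example0] using hf.1
    have f1 : (ε : ℂ) ^ 2 * φ' 1 (ε * l₂) = ε * (sqrtC z * (φ 1 (ε * l₂) * cos w - φ 1 0) / sin w) := by
      simpa [Composite.coefEps, example0] using hf.2
    have k0 : -((a₁ : ℂ) ^ 2 * φ' 0 (ε * l₁)) + (ε : ℂ) ^ 2 * φ' 1 0 = 0 := by
      simpa [Fin.sum_univ_two, MetricGraph.endSign, Composite.coefEps, example0] using d.kirchhoff 0
    have k1 : exp (I * τ) * ((a₁ : ℂ) ^ 2 * φ' 0 0) + -((ε : ℂ) ^ 2 * φ' 1 (ε * l₂)) = 0 := by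
      simpa [Fin.sum_univ_two, MetricGraph.endSign, Composite.coefEps, example0] using d.kirchhoff 1
    have hxy := exp_mul_exp_neg τ
    have H := hC (Real.sqrt ε) N z (dispersion0 l₁ l₂ τ z) (sqrtC z * cos w / sin w)
      (-(exp (-(I * τ)) * (sqrtC z / sin w))) (exp (I * τ) * (sqrtC z / sin w)) (-(sqrtC z * cos w / sin w))
      (F 0) (φ 0) (φ' 0) (φ'' 0) hs0 hs1 hN hzδ hzB hb2 (by rwa [norm_neg, norm_mul, norm_exp_neg_I_mul, one_mul])
      (by rwa [norm_mul, norm_exp_I_mul, one_mul]) (by rwa [norm_neg])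
    rw [hs2] at H
    have H' := H ?_ (hzδ.trans (abs_im_le_norm_sub (im_mul_dispersion0 hl₁ hl₂ τ hz0))) (d.w22 0) (d.memLp 0) ?_
      (d.load 0) (d.size 0) ?_ ?_ ?_ x hx
    · rw [hLe]
      simpa [Fin.sum_univ_two, example0] using H'
    · have : (l₁ : ℂ) ≠ 0 := by exact_mod_cast hl₁.ne'
      rw [dispersion0, ← hw]
      field_simp
      linear_combination sqrtC z * exp_add_exp_neg τ
    · simpa [Composite.coefEps, example0] using d.eq 0
    · simpa [Composite.coefEps, example0] using d.energy 0
    · rw [f1, ← c0, ← c1] at k1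
      linear_combination exp (-(I * τ)) * k1 + ((ε : ℂ) * (sqrtC z * cos w / sin w) * φ 0 0 - (a₁ : ℂ) ^ 2 * φ' 0 0) * hxy
    · rw [f0, ← c0, ← c1] at k0
      linear_combination -k0
  · rw [hLe, Real.sqrt_mul hε.le]
    calc _ = Real.sqrt l₁ * C * (Real.sqrt ε ^ 2) ^ 2 * ‖f‖ := by ring
      _ = _ := by rw [hs2]

theorem stiffDispersiveAsymptotics_example2 (hl₁ : 0 < l₁) (hl₂ : 0 < l₂) (hl₃ : 0 < l₃) (ha₁ : 0 < a₁) (ha₂ : 0 < a₂)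
    (ha₃ : 0 < a₃) (h : l₁ + l₂ + l₃ = 1) : (example2 l₁ l₂ l₃ a₁ a₂ a₃).StiffDispersiveAsymptotics
      (fun _ τ z => dispersion2 l₁ l₂ l₃ a₁ a₂ τ z) 2 := by
  have hW : (example2 l₁ l₂ l₃ a₁ a₂ a₃).WellFormed :=
    wellFormed_loopGraph hl₁ hl₂ hl₃ (fun e => by fin_cases e <;> simpa) h
  have hLe : (example2 l₁ l₂ l₃ a₁ a₂ a₃).stiffLength = l₃ := by
    simp [Composite.stiffLength, example2, loopGraph, Fin.sum_univ_three]
  have hL : 0 < (example2 l₁ l₂ l₃ a₁ a₂ a₃).stiffLength := by rw [hLe]; exact hl₃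
  have hp₁ : 0 < l₁ / a₁ := div_pos hl₁ ha₁
  have hp₂ : 0 < l₂ / a₂ := div_pos hl₂ ha₂
  refine hW.stiffDispersiveAsymptotics hL (fun _ z => ?_) (fun z hz => ⟨|z.im|⁻¹, fun _ τ =>
    norm_inv_sub_le hz (im_mul_dispersion2 hl₁ hl₂ hl₃ ha₁ ha₂ τ hz)⟩) fun Z δ hZ hδ => ?_
  · unfold dispersion2
    fun_prop
  obtain ⟨B₁, hB₁0, hB₁⟩ := exists_coef_bound hZ hδ hp₁
  obtain ⟨B₂, hB₂0, hB₂⟩ := exists_coef_bound hZ hδ hp₂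
  obtain ⟨C, hC0, hC⟩ := exists_single_edge_bound (B := a₁ * B₁ + a₂ * B₂) hl₃ ha₃ hδ (by positivity) hB₁0
  refine ⟨Real.sqrt l₃ * C, 1, by positivity, one_pos, fun ε hε hε1 z hz hzδ t _ R hR f => ?_⟩
  obtain ⟨hzB, hb1, hb2⟩ := hB₁ z hz hzδ
  obtain ⟨-, hb3, hb4⟩ := hB₂ z hz hzδ
  have hz0 : z.im ≠ 0 := fun h0 => by rw [h0, abs_zero] at hzδ; linarith
  have hs0 : 0 < Real.sqrt ε := Real.sqrt_pos.2 hε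
  have hs2 : Real.sqrt ε ^ 2 = ε := Real.sq_sqrt hε.le
  have hs1 : Real.sqrt ε ≤ 1 := Real.sqrt_le_one.2 hε1
  refine (hW.norm_sub_rankOneOp_le hε hL (B := C * Real.sqrt ε ^ 3) (by positivity) ?_ hR f).trans (le_of_eq ?_)
  · intro N F φ φ' φ'' hN d e he x hx
    have he0 : e = 2 := by
      fin_cases e
      · simp [example2, loopGraph] at he
      · simp [example2, loopGraph] at he
      · rfl
    subst he0
    set τ := ε * t
    have c0 : exp (I * τ) * φ 0 0 = φ 2 0 := by simpa [example2, loopGraph] using d.cont 0 0 2 0 rfl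
    have c1 : φ 0 (ε * l₁) = φ 2 (ε * l₃) := by simpa [example2, loopGraph] using d.cont 0 1 2 1 rfl
    have c2 : φ 1 0 = φ 2 (ε * l₃) := by simpa [example2, loopGraph] using d.cont 1 0 2 1 rfl
    have c3 : φ 1 (ε * l₂) = φ 2 0 := by simpa [example2, loopGraph] using d.cont 1 1 2 0 rfl
    have hxy := exp_mul_exp_neg τ
    have c0' : φ 0 0 = exp (-(I * τ)) * φ 2 0 := by linear_combination exp (-(I * τ)) * c0 - φ 0 0 * hxy
    set w₁ := ((l₁ / a₁ : ℝ) : ℂ) * sqrtC z with hw₁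
    set w₂ := ((l₂ / a₂ : ℝ) : ℂ) * sqrtC z with hw₂
    have hf₁ := d.soft_flux (e := 0) (w := w₁) hε hz0 hl₁ ha₁ rfl (by simp [example2, loopGraph, hw₁])
    have hf₂ := d.soft_flux (e := 1) (w := w₂) hε hz0 hl₂ ha₂ rfl (by simp [example2, loopGraph, hw₂])
    have f0 : ((ε : ℂ) * a₁) ^ 2 * φ' 0 0 = ε * (a₁ * sqrtC z * (φ 0 (ε * l₁) - φ 0 0 * cos w₁) / sin w₁) := by
      simpa [Composite.coefEps, example2, loopGraph] using hf₁.1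
    have f1 : ((ε : ℂ) * a₁) ^ 2 * φ' 0 (ε * l₁) = ε * (a₁ * sqrtC z * (φ 0 (ε * l₁) * cos w₁ - φ 0 0) / sin w₁) := by
      simpa [Composite.coefEps, example2, loopGraph] using hf₁.2
    have f2 : ((ε : ℂ) * a₂) ^ 2 * φ' 1 0 = ε * (a₂ * sqrtC z * (φ 1 (ε * l₂) - φ 1 0 * cos w₂) / sin w₂) := by
      simpa [Composite.coefEps, example2, loopGraph] using hf₂.1
    have f3 : ((ε : ℂ) * a₂) ^ 2 * φ' 1 (ε * l₂) = ε * (a₂ * sqrtC z * (φ 1 (ε * l₂) * cos w₂ - φ 1 0) / sin w₂) := by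
      simpa [Composite.coefEps, example2, loopGraph] using hf₂.2
    have k0 : -(((ε : ℂ) * a₁) ^ 2 * φ' 0 (ε * l₁)) + ((ε : ℂ) * a₂) ^ 2 * φ' 1 0 + -((a₃ : ℂ) ^ 2 * φ' 2 (ε * l₃)) = 0 := by
      simpa [Fin.sum_univ_three, MetricGraph.endSign, Composite.coefEps, example2, loopGraph] using d.kirchhoff 0
    have k1 : exp (I * τ) * (((ε : ℂ) * a₁) ^ 2 * φ' 0 0) + -(((ε : ℂ) * a₂) ^ 2 * φ' 1 (ε * l₂)) +
        (a₃ : ℂ) ^ 2 * φ' 2 0 = 0 := by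
      simpa [Fin.sum_univ_three, MetricGraph.endSign, Composite.coefEps, example2, loopGraph] using d.kirchhoff 1
    have na₁ : ‖(a₁ : ℂ)‖ = a₁ := by rw [norm_real, Real.norm_eq_abs, abs_of_pos ha₁]
    have na₂ : ‖(a₂ : ℂ)‖ = a₂ := by rw [norm_real, Real.norm_eq_abs, abs_of_pos ha₂]
    have bound : ∀ (θ u v : ℂ), ‖θ‖ = 1 → ‖u‖ ≤ B₁ → ‖v‖ ≤ B₂ → ‖θ * (a₁ * u) + a₂ * v‖ ≤ a₁ * B₁ + a₂ * B₂ := by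
      intro θ u v hθ hu hv
      refine (norm_add_le _ _).trans ?_
      rw [norm_mul, norm_mul, norm_mul, hθ, na₁, na₂, one_mul]
      gcongr
    have H := hC (Real.sqrt ε) N z (dispersion2 l₁ l₂ l₃ a₁ a₂ τ z)
      (1 * (a₁ * (sqrtC z * cos w₁ / sin w₁)) + a₂ * (sqrtC z * cos w₂ / sin w₂))
      (-(exp (I * τ) * (a₁ * (sqrtC z / sin w₁)) + a₂ * (sqrtC z / sin w₂)))
      (exp (-(I * τ)) * (a₁ * (sqrtC z / sin w₁)) + a₂ * (sqrtC z / sin w₂))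
      (-(1 * (a₁ * (sqrtC z * cos w₁ / sin w₁)) + a₂ * (sqrtC z * cos w₂ / sin w₂)))
      (F 2) (φ 2) (φ' 2) (φ'' 2) hs0 hs1 hN hzδ hzB (bound _ _ _ norm_one hb2 hb4)
      (by rw [norm_neg]; exact bound _ _ _ (norm_exp_I_mul τ) hb1 hb3)
      (bound _ _ _ (norm_exp_neg_I_mul τ) hb1 hb3) (by rw [norm_neg]; exact bound _ _ _ norm_one hb2 hb4)
    rw [hs2] at H
    have H' := H ?_ (hzδ.trans (abs_im_le_norm_sub (im_mul_dispersion2 hl₁ hl₂ hl₃ ha₁ ha₂ τ hz0))) (d.w22 2) (d.memLp 2) ?_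
      (d.load 2) (d.size 2) ?_ ?_ ?_ x hx
    · rw [hLe]
      simpa [Fin.sum_univ_three, example2, loopGraph] using H'
    · have e0 : (l₃ : ℂ) ≠ 0 := by exact_mod_cast hl₃.ne'
      have hv := half_angle_sq_im hz0 (div_pos hl₂ (mul_pos two_pos ha₂)).ne'
      have e1 : ((l₂ / (2 * a₂) : ℝ) : ℂ) * sqrtC z = w₂ / 2 := by rw [hw₂]; push_cast; ring
      have e2 := (cot_two_mul (sin_ne_zero_of_sq_im hv) (cos_ne_zero_of_sq_im hv)).1
      rw [e1, mul_div_cancel₀ _ (two_ne_zero (α := ℂ))] at e2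
      have e3 := exp_add_exp_neg τ
      rw [dispersion2_eq, ← hw₁, e1]
      push_cast at e3 ⊢
      field_simp
      linear_combination a₁ * sqrtC z / sin w₁ * e3 - 2 * a₂ * sqrtC z * e2
    · simpa [Composite.coefEps, example2, loopGraph] using d.eq 2
    · simpa [Composite.coefEps, example2, loopGraph] using d.energy 2
    · rw [f0, f3, c1, c2, c3, c0'] at k1
      linear_combination k1 + (ε : ℂ) * (a₁ * (sqrtC z * cos w₁ / sin w₁)) * φ 2 0 * hxy
    · rw [f1, f2, c1, c2, c3, c0'] at k0
      linear_combination -k0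
  · rw [hLe, Real.sqrt_mul hε.le]
    calc _ = Real.sqrt l₃ * C * (Real.sqrt ε ^ 2) ^ 2 * ‖f‖ := by ring
      _ = _ := by rw [hs2]

end

/-! ### The phase `θ(τ)` -/

theorem norm_exp_neg_I_mul_sub_one_le (τ : ℝ) : ‖exp (-I * τ) - 1‖ ≤ |τ| := by
  have := Real.norm_exp_I_mul_ofReal_sub_one_le (x := -τ)
  rw [norm_neg, Real.norm_eq_abs] at this
  rwa [show -I * (τ : ℂ) = I * ((-τ : ℝ) : ℂ) by push_cast; ring]

theorem abs_le_norm_exp_neg_I_mul_sub_one {τ : ℝ} (hτ : |τ| ≤ Real.pi) : 2 / Real.pi * |τ| ≤ ‖exp (-I * τ) - 1‖ := by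
  have h1 := Complex.norm_exp_I_mul_ofReal_sub_one (-τ)
  rw [show -I * (τ : ℂ) = I * ((-τ : ℝ) : ℂ) by push_cast; ring, h1, norm_mul, Real.norm_two, Real.norm_eq_abs]
  have h2 : |(-τ) / 2| = |τ| / 2 := by rw [abs_div, abs_neg, abs_two]
  have h3 := Real.mul_abs_le_abs_sin (x := (-τ) / 2) (by rw [h2]; linarith)
  rw [h2] at h3
  linarith

theorem abs_one_sub_cos_sub_le (τ : ℝ) : |(1 - Real.cos τ) - τ ^ 2 / 2| ≤ τ ^ 4 / 2 := by
  rcases le_or_gt |τ| 1 with h | h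
  · have h1 := Real.cos_bound h
    rw [abs_sub_comm] at h1
    have h2 : |τ| ^ 4 = τ ^ 4 := (even_two_mul 2).pow_abs τ
    rw [h2] at h1
    have h3 : (1 - Real.cos τ) - τ ^ 2 / 2 = 1 - τ ^ 2 / 2 - Real.cos τ := by ring
    rw [h3]
    have : 0 ≤ τ ^ 4 := by positivity
    linarith
  · have h1 := Real.one_sub_sq_div_two_le_cos (x := τ)
    have h2 := Real.cos_le_one τ
    have h3 : 1 ≤ τ ^ 2 := by
      rw [← sq_abs]; nlinarith
    rw [abs_le]
    constructor <;> nlinarith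

section

variable {κ₁ κ₃ : ℝ}

/-- `ζ(τ) = κ₁ exp (-iτ) + κ₃`. -/
def zetaC (κ₁ κ₃ τ : ℝ) : ℂ := (κ₁ : ℂ) * exp (-I * τ) + (κ₃ : ℂ)

theorem thetaPhase_eq (l₁ l₃ a₁ a₃ τ : ℝ) : thetaPhase l₁ l₃ a₁ a₃ τ =
    zetaC (a₁ ^ 2 / l₁) (a₃ ^ 2 / l₃) τ / ((‖zetaC (a₁ ^ 2 / l₁) (a₃ ^ 2 / l₃) τ‖ : ℝ) : ℂ) := rfl

theorem norm_zetaC_sq (κ₁ κ₃ τ : ℝ) :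
    ‖zetaC κ₁ κ₃ τ‖ ^ 2 = (κ₁ + κ₃) ^ 2 - 2 * κ₁ * κ₃ * (1 - Real.cos τ) := by
  have h1 : zetaC κ₁ κ₃ τ = ((κ₁ * Real.cos τ + κ₃ : ℝ) : ℂ) + ((-(κ₁ * Real.sin τ) : ℝ) : ℂ) * I := by
    have : exp (-I * τ) = cos τ - sin τ * I := by
      rw [show -I * (τ : ℂ) = (-(τ : ℂ)) * I by ring, exp_mul_I, cos_neg, sin_neg]
      ring
    rw [zetaC, this]
    push_cast
    ring
  rw [← normSq_eq_norm_sq, h1, normSq_add_mul_I]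
  linear_combination κ₁ ^ 2 * Real.sin_sq_add_cos_sq τ

theorem norm_zetaC_le (h₁ : 0 < κ₁) (h₃ : 0 < κ₃) (τ : ℝ) : ‖zetaC κ₁ κ₃ τ‖ ≤ κ₁ + κ₃ := by
  refine (sq_le_sq₀ (norm_nonneg _) (by positivity)).1 ?_
  rw [norm_zetaC_sq]
  have : 0 ≤ 2 * κ₁ * κ₃ * (1 - Real.cos τ) := mul_nonneg (by positivity) (by linarith [Real.cos_le_one τ])
  linarith

theorem zetaC_ne_zero (h₁ : 0 < κ₁) (h₃ : 0 < κ₃) {τ : ℝ} (hτ : |τ| < Real.pi) : zetaC κ₁ κ₃ τ ≠ 0 := by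
  intro h0
  have h := norm_zetaC_sq κ₁ κ₃ τ
  rw [h0, norm_zero] at h
  have h2 : -1 < Real.cos τ := by
    rw [← Real.cos_abs, ← Real.cos_pi]
    exact Real.cos_lt_cos_of_nonneg_of_le_pi (abs_nonneg τ) le_rfl hτ
  have h3 : 0 < κ₁ * κ₃ := mul_pos h₁ h₃
  nlinarith [sq_nonneg (κ₁ - κ₃)]

theorem norm_div_norm_le (ζ : ℂ) : ‖ζ / ((‖ζ‖ : ℝ) : ℂ)‖ ≤ 1 := by
  rw [norm_div, norm_real, norm_norm]
  exact div_self_le_one _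

theorem norm_zeta_phase_sub_one_le (h₁ : 0 < κ₁) (h₃ : 0 < κ₃) (τ : ℝ) :
    ‖zetaC κ₁ κ₃ τ / ((‖zetaC κ₁ κ₃ τ‖ : ℝ) : ℂ) - 1‖ ≤ 4 * κ₁ / (κ₁ + κ₃) * |τ| := by
  set ζ := zetaC κ₁ κ₃ τ with hζ
  have e0 : ζ - ((κ₁ + κ₃ : ℝ) : ℂ) = κ₁ * (exp (-I * τ) - 1) := by
    rw [hζ, zetaC]; push_cast; ring
  have e1 : ‖ζ - ((κ₁ + κ₃ : ℝ) : ℂ)‖ ≤ κ₁ * |τ| := by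
    rw [e0, norm_mul, norm_real, Real.norm_eq_abs, abs_of_pos h₁]
    exact mul_le_mul_of_nonneg_left (norm_exp_neg_I_mul_sub_one_le τ) h₁.le
  have e2 : |‖ζ‖ - (κ₁ + κ₃)| ≤ κ₁ * |τ| := by
    have := abs_norm_sub_norm_le ζ ((κ₁ + κ₃ : ℝ) : ℂ)
    rw [norm_real, Real.norm_eq_abs, abs_of_pos (add_pos h₁ h₃)] at this
    exact this.trans e1
  set d := ‖ζ / ((‖ζ‖ : ℝ) : ℂ) - 1‖ with hd
  have e3 : d ≤ 2 := (norm_sub_le _ _).trans (by rw [norm_one]; linarith [norm_div_norm_le ζ])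
  have e4 : ‖ζ‖ * d ≤ 2 * (κ₁ * |τ|) := by
    have k1 : ‖ζ‖ * d = ‖ζ - ((‖ζ‖ : ℝ) : ℂ)‖ := by
      by_cases h0 : ζ = 0
      · simp [h0]
      · have h0' : ((‖ζ‖ : ℝ) : ℂ) ≠ 0 := by exact_mod_cast (norm_pos_iff.2 h0).ne'
        have k2 : ζ - ((‖ζ‖ : ℝ) : ℂ) = ((‖ζ‖ : ℝ) : ℂ) * (ζ / ((‖ζ‖ : ℝ) : ℂ) - 1) := by
          field_simp
        rw [k2, norm_mul, norm_real, norm_norm]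
    rw [k1]
    have k3 : ζ - ((‖ζ‖ : ℝ) : ℂ) = (ζ - ((κ₁ + κ₃ : ℝ) : ℂ)) - ((‖ζ‖ - (κ₁ + κ₃) : ℝ) : ℂ) := by push_cast; ring
    rw [k3]
    refine (norm_sub_le _ _).trans ?_
    rw [norm_real, Real.norm_eq_abs]
    linarith
  rw [div_mul_eq_mul_div, le_div_iff₀ (add_pos h₁ h₃)]
  have e5 : κ₁ + κ₃ ≤ ‖ζ‖ + κ₁ * |τ| := by linarith [(abs_le.1 e2).1]
  have hd0 : 0 ≤ d := norm_nonneg _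
  have hk : 0 ≤ κ₁ * |τ| := by positivity
  calc d * (κ₁ + κ₃) ≤ d * (‖ζ‖ + κ₁ * |τ|) := by gcongr
    _ = ‖ζ‖ * d + d * (κ₁ * |τ|) := by ring
    _ ≤ 2 * (κ₁ * |τ|) + 2 * (κ₁ * |τ|) := by gcongr
    _ = _ := by ring

theorem abs_zeta_phase_re_le (κ₁ κ₃ τ : ℝ) : |(zetaC κ₁ κ₃ τ / ((‖zetaC κ₁ κ₃ τ‖ : ℝ) : ℂ)).re| ≤ 1 :=
  (abs_re_le_norm _).trans (norm_div_norm_le _)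

theorem abs_one_sub_zeta_phase_re_le (h₁ : 0 < κ₁) (h₃ : 0 < κ₃) (τ : ℝ) :
    |1 - (zetaC κ₁ κ₃ τ / ((‖zetaC κ₁ κ₃ τ‖ : ℝ) : ℂ)).re| ≤ (4 * κ₁ / (κ₁ + κ₃)) ^ 2 * τ ^ 2 := by
  have h := norm_zeta_phase_sub_one_le h₁ h₃ τ
  have h2 := norm_div_norm_le (zetaC κ₁ κ₃ τ)
  have h4 := abs_zeta_phase_re_le κ₁ κ₃ τ
  have h5 : zetaC κ₁ κ₃ τ = 0 ∨ ‖zetaC κ₁ κ₃ τ / ((‖zetaC κ₁ κ₃ τ‖ : ℝ) : ℂ)‖ = 1 := by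
    by_cases h0 : zetaC κ₁ κ₃ τ = 0
    · exact Or.inl h0
    · right
      rw [norm_div, norm_real, norm_norm, div_self (norm_pos_iff.2 h0).ne']
  set θ := zetaC κ₁ κ₃ τ / ((‖zetaC κ₁ κ₃ τ‖ : ℝ) : ℂ) with hθ
  have h6 : 1 - θ.re ≤ ‖θ - 1‖ ^ 2 := by
    have k1 : ‖θ - 1‖ ^ 2 = ‖θ‖ ^ 2 - 2 * θ.re + 1 := by
      rw [← normSq_eq_norm_sq, ← normSq_eq_norm_sq, normSq_apply, normSq_apply, sub_re, sub_im, one_re, one_im]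
      ring
    rcases h5 with h0 | h0
    · have : θ = 0 := by rw [hθ, h0, zero_div]
      simp [this]
    · rw [k1, h0]
      linarith [(abs_le.1 h4).2]
  rw [abs_of_nonneg (by linarith [(abs_le.1 h4).2])]
  calc _ ≤ _ := h6
    _ ≤ (4 * κ₁ / (κ₁ + κ₃) * |τ|) ^ 2 := by gcongr
    _ = _ := by rw [mul_pow, sq_abs]

theorem zeta_gap_bounds (h₁ : 0 < κ₁) (h₃ : 0 < κ₃) (τ : ℝ) :
    (|τ| ≤ Real.pi → κ₁ * κ₃ / (κ₁ + κ₃) * (2 / Real.pi ^ 2 * τ ^ 2) ≤ κ₁ + κ₃ - ‖zetaC κ₁ κ₃ τ‖) ∧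
    |2 * (κ₁ + κ₃ - ‖zetaC κ₁ κ₃ τ‖) - κ₁ * κ₃ / (κ₁ + κ₃) * τ ^ 2| ≤
      (κ₁ * κ₃ / (κ₁ + κ₃) + (κ₁ * κ₃ / (κ₁ + κ₃)) ^ 2 / (κ₁ + κ₃)) * τ ^ 4 := by
  have hle := norm_zetaC_le h₁ h₃ τ
  have hsq := norm_zetaC_sq κ₁ κ₃ τ
  have hn := norm_nonneg (zetaC κ₁ κ₃ τ)
  have hs : 0 < κ₁ + κ₃ := add_pos h₁ h₃
  set s := κ₁ + κ₃ with hsdef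
  set n := ‖zetaC κ₁ κ₃ τ‖
  set σ := κ₁ * κ₃ / s with hσ
  set c := 1 - Real.cos τ with hc
  have hσ0 : 0 < σ := by positivity
  have hσs : κ₁ * κ₃ = σ * s := by rw [hσ]; field_simp
  have hc0 : 0 ≤ c := by rw [hc]; linarith [Real.cos_le_one τ]
  have e1 : (s - n) * (s + n) = 2 * (σ * s) * c := by rw [← hσs]; linear_combination -hsq
  have lower : σ * c ≤ s - n := by
    have k1 : (s - n) * (s + n) ≤ (s - n) * (2 * s) := mul_le_mul_of_nonneg_left (by linarith) (by linarith)
    have k2 : σ * c * (2 * s) ≤ (s - n) * (2 * s) := by linarith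
    exact le_of_mul_le_mul_right k2 (by linarith)
  have upper : s - n ≤ σ * τ ^ 2 := by
    have k1 : (s - n) * s ≤ (s - n) * (s + n) := mul_le_mul_of_nonneg_left (by linarith) (by linarith)
    have k2 : c ≤ τ ^ 2 / 2 := by rw [hc]; linarith [Real.one_sub_sq_div_two_le_cos (x := τ)]
    have k3 : (s - n) * s ≤ σ * τ ^ 2 * s := by
      have := mul_le_mul_of_nonneg_left k2 (by positivity : 0 ≤ 2 * (σ * s))
      linarith
    exact le_of_mul_le_mul_right k3 hs
  constructor
  · intro hτ
    refine le_trans (mul_le_mul_of_nonneg_left ?_ hσ0.le) lower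
    have := Real.cos_le_one_sub_mul_cos_sq hτ
    rw [hc]; linarith
  · have e2 : 2 * (s - n) - σ * τ ^ 2 = 2 * σ * (c - τ ^ 2 / 2) + (s - n) ^ 2 / s := by
      field_simp
      linear_combination e1
    rw [e2]
    have k1 : |2 * σ * (c - τ ^ 2 / 2)| ≤ σ * τ ^ 4 := by
      rw [abs_mul, abs_of_pos (by positivity)]
      have := mul_le_mul_of_nonneg_left (abs_one_sub_cos_sub_le τ) (by positivity : 0 ≤ 2 * σ)
      linarith
    have k2 : |(s - n) ^ 2 / s| ≤ σ ^ 2 / s * τ ^ 4 := by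
      rw [abs_of_nonneg (by positivity)]
      have : (s - n) ^ 2 ≤ (σ * τ ^ 2) ^ 2 := pow_le_pow_left₀ (by linarith) upper 2
      calc (s - n) ^ 2 / s ≤ (σ * τ ^ 2) ^ 2 / s := by gcongr
        _ = _ := by ring
    calc _ ≤ _ := abs_add_le _ _
      _ ≤ σ * τ ^ 4 + σ ^ 2 / s * τ ^ 4 := add_le_add k1 k2
      _ = _ := by ring

end

section

variable {l₁ l₂ l₃ a₁ a₃ : ℝ}

theorem sigmaSq_eq (hl₁ : 0 < l₁) (hl₃ : 0 < l₃) (ha₁ : 0 < a₁) (ha₃ : 0 < a₃) : sigmaSq l₁ l₃ a₁ a₃ =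
    (a₁ ^ 2 / l₁) * (a₃ ^ 2 / l₃) / (a₁ ^ 2 / l₁ + a₃ ^ 2 / l₃) := by
  rw [sigmaSq]
  field_simp
  ring

theorem sigmaSq_pos (hl₁ : 0 < l₁) (hl₃ : 0 < l₃) (ha₁ : 0 < a₁) (ha₃ : 0 < a₃) : 0 < sigmaSq l₁ l₃ a₁ a₃ := by
  unfold sigmaSq; positivity

/-- The dispersion function with `ρ` in place of the real part of the phase, and `X` in place of the kinetic term. -/
def loopSymbol (L l₂ ρ X : ℝ) (z : ℂ) : ℂ :=
  ((2 / L : ℝ) : ℂ) * (sqrtC z * ((cos (l₂ * sqrtC z) - (ρ : ℂ)) / sin (l₂ * sqrtC z))) + ((X / L : ℝ) : ℂ)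

theorem dispersion1_eq (l₁ l₂ l₃ a₁ a₃ ε τ : ℝ) (z : ℂ) : dispersion1 l₁ l₂ l₃ a₁ a₃ ε τ z =
    loopSymbol (l₁ + l₃) l₂ (thetaPhase l₁ l₃ a₁ a₃ τ).re (sigmaSq l₁ l₃ a₁ a₃ * (τ / ε) ^ 2) z := by
  rw [dispersion1, loopSymbol]
  push_cast
  ring

theorem im_mul_loopSymbol {L ρ : ℝ} (hL : 0 < L) (hl₂ : 0 < l₂) (hρ : |ρ| ≤ 1) (X : ℝ) {z : ℂ} (hz : z.im ≠ 0) :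
    z.im * (loopSymbol L l₂ ρ X z).im ≤ 0 := by
  rw [loopSymbol, add_im, ofReal_im, add_zero, im_ofReal_mul, mul_left_comm]
  exact mul_nonpos_of_nonneg_of_nonpos (by positivity) (im_sqrtC_mul_cos_sub_div_sin hz hl₂ hρ)

theorem exists_loopSymbol_bound {L : ℝ} (hL : 0 < L) (hl₂ : 0 < l₂) {Z : Set ℂ} {δ : ℝ} (hZ : IsCompact Z) (hδ : 0 < δ) :
    ∃ C : ℝ, 0 < C ∧ ∀ z ∈ Z, δ ≤ |z.im| → ∀ ρ X : ℝ, |ρ| ≤ 1 → 0 ≤ X → 1 + X ≤ C * ‖loopSymbol L l₂ ρ X z - z‖ := by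
  obtain ⟨B, hB0, hB⟩ := exists_coef_bound hZ hδ hl₂
  refine ⟨L + (1 + L * (2 / L * (B + B) + B)) / δ, by positivity, fun z hz hzδ ρ X hρ hX => ?_⟩
  obtain ⟨b1, b2, b3⟩ := hB z hz hzδ
  have hz0 : z.im ≠ 0 := fun h0 => by rw [h0, abs_zero] at hzδ; linarith
  have h1 := hzδ.trans (abs_im_le_norm_sub (im_mul_loopSymbol hL hl₂ hρ X hz0))
  set Λ := loopSymbol L l₂ ρ X z - z with hΛ
  have h2 : X / L ≤ ‖Λ‖ + (2 / L * (B + B) + B) := by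
    have e1 : ((X / L : ℝ) : ℂ) = Λ - ((2 / L : ℝ) : ℂ) * (sqrtC z * cos (l₂ * sqrtC z) / sin (l₂ * sqrtC z) -
        (ρ : ℂ) * (sqrtC z / sin (l₂ * sqrtC z))) + z := by
      rw [hΛ, loopSymbol]; ring
    have e2 : X / L = ‖((X / L : ℝ) : ℂ)‖ := by
      rw [norm_real, Real.norm_eq_abs, abs_of_nonneg (by positivity)]
    rw [e2, e1]
    refine (norm_add_le _ _).trans ?_
    have e3 : ‖((2 / L : ℝ) : ℂ) * (sqrtC z * cos (l₂ * sqrtC z) / sin (l₂ * sqrtC z) -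
        (ρ : ℂ) * (sqrtC z / sin (l₂ * sqrtC z)))‖ ≤ 2 / L * (B + B) := by
      rw [norm_mul, norm_real, Real.norm_eq_abs, abs_of_pos (by positivity)]
      gcongr
      refine (norm_sub_le _ _).trans (add_le_add b3 ?_)
      rw [norm_mul, norm_real, Real.norm_eq_abs]
      calc _ ≤ 1 * B := by gcongr
        _ = B := one_mul B
    have := norm_sub_le Λ (((2 / L : ℝ) : ℂ) * (sqrtC z * cos (l₂ * sqrtC z) / sin (l₂ * sqrtC z) -
        (ρ : ℂ) * (sqrtC z / sin (l₂ * sqrtC z))))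
    linarith
  rw [div_le_iff₀ hL] at h2
  have h3 : 1 + L * (2 / L * (B + B) + B) ≤ (1 + L * (2 / L * (B + B) + B)) / δ * ‖Λ‖ := by
    have hK : 0 ≤ (1 + L * (2 / L * (B + B) + B)) / δ := by positivity
    calc _ = (1 + L * (2 / L * (B + B) + B)) / δ * δ := by field_simp
      _ ≤ _ := mul_le_mul_of_nonneg_left h1 hK
  rw [add_mul]
  linarith

end

/-! ### Asymptotics in the case of a connected stiff component -/

/-- The resolvent equation on an edge, tested with an affine function. -/
theorem norm_affine_test_le {a ℓ M N ω η : ℝ} {z b S W₀ W₁ : ℂ} {F φ φ' φ'' : ℝ → ℂ} (hℓ : 0 < ℓ)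
    (hw : IsW22 ℓ φ φ' φ'') (hF : MemLp F 2 (volume.restrict (Ioo 0 ℓ)))
    (he : ∀ᵐ x ∂(volume.restrict (Ioo 0 ℓ)), F x + z * φ x = -(a : ℂ) ^ 2 * φ'' x) (hN : 0 ≤ N)
    (hload : sqInt ℓ F ≤ N ^ 2) (hz : ‖z‖ ≤ M) (hω : 0 ≤ ω) (h₀ : ‖W₀‖ ≤ 1) (h₁ : ‖W₁‖ ≤ 1) (k₀ : ‖W₀ - 1‖ ≤ ω)
    (k₁ : ‖W₁ - 1‖ ≤ ω) (hb : ∀ x ∈ Icc 0 ℓ, ‖φ x - b‖ ≤ η) (hbω : ‖b‖ * ω ≤ η) (hbS : ‖b - S‖ ≤ η) :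
    ‖(a : ℂ) ^ 2 * (φ' ℓ * W₁ - φ' 0 * W₀) - (a : ℂ) ^ 2 / ℓ * ((W₁ - W₀) * (φ ℓ - φ 0)) +
      (∫ x in (0 : ℝ)..ℓ, F x) + z * ℓ * S‖ ≤ M * (ℓ * (3 * η)) + Real.sqrt ℓ * ω * N := by
  have hℓc : (ℓ : ℂ) ≠ 0 := by exact_mod_cast hℓ.ne'
  set r := (W₁ - W₀) / ℓ with hr
  have hη : 0 ≤ η := (norm_nonneg _).trans hbS
  have hM : 0 ≤ M := (norm_nonneg _).trans hz
  have hWw : IsW22 ℓ (fun x => W₀ + r * x) (fun _ => r) (fun _ => 0) := by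
    have := IsW22.cubic (ℓ := ℓ) W₀ r 0 0
    simpa using this
  have hW : Continuous fun x : ℝ => W₀ + r * x := by fun_prop
  have hconv : ∀ x ∈ Icc 0 ℓ, ∀ c m, ‖W₀ - c‖ ≤ m → ‖W₁ - c‖ ≤ m → ‖W₀ + r * x - c‖ ≤ m := by
    intro x hx c m h0 h1
    have e1 : W₀ + r * x - c = ((1 - x / ℓ : ℝ) : ℂ) * (W₀ - c) + ((x / ℓ : ℝ) : ℂ) * (W₁ - c) := by
      rw [hr]; push_cast; field_simp; ring
    have hx0 : 0 ≤ x / ℓ := div_nonneg hx.1 hℓ.le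
    have hx1 : 0 ≤ 1 - x / ℓ := sub_nonneg.2 ((div_le_one hℓ).2 hx.2)
    rw [e1]
    refine (norm_add_le _ _).trans ?_
    rw [norm_mul, norm_mul, norm_real, norm_real, Real.norm_eq_abs, Real.norm_eq_abs, abs_of_nonneg hx0, abs_of_nonneg hx1]
    calc _ ≤ (1 - x / ℓ) * m + x / ℓ * m := by gcongr
      _ = m := by ring
  have hW1 : ∀ x ∈ Icc 0 ℓ, ‖W₀ + r * x‖ ≤ 1 := fun x hx => by
    have := hconv x hx 0 1 (by rwa [sub_zero]) (by rwa [sub_zero])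
    rwa [sub_zero] at this
  have hWω : ∀ x ∈ Icc 0 ℓ, ‖W₀ + r * x - 1‖ ≤ ω := fun x hx => hconv x hx 1 ω k₀ k₁
  have hφ := hw.continuousOn
  have hφc : ContinuousOn (fun x : ℝ => φ x * (W₀ + r * x)) (Icc 0 ℓ) := hφ.mul hW.continuousOn
  have hφi := hφc.intervalIntegrable_of_Icc (μ := volume) hℓ.le
  have hmW1 : MemLp (fun x : ℝ => W₀ + r * x - 1) 2 (volume.restrict (Ioo 0 ℓ)) :=
    IsW22.memLp_of_continuousOn (by fun_prop)
  have hFi : IntervalIntegrable F volume 0 ℓ := by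
    rw [intervalIntegrable_iff_integrableOn_Ioo_of_le hℓ.le]
    exact hF.integrable (by norm_num)
  have hFW : IntervalIntegrable (fun x => F x * (W₀ + r * x - 1)) volume 0 ℓ := by
    rw [intervalIntegrable_iff_integrableOn_Ioo_of_le hℓ.le]
    exact hF.integrable_mul hmW1
  have i1 : ∫ x in (0 : ℝ)..ℓ, (F x + z * φ x) * (W₀ + r * x) = ∫ x in (0 : ℝ)..ℓ, -(a : ℂ) ^ 2 * (φ'' x * (W₀ + r * x)) := by
    rw [integral_Ioo_eq hℓ.le, integral_Ioo_eq hℓ.le]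
    refine integral_congr_ae ?_
    filter_upwards [he] with x hx
    rw [hx]; ring
  have i2 : ∫ x in (0 : ℝ)..ℓ, φ'' x * (W₀ + r * x) = φ' ℓ * W₁ - φ' 0 * W₀ - r * (φ ℓ - φ 0) := by
    have j := IsW22.integral_by_parts hℓ.le hw hWw
    rw [intervalIntegral.integral_mul_const, ← hw.eq_add_integral hℓ.le ⟨le_rfl, hℓ.le⟩ ⟨hℓ.le, le_rfl⟩] at j
    have j2 : r * ℓ = W₁ - W₀ := by rw [hr]; field_simp
    push_cast at j
    linear_combination j + φ' ℓ * j2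
  have i3 : ∫ x in (0 : ℝ)..ℓ, (F x + z * φ x) * (W₀ + r * x) = (∫ x in (0 : ℝ)..ℓ, F x * (W₀ + r * x - 1)) +
      (∫ x in (0 : ℝ)..ℓ, F x) + z * ((∫ x in (0 : ℝ)..ℓ, (φ x * (W₀ + r * x) - S)) + ℓ * S) := by
    have j1 : ∫ x in (0 : ℝ)..ℓ, (φ x * (W₀ + r * x) - S) = (∫ x in (0 : ℝ)..ℓ, φ x * (W₀ + r * x)) - ℓ * S := by
      rw [intervalIntegral.integral_sub hφi (by simp), intervalIntegral.integral_const, sub_zero, real_smul]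
    rw [j1, ← intervalIntegral.integral_add hFW hFi, sub_add_cancel, ← intervalIntegral.integral_const_mul,
      ← intervalIntegral.integral_add (hFW.add hFi) (hφi.const_mul z)]
    refine intervalIntegral.integral_congr fun x _ => ?_
    ring
  have e : (a : ℂ) ^ 2 * (φ' ℓ * W₁ - φ' 0 * W₀) - (a : ℂ) ^ 2 / ℓ * ((W₁ - W₀) * (φ ℓ - φ 0)) +
      (∫ x in (0 : ℝ)..ℓ, F x) + z * ℓ * S =
      -((∫ x in (0 : ℝ)..ℓ, F x * (W₀ + r * x - 1)) + z * ∫ x in (0 : ℝ)..ℓ, (φ x * (W₀ + r * x) - S)) := by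
    rw [intervalIntegral.integral_const_mul, i2] at i1
    have hr' : (a : ℂ) ^ 2 / ℓ * ((W₁ - W₀) * (φ ℓ - φ 0)) = (a : ℂ) ^ 2 * (r * (φ ℓ - φ 0)) := by rw [hr]; ring
    rw [hr']
    linear_combination i1 - i3
  rw [e, norm_neg, add_comm]
  have n1 : ‖∫ x in (0 : ℝ)..ℓ, (φ x * (W₀ + r * x) - S)‖ ≤ ℓ * (3 * η) := by
    refine (intervalIntegral.norm_integral_le_of_norm_le_const (C := 3 * η) fun x hx => ?_).trans
      (le_of_eq (by rw [sub_zero, abs_of_pos hℓ, mul_comm]))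
    rw [uIoc_of_le hℓ.le] at hx
    have hx' : x ∈ Icc 0 ℓ := ⟨hx.1.le, hx.2⟩
    have e1 : φ x * (W₀ + r * x) - S = (φ x - b) * (W₀ + r * x) + b * (W₀ + r * x - 1) + (b - S) := by ring
    rw [e1]
    refine norm_add₃_le.trans ?_
    rw [norm_mul, norm_mul]
    have m1 : ‖φ x - b‖ * ‖W₀ + r * x‖ ≤ η * 1 := mul_le_mul (hb x hx') (hW1 x hx') (norm_nonneg _) hη
    have m2 : ‖b‖ * ‖W₀ + r * x - 1‖ ≤ η := (mul_le_mul_of_nonneg_left (hWω x hx') (norm_nonneg _)).trans hbω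
    linarith
  have n2 : ‖∫ x in (0 : ℝ)..ℓ, F x * (W₀ + r * x - 1)‖ ≤ Real.sqrt ℓ * ω * N := by
    refine (sq_le_sq₀ (norm_nonneg _) (by positivity)).1 ?_
    refine (norm_integral_mul_sq_le_sqInt hℓ.le hF hmW1).trans ?_
    have m1 := sqInt_le_of_bound hℓ.le (fun x hx => hWω x (Ioo_subset_Icc_self hx))
    calc _ ≤ N ^ 2 * (ℓ * ω ^ 2) := mul_le_mul hload m1 (sqInt_nonneg _ _) (by positivity)
      _ = _ := by rw [mul_pow, mul_pow, Real.sq_sqrt hℓ.le]; ring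
  refine (norm_add_le _ _).trans (add_le_add ?_ n2)
  rw [norm_mul]
  gcongr

/-- Consequences of the smallness of the gradients on the stiff component. -/
theorem loop_value_bounds {A B θ : ℂ} {τ c Cθ : ℝ} (hτ : |τ| < Real.pi) (h₁ : ‖A - exp (-I * τ) * B‖ ≤ c)
    (h₂ : ‖A - B‖ ≤ c) (hθ : ‖θ‖ = 1) (hθ1 : ‖θ - 1‖ ≤ Cθ * |τ|) (hCθ : 0 ≤ Cθ) :
    ‖B‖ * |τ| ≤ Real.pi * c ∧ ‖A * (starRingEnd ℂ) θ - B‖ ≤ (1 + Cθ * Real.pi) * c := by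
  have hπ := Real.pi_pos
  have e1 : ‖B‖ * |τ| ≤ Real.pi * c := by
    have k1 : (exp (-I * τ) - 1) * B = (A - B) - (A - exp (-I * τ) * B) := by ring
    have k2 : ‖exp (-I * τ) - 1‖ * ‖B‖ ≤ 2 * c := by
      rw [← norm_mul, k1]
      exact (norm_sub_le _ _).trans (by linarith)
    have k3 : 2 / Real.pi * |τ| * ‖B‖ ≤ 2 * c :=
      (mul_le_mul_of_nonneg_right (abs_le_norm_exp_neg_I_mul_sub_one hτ.le) (norm_nonneg _)).trans k2
    have k4 : ‖B‖ * |τ| = Real.pi / 2 * (2 / Real.pi * |τ| * ‖B‖) := by field_simp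
    rw [k4]
    calc _ ≤ Real.pi / 2 * (2 * c) := by gcongr
      _ = _ := by ring
  refine ⟨e1, ?_⟩
  have k1 : A * (starRingEnd ℂ) θ - B = (A - B) * (starRingEnd ℂ) θ + B * (starRingEnd ℂ) (θ - 1) := by
    rw [map_sub, map_one]; ring
  rw [k1]
  refine (norm_add_le _ _).trans ?_
  rw [norm_mul, norm_mul, RCLike.norm_conj, RCLike.norm_conj, hθ, mul_one]
  have k2 : ‖B‖ * ‖θ - 1‖ ≤ Cθ * (Real.pi * c) := by
    calc ‖B‖ * ‖θ - 1‖ ≤ ‖B‖ * (Cθ * |τ|) := by gcongr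
      _ = Cθ * (‖B‖ * |τ|) := by ring
      _ ≤ _ := by gcongr
  linarith

section

variable {l₁ l₂ l₃ a₁ a₃ : ℝ}

/-- Replacing the kinetic term by its approximation. -/
theorem exists_symbol_comparison {κ₁ κ₃ L : ℝ} (h₁ : 0 < κ₁) (h₃ : 0 < κ₃) (hL : 0 < L) (hl₂ : 0 < l₂) {Z : Set ℂ}
    {δ : ℝ} (hZ : IsCompact Z) (hδ : 0 < δ) : ∃ C : ℝ, 0 ≤ C ∧ ∀ z ∈ Z, δ ≤ |z.im| → ∀ ε τ ρ : ℝ, 0 < ε →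
      |τ| ≤ Real.pi → |ρ| ≤ 1 →
      |τ| * ‖(loopSymbol L l₂ ρ (2 * (κ₁ + κ₃ - ‖zetaC κ₁ κ₃ τ‖) / ε ^ 2) z - z)⁻¹‖ ≤ C * ε ∧
      ‖(loopSymbol L l₂ ρ (2 * (κ₁ + κ₃ - ‖zetaC κ₁ κ₃ τ‖) / ε ^ 2) z - z)⁻¹ -
        (loopSymbol L l₂ ρ (κ₁ * κ₃ / (κ₁ + κ₃) * (τ / ε) ^ 2) z - z)⁻¹‖ ≤ C * ε ^ 2 := by
  obtain ⟨C, hC0, hC⟩ := exists_loopSymbol_bound hL hl₂ hZ hδ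
  set σ := κ₁ * κ₃ / (κ₁ + κ₃) with hσ
  have hσ0 : 0 < σ := by positivity
  have hπ := Real.pi_pos
  set c := σ * (4 / Real.pi ^ 2) with hc
  have hc0 : 0 < c := by positivity
  set C4 := σ + σ ^ 2 / (κ₁ + κ₃) with hC4
  have hC40 : 0 < C4 := by positivity
  refine ⟨C * (1 + 1 / c) + C4 / L * C ^ 2 / (c * σ), by positivity, fun z hz hzδ ε τ ρ hε hτ hρ => ?_⟩
  obtain ⟨g1, g2⟩ := zeta_gap_bounds h₁ h₃ τ
  have g1 := g1 hτ
  set q := κ₁ + κ₃ - ‖zetaC κ₁ κ₃ τ‖ with hq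
  set T := |τ| / ε with hT
  have hT0 : 0 ≤ T := by positivity
  have hTτ : T ^ 2 = (τ / ε) ^ 2 := by rw [hT, div_pow, div_pow, sq_abs]
  have hX : c * T ^ 2 ≤ 2 * q / ε ^ 2 := by
    rw [le_div_iff₀ (by positivity), hTτ, hc]
    calc σ * (4 / Real.pi ^ 2) * (τ / ε) ^ 2 * ε ^ 2 = 2 * (σ * (2 / Real.pi ^ 2 * τ ^ 2)) := by field_simp; ring
      _ ≤ 2 * q := by linarith
  have hq0 : 0 ≤ 2 * q / ε ^ 2 := le_trans (by positivity) hX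
  have hX' : 0 ≤ σ * (τ / ε) ^ 2 := by positivity
  have b1 := hC z hz hzδ ρ _ hρ hq0
  have b2 := hC z hz hzδ ρ _ hρ hX'
  set Λ' := loopSymbol L l₂ ρ (2 * q / ε ^ 2) z - z with hΛ'
  set Λ := loopSymbol L l₂ ρ (σ * (τ / ε) ^ 2) z - z with hΛ
  have p1 : 0 < ‖Λ'‖ := pos_of_mul_pos_right (lt_of_lt_of_le (by linarith) b1) hC0.le
  have p2 : 0 < ‖Λ‖ := pos_of_mul_pos_right (lt_of_lt_of_le (by linarith) b2) hC0.le
  have hτε : |τ| = T * ε := by rw [hT]; field_simp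
  have hrest : 0 ≤ C4 / L * C ^ 2 / (c * σ) := by positivity
  have hrest' : 0 ≤ C * (1 + 1 / c) := by positivity
  constructor
  · have k1 : T ≤ C * (1 + 1 / c) * ‖Λ'‖ := by
      have j1 : T ≤ 1 + T ^ 2 := by nlinarith [sq_nonneg (T - 1)]
      have j2 : 1 + T ^ 2 ≤ (1 + 1 / c) * (1 + c * T ^ 2) := by
        have : (1 + 1 / c) * (1 + c * T ^ 2) = 1 + T ^ 2 + (c * T ^ 2 + 1 / c) := by field_simp; ring
        rw [this]
        have : 0 ≤ c * T ^ 2 + 1 / c := by positivity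
        linarith
      have j3 : (1 + 1 / c) * (1 + c * T ^ 2) ≤ (1 + 1 / c) * (C * ‖Λ'‖) := by
        have : 0 ≤ 1 + 1 / c := by positivity
        gcongr
        linarith
      calc T ≤ _ := j1.trans (j2.trans j3)
        _ = _ := by ring
    rw [norm_inv, hτε, ← div_eq_mul_inv, div_le_iff₀ p1]
    calc T * ε ≤ C * (1 + 1 / c) * ‖Λ'‖ * ε := by gcongr
      _ = C * (1 + 1 / c) * (ε * ‖Λ'‖) := by ring
      _ ≤ (C * (1 + 1 / c) + C4 / L * C ^ 2 / (c * σ)) * (ε * ‖Λ'‖) := by gcongr; linarith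
      _ = _ := by ring
  · have n1 : Λ' ≠ 0 := norm_pos_iff.1 p1
    have n2 : Λ ≠ 0 := norm_pos_iff.1 p2
    rw [inv_sub_inv n1 n2, norm_div, norm_mul, div_le_iff₀ (by positivity)]
    have e1 : Λ - Λ' = ((-(2 * q - σ * τ ^ 2) / ε ^ 2 / L : ℝ) : ℂ) := by
      rw [hΛ, hΛ', loopSymbol, loopSymbol]
      push_cast
      field_simp
      ring
    have e2 : ‖Λ - Λ'‖ ≤ C4 / L * (ε ^ 2 * T ^ 4) := by
      rw [e1, norm_real, Real.norm_eq_abs, abs_div, abs_div, abs_neg, abs_of_pos hL, abs_of_pos (by positivity : 0 < ε ^ 2)]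
      have : C4 / L * (ε ^ 2 * T ^ 4) = C4 * τ ^ 4 / ε ^ 2 / L := by
        have : T ^ 4 = (τ / ε) ^ 4 := by
          rw [show T ^ 4 = (T ^ 2) ^ 2 by ring, hTτ]; ring
        rw [this]
        field_simp
      rw [this]
      gcongr
    have e3 : c * σ * T ^ 4 ≤ C ^ 2 * (‖Λ'‖ * ‖Λ‖) := by
      have m1 : c * T ^ 2 ≤ C * ‖Λ'‖ := by linarith
      have m2 : σ * T ^ 2 ≤ C * ‖Λ‖ := by rw [hTτ]; linarith
      calc c * σ * T ^ 4 = (c * T ^ 2) * (σ * T ^ 2) := by ring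
        _ ≤ (C * ‖Λ'‖) * (C * ‖Λ‖) := by gcongr
        _ = _ := by ring
    calc ‖Λ - Λ'‖ ≤ C4 / L * (ε ^ 2 * T ^ 4) := e2
      _ = C4 / L / (c * σ) * ε ^ 2 * (c * σ * T ^ 4) := by field_simp
      _ ≤ C4 / L / (c * σ) * ε ^ 2 * (C ^ 2 * (‖Λ'‖ * ‖Λ‖)) := by gcongr
      _ = C4 / L * C ^ 2 / (c * σ) * ε ^ 2 * (‖Λ'‖ * ‖Λ‖) := by ring
      _ ≤ _ := by gcongr; linarith

end

section

variable {l₁ l₂ l₃ a₁ a₃ : ℝ}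

/-- The exact balance of the fluxes in the loop. -/
theorem loop_flux_balance {κ₁ κ₃ ε ρ n : ℝ} {A B θ x y Q R S D f₁ f₁' f₃ f₃' g g' : ℂ} (hxy : x * y = 1)
    (hθ : θ * (starRingEnd ℂ) θ = 1) (hζ : (κ₁ : ℂ) * y + κ₃ = n * θ) (hζ' : (κ₁ : ℂ) * x + κ₃ = n * (starRingEnd ℂ) θ)
    (hρ : θ + (starRingEnd ℂ) θ = 2 * ρ) (hS : S = (A * (starRingEnd ℂ) θ + B) / 2)
    (hD : D = (A * (starRingEnd ℂ) θ - B) / 2) (k₁ : -f₁' + g + -f₃' = 0) (k₂ : x * f₁ + -g' + f₃ = 0)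
    (hg : g = ε * (Q * B - R * A)) (hg' : g' = ε * (R * B - Q * A)) (hε : ε ≠ 0) :
    (f₁' * (starRingEnd ℂ) θ - f₁ * x - κ₁ / ε * (((starRingEnd ℂ) θ - x) * (A - y * B))) +
      (f₃' * (starRingEnd ℂ) θ - f₃ - κ₃ / ε * (((starRingEnd ℂ) θ - 1) * (A - B))) =
      ε * (2 * (ρ * Q - R)) * S - 2 * (κ₁ + κ₃ - n) / ε * S + ε * Q * ((θ - (starRingEnd ℂ) θ) * D) := by
  have hεc : (ε : ℂ) ≠ 0 := by exact_mod_cast hε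
  set t := (starRingEnd ℂ) θ
  have hf : f₁' * t - f₁ * x + (f₃' * t - f₃) = t * g - g' := by linear_combination -t * k₁ - k₂
  have h1 : t * g - g' = ε * (2 * (ρ * Q - R)) * S + ε * Q * ((θ - t) * D) := by
    rw [hg, hg', hS, hD]
    linear_combination -(ε * Q * A) * hθ + (ε * Q * ((A * t + B) / 2)) * hρ
  have h2 : (κ₁ : ℂ) * ((t - x) * (A - y * B)) + κ₃ * ((t - 1) * (A - B)) = 2 * (κ₁ + κ₃ - n) * S := by
    rw [hS]
    linear_combination κ₁ * B * hxy - t * B * hζ - A * hζ' - n * B * hθ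
  have h3 : (κ₁ : ℂ) / ε * ((t - x) * (A - y * B)) + κ₃ / ε * ((t - 1) * (A - B)) = 2 * (κ₁ + κ₃ - n) / ε * S := by
    rw [div_mul_eq_mul_div, div_mul_eq_mul_div, ← add_div, h2]
    ring
  linear_combination hf + h1 - h3

theorem loop_final_estimate {s L δ M H lam Cθ Cc τ N : ℝ} {Λ Λ' S J : ℂ} (hs : 0 < s) (hs1 : s ≤ 1) (hL : 0 < L)
    (hM : 0 ≤ M) (hH : 0 ≤ H) (hlam : 0 ≤ lam) (hCθ : 0 ≤ Cθ) (hCc : 0 ≤ Cc) (hN : 0 ≤ N)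
    (h0 : Λ' ≠ 0) (hi : ‖Λ'⁻¹‖ ≤ δ⁻¹) (c1 : |τ| * ‖Λ'⁻¹‖ ≤ Cc * s ^ 2) (c2 : ‖Λ'⁻¹ - Λ⁻¹‖ ≤ Cc * (s ^ 2) ^ 2)
    (hJ : ‖J‖ ≤ lam * s * N) (hm : ‖((s ^ 2 * L : ℝ) : ℂ) * Λ' * S - J‖ ≤
      3 * M * (H * s * N) * (s ^ 2 * L) + lam * s * ((1 + Cθ) * |τ|) * N + s ^ 2 * M * (H * s * N)) :
    ‖S - Λ⁻¹ * (((s ^ 2 * L : ℝ) : ℂ)⁻¹ * J)‖ ≤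
      (Cc * L⁻¹ * lam + L⁻¹ * (δ⁻¹ * (3 * M * L + M) * H + lam * (1 + Cθ) * Cc)) * s * N := by
  set ℓ := s ^ 2 * L with hℓ
  have hℓ0 : 0 < ℓ := by positivity
  have hℓc : (ℓ : ℂ) ≠ 0 := by exact_mod_cast hℓ0.ne'
  set E := (ℓ : ℂ) * Λ' * S - J with hE
  have e1 : S - Λ⁻¹ * ((ℓ : ℂ)⁻¹ * J) = (Λ'⁻¹ - Λ⁻¹) * ((ℓ : ℂ)⁻¹ * J) + (ℓ : ℂ)⁻¹ * (Λ'⁻¹ * E) := by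
    have : S = Λ'⁻¹ * ((ℓ : ℂ)⁻¹ * ((ℓ : ℂ) * Λ' * S)) := by field_simp
    rw [hE]
    linear_combination this
  rw [e1]
  refine (norm_add_le _ _).trans ?_
  rw [norm_mul, norm_mul, norm_mul, norm_mul, norm_inv (ℓ : ℂ), norm_real, Real.norm_of_nonneg hℓ0.le]
  have b1 : ‖Λ'⁻¹ - Λ⁻¹‖ * (ℓ⁻¹ * ‖J‖) ≤ Cc * L⁻¹ * lam * s * N := by
    calc _ ≤ (Cc * (s ^ 2) ^ 2) * (ℓ⁻¹ * (lam * s * N)) := by gcongr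
      _ = (Cc * L⁻¹ * lam * s * N) * (s * s) := by rw [hℓ]; field_simp
      _ ≤ (Cc * L⁻¹ * lam * s * N) * 1 := by
        gcongr
        nlinarith
      _ = _ := mul_one _
  have b2 : ‖Λ'⁻¹‖ * ‖E‖ ≤ s ^ 2 * ((δ⁻¹ * (3 * M * L + M) * H + lam * (1 + Cθ) * Cc) * s * N) := by
    calc ‖Λ'⁻¹‖ * ‖E‖ ≤ ‖Λ'⁻¹‖ * (3 * M * (H * s * N) * ℓ + lam * s * ((1 + Cθ) * |τ|) * N + s ^ 2 * M * (H * s * N)) := by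
          gcongr
      _ = ‖Λ'⁻¹‖ * ((3 * M * L + M) * H * (s ^ 3 * N)) + (|τ| * ‖Λ'⁻¹‖) * (lam * s * (1 + Cθ) * N) := by rw [hℓ]; ring
      _ ≤ δ⁻¹ * ((3 * M * L + M) * H * (s ^ 3 * N)) + (Cc * s ^ 2) * (lam * s * (1 + Cθ) * N) := by gcongr
      _ = _ := by ring
  have b3 : ℓ⁻¹ * (‖Λ'⁻¹‖ * ‖E‖) ≤ L⁻¹ * (δ⁻¹ * (3 * M * L + M) * H + lam * (1 + Cθ) * Cc) * s * N := by
    rw [inv_mul_le_iff₀ hℓ0]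
    refine b2.trans (le_of_eq ?_)
    rw [hℓ]
    field_simp
  linarith

set_option maxHeartbeats 1000000 in
/-- The asymptotics on the two edges of the stiff component. -/
theorem exists_two_edge_bound (hl₁ : 0 < l₁) (hl₂ : 0 < l₂) (hl₃ : 0 < l₃) (ha₁ : 0 < a₁) (ha₃ : 0 < a₃) {Z : Set ℂ} {δ : ℝ}
    (hZ : IsCompact Z) (hδ : 0 < δ) : ∃ C : ℝ, 0 ≤ C ∧ ∀ z ∈ Z, δ ≤ |z.im| → ∀ s τ N : ℝ, 0 < s → s ≤ 1 → 0 ≤ N →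
      |τ| < Real.pi → ∀ (g g' : ℂ) (F₁ φ₁ φ₁' φ₁'' F₃ φ₃ φ₃' φ₃'' : ℝ → ℂ),
      IsW22 (s ^ 2 * l₁) φ₁ φ₁' φ₁'' → IsW22 (s ^ 2 * l₃) φ₃ φ₃' φ₃'' →
      MemLp F₁ 2 (volume.restrict (Ioo 0 (s ^ 2 * l₁))) → MemLp F₃ 2 (volume.restrict (Ioo 0 (s ^ 2 * l₃))) →
      (∀ᵐ x ∂(volume.restrict (Ioo 0 (s ^ 2 * l₁))), F₁ x + z * φ₁ x = -(a₁ : ℂ) ^ 2 * φ₁'' x) →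
      (∀ᵐ x ∂(volume.restrict (Ioo 0 (s ^ 2 * l₃))), F₃ x + z * φ₃ x = -(a₃ : ℂ) ^ 2 * φ₃'' x) →
      sqInt (s ^ 2 * l₁) F₁ ≤ N ^ 2 → sqInt (s ^ 2 * l₃) F₃ ≤ N ^ 2 →
      z.im ^ 2 * sqInt (s ^ 2 * l₁) φ₁ ≤ N ^ 2 → z.im ^ 2 * sqInt (s ^ 2 * l₃) φ₃ ≤ N ^ 2 →
      z.im ^ 2 * (a₁ ^ 2 * sqInt (s ^ 2 * l₁) φ₁') ≤ (|z.im| + ‖z‖) * N ^ 2 →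
      z.im ^ 2 * (a₃ ^ 2 * sqInt (s ^ 2 * l₃) φ₃') ≤ (|z.im| + ‖z‖) * N ^ 2 →
      exp (I * τ) * φ₁ 0 = φ₃ 0 → φ₁ (s ^ 2 * l₁) = φ₃ (s ^ 2 * l₃) →
      -((a₁ : ℂ) ^ 2 * φ₁' (s ^ 2 * l₁)) + g + -((a₃ : ℂ) ^ 2 * φ₃' (s ^ 2 * l₃)) = 0 →
      exp (I * τ) * ((a₁ : ℂ) ^ 2 * φ₁' 0) + -g' + (a₃ : ℂ) ^ 2 * φ₃' 0 = 0 →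
      g = ((s ^ 2 : ℝ) : ℂ) * (sqrtC z / sin (l₂ * sqrtC z) * φ₃ 0 -
        sqrtC z * cos (l₂ * sqrtC z) / sin (l₂ * sqrtC z) * φ₃ (s ^ 2 * l₃)) →
      g' = ((s ^ 2 : ℝ) : ℂ) * (sqrtC z * cos (l₂ * sqrtC z) / sin (l₂ * sqrtC z) * φ₃ 0 -
        sqrtC z / sin (l₂ * sqrtC z) * φ₃ (s ^ 2 * l₃)) →
      (∀ x ∈ Ioo 0 (s ^ 2 * l₁), ‖φ₁ x - (dispersion1 l₁ l₂ l₃ a₁ a₃ (s ^ 2) τ z - z)⁻¹ *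
        (((s ^ 2 * (l₁ + l₃) : ℝ) : ℂ)⁻¹ * ((∫ x in (0 : ℝ)..s ^ 2 * l₁, F₁ x) + ∫ x in (0 : ℝ)..s ^ 2 * l₃, F₃ x))‖ ≤
          C * s * N) ∧
      ∀ x ∈ Ioo 0 (s ^ 2 * l₃), ‖φ₃ x - (dispersion1 l₁ l₂ l₃ a₁ a₃ (s ^ 2) τ z - z)⁻¹ *
        (((s ^ 2 * (l₁ + l₃) : ℝ) : ℂ)⁻¹ * ((∫ x in (0 : ℝ)..s ^ 2 * l₁, F₁ x) + ∫ x in (0 : ℝ)..s ^ 2 * l₃, F₃ x))‖ ≤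
          C * s * N := by
  set κ₁ := a₁ ^ 2 / l₁ with hκ₁
  set κ₃ := a₃ ^ 2 / l₃ with hκ₃
  set L := l₁ + l₃ with hLdef
  have hκ₁0 : 0 < κ₁ := by positivity
  have hκ₃0 : 0 < κ₃ := by positivity
  have hL : 0 < L := by positivity
  have hπ := Real.pi_pos
  obtain ⟨M, hM0, hM⟩ := exists_coef_bound hZ hδ hl₂
  obtain ⟨Cc, hCc0, hCc⟩ := exists_symbol_comparison hκ₁0 hκ₃0 hL hl₂ hZ hδ
  obtain ⟨C₁, hC₁0, hC₁⟩ := exists_short_edge_bound hl₁ ha₁ hδ hM0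
  obtain ⟨C₃, hC₃0, hC₃⟩ := exists_short_edge_bound hl₃ ha₃ hδ hM0
  set G := C₁ + C₃ with hG
  set Cθ := 4 * κ₁ / (κ₁ + κ₃) with hCθ
  have hCθ0 : 0 ≤ Cθ := by positivity
  set H := (2 + (1 + Cθ) * Real.pi + (1 + Cθ * Real.pi)) * G with hH
  have hG0 : 0 ≤ G := by positivity
  have hH0 : 0 ≤ H := by positivity
  set lam := Real.sqrt l₁ + Real.sqrt l₃ with hlam
  have hlam0 : 0 ≤ lam := by positivity
  refine ⟨2 * H + (Cc * L⁻¹ * lam + L⁻¹ * (δ⁻¹ * (3 * M * L + M) * H + lam * (1 + Cθ) * Cc)), by positivity, ?_⟩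
  intro z hz hzδ s τ N hs hs1 hN hτ g g' F₁ φ₁ φ₁' φ₁'' F₃ φ₃ φ₃' φ₃'' w₁ w₃ m₁ m₃ e₁ e₃ ld₁ ld₃ sz₁ sz₃ en₁ en₃ c0 c1 k0 k1 f0 f1
  obtain ⟨hzM, hQ, -⟩ := hM z hz hzδ
  have hz0 : z.im ≠ 0 := fun h0 => by rw [h0, abs_zero] at hzδ; linarith
  have hε : 0 < s ^ 2 := by positivity
  have hℓ₁ : 0 < s ^ 2 * l₁ := by positivity
  have hℓ₃ : 0 < s ^ 2 * l₃ := by positivity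
  set θ := zetaC κ₁ κ₃ τ / ((‖zetaC κ₁ κ₃ τ‖ : ℝ) : ℂ) with hθ
  set n := ‖zetaC κ₁ κ₃ τ‖ with hn
  have hn0 : 0 < n := norm_pos_iff.2 (zetaC_ne_zero hκ₁0 hκ₃0 hτ)
  have hnc : (n : ℂ) ≠ 0 := by exact_mod_cast hn0.ne'
  have hθn : ‖θ‖ = 1 := by rw [hθ, norm_div, norm_real, ← hn, Real.norm_of_nonneg hn0.le, div_self hn0.ne']
  have hθθ : θ * (starRingEnd ℂ) θ = 1 := by rw [mul_conj, normSq_eq_norm_sq, hθn]; norm_num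
  have hθ1 : ‖θ - 1‖ ≤ Cθ * |τ| := norm_zeta_phase_sub_one_le hκ₁0 hκ₃0 τ
  have hρ : |θ.re| ≤ 1 := abs_zeta_phase_re_le κ₁ κ₃ τ
  obtain ⟨cc1, cc2⟩ := hCc z hz hzδ (s ^ 2) τ θ.re hε hτ.le hρ
  have hK : dispersion1 l₁ l₂ l₃ a₁ a₃ (s ^ 2) τ z =
      loopSymbol L l₂ θ.re (κ₁ * κ₃ / (κ₁ + κ₃) * (τ / s ^ 2) ^ 2) z := by
    rw [dispersion1_eq, sigmaSq_eq hl₁ hl₃ ha₁ ha₃, thetaPhase_eq]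
  rw [hK]
  set X := 2 * (κ₁ + κ₃ - n) / (s ^ 2) ^ 2 with hX
  have him' := abs_im_le_norm_sub (im_mul_loopSymbol (l₂ := l₂) hL hl₂ hρ X hz0)
  set Λ := loopSymbol L l₂ θ.re (κ₁ * κ₃ / (κ₁ + κ₃) * (τ / s ^ 2) ^ 2) z - z with hΛ
  set Λ' := loopSymbol L l₂ θ.re X z - z with hΛ'
  have hΛ'0 : Λ' ≠ 0 := norm_pos_iff.1 (hδ.trans_le (hzδ.trans him'))
  have hΛ'i : ‖Λ'⁻¹‖ ≤ δ⁻¹ := by rw [norm_inv]; exact inv_anti₀ hδ (hzδ.trans him')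
  obtain ⟨-, -, o₁⟩ := hC₁ s N z _ _ _ hs hs1 hN hzδ hzM w₁ sz₁ en₁
  obtain ⟨-, -, o₃⟩ := hC₃ s N z _ _ _ hs hs1 hN hzδ hzM w₃ sz₃ en₃
  have z₁ : (0 : ℝ) ∈ Icc 0 (s ^ 2 * l₁) := ⟨le_rfl, hℓ₁.le⟩
  have t₁ : s ^ 2 * l₁ ∈ Icc 0 (s ^ 2 * l₁) := ⟨hℓ₁.le, le_rfl⟩
  have z₃ : (0 : ℝ) ∈ Icc 0 (s ^ 2 * l₃) := ⟨le_rfl, hℓ₃.le⟩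
  have t₃ : s ^ 2 * l₃ ∈ Icc 0 (s ^ 2 * l₃) := ⟨hℓ₃.le, le_rfl⟩
  set A := φ₃ (s ^ 2 * l₃) with hA
  set B := φ₃ 0 with hB
  have hneg : exp (-(I * τ)) = exp (-I * τ) := by rw [neg_mul]
  have hxy : exp (I * τ) * exp (-I * τ) = 1 := by rw [← hneg]; exact exp_mul_exp_neg τ
  have c0' : φ₁ 0 = exp (-I * τ) * B := by linear_combination exp (-I * τ) * c0 - φ₁ 0 * hxy
  have hconj : (starRingEnd ℂ) (exp (-I * τ)) = exp (I * τ) := by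
    rw [← exp_conj, map_mul, map_neg, conj_I, neg_neg, conj_ofReal]
  set Q := sqrtC z / sin (l₂ * sqrtC z) with hQdef
  set R := sqrtC z * cos (l₂ * sqrtC z) / sin (l₂ * sqrtC z) with hRdef
  -- smallness
  have hAy : ‖A - exp (-I * τ) * B‖ ≤ G * s * N := by
    have := o₁ 0 z₁ _ t₁
    rw [c1, c0'] at this
    refine this.trans ?_
    gcongr
    linarith
  have hAB : ‖A - B‖ ≤ G * s * N := by
    refine (o₃ 0 z₃ _ t₃).trans ?_
    gcongr
    linarith
  obtain ⟨v1, v2⟩ := loop_value_bounds hτ hAy hAB hθn hθ1 hCθ0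
  set S := (A * (starRingEnd ℂ) θ + B) / 2 with hS
  set D := (A * (starRingEnd ℂ) θ - B) / 2 with hD
  set η := H * s * N with hη
  have hη0 : 0 ≤ η := by positivity
  have hsN : 0 ≤ G * s * N := by positivity
  have hηeq : η = 2 * (G * s * N) + (1 + Cθ) * (Real.pi * (G * s * N)) + (1 + Cθ * Real.pi) * (G * s * N) := by
    rw [hη, hH]; ring
  have hp1 : 0 ≤ (1 + Cθ) * (Real.pi * (G * s * N)) := by positivity
  have hp2 : 0 ≤ (1 + Cθ * Real.pi) * (G * s * N) := by positivity
  have hDn : 2 * ‖D‖ ≤ η := by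
    rw [hD, norm_div, RCLike.norm_ofNat]
    linarith
  have hBS : ‖B - S‖ ≤ η := by
    have : B - S = -D := by rw [hS, hD]; ring
    rw [this, norm_neg]
    linarith [norm_nonneg D]
  have hb₃ : ∀ x ∈ Icc 0 (s ^ 2 * l₃), ‖φ₃ x - B‖ ≤ η := fun x hx => by
    have h1 := o₃ 0 z₃ x hx
    have h2 : C₃ * s * N ≤ G * s * N := by gcongr; linarith
    linarith
  have hb₁ : ∀ x ∈ Icc 0 (s ^ 2 * l₁), ‖φ₁ x - B‖ ≤ η := fun x hx => by
    have h1 := o₁ _ t₁ x hx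
    have h2 : C₁ * s * N ≤ G * s * N := by gcongr; linarith
    rw [c1] at h1
    have h3 : φ₁ x - B = (φ₁ x - A) + (A - B) := by ring
    rw [h3]
    refine (norm_add_le _ _).trans ?_
    linarith
  set ω := (1 + Cθ) * |τ| with hω
  have hω0 : 0 ≤ ω := by positivity
  have hbω : ‖B‖ * ω ≤ η := by
    have : ‖B‖ * ω = (1 + Cθ) * (‖B‖ * |τ|) := by rw [hω]; ring
    rw [this]
    have := mul_le_mul_of_nonneg_left v1 (by positivity : 0 ≤ 1 + Cθ)
    linarith
  have hωτ : |τ| ≤ ω := by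
    rw [hω]; nlinarith [abs_nonneg τ]
  have hωθ : ‖(starRingEnd ℂ) θ - 1‖ ≤ ω := by
    have : (starRingEnd ℂ) θ - 1 = (starRingEnd ℂ) (θ - 1) := by rw [map_sub, map_one]
    rw [this, RCLike.norm_conj, hω]
    linarith [abs_nonneg τ]
  have hωx : ‖exp (I * τ) - 1‖ ≤ ω := by
    rw [← hconj, ← map_one (starRingEnd ℂ), ← map_sub, RCLike.norm_conj]
    exact (norm_exp_neg_I_mul_sub_one_le τ).trans hωτ
  -- testing on the two edges
  have T₁ := norm_affine_test_le (S := S) hℓ₁ w₁ m₁ e₁ hN ld₁ hzM hω0 (norm_exp_I_mul τ).le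
    (by rw [RCLike.norm_conj, hθn]) hωx hωθ hb₁ hbω hBS
  have T₃ := norm_affine_test_le (S := S) hℓ₃ w₃ m₃ e₃ hN ld₃ hzM hω0 norm_one.le
    (by rw [RCLike.norm_conj, hθn]) (by rw [sub_self, norm_zero]; exact hω0) hωθ hb₃ hbω hBS
  set J₁ := ∫ x in (0 : ℝ)..s ^ 2 * l₁, F₁ x with hJ₁
  set J₃ := ∫ x in (0 : ℝ)..s ^ 2 * l₃, F₃ x with hJ₃
  have hbal := loop_flux_balance (κ₁ := κ₁) (κ₃ := κ₃) (ε := s ^ 2) (ρ := θ.re) (n := n) hxy hθθ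
    (by rw [hθ, mul_div_cancel₀ _ hnc]; rfl)
    (by
      have : (κ₁ : ℂ) * exp (I * τ) + κ₃ = (starRingEnd ℂ) (zetaC κ₁ κ₃ τ) := by
        rw [zetaC, map_add, map_mul, hconj, conj_ofReal, conj_ofReal]
      rw [this, hθ, map_div₀, conj_ofReal, mul_div_cancel₀ _ hnc])
    (by rw [add_conj]; push_cast; ring) hS hD k0 k1 f0 f1 hε.ne'
  have n₁ : ‖J₁‖ ≤ Real.sqrt l₁ * s * N := by
    refine (sq_le_sq₀ (norm_nonneg _) (by positivity)).1 ((norm_integral_sq_le_sqInt hℓ₁.le m₁).trans ?_)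
    rw [mul_pow, mul_pow, Real.sq_sqrt hl₁.le]
    calc _ ≤ s ^ 2 * l₁ * N ^ 2 := by gcongr
      _ = _ := by ring
  have n₃ : ‖J₃‖ ≤ Real.sqrt l₃ * s * N := by
    refine (sq_le_sq₀ (norm_nonneg _) (by positivity)).1 ((norm_integral_sq_le_sqInt hℓ₃.le m₃).trans ?_)
    rw [mul_pow, mul_pow, Real.sq_sqrt hl₃.le]
    calc _ ≤ s ^ 2 * l₃ * N ^ 2 := by gcongr
      _ = _ := by ring
  have hJ : ‖J₁ + J₃‖ ≤ lam * s * N := by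
    refine (norm_add_le _ _).trans ((add_le_add n₁ n₃).trans (le_of_eq ?_))
    rw [hlam]; ring
  have hfin := loop_final_estimate (Λ := Λ) (S := S) hs hs1 hL hM0 hH0 hlam0 hCθ0 hCc0 hN hΛ'0 hΛ'i cc1 cc2 hJ ?_
  · have hSx : ∀ u : ℂ, ‖u - B‖ ≤ η → ‖u - Λ⁻¹ * (((s ^ 2 * L : ℝ) : ℂ)⁻¹ * (J₁ + J₃))‖ ≤
        (2 * H + (Cc * L⁻¹ * lam + L⁻¹ * (δ⁻¹ * (3 * M * L + M) * H + lam * (1 + Cθ) * Cc))) * s * N := by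
      intro u hu
      have : u - Λ⁻¹ * (((s ^ 2 * L : ℝ) : ℂ)⁻¹ * (J₁ + J₃)) = (u - B) + (B - S) +
          (S - Λ⁻¹ * (((s ^ 2 * L : ℝ) : ℂ)⁻¹ * (J₁ + J₃))) := by ring
      rw [this]
      refine norm_add₃_le.trans ((add_le_add (add_le_add hu hBS) hfin).trans (le_of_eq ?_))
      rw [hη]; ring
    exact ⟨fun x hx => hSx _ (hb₁ x (Ioo_subset_Icc_self hx)), fun x hx => hSx _ (hb₃ x (Ioo_subset_Icc_self hx))⟩
  · have hsq₁ : Real.sqrt (s ^ 2 * l₁) = s * Real.sqrt l₁ := by rw [Real.sqrt_mul (by positivity), Real.sqrt_sq hs.le]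
    have hsq₃ : Real.sqrt (s ^ 2 * l₃) = s * Real.sqrt l₃ := by rw [Real.sqrt_mul (by positivity), Real.sqrt_sq hs.le]
    rw [hsq₁] at T₁
    rw [hsq₃] at T₃
    have hl₁c : (l₁ : ℂ) ≠ 0 := by exact_mod_cast hl₁.ne'
    have hl₃c : (l₃ : ℂ) ≠ 0 := by exact_mod_cast hl₃.ne'
    have hsc : (s : ℂ) ≠ 0 := by exact_mod_cast hs.ne'
    have q₁ : (a₁ : ℂ) ^ 2 / ((s ^ 2 * l₁ : ℝ) : ℂ) = κ₁ / ((s ^ 2 : ℝ) : ℂ) := by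
      rw [hκ₁]; push_cast; field_simp
    have q₃ : (a₃ : ℂ) ^ 2 / ((s ^ 2 * l₃ : ℝ) : ℂ) = κ₃ / ((s ^ 2 : ℝ) : ℂ) := by
      rw [hκ₃]; push_cast; field_simp
    rw [q₁, c1, c0'] at T₁
    rw [q₃] at T₃
    have hLΛ : ((s ^ 2 * L : ℝ) : ℂ) * Λ' * S = -((((s ^ 2 : ℝ) : ℂ) * (2 * (θ.re * Q - R)) * S -
        2 * (κ₁ + κ₃ - n) / ((s ^ 2 : ℝ) : ℂ) * S) + z * ((s ^ 2 * L : ℝ) : ℂ) * S) := by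
      have hLc : (L : ℂ) ≠ 0 := by exact_mod_cast hL.ne'
      rw [hΛ', loopSymbol, hX, hQdef, hRdef]
      push_cast
      field_simp
      ring
    have hE : ((s ^ 2 * L : ℝ) : ℂ) * Λ' * S - (J₁ + J₃) = ((s ^ 2 : ℝ) : ℂ) * Q * ((θ - (starRingEnd ℂ) θ) * D) -
        (((a₁ : ℂ) ^ 2 * (φ₁' (s ^ 2 * l₁) * (starRingEnd ℂ) θ - φ₁' 0 * exp (I * τ)) -
          κ₁ / ((s ^ 2 : ℝ) : ℂ) * (((starRingEnd ℂ) θ - exp (I * τ)) * (A - exp (-I * τ) * B)) + J₁ +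
          z * ((s ^ 2 * l₁ : ℝ) : ℂ) * S) +
        ((a₃ : ℂ) ^ 2 * (φ₃' (s ^ 2 * l₃) * (starRingEnd ℂ) θ - φ₃' 0 * 1) -
          κ₃ / ((s ^ 2 : ℝ) : ℂ) * (((starRingEnd ℂ) θ - 1) * (A - B)) + J₃ +
          z * ((s ^ 2 * l₃ : ℝ) : ℂ) * S)) := by
      rw [hLΛ]
      have : ((s ^ 2 * L : ℝ) : ℂ) = ((s ^ 2 * l₁ : ℝ) : ℂ) + ((s ^ 2 * l₃ : ℝ) : ℂ) := by
        rw [hLdef]; push_cast; ring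
      rw [this]
      linear_combination hbal
    have hθ2 : ‖θ - (starRingEnd ℂ) θ‖ ≤ 2 := by
      refine (norm_sub_le _ _).trans ?_
      rw [RCLike.norm_conj, hθn]
      norm_num
    have hQD : ‖((s ^ 2 : ℝ) : ℂ) * Q * ((θ - (starRingEnd ℂ) θ) * D)‖ ≤ s ^ 2 * M * η := by
      rw [norm_mul, norm_mul, norm_mul, norm_real, Real.norm_of_nonneg hε.le]
      have : ‖θ - (starRingEnd ℂ) θ‖ * ‖D‖ ≤ η :=
        (mul_le_mul_of_nonneg_right hθ2 (norm_nonneg _)).trans hDn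
      gcongr
    rw [hE]
    refine (norm_sub_le _ _).trans ((add_le_add hQD ((norm_add_le _ _).trans (add_le_add T₁ T₃))).trans (le_of_eq ?_))
    rw [hlam, hLdef]
    ring

end

theorem measurable_dispersion1 (l₁ l₂ l₃ a₁ a₃ ε : ℝ) (z : ℂ) :
    Measurable fun τ => dispersion1 l₁ l₂ l₃ a₁ a₃ ε τ z := by
  unfold dispersion1 thetaPhase
  fun_prop

section

variable {l₁ l₂ l₃ a₁ a₃ : ℝ}

theorem im_mul_dispersion1 (hl₁ : 0 < l₁) (hl₂ : 0 < l₂) (hl₃ : 0 < l₃) (ε τ : ℝ) {z : ℂ} (hz : z.im ≠ 0) :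
    z.im * (dispersion1 l₁ l₂ l₃ a₁ a₃ ε τ z).im ≤ 0 := by
  rw [dispersion1_eq]
  exact im_mul_loopSymbol (add_pos hl₁ hl₃) hl₂ (abs_zeta_phase_re_le _ _ τ) _ hz

theorem wellFormed_example1 (hl₁ : 0 < l₁) (hl₂ : 0 < l₂) (hl₃ : 0 < l₃) (ha₁ : 0 < a₁) (ha₃ : 0 < a₃)
    (h : l₁ + l₂ + l₃ = 1) : (example1 l₁ l₂ l₃ a₁ a₃).WellFormed :=
  wellFormed_loopGraph hl₁ hl₂ hl₃ (fun e => by fin_cases e <;> simpa) h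

theorem stiffDispersiveAsymptotics_example1 (hl₁ : 0 < l₁) (hl₂ : 0 < l₂) (hl₃ : 0 < l₃) (ha₁ : 0 < a₁) (ha₃ : 0 < a₃)
    (h : l₁ + l₂ + l₃ = 1) : (example1 l₁ l₂ l₃ a₁ a₃).StiffDispersiveAsymptotics
      (fun ε τ z => dispersion1 l₁ l₂ l₃ a₁ a₃ ε τ z) 1 := by
  have hW := wellFormed_example1 hl₁ hl₂ hl₃ ha₁ ha₃ h
  have hLe : (example1 l₁ l₂ l₃ a₁ a₃).stiffLength = l₁ + l₃ := by
    simp [Composite.stiffLength, example1, loopGraph, Fin.sum_univ_three]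
  have hL : 0 < (example1 l₁ l₂ l₃ a₁ a₃).stiffLength := by rw [hLe]; exact add_pos hl₁ hl₃
  refine hW.stiffDispersiveAsymptotics hL (fun ε z => measurable_dispersion1 _ _ _ _ _ ε z) (fun z hz => ⟨|z.im|⁻¹, fun ε τ =>
    norm_inv_sub_le hz (im_mul_dispersion1 hl₁ hl₂ hl₃ ε τ hz)⟩) fun Z δ hZ hδ => ?_
  obtain ⟨C, hC0, hC⟩ := exists_two_edge_bound hl₁ hl₂ hl₃ ha₁ ha₃ hZ hδ
  refine ⟨Real.sqrt (l₁ + l₃) * C, 1, by positivity, one_pos, fun ε hε hε1 z hz hzδ t ht T hT f => ?_⟩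
  have hz0 : z.im ≠ 0 := fun h0 => by rw [h0, abs_zero] at hzδ; linarith
  have hs0 : 0 < Real.sqrt ε := Real.sqrt_pos.2 hε
  have hs2 : Real.sqrt ε ^ 2 = ε := Real.sq_sqrt hε.le
  have hs1 : Real.sqrt ε ≤ 1 := Real.sqrt_le_one.2 hε1
  have hτ : |ε * t| < Real.pi := by
    rw [mem_Ioo, ← neg_div, div_lt_iff₀ hε, lt_div_iff₀ hε] at ht
    rw [abs_lt]
    constructor <;> linarith
  refine (hW.norm_sub_rankOneOp_le hε hL (B := C * Real.sqrt ε) (by positivity) ?_ hT f).trans (le_of_eq ?_)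
  · intro N F φ φ' φ'' hN d e he x hx
    set τ := ε * t
    have c0 : exp (I * τ) * φ 0 0 = φ 2 0 := by simpa [example1, loopGraph] using d.cont 0 0 2 0 rfl
    have c1 : φ 0 (ε * l₁) = φ 2 (ε * l₃) := by simpa [example1, loopGraph] using d.cont 0 1 2 1 rfl
    have c2 : φ 1 0 = φ 2 (ε * l₃) := by simpa [example1, loopGraph] using d.cont 1 0 2 1 rfl
    have c3 : φ 1 (ε * l₂) = φ 2 0 := by simpa [example1, loopGraph] using d.cont 1 1 2 0 rfl
    have hf := d.soft_flux (e := 1) (w := l₂ * sqrtC z) hε hz0 hl₂ one_pos rfl (by simp [example1, loopGraph])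
    have f0 : (ε : ℂ) ^ 2 * φ' 1 0 = ε * (sqrtC z * (φ 1 (ε * l₂) - φ 1 0 * cos (l₂ * sqrtC z)) / sin (l₂ * sqrtC z)) := by
      simpa [Composite.coefEps, example1, loopGraph] using hf.1
    have f1 : (ε : ℂ) ^ 2 * φ' 1 (ε * l₂) =
        ε * (sqrtC z * (φ 1 (ε * l₂) * cos (l₂ * sqrtC z) - φ 1 0) / sin (l₂ * sqrtC z)) := by
      simpa [Composite.coefEps, example1, loopGraph] using hf.2
    have k0 : -((a₁ : ℂ) ^ 2 * φ' 0 (ε * l₁)) + (ε : ℂ) ^ 2 * φ' 1 0 + -((a₃ : ℂ) ^ 2 * φ' 2 (ε * l₃)) = 0 := by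
      simpa [Fin.sum_univ_three, MetricGraph.endSign, Composite.coefEps, example1, loopGraph] using d.kirchhoff 0
    have k1 : exp (I * τ) * ((a₁ : ℂ) ^ 2 * φ' 0 0) + -((ε : ℂ) ^ 2 * φ' 1 (ε * l₂)) + (a₃ : ℂ) ^ 2 * φ' 2 0 = 0 := by
      simpa [Fin.sum_univ_three, MetricGraph.endSign, Composite.coefEps, example1, loopGraph] using d.kirchhoff 1
    have H := hC z hz hzδ (Real.sqrt ε) τ N hs0 hs1 hN hτ ((ε : ℂ) ^ 2 * φ' 1 0) ((ε : ℂ) ^ 2 * φ' 1 (ε * l₂)) (F 0) (φ 0)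
      (φ' 0) (φ'' 0) (F 2) (φ 2) (φ' 2) (φ'' 2)
    rw [hs2] at H
    obtain ⟨H1, H3⟩ := H (d.w22 0) (d.w22 2) (d.memLp 0) (d.memLp 2)
      (by simpa [Composite.coefEps, example1, loopGraph] using d.eq 0)
      (by simpa [Composite.coefEps, example1, loopGraph] using d.eq 2) (d.load 0) (d.load 2) (d.size 0) (d.size 2)
      (by simpa [Composite.coefEps, example1, loopGraph] using d.energy 0)
      (by simpa [Composite.coefEps, example1, loopGraph] using d.energy 2) c0 c1 k0 k1
      (by rw [f0, c2, c3]; ring) (by rw [f1, c2, c3]; ring)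
    rw [hLe]
    fin_cases e
    · simpa [Fin.sum_univ_three, example1, loopGraph] using H1 x hx
    · simp [example1, loopGraph] at he
    · simpa [Fin.sum_univ_three, example1, loopGraph] using H3 x hx
  · rw [hLe, Real.sqrt_mul hε.le, pow_one]
    calc _ = Real.sqrt (l₁ + l₃) * C * (Real.sqrt ε ^ 2) * ‖f‖ := by ring
      _ = _ := by rw [hs2]

end

/-! ### The effective equation on the line -/

section

variable {s : ℝ} {c : ℂ}

theorem norm_symbol_ge (t : ℝ) : |c.im| ≤ ‖(s * t ^ 2 : ℝ) - c‖ := by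
  refine le_trans (le_of_eq ?_) (Complex.abs_im_le_norm _)
  rw [sub_im, ofReal_im, zero_sub, abs_neg]

theorem symbol_ne_zero (hc : c.im ≠ 0) (t : ℝ) : ((s * t ^ 2 : ℝ) : ℂ) - c ≠ 0 := fun h => by
  have := norm_symbol_ge (s := s) (c := c) t
  rw [h, norm_zero] at this
  exact hc (abs_eq_zero.1 (le_antisymm this (abs_nonneg _)))

theorem measurable_symbol : Measurable fun t : ℝ => (((s * t ^ 2 : ℝ) : ℂ) - c)⁻¹ := by
  fun_prop

theorem norm_symbol_inv_le (hc : c.im ≠ 0) (t : ℝ) : ‖(((s * t ^ 2 : ℝ) : ℂ) - c)⁻¹‖ ≤ |c.im|⁻¹ := by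
  rw [norm_inv]
  exact inv_anti₀ (abs_pos.2 hc) (norm_symbol_ge t)

theorem norm_mul_symbol_inv_le (hs : 0 < s) (hc : c.im ≠ 0) (t : ℝ) :
    ‖I * t * (((s * t ^ 2 : ℝ) : ℂ) - c)⁻¹‖ ≤ (1 + s⁻¹ * ‖c‖) * |c.im|⁻¹ + s⁻¹ := by
  have h0 := norm_pos_iff.2 (symbol_ne_zero (s := s) hc t)
  have hi : 0 < |c.im| := abs_pos.2 hc
  have h1 := norm_symbol_ge (s := s) (c := c) t
  have h2 : s * t ^ 2 ≤ ‖((s * t ^ 2 : ℝ) : ℂ) - c‖ + ‖c‖ := by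
    have := norm_sub_norm_le ((s * t ^ 2 : ℝ) : ℂ) c
    rw [Complex.norm_real, Real.norm_of_nonneg (by positivity)] at this
    linarith
  rw [norm_mul, norm_mul, norm_I, one_mul, norm_inv, Complex.norm_real, Real.norm_eq_abs, ← div_eq_mul_inv,
    div_le_iff₀ h0]
  set N := ‖((s * t ^ 2 : ℝ) : ℂ) - c‖
  have h3 : t ^ 2 ≤ s⁻¹ * (N + ‖c‖) := by rw [inv_mul_eq_div, le_div_iff₀ hs]; linarith
  have h4 : |t| ≤ 1 + t ^ 2 := by rw [← sq_abs]; nlinarith [sq_nonneg (|t| - 1), abs_nonneg t]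
  have h5 : 1 ≤ |c.im|⁻¹ * N := by rw [inv_mul_eq_div, le_div_iff₀ hi]; linarith
  have h6 : 0 ≤ s⁻¹ * ‖c‖ := by positivity
  nlinarith

/-- `U` is a primitive of `V`. -/
def IsPrimitive (U V : L2Line) : Prop :=
  ∃ k : ℂ, U =ᵐ[volume] fun x => k + ∫ y in (0 : ℝ)..x, V y

theorem intervalIntegrable_of_memLp_two {g : ℝ → ℂ} (hg : MemLp g 2 volume) (a b : ℝ) :
    IntervalIntegrable g volume a b :=
  ((hg.locallyIntegrable one_le_two).integrableOn_isCompact isCompact_uIcc).intervalIntegrable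

theorem continuous_setIntegral_Lp {S : Set ℝ} (hS : MeasurableSet S) (hf : volume S ≠ ⊤) :
    Continuous fun V : L2Line => ∫ x in S, V x := by
  have : (fun V : L2Line => ∫ x in S, V x) = fun V => inner ℂ (indicatorConstLp 2 hS hf (1 : ℂ)) V := by
    funext V
    rw [L2.inner_indicatorConstLp_one]
  rw [this]
  fun_prop

theorem continuous_intervalIntegral_Lp (a b : ℝ) : Continuous fun V : L2Line => ∫ x in a..b, V x := by
  simp only [intervalIntegral]
  exact (continuous_setIntegral_Lp measurableSet_Ioc (by simp)).sub
    (continuous_setIntegral_Lp measurableSet_Ioc (by simp))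

theorem isClosed_isPrimitive : IsClosed {p : L2Line × L2Line | IsPrimitive p.1 p.2} := by
  refine IsSeqClosed.isClosed fun p q hp hpq => ?_
  choose k hk using hp
  have h1 : Filter.Tendsto (fun n => (p n).1) Filter.atTop (nhds q.1) := (continuous_fst.tendsto _).comp hpq
  have h2 : Filter.Tendsto (fun n => (p n).2) Filter.atTop (nhds q.2) := (continuous_snd.tendsto _).comp hpq
  obtain ⟨ns, hns, hae⟩ := (tendstoInMeasure_of_tendsto_Lp h1).exists_seq_tendsto_ae
  have hall : ∀ᵐ x, ∀ n, (p n).1 x = k n + ∫ y in (0 : ℝ)..x, (p n).2 y := ae_all_iff.2 hk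
  have hint : ∀ x : ℝ, Filter.Tendsto (fun n => ∫ y in (0 : ℝ)..x, (p (ns n)).2 y) Filter.atTop
      (nhds (∫ y in (0 : ℝ)..x, q.2 y)) := fun x =>
    ((continuous_intervalIntegral_Lp 0 x).tendsto _).comp (h2.comp hns.tendsto_atTop)
  obtain ⟨x₀, hx₀, hx₁⟩ := (hae.and hall).exists
  have hk' : Filter.Tendsto (fun n => k (ns n)) Filter.atTop (nhds (q.1 x₀ - ∫ y in (0 : ℝ)..x₀, q.2 y)) := by
    refine (hx₀.sub (hint x₀)).congr fun n => ?_
    rw [hx₁ (ns n)]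
    ring
  refine ⟨q.1 x₀ - ∫ y in (0 : ℝ)..x₀, q.2 y, ?_⟩
  filter_upwards [hae, hall] with x hx hx'
  refine tendsto_nhds_unique hx ?_
  simp only [hx']
  exact hk'.add (hint x)

theorem isPrimitive_schwartz (f : SchwartzMap ℝ ℂ) :
    IsPrimitive (f.toLp 2) ((SchwartzMap.derivCLM ℂ ℂ f).toLp 2) := by
  refine ⟨f 0, ?_⟩
  filter_upwards [f.coeFn_toLp 2 volume] with x hx
  rw [hx, intervalIntegral.integral_congr_ae
    (((SchwartzMap.derivCLM ℂ ℂ f).coeFn_toLp 2 volume).mono fun y hy _ => hy),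
    intervalIntegral.integral_eq_sub_of_hasDerivAt (f := f)]
  · ring
  · intro y _
    exact f.hasDerivAt y
  · exact (SchwartzMap.derivCLM ℂ ℂ f).continuous.intervalIntegrable _ _

theorem fourier_deriv_schwartz (f : SchwartzMap ℝ ℂ) : (𝓕 ((SchwartzMap.derivCLM ℂ ℂ f).toLp 2) : L2Line) =ᵐ[volume]
    fun ξ : ℝ => I * ((2 * Real.pi * ξ : ℝ) : ℂ) * (𝓕 (f.toLp 2) : L2Line) ξ := by
  rw [SchwartzMap.toLp_fourier_eq, SchwartzMap.toLp_fourier_eq]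
  filter_upwards [(𝓕 f).coeFn_toLp 2 volume, (𝓕 (SchwartzMap.derivCLM ℂ ℂ f)).coeFn_toLp 2 volume] with ξ h1 h2
  rw [h1, h2, SchwartzMap.fourier_coe, SchwartzMap.fourier_coe]
  have h := Real.fourier_deriv f.integrable f.differentiable
    ((SchwartzMap.derivCLM ℂ ℂ f).integrable (μ := volume))
  have h' : (⇑(SchwartzMap.derivCLM ℂ ℂ f) : ℝ → ℂ) = deriv f := rfl
  rw [h', h]
  simp only [smul_eq_mul]
  push_cast
  ring

end

section

variable {s : ℝ} {c : ℂ}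

theorem fourier_ext {F H : L2Line} (h : (𝓕 F : L2Line) =ᵐ[volume] (𝓕 H : L2Line)) : F = H :=
  (Lp.fourierTransformₗᵢ ℝ ℂ).injective (Lp.ext h)

theorem isPrimitive_multiplier_of_smooth (hs : 0 < s) (hc : c.im ≠ 0) {Ψ M : L2Line →L[ℂ] L2Line}
    (hΨ : IsFourierMultiplier (fun t => (((s * t ^ 2 : ℝ) : ℂ) - c)⁻¹) Ψ)
    (hM : IsFourierMultiplier (fun t => I * t * (((s * t ^ 2 : ℝ) : ℂ) - c)⁻¹) M) {g : ℝ → ℂ}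
    (hg : HasCompactSupport g) (hg' : ContDiff ℝ (⊤ : ℕ∞) g) {F : L2Line}
    (hF : (𝓕 F : L2Line) =ᵐ[volume] g) :
    IsPrimitive (Ψ F) (M F) ∧ IsPrimitive (M F) (-(s : ℂ)⁻¹ • (F + c • Ψ F)) := by
  have hs' : (s : ℂ) ≠ 0 := by exact_mod_cast hs.ne'
  have hsm : ContDiff ℝ (⊤ : ℕ∞) fun ξ : ℝ => ((s : ℂ) * ((2 * Real.pi * ξ : ℝ) : ℂ) ^ 2 - c)⁻¹ * g ξ := by
    refine ContDiff.mul (ContDiff.inv ?_ fun ξ => ?_) hg'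
    · exact (contDiff_const.mul ((ofRealCLM.contDiff.comp (contDiff_const.mul contDiff_id)).pow 2)).sub contDiff_const
    · have := symbol_ne_zero (s := s) hc (2 * Real.pi * ξ)
      push_cast at this ⊢
      exact this
  set G : SchwartzMap ℝ ℂ := (hg.mul_left (f := fun ξ : ℝ => ((s : ℂ) * ((2 * Real.pi * ξ : ℝ) : ℂ) ^ 2 - c)⁻¹)).toSchwartzMap hsm with hGdef
  have hG : ∀ ξ, G ξ = ((s : ℂ) * ((2 * Real.pi * ξ : ℝ) : ℂ) ^ 2 - c)⁻¹ * g ξ := fun ξ => rfl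
  set f : SchwartzMap ℝ ℂ := 𝓕⁻ G with hf
  have hfG : (𝓕 (f.toLp 2) : L2Line) =ᵐ[volume] G := by
    rw [SchwartzMap.toLp_fourier_eq, hf, FourierTransform.fourier_fourierInv_eq]
    exact G.coeFn_toLp 2 volume
  have d1 := fourier_deriv_schwartz f
  have d2 := fourier_deriv_schwartz (SchwartzMap.derivCLM ℂ ℂ f)
  have e0 : Ψ F = f.toLp 2 := by
    refine fourier_ext ?_
    filter_upwards [hΨ F, hF, hfG] with ξ h1 h2 h3
    rw [h1, h2, h3, hG]
    push_cast
    rfl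
  have e1 : M F = (SchwartzMap.derivCLM ℂ ℂ f).toLp 2 := by
    refine fourier_ext ?_
    filter_upwards [hM F, hF, hfG, d1] with ξ h1 h2 h3 h4
    rw [h1, h2, h4, h3, hG]
    push_cast
    ring
  have e2 : -(s : ℂ)⁻¹ • (F + c • Ψ F) = (SchwartzMap.derivCLM ℂ ℂ (SchwartzMap.derivCLM ℂ ℂ f)).toLp 2 := by
    refine fourier_ext ?_
    have hlin : (𝓕 (-(s : ℂ)⁻¹ • (F + c • Ψ F)) : L2Line) = -(s : ℂ)⁻¹ • (𝓕 F + c • 𝓕 (Ψ F)) := by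
      have := (Lp.fourierTransformₗᵢ ℝ ℂ).map_smul (-(s : ℂ)⁻¹) (F + c • Ψ F)
      refine this.trans ?_
      rw [map_add, map_smul]
      rfl
    rw [hlin]
    filter_upwards [hΨ F, hF, hfG, d1, d2, Lp.coeFn_smul (-(s : ℂ)⁻¹) (𝓕 F + c • 𝓕 (Ψ F) : L2Line),
      Lp.coeFn_add (𝓕 F : L2Line) (c • 𝓕 (Ψ F)), Lp.coeFn_smul c (𝓕 (Ψ F) : L2Line)] with ξ h1 h2 h3 h4 h5 h6 h7 h8
    have h0 := symbol_ne_zero (s := s) hc (2 * Real.pi * ξ)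
    rw [h6, Pi.smul_apply, h7, Pi.add_apply, h8, Pi.smul_apply, h5, h4, h3, h1, h2, hG]
    push_cast at h0 ⊢
    simp only [smul_eq_mul]
    generalize hw : (2 * Real.pi * ξ : ℂ) = w at *
    have hy : g ξ = (s * w ^ 2 - c) * ((s * w ^ 2 - c)⁻¹ * g ξ) := (mul_inv_cancel_left₀ h0 _).symm
    generalize (s * w ^ 2 - c)⁻¹ * g ξ = y at hy ⊢
    rw [hy]
    have hi : (s : ℂ)⁻¹ * s = 1 := inv_mul_cancel₀ hs'
    linear_combination (-(w ^ 2 * y)) * I_sq - (w ^ 2 * y) * hi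
  rw [e2, e0, e1]
  exact ⟨isPrimitive_schwartz f, isPrimitive_schwartz _⟩

theorem isPrimitive_multiplier (hs : 0 < s) (hc : c.im ≠ 0) {Ψ M : L2Line →L[ℂ] L2Line}
    (hΨ : IsFourierMultiplier (fun t => (((s * t ^ 2 : ℝ) : ℂ) - c)⁻¹) Ψ)
    (hM : IsFourierMultiplier (fun t => I * t * (((s * t ^ 2 : ℝ) : ℂ) - c)⁻¹) M) (F : L2Line) :
    IsPrimitive (Ψ F) (M F) ∧ IsPrimitive (M F) (-(s : ℂ)⁻¹ • (F + c • Ψ F)) := by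
  have hcl : IsClosed {F : L2Line | IsPrimitive (Ψ F) (M F) ∧ IsPrimitive (M F) (-(s : ℂ)⁻¹ • (F + c • Ψ F))} :=
    (isClosed_isPrimitive.preimage (f := fun F : L2Line => (Ψ F, M F)) (by fun_prop)).inter
      (isClosed_isPrimitive.preimage (f := fun F : L2Line => (M F, -(s : ℂ)⁻¹ • (F + c • Ψ F))) (by fun_prop))
  have : F ∈ closure {F : L2Line | IsPrimitive (Ψ F) (M F) ∧ IsPrimitive (M F) (-(s : ℂ)⁻¹ • (F + c • Ψ F))} := by
    refine (mem_closure_iff_nhds_basis Metric.nhds_basis_closedBall).2 fun ε hε => ?_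
    obtain ⟨g, hg₁, hg₂, hg₃⟩ := MemLp.exist_eLpNorm_sub_le (by simp) one_le_two (Lp.memLp (𝓕 F : L2Line)) hε
    set G := hg₁.toSchwartzMap hg₂
    have hG : (G.toLp 2 volume : L2Line) =ᵐ[volume] g := G.coeFn_toLp 2 volume
    have hF' : (𝓕 ((Lp.fourierTransformₗᵢ ℝ ℂ).symm (G.toLp 2)) : L2Line) = G.toLp 2 :=
      (Lp.fourierTransformₗᵢ ℝ ℂ).apply_symm_apply _
    refine ⟨(Lp.fourierTransformₗᵢ ℝ ℂ).symm (G.toLp 2),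
      isPrimitive_multiplier_of_smooth hs hc hΨ hM hg₁ hg₂ (by rw [hF']; exact hG), ?_⟩
    rw [Metric.mem_closedBall', ← (Lp.fourierTransformₗᵢ ℝ ℂ).dist_map, LinearIsometryEquiv.apply_symm_apply, Lp.dist_def]
    refine ENNReal.toReal_le_of_le_ofReal hε.le (le_trans (le_of_eq (eLpNorm_congr_ae ?_)) hg₃)
    filter_upwards [hG] with x hx
    simp only [Pi.sub_apply, hx]
    rfl
  rwa [hcl.closure_eq] at this

theorem solvesLineEquation_multiplier (hs : 0 < s) (hc : c.im ≠ 0) {Ψ : L2Line →L[ℂ] L2Line}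
    (hΨ : IsFourierMultiplier (fun t => (((s * t ^ 2 : ℝ) : ℂ) - c)⁻¹) Ψ) (F : L2Line) :
    SolvesLineEquation s c (Ψ F) F := by
  have hs' : (s : ℂ) ≠ 0 := by exact_mod_cast hs.ne'
  obtain ⟨M, hM⟩ := exists_isFourierMultiplier (m := fun t => I * t * (((s * t ^ 2 : ℝ) : ℂ) - c)⁻¹)
    (by fun_prop) (norm_mul_symbol_inv_le hs hc)
  obtain ⟨⟨k, hk⟩, ⟨k', hk'⟩⟩ := isPrimitive_multiplier hs hc hΨ hM F
  set W := -(s : ℂ)⁻¹ • (F + c • Ψ F) with hW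
  refine ⟨_, _, W, hk, (memLp_congr_ae hk').1 (Lp.memLp (M F)), Lp.memLp W, fun x => ?_, fun x => ?_, ?_⟩
  · simp only [intervalIntegral.integral_same, add_zero]
    congr 1
    exact intervalIntegral.integral_congr_ae (hk'.mono fun y hy _ => hy)
  · simp
  · filter_upwards [hk, Lp.coeFn_smul (-(s : ℂ)⁻¹) (F + c • Ψ F), Lp.coeFn_add F (c • Ψ F),
      Lp.coeFn_smul c (Ψ F)] with x h1 h2 h3 h4
    rw [← h1, hW, h2, Pi.smul_apply, h3, Pi.add_apply, h4, Pi.smul_apply]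
    simp only [smul_eq_mul]
    field_simp
    ring

theorem SolvesLineEquation.sub {U U' F F' : L2Line} (h : SolvesLineEquation s c U F)
    (h' : SolvesLineEquation s c U' F') : SolvesLineEquation s c (U - U') (F - F') := by
  obtain ⟨φ, φ', φ'', a1, a2, a3, a4, a5, a6⟩ := h
  obtain ⟨χ, χ', χ'', b1, b2, b3, b4, b5, b6⟩ := h'
  refine ⟨φ - χ, φ' - χ', φ'' - χ'', ?_, a2.sub b2, a3.sub b3, fun x => ?_, fun x => ?_, ?_⟩
  · filter_upwards [a1, b1, Lp.coeFn_sub U U'] with x h1 h2 h3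
    rw [h3, Pi.sub_apply, Pi.sub_apply, h1, h2]
  · simp only [Pi.sub_apply]
    rw [intervalIntegral.integral_sub (intervalIntegrable_of_memLp_two a2 0 x) (intervalIntegrable_of_memLp_two b2 0 x), a4 x, b4 x]
    ring
  · simp only [Pi.sub_apply]
    rw [intervalIntegral.integral_sub (intervalIntegrable_of_memLp_two a3 0 x) (intervalIntegrable_of_memLp_two b3 0 x), a5 x, b5 x]
    ring
  · filter_upwards [a6, b6, Lp.coeFn_sub F F'] with x h1 h2 h3
    rw [h3]
    simp only [Pi.sub_apply]
    rw [← h1, ← h2]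
    ring

theorem SolvesLineEquation.eq_zero (hs : 0 < s) (hc : c.im ≠ 0) {U : L2Line}
    (h : SolvesLineEquation s c U 0) : U = 0 := by
  have hs' : (s : ℂ) ≠ 0 := by exact_mod_cast hs.ne'
  obtain ⟨φ, φ', φ'', a1, a2, a3, a4, a5, a6⟩ := h
  have prim : ∀ {f g : ℝ → ℂ}, MemLp g 2 volume → (∀ x, f x = f 0 + ∫ y in (0 : ℝ)..x, g y) → Continuous f := by
    intro f g hg hf
    rw [funext hf]
    exact continuous_const.add (intervalIntegral.continuous_primitive (intervalIntegrable_of_memLp_two hg) 0)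
  have hφ : MemLp φ 2 volume := (memLp_congr_ae a1).1 (Lp.memLp U)
  have cφ := prim a2 a4
  have cφ' := prim a3 a5
  have h'' : ∀ᵐ x : ℝ, φ'' x = -(c / s) * φ x := by
    filter_upwards [a6, Lp.coeFn_zero ℂ 2 (volume : Measure ℝ)] with x h1 h2
    rw [h2, Pi.zero_apply] at h1
    field_simp
    linear_combination -h1
  have d1 : ∀ x, HasDerivAt φ (φ' x) x := fun x => by
    have := (intervalIntegral.integral_hasDerivAt_right (cφ'.intervalIntegrable 0 x)
      (cφ'.stronglyMeasurableAtFilter _ _) cφ'.continuousAt).const_add (φ 0)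
    rwa [← funext a4] at this
  have d2 : ∀ x, HasDerivAt φ' (-(c / s) * φ x) x := fun x => by
    have c' : Continuous fun x => -(c / s) * φ x := continuous_const.mul cφ
    have := (intervalIntegral.integral_hasDerivAt_right (c'.intervalIntegrable 0 x)
      (c'.stronglyMeasurableAtFilter _ _) c'.continuousAt).const_add (φ' 0)
    have e : φ' = fun x => φ' 0 + ∫ y in (0 : ℝ)..x, -(c / s) * φ y := by
      funext x
      rw [a5 x, intervalIntegral.integral_congr_ae (h''.mono fun y hy _ => hy)]
    rwa [← e] at this
  have i0 := integrable_norm_sq hφ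
  have i1 := integrable_norm_sq a2
  have key := integral_eq_zero_of_hasDerivAt_of_integrable (f := fun x => φ' x * (starRingEnd ℂ) (φ x))
    (f' := fun x => -(c / s) * ((‖φ x‖ ^ 2 : ℝ) : ℂ) + ((‖φ' x‖ ^ 2 : ℝ) : ℂ)) (fun x => by
      have := (d2 x).mul (d1 x).star
      refine this.congr_deriv ?_
      simp only [← Complex.normSq_eq_norm_sq, Complex.normSq_eq_conj_mul_self, Complex.star_def]
      ring) ((i0.ofReal.const_mul _).add i1.ofReal) (a2.integrable_mul hφ.star)
  rw [integral_add (i0.ofReal.const_mul _) i1.ofReal, integral_const_mul, integral_complex_ofReal, integral_complex_ofReal] at key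
  have him := congrArg Complex.im key
  have hci : (c / (s : ℂ)).im = c.im / s := by simp
  simp only [add_im, mul_im, neg_im, neg_re, ofReal_im, ofReal_re, mul_zero, zero_add, add_zero, zero_im, hci] at him
  have h0 : ∫ x, ‖φ x‖ ^ 2 = 0 := by
    rcases mul_eq_zero.1 him with h | h
    · exact absurd h (by simp [hc, hs.ne'])
    · exact h
  have h1 := (integral_eq_zero_iff_of_nonneg (fun x => by positivity) i0).1 h0
  refine Lp.ext ?_
  filter_upwards [h1, a1, Lp.coeFn_zero ℂ 2 (volume : Measure ℝ)] with x h2 h3 h4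
  rw [h3, h4]
  simpa using h2

theorem solvesLineEquation_iff (hs : 0 < s) (hc : c.im ≠ 0) {Ψ : L2Line →L[ℂ] L2Line}
    (hΨ : IsFourierMultiplier (fun t => (((s * t ^ 2 : ℝ) : ℂ) - c)⁻¹) Ψ) (F U : L2Line) :
    SolvesLineEquation s c U F ↔ U = Ψ F := by
  refine ⟨fun h => ?_, fun h => h ▸ solvesLineEquation_multiplier hs hc hΨ F⟩
  have := h.sub (solvesLineEquation_multiplier hs hc hΨ F)
  rw [sub_self] at this
  exact sub_eq_zero.1 (this.eq_zero hs hc)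

end

section

variable {l₁ l₂ l₃ a₁ a₃ : ℝ}

theorem ofReal_sub_effectiveCoef (hl₁ : 0 < l₁) (hl₂ : 0 < l₂) (hl₃ : 0 < l₃) (X : ℝ) {z : ℂ} (hz : z.im ≠ 0) :
    (X : ℂ) - effectiveCoef l₁ l₂ l₃ z = ((l₁ + l₃ : ℝ) : ℂ) * (loopSymbol (l₁ + l₃) l₂ 1 X z - z) := by
  have hv := half_angle_sq_im hz (half_pos hl₂).ne'
  have h := (cot_two_mul (sin_ne_zero_of_sq_im hv) (cos_ne_zero_of_sq_im hv)).1
  have e0 : 2 * (((l₂ / 2 : ℝ) : ℂ) * sqrtC z) = l₂ * sqrtC z := by push_cast; ring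
  have e1 : ((l₂ / 2 : ℝ) : ℂ) * sqrtC z = l₂ * sqrtC z / 2 := by push_cast; ring
  rw [e0, e1] at h
  have hL : ((l₁ + l₃ : ℝ) : ℂ) ≠ 0 := by exact_mod_cast (add_pos hl₁ hl₃).ne'
  rw [effectiveCoef, loopSymbol, ofReal_div, ofReal_div]
  generalize ((l₁ + l₃ : ℝ) : ℂ) = L at *
  have e2 : (cos (l₂ * sqrtC z) - ((1 : ℝ) : ℂ)) / sin (l₂ * sqrtC z) = -tan (l₂ * sqrtC z / 2) := by
    rw [← h, ofReal_one, sub_div]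
  rw [e2]
  field_simp
  push_cast
  ring

theorem effectiveCoef_im_ne_zero (hl₁ : 0 < l₁) (hl₂ : 0 < l₂) (hl₃ : 0 < l₃) {z : ℂ} (hz : z.im ≠ 0) :
    (effectiveCoef l₁ l₂ l₃ z).im ≠ 0 := by
  have h := im_sqrtC_mul_tan_pos hz (half_pos hl₂)
  have e1 : ((l₂ / 2 : ℝ) : ℂ) * sqrtC z = l₂ * sqrtC z / 2 := by push_cast; ring
  rw [e1] at h
  have e2 : (effectiveCoef l₁ l₂ l₃ z).im = (l₁ + l₃) * z.im + 2 * (sqrtC z * tan (l₂ * sqrtC z / 2)).im := by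
    rw [effectiveCoef, mul_assoc, add_im, im_ofReal_mul, ← im_ofReal_mul 2, ofReal_ofNat]
  intro h0
  rw [e2] at h0
  have h1 : 0 < (l₁ + l₃) * (z.im * z.im) := mul_pos (add_pos hl₁ hl₃) (mul_self_pos.2 hz)
  have h2 : (l₁ + l₃) * (z.im * z.im) + 2 * (z.im * (sqrtC z * tan (l₂ * sqrtC z / 2)).im) = 0 := by
    linear_combination z.im * h0
  linarith

theorem exists_effective_symbol_bound (hl₁ : 0 < l₁) (hl₂ : 0 < l₂) (hl₃ : 0 < l₃) (ha₁ : 0 < a₁) (ha₃ : 0 < a₃)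
    {Z : Set ℂ} {δ : ℝ} (hZ : IsCompact Z) (hδ : 0 < δ) :
    ∃ C : ℝ, 0 ≤ C ∧ ∀ z ∈ Z, δ ≤ |z.im| → ∀ ε : ℝ, 0 < ε → ∀ t : ℝ,
      ‖((l₁ + l₃ : ℝ) : ℂ)⁻¹ * dispersionSymbol ε (fun τ => dispersion1 l₁ l₂ l₃ a₁ a₃ ε τ z) z t -
        (((sigmaSq l₁ l₃ a₁ a₃ * t ^ 2 : ℝ) : ℂ) - effectiveCoef l₁ l₂ l₃ z)⁻¹‖ ≤ C * ε ^ 2 := by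
  have hL := add_pos hl₁ hl₃
  have hs := sigmaSq_pos hl₁ hl₃ ha₁ ha₃
  obtain ⟨B, hB0, hB⟩ := exists_coef_bound hZ hδ hl₂
  obtain ⟨C, hC0, hC⟩ := exists_loopSymbol_bound hL hl₂ hZ hδ
  set k := (4 * (a₁ ^ 2 / l₁) / (a₁ ^ 2 / l₁ + a₃ ^ 2 / l₃)) ^ 2
  set s := sigmaSq l₁ l₃ a₁ a₃
  set L := l₁ + l₃ with hLdef
  have hk : 0 ≤ k := sq_nonneg _
  refine ⟨L⁻¹ * (C / s) + L⁻¹ * (2 / L * B * k * C ^ 2 / s), by positivity, fun z hz hzδ ε hε t => ?_⟩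
  have hz0 : z.im ≠ 0 := fun h0 => by rw [h0, abs_zero] at hzδ; linarith
  have hLn : ‖((L : ℝ) : ℂ)⁻¹‖ = L⁻¹ := by rw [norm_inv, norm_real, Real.norm_of_nonneg hL.le]
  have hX : 0 ≤ s * t ^ 2 := by positivity
  rw [ofReal_sub_effectiveCoef hl₁ hl₂ hl₃ _ hz0, ← hLdef, mul_inv, ← mul_sub, norm_mul, hLn, add_mul]
  have h1 := hC z hz hzδ 1 (s * t ^ 2) (by simp) hX
  set A₁ := loopSymbol L l₂ 1 (s * t ^ 2) z - z with hA₁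
  have hA₁0 : 0 < ‖A₁‖ := pos_of_mul_pos_right (by linarith) hC0.le
  by_cases ht : t ∈ Ico (-(Real.pi / ε)) (Real.pi / ε)
  · rw [dispersionSymbol, indicator_of_mem ht, dispersion1_eq, ← hLdef, mul_div_cancel_left₀ t hε.ne']
    have hρ := abs_zeta_phase_re_le (a₁ ^ 2 / l₁) (a₃ ^ 2 / l₃) (ε * t)
    have hρ' := abs_one_sub_zeta_phase_re_le (κ₁ := a₁ ^ 2 / l₁) (κ₃ := a₃ ^ 2 / l₃) (by positivity) (by positivity) (ε * t)
    rw [← thetaPhase_eq] at hρ hρ'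
    set ρ := (thetaPhase l₁ l₃ a₁ a₃ (ε * t)).re
    have h2 := hC z hz hzδ ρ (s * t ^ 2) hρ hX
    set A := loopSymbol L l₂ ρ (s * t ^ 2) z - z with hA
    have hA0 : 0 < ‖A‖ := pos_of_mul_pos_right (by linarith) hC0.le
    have hdiff : A⁻¹ - A₁⁻¹ = -((2 / L : ℝ) : ℂ) * (sqrtC z / sin (l₂ * sqrtC z)) * ((1 - ρ : ℝ) : ℂ) * (A⁻¹ * A₁⁻¹) := by
      have e : A₁ - A = -((2 / L : ℝ) : ℂ) * (sqrtC z / sin (l₂ * sqrtC z)) * ((1 - ρ : ℝ) : ℂ) := by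
        rw [hA, hA₁, loopSymbol, loopSymbol]
        push_cast
        ring
      rw [← e]
      have := norm_pos_iff.1 hA0
      have := norm_pos_iff.1 hA₁0
      field_simp
    have hn : ‖A⁻¹ - A₁⁻¹‖ ≤ 2 / L * B * (k * (ε * t) ^ 2) * (C / (1 + s * t ^ 2)) ^ 2 := by
      have i1 : ‖A‖⁻¹ ≤ C / (1 + s * t ^ 2) := by
        rw [inv_le_comm₀ hA0 (by positivity), inv_div, div_le_iff₀ hC0]
        linarith
      have i2 : ‖A₁‖⁻¹ ≤ C / (1 + s * t ^ 2) := by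
        rw [inv_le_comm₀ hA₁0 (by positivity), inv_div, div_le_iff₀ hC0]
        linarith
      rw [hdiff, norm_mul, norm_mul, norm_mul, norm_mul, norm_neg, norm_inv, norm_inv, norm_real, norm_real,
        Real.norm_of_nonneg (by positivity : 0 ≤ 2 / L), Real.norm_eq_abs, sq (C / _)]
      have := (hB z hz hzδ).2.1
      gcongr
    have hfin : 2 / L * B * (k * (ε * t) ^ 2) * (C / (1 + s * t ^ 2)) ^ 2 ≤ 2 / L * B * k * C ^ 2 / s * ε ^ 2 := by
      have e : 2 / L * B * (k * (ε * t) ^ 2) * (C / (1 + s * t ^ 2)) ^ 2 =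
          2 / L * B * k * C ^ 2 / s * ε ^ 2 * ((s * t ^ 2) / (1 + s * t ^ 2) ^ 2) := by
        field_simp
      rw [e]
      refine mul_le_of_le_one_right (by positivity) ?_
      rw [div_le_one (by positivity)]
      nlinarith
    have h0 : 0 ≤ L⁻¹ * (C / s) * ε ^ 2 := by positivity
    calc _ ≤ L⁻¹ * (2 / L * B * k * C ^ 2 / s * ε ^ 2) := by gcongr; exact hn.trans hfin
      _ ≤ _ := by linarith
  · rw [dispersionSymbol, indicator_of_notMem ht, zero_sub, norm_neg, norm_inv]
    have ht2 : 1 ≤ ε ^ 2 * t ^ 2 := by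
      have : Real.pi / ε ≤ |t| := by
        by_contra hlt
        push Not at hlt
        exact ht ⟨(abs_lt.1 hlt).1.le, (abs_lt.1 hlt).2⟩
      rw [div_le_iff₀ hε] at this
      have h3 : 1 ≤ |t| * ε := by linarith [Real.pi_gt_three]
      calc (1 : ℝ) ≤ (|t| * ε) ^ 2 := one_le_pow₀ h3
        _ = _ := by rw [mul_pow, sq_abs]; ring
    have hn : ‖A₁‖⁻¹ ≤ C / s * ε ^ 2 := by
      have e : s * t ^ 2 ≤ C * ‖A₁‖ := by linarith
      rw [inv_le_iff_one_le_mul₀ hA₁0]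
      calc (1 : ℝ) ≤ ε ^ 2 * t ^ 2 := ht2
        _ = ε ^ 2 / s * (s * t ^ 2) := by field_simp
        _ ≤ ε ^ 2 / s * (C * ‖A₁‖) := by gcongr
        _ = _ := by ring
    have h0 : 0 ≤ L⁻¹ * (2 / L * B * k * C ^ 2 / s) * ε ^ 2 := by positivity
    calc _ ≤ L⁻¹ * (C / s * ε ^ 2) := by gcongr
      _ ≤ _ := by linarith

theorem exists_effective_solution_operator (hl₁ : 0 < l₁) (hl₂ : 0 < l₂) (hl₃ : 0 < l₃) (ha₁ : 0 < a₁) (ha₃ : 0 < a₃) :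
    ∃ Ψ₀ : ℂ → L2Line →L[ℂ] L2Line,
      (∀ z : ℂ, z.im ≠ 0 → ∀ F U : L2Line,
        SolvesLineEquation (sigmaSq l₁ l₃ a₁ a₃) (effectiveCoef l₁ l₂ l₃ z) U F ↔ U = Ψ₀ z F) ∧
      ∀ (Z : Set ℂ) (δ : ℝ), IsCompact Z → 0 < δ → ∃ C ε₀ : ℝ, 0 < ε₀ ∧
        ∀ ε : ℝ, 0 < ε → ε ≤ ε₀ → ∀ z ∈ Z, δ ≤ |z.im| →
          ∃ Ψ : L2Line →L[ℂ] L2Line,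
            IsFourierMultiplier
              (dispersionSymbol ε (fun τ => dispersion1 l₁ l₂ l₃ a₁ a₃ ε τ z) z) Ψ ∧
            ‖((l₁ + l₃ : ℝ) : ℂ)⁻¹ • Ψ - Ψ₀ z‖ ≤ C * ε ^ 2 := by
  have hs := sigmaSq_pos hl₁ hl₃ ha₁ ha₃
  have hex : ∀ z : ℂ, ∃ M : L2Line →L[ℂ] L2Line, z.im ≠ 0 → IsFourierMultiplier
      (fun t => (((sigmaSq l₁ l₃ a₁ a₃ * t ^ 2 : ℝ) : ℂ) - effectiveCoef l₁ l₂ l₃ z)⁻¹) M := fun z => by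
    by_cases hz : z.im = 0
    · exact ⟨0, fun h => absurd hz h⟩
    · obtain ⟨M, hM⟩ := exists_isFourierMultiplier measurable_symbol
        (norm_symbol_inv_le (s := sigmaSq l₁ l₃ a₁ a₃) (effectiveCoef_im_ne_zero hl₁ hl₂ hl₃ hz))
      exact ⟨M, fun _ => hM⟩
  choose Ψ₀ hΨ₀ using hex
  refine ⟨Ψ₀, fun z hz => solvesLineEquation_iff hs (effectiveCoef_im_ne_zero hl₁ hl₂ hl₃ hz) (hΨ₀ z hz),
    fun Z δ hZ hδ => ?_⟩
  obtain ⟨C, hC0, hC⟩ := exists_effective_symbol_bound hl₁ hl₂ hl₃ ha₁ ha₃ hZ hδ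
  refine ⟨C, 1, one_pos, fun ε hε _ z hz hzδ => ?_⟩
  have hz0 : z.im ≠ 0 := fun h0 => by rw [h0, abs_zero] at hzδ; linarith
  obtain ⟨Ψ, hΨ⟩ := exists_isFourierMultiplier
    (m := dispersionSymbol ε (fun τ => dispersion1 l₁ l₂ l₃ a₁ a₃ ε τ z) z) (B := |z.im|⁻¹)
    (((measurable_dispersion1 l₁ l₂ l₃ a₁ a₃ ε z).comp (measurable_const_mul ε)).sub_const z |>.inv.indicator measurableSet_Ico)
    (fun t => (norm_indicator_le_norm_self _ t).trans (norm_inv_sub_le hz0 (im_mul_dispersion1 hl₁ hl₂ hl₃ ε _ hz0)))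
  refine ⟨Ψ, hΨ, ContinuousLinearMap.opNorm_le_bound _ (by positivity) fun F => norm_le_of_fourier (by positivity) ?_⟩
  have hlin : (𝓕 ((((l₁ + l₃ : ℝ) : ℂ)⁻¹ • Ψ - Ψ₀ z) F) : L2Line) = ((l₁ + l₃ : ℝ) : ℂ)⁻¹ • 𝓕 (Ψ F) - 𝓕 (Ψ₀ z F) := by
    refine ((Lp.fourierTransformₗᵢ ℝ ℂ).map_sub (((l₁ + l₃ : ℝ) : ℂ)⁻¹ • Ψ F) (Ψ₀ z F)).trans ?_
    rw [map_smul]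
    rfl
  rw [hlin]
  filter_upwards [hΨ F, hΨ₀ z hz0 F, Lp.coeFn_sub (((l₁ + l₃ : ℝ) : ℂ)⁻¹ • 𝓕 (Ψ F) : L2Line) (𝓕 (Ψ₀ z F)),
    Lp.coeFn_smul ((l₁ + l₃ : ℝ) : ℂ)⁻¹ (𝓕 (Ψ F) : L2Line)] with ξ h1 h2 h3 h4
  rw [h3, Pi.sub_apply, h4, Pi.smul_apply, h1, h2, smul_eq_mul, ← mul_assoc, ← sub_mul, norm_mul]
  exact mul_le_mul_of_nonneg_right (hC z hz hzδ ε hε _) (norm_nonneg _)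

end

end

theorem mainTheorem10 :
    -- Example (0)
    (∀ l₁ l₂ a₁ : ℝ, 0 < l₁ → 0 < l₂ → 0 < a₁ → l₁ + l₂ = 1 →
      (example0 l₁ l₂ a₁).StiffCompressionIsDirectIntegral ∧
      (example0 l₁ l₂ a₁).StiffDispersiveAsymptotics (fun _ τ z => dispersion0 l₁ l₂ τ z) 2) ∧
    -- Example (1)
    (∀ l₁ l₂ l₃ a₁ a₃ : ℝ, 0 < l₁ → 0 < l₂ → 0 < l₃ → 0 < a₁ → 0 < a₃ → l₁ + l₂ + l₃ = 1 →
      (example1 l₁ l₂ l₃ a₁ a₃).StiffCompressionIsDirectIntegral ∧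
      (example1 l₁ l₂ l₃ a₁ a₃).StiffDispersiveAsymptotics
        (fun ε τ z => dispersion1 l₁ l₂ l₃ a₁ a₃ ε τ z) 1 ∧
      -- the effective time-dispersive equation on the line, with its solution operator `Ψ₀ z`
      ∃ Ψ₀ : ℂ → L2Line →L[ℂ] L2Line,
        (∀ z : ℂ, z.im ≠ 0 → ∀ F U : L2Line,
          SolvesLineEquation (sigmaSq l₁ l₃ a₁ a₃) (effectiveCoef l₁ l₂ l₃ z) U F ↔ U = Ψ₀ z F) ∧
        ∀ (Z : Set ℂ) (δ : ℝ), IsCompact Z → 0 < δ → ∃ C ε₀ : ℝ, 0 < ε₀ ∧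
          ∀ ε : ℝ, 0 < ε → ε ≤ ε₀ → ∀ z ∈ Z, δ ≤ |z.im| →
            ∃ Ψ : L2Line →L[ℂ] L2Line,
              IsFourierMultiplier
                (dispersionSymbol ε (fun τ => dispersion1 l₁ l₂ l₃ a₁ a₃ ε τ z) z) Ψ ∧
              ‖((l₁ + l₃ : ℝ) : ℂ)⁻¹ • Ψ - Ψ₀ z‖ ≤ C * ε ^ 2) ∧
    -- Example (2)
    (∀ l₁ l₂ l₃ a₁ a₂ a₃ : ℝ, 0 < l₁ → 0 < l₂ → 0 < l₃ → 0 < a₁ → 0 < a₂ → 0 < a₃ →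
      l₁ + l₂ + l₃ = 1 →
      (example2 l₁ l₂ l₃ a₁ a₂ a₃).StiffCompressionIsDirectIntegral ∧
      (example2 l₁ l₂ l₃ a₁ a₂ a₃).StiffDispersiveAsymptotics
        (fun _ τ z => dispersion2 l₁ l₂ l₃ a₁ a₂ τ z) 2) := by
  refine ⟨fun l₁ l₂ a₁ hl₁ hl₂ ha₁ h => ?_, fun l₁ l₂ l₃ a₁ a₃ hl₁ hl₂ hl₃ ha₁ ha₃ h => ?_,
    fun l₁ l₂ l₃ a₁ a₂ a₃ hl₁ hl₂ hl₃ ha₁ ha₂ ha₃ h => ?_⟩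
  · exact ⟨(wellFormed_example0 hl₁ hl₂ ha₁ h).stiffCompressionIsDirectIntegral,
      stiffDispersiveAsymptotics_example0 hl₁ hl₂ ha₁ h⟩
  · exact ⟨(wellFormed_example1 hl₁ hl₂ hl₃ ha₁ ha₃ h).stiffCompressionIsDirectIntegral,
      stiffDispersiveAsymptotics_example1 hl₁ hl₂ hl₃ ha₁ ha₃ h,
      exists_effective_solution_operator hl₁ hl₂ hl₃ ha₁ ha₃⟩
  · exact ⟨(wellFormed_loopGraph hl₁ hl₂ hl₃ (fun e => by fin_cases e <;> simpa) h).stiffCompressionIsDirectIntegral,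
      stiffDispersiveAsymptotics_example2 hl₁ hl₂ hl₃ ha₁ ha₂ ha₃ h⟩
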